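/- **Setting.** Let $n\ge 0$ and let $\theta$ be one of the following real antisymmetric $2n\times 2n$ matrices (blocks of size $n$): $$\text{Type }\theta_1:\ \theta=\begin{pmatrix}\theta_1&0\\0&0\end{pmatrix},\qquad \text{Type }\theta_2:\ \theta=\begin{pmatrix}0&-\theta_2\\ \theta_2^t&0\end{pmatrix},\qquad \text{Type }\theta_3:\ \theta=\begin{pmatrix}0&0\\0&-\theta_3\end{pmatrix},$$ with $\theta_1,\theta_3\in \mathrm{Mat}_n(\mathbb R)$ antisymmetric and $\theta_2\in \mathrm{Mat}_n(\mathbb R)$ arbitrary. For a skew matrix $\vartheta$, $T_\vartheta$ is the algebra of series $\sum_{m\in\mathbb Z^{2n}}u_mU_m$ with rapidly decreasing coefficients and $U_mU_{m'}=e^{-\pi i\,m^t\vartheta m'}U_{m+m'}$ (so $U_jU_k=e^{-2\pi i\vartheta^{jk}}U_kU_j$). Let $\mathrm{Ob}$ be a set and $a\mapsto A_a$ a map to symmetric integer $n\times n$ matrices such that $A_{ab}:=A_b-A_a$ is nondegenerate whenever $a\ne b$; for Type $\theta_2$ assume also $\det(1+\theta_2A_a)\ne0$ for all $a$. Put $F_{a,0}=\begin{pmatrix}0&A_a\\-A_a&0\end{pmatrix}$,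 $G_a=F_{a,0}\theta+1$, $\theta_a=\theta G_a^{-1}$, $A^+_{ab}=A_a+A_b$. For Type $\theta_1$ let $*$ be the Moyal product $f*g=f\exp\!\big(\tfrac{i}{4\pi}\overleftarrow{\partial_x}\theta_1\overrightarrow{\partial_x}\big)g$, i.e. $(f*g)(x)=\iint \hat f(k)\hat g(l)e^{-\pi i k^t\theta_1 l}e^{2\pi i(k+l)\cdot x}\,dk\,dl$; for the other types $*$ is the pointwise product. **Morphisms.** $\mathrm{Hom}(a,a)=T_{\theta_a}$, and for $a\neq b$, $\mathrm{Hom}(a,b)=\mathcal S(\mathbb R^n\times(\mathbb Z^n/A_{ab}\mathbb Z^n))$. (If $A_o=0$, $\mathrm{Hom}(o,a)$ is the basic module of $a$.) For $a\ne b$ the right action of $T_{\theta_a}$ (generators $U_i,U_{\bar i}$) and the left action of $T_{\theta_b}$ (generators $Z_i,Z_{\bar i}$), $1\le i\le n$, with $t_i$ the standard basis of $\mathbb Z^n$, are * Type $\theta_1$: $(\xi U_i)(x;\mu)=\xi(x;\mu)*e^{2\pi i(x_i+(A_{ab}^{-1}\mu)_i)}$, $(Z_i\xi)(x;\mu)=e^{2\pi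 i(x_i+(A_{ab}^{-1}\mu)_i)}*\xi(x;\mu)$, $(\xi U_{\bar i})(x;\mu)=(Z_{\bar i}\xi)(x;\mu)=\xi(x+A_{ab}^{-1}t_i;\mu-t_i)$; * Type $\theta_2$: $(\xi U_i)(x;\mu)=e^{2\pi i(((1+\theta_2A_a)^{-1}x)_i+(A_{ab}^{-1}\mu)_i)}\xi(x;\mu)$, $(\xi U_{\bar i})(x;\mu)=\xi(x+(1+\theta_2A_b)A_{ab}^{-1}t_i;\mu-t_i)$, and $Z_i$, $Z_{\bar i}$ are given by the same formulas with $A_a$ and $A_b$ exchanged in the factors $1+\theta_2A$; * Type $\theta_3$: $(\xi U_i)(x;\mu)=(Z_i\xi)(x;\mu)=e^{2\pi i(x_i+(A_{ab}^{-1}\mu)_i)}\xi(x;\mu)$, $(\xi U_{\bar i})(x;\mu)=\xi(x+A_{ab}^{-1}t_i;\mu-t_i)e^{-\pi i x^tA_{ab}\theta_3t_i}$, $(Z_{\bar i}\xi)(x;\mu)=e^{\pi i x^tA_{ab}\theta_3t_i}\xi(x+A_{ab}^{-1}t_i;\mu-t_i)$; extended to $U_m=U_1^{m_1}\cdots U_{2n}^{m_{2n}}e^{\pi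 i\sum_{j<k}m_jm_k\theta_a^{jk}}$ (and likewise to $Z_m$, with $\theta_b$) and to series. **Composition** $m:\mathrm{Hom}(b,c)\otimes\mathrm{Hom}(a,b)\to\mathrm{Hom}(a,c)$. If $a=b$ or $b=c$ it is the right, respectively left, action (the product of $T_{\theta_a}$ if $a=b=c$). If $a=c\ne b$, $$m(\xi_{ba},\xi_{ab})=|\det G_a|^{-1/2}\sum_{m\in\mathbb Z^{2n}}U_m\sum_{\mu\in\mathbb Z^n/A_{ab}\mathbb Z^n}\int_{\mathbb R^n}\xi_{ba}(x,\mu)*(\xi_{ab}U_{-m})(x,-\mu)\,dx .$$ If $a,b,c$ are distinct, put $w=u-A_{ab}A_{ac}^{-1}\rho$; then $m(\xi_{bc},\xi_{ab})(x,\rho)=\sum_{u\in\mathbb Z^n}(\cdots)$ with summand * Type $\theta_1$: $\xi_{bc}(x+A_{bc}^{-1}w,-u+\rho)*\xi_{ab}(x-A_{ab}^{-1}w,u)$; * Type $\theta_2$: $\xi_{bc}(x+(1+\theta_2A_c)A_{bc}^{-1}w,-u+\rho)\,\xi_{ab}(x-(1+\theta_2A_a)A_{ab}^{-1}w,u)$;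 * Type $\theta_3$: $\xi_{bc}(x',-u+\rho)\,e^{\pi i\,x'^tA_{bc}\theta_3A_{ab}x''}\,\xi_{ab}(x'',u)$, $x'=x+A_{bc}^{-1}w$, $x''=x-A_{ab}^{-1}w$. **Connections, curvature, trace.** For $a\ne b$, $(\nabla_1,\dots,\nabla_{2n})^t=M_{ab}\begin{pmatrix}\partial_x\\2\pi i x\end{pmatrix}$ on $\mathrm{Hom}(a,b)$, where $M_{ab}$ is $$\begin{pmatrix}1&0\\\frac12A^+_{ab}\theta_1&-A_{ab}\end{pmatrix},\quad\begin{pmatrix}1&0\\0&-K_b+K_a\end{pmatrix},\ K_a=(1+A_a\theta_2)^{-1}A_a,\quad\begin{pmatrix}1&-\frac12A^+_{ab}\theta_3A_{ab}\\0&-A_{ab}\end{pmatrix}$$ for the three types (if $A_a$ is nondegenerate, $K_a=(A_a^{-1}+\theta_2)^{-1}$). On $\mathrm{Hom}(a,a)=T_{\theta_a}$, $\nabla_jU_m=2\pi i\,(G_a^{-1}m)_jU_m$. Let $F_a$ be $$\begin{pmatrix}0&A_a\\-A_a&A_a\theta_1A_a\end{pmatrix},\quad\begin{pmatrix}0&K_a^t\\-K_a&0\end{pmatrix},\quad\begin{pmatrix}-A_a\theta_3A_a&A_a\\-A_a&0\end{pmatrix},$$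 respectively, and $\mathrm{Tr}_a(\sum u_mU_m)=|\det G_a|^{1/2}u_0$ on $\mathrm{Hom}(a,a)$. **Claim.** All lattice sums above converge, and the formulas determine unique well-defined bilinear compositions and linear connections and traces on the stated spaces. For each of the three types: 1. (Associativity) $m(m(\xi_{cd},\xi_{bc}),\xi_{ab})=m(\xi_{cd},m(\xi_{bc},\xi_{ab}))$ for all objects $a,b,c,d$ (equal or not), and $1\in T_{\theta_a}$ is the identity of $a$. 2. (Leibniz rule) $\nabla_jm(\xi_{bc},\xi_{ab})=m(\nabla_j\xi_{bc},\xi_{ab})+m(\xi_{bc},\nabla_j\xi_{ab})$ for all objects $a,b,c$ and $1\le j\le 2n$. 3. These data form a pre-category: moreover each $F_a$ is skew-symmetric, $[\nabla_i,\nabla_j]=-2\pi i(F_b-F_a)_{ij}$ on $\mathrm{Hom}(a,b)$, the pairing $\mathrm{Tr}_am:\mathrm{Hom}(b,a)\otimes\mathrm{Hom}(a,b)\to\mathbb C$ is nondegenerate, and $\mathrm{Tr}_am(\xi_{ba},\xi_{ab})=\mathrm{Tr}_bm(\xi_{ab},\xi_{ba})$. 4. Let $\tau\in\mathrm{Mat}_n(\mathbb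 C)$ have symmetric positive definite imaginary part $\tau_I$ (e.g. $\tau=i\,1_n$), let $\Lambda$ be the Grassmann algebra on $d\bar z^1,\dots,d\bar z^n$, and let $c=\frac1{2i}(\tau_I^{-1}\tau,\,-\tau_I^{-1})$, an $n\times 2n$ matrix. Put $V_{ab}=\mathrm{Hom}(a,b)\otimes\Lambda$, graded by form degree, with the composition induced by $m$ and the product of $\Lambda$, $d=\sum_id\bar z^i\,\bar\nabla_i$ with $\bar\nabla_i=\sum_jc_{ij}\nabla_j$, curvature elements $f_a=1_a\otimes\big(-\pi i\sum_{i,j}(cF_ac^t)_{ij}\,d\bar z^id\bar z^j\big)$, and $\eta(v,v')=\int m(v,v')$, where $\int$ is $\mathrm{Tr}_a$ of the coefficient of $d\bar z^1\cdots d\bar z^n$. Then $\mathcal C=(V,f,d,m,\eta)$ is a cyclic CDG category with $\eta$ of degree $-n$: $d$ and $m$ have degrees $1$ and $0$, $f_a\in V^2_{aa}$, $df_a=0$, $d^2v_{ab}=m(f_b,v_{ab})-m(v_{ab},f_a)$, $dm(v_{bc},v_{ab})=m(dv_{bc},v_{ab})+(-1)^{|v_{bc}|}m(v_{bc},dv_{ab})$,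 $m$ is associative; $\eta$ is nondegenerate, of degree $-n$ and graded symmetric, $\eta(dv_{ba},v_{ab})+(-1)^{|v_{ba}|}\eta(v_{ba},dv_{ab})=0$, and $\eta(m(v_{bc},v_{ab}),v_{ca})=(-1)^{|v_{bc}|(|v_{ab}|+|v_{ca}|)}\eta(m(v_{ab},v_{ca}),v_{bc})$. -/

import Mathlib

open scoped TensorProduct SchwartzMap FourierTransform RealInnerProductSpace

noncomputable section

namespace NCTori

universe u v

/-! ### Curved differential graded categories -/

/-- The data of a curved differential graded category over `ℂ`: for every pair of objects a graded
space of morphisms `V a b`, with graded pieces `gr a b k`, a curvature element `f a`, a map `d`,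
and a composition `V b c ⊗ V a b → V a c`. -/
structure CDGData (Ob : Type u) (V : Ob → Ob → Type v)
    [∀ a b, AddCommGroup (V a b)] [∀ a b, Module ℂ (V a b)] where
  gr : ∀ a b, ℤ → Submodule ℂ (V a b)
  f : ∀ a, V a a
  d : ∀ a b, V a b →ₗ[ℂ] V a b
  m : ∀ a b c, V b c →ₗ[ℂ] V a b →ₗ[ℂ] V a c

namespace CDGData

variable {Ob : Type u} {V : Ob → Ob → Type v}
  [∀ a b, AddCommGroup (V a b)] [∀ a b, Module ℂ (V a b)]

/-- The axioms of a CDG category. -/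
structure IsCDGCategory (C : CDGData Ob V) : Prop where
  grading : ∀ a b, DirectSum.IsInternal (C.gr a b)
  f_mem : ∀ a, C.f a ∈ C.gr a a 2
  d_mem : ∀ a b k, ∀ v ∈ C.gr a b k, C.d a b v ∈ C.gr a b (k + 1)
  m_mem : ∀ a b c k l, ∀ v ∈ C.gr b c k, ∀ w ∈ C.gr a b l, C.m a b c v w ∈ C.gr a c (k + l)
  d_f : ∀ a, C.d a a (C.f a) = 0
  d_d : ∀ a b (v : V a b), C.d a b (C.d a b v) = C.m a b b (C.f b) v - C.m a a b v (C.f a)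
  leibniz : ∀ a b c k, ∀ v ∈ C.gr b c k, ∀ w : V a b,
    C.d a c (C.m a b c v w) = C.m a b c (C.d b c v) w + (-1 : ℂ) ^ k • C.m a b c v (C.d a b w)
  assoc : ∀ a b c e (v : V c e) (w : V b c) (z : V a b),
    C.m a b e (C.m b c e v w) z = C.m a c e v (C.m a b c w z)

/-- The axioms of a cyclic CDG category with respect to pairings `η a b : V b a ⊗ V a b → ℂ`
of degree `deg`. -/
structure IsCyclicCDGCategory (C : CDGData Ob V)
    (η : ∀ a b, V b a →ₗ[ℂ] V a b →ₗ[ℂ] ℂ) (deg : ℤ) : Prop extends C.IsCDGCategory where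
  η_nondegenerate : ∀ a b, (η a b).Nondegenerate
  η_degree : ∀ a b k l, k + l + deg ≠ 0 → ∀ v ∈ C.gr b a k, ∀ w ∈ C.gr a b l, η a b v w = 0
  η_symm : ∀ a b k l, ∀ v ∈ C.gr b a k, ∀ w ∈ C.gr a b l,
    η a b v w = (-1 : ℂ) ^ (k * l) * η b a w v
  η_d : ∀ a b k, ∀ v ∈ C.gr b a k, ∀ w : V a b,
    η a b (C.d b a v) w + (-1 : ℂ) ^ k * η a b v (C.d a b w) = 0
  η_cyclic : ∀ a b c i j k, ∀ x ∈ C.gr b c i, ∀ y ∈ C.gr a b j, ∀ z ∈ C.gr c a k,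
    η c a (C.m a b c x y) z = (-1 : ℂ) ^ (i * (j + k)) * η b c (C.m c a b y z) x

end CDGData

/-! ### Pre-categories with constant curvature connections -/

/-- The index set `1, …, n, 1̄, …, n̄` of the `2n` real directions of a `2n`-dimensional torus. -/
abbrev Idx (n : ℕ) : Type := Fin n ⊕ Fin n

/-- The data of a pre-category: identities, a composition, connections `∇_j` on the morphism
spaces along the `2n` basic derivations, a curvature matrix for each object, and traces. -/
structure PreCategoryData (n : ℕ) (Ob : Type u) (H : Ob → Ob → Type v)
    [∀ a b, AddCommGroup (H a b)] [∀ a b, Module ℂ (H a b)] where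
  one : ∀ a, H a a
  comp : ∀ a b c, H b c →ₗ[ℂ] H a b →ₗ[ℂ] H a c
  nabla : ∀ a b, Idx n → H a b →ₗ[ℂ] H a b
  F : Ob → Matrix (Idx n) (Idx n) ℝ
  Tr : ∀ a, H a a →ₗ[ℂ] ℂ

/-- The coefficients of `∂̄_i = (1 / 2√-1) ∑_j ((τ_I⁻¹ τ)_{ij} δ_j - (τ_I⁻¹)_{ij} δ_{n+j})`,
`τ_I = Im τ`. -/
def dbarCoeff {n : ℕ} (τ : Matrix (Fin n) (Fin n) ℂ) : Matrix (Fin n) (Idx n) ℂ :=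
  let τI : Matrix (Fin n) (Fin n) ℂ := (τ.map Complex.im).map Complex.ofReal
  (1 / (2 * Complex.I)) • Matrix.fromCols (τI⁻¹ * τ) (-τI⁻¹)

/-- The Grassmann algebra generated by `dz̄^1, …, dz̄^n`. -/
abbrev Grassmann (n : ℕ) : Type := ExteriorAlgebra ℂ (Fin n → ℂ)

/-- The generator `dz̄^i`. -/
def dzbar {n : ℕ} (i : Fin n) : Grassmann n := ExteriorAlgebra.ι ℂ (Pi.single i (1 : ℂ))

/-- The coefficient of `dz̄^1 ⋯ dz̄^n`. -/
def topCoeff (n : ℕ) : Grassmann n →ₗ[ℂ] ℂ :=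
  ExteriorAlgebra.liftAlternating (R := ℂ) (M := Fin n → ℂ) (N := ℂ)
    (Pi.single n (Matrix.detRowAlternating (n := Fin n) (R := ℂ)))

namespace PreCategoryData

variable {n : ℕ} {Ob : Type u} {H : Ob → Ob → Type v}
  [∀ a b, AddCommGroup (H a b)] [∀ a b, Module ℂ (H a b)]

/-- The axioms of a pre-category: the composition is associative and unital, the connections
satisfy the Leibniz rule, the curvature of `Hom(a, b)` is the constant `F_b - F_a`, and the trace
gives a nondegenerate pairing with `Tr_a m(ξ, ζ) = Tr_b m(ζ, ξ)`. -/
structure IsPreCategory (P : PreCategoryData n Ob H) : Prop where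
  comp_assoc : ∀ a b c e (ξ : H c e) (ζ : H b c) (χ : H a b),
    P.comp a b e (P.comp b c e ξ ζ) χ = P.comp a c e ξ (P.comp a b c ζ χ)
  leibniz : ∀ a b c j (ξ : H b c) (ζ : H a b),
    P.nabla a c j (P.comp a b c ξ ζ) =
      P.comp a b c (P.nabla b c j ξ) ζ + P.comp a b c ξ (P.nabla a b j ζ)
  one_comp : ∀ a b (ξ : H a b), P.comp a b b (P.one b) ξ = ξ
  comp_one : ∀ a b (ξ : H a b), P.comp a a b ξ (P.one a) = ξ
  F_skew : ∀ a, (P.F a).transpose = -P.F a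
  curvature : ∀ a b i j (ξ : H a b),
    P.nabla a b i (P.nabla a b j ξ) - P.nabla a b j (P.nabla a b i ξ) =
      (-(2 * Real.pi * Complex.I) * ((P.F b i j - P.F a i j : ℝ) : ℂ)) • ξ
  trace_comm : ∀ a b (ξ : H b a) (ζ : H a b),
    P.Tr a (P.comp a b a ξ ζ) = P.Tr b (P.comp b a b ζ ξ)
  trace_nondegenerate : ∀ a b, ((P.comp a b a).compr₂ (P.Tr a)).Nondegenerate

/-- The holomorphic structure `∇̄_i` on `Hom(a, b)`. -/
def nablaBar (P : PreCategoryData n Ob H) (τ : Matrix (Fin n) (Fin n) ℂ) (a b : Ob) (i : Fin n) :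
    H a b →ₗ[ℂ] H a b :=
  ∑ j : Idx n, dbarCoeff τ i j • P.nabla a b j

/-- The potential two-form `f̂_a` of the object `a`: the value of `(∑_i dz̄^i ∇̄_{a,i})²` for a
connection `∇_a` with `[∇_{a,i}, ∇_{a,j}] = -2π√-1 (F_a)_{ij}`. -/
def potential (P : PreCategoryData n Ob H) (τ : Matrix (Fin n) (Fin n) ℂ) (a : Ob) :
    Grassmann n :=
  (-(Real.pi * Complex.I)) • ∑ i, ∑ j,
    (dbarCoeff τ * (P.F a).map Complex.ofReal * (dbarCoeff τ).transpose) i j • (dzbar i * dzbar j)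

/-- The category `𝒞` attached to a pre-category and a complex structure `τ`:
its morphism spaces are `Hom(a, b) ⊗ Λ`. -/
def toCDG (P : PreCategoryData n Ob H) (τ : Matrix (Fin n) (Fin n) ℂ) :
    CDGData Ob (fun a b => H a b ⊗[ℂ] Grassmann n) where
  gr a b
    | Int.ofNat k =>
        LinearMap.range (TensorProduct.map (LinearMap.id (R := ℂ) (M := H a b))
          (⋀[ℂ]^k (Fin n → ℂ)).subtype)
    | Int.negSucc _ => ⊥
  f a := P.one a ⊗ₜ[ℂ] P.potential τ a
  d a b := ∑ i, TensorProduct.map (P.nablaBar τ a b i) (LinearMap.mulLeft ℂ (dzbar i))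
  m a b c := TensorProduct.map₂ (P.comp a b c) (LinearMap.mul ℂ (Grassmann n))

/-- The integral `∫ : Hom(a, a) ⊗ Λ → ℂ` extending the trace. -/
def integral (P : PreCategoryData n Ob H) (a : Ob) : H a a ⊗[ℂ] Grassmann n →ₗ[ℂ] ℂ :=
  LinearMap.mul' ℂ ℂ ∘ₗ TensorProduct.map (P.Tr a) (topCoeff n)

/-- The inner product `η = ∫ m`. -/
def eta (P : PreCategoryData n Ob H) (a b : Ob) :
    (H b a ⊗[ℂ] Grassmann n) →ₗ[ℂ] (H a b ⊗[ℂ] Grassmann n) →ₗ[ℂ] ℂ :=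
  (TensorProduct.map₂ (P.comp a b a) (LinearMap.mul ℂ (Grassmann n))).compr₂ (P.integral a)

end PreCategoryData

/-! ### Schwartz spaces, phases and the Moyal product -/

/-- Euclidean `ℝⁿ`. -/
abbrev E (n : ℕ) : Type := EuclideanSpace ℝ (Fin n)

/-- The real matrix with the same entries as an integer matrix. -/
def toReal {n : ℕ} (A : Matrix (Fin n) (Fin n) ℤ) : Matrix (Fin n) (Fin n) ℝ :=
  A.map (fun z : ℤ => (z : ℝ))

/-- An integer vector as an element of `ℝⁿ`. -/
def vec {n : ℕ} (v : Fin n → ℤ) : E n := WithLp.toLp 2 (fun i => (v i : ℝ))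

/-- A matrix acting on `ℝⁿ`. -/
def act {n : ℕ} (M : Matrix (Fin n) (Fin n) ℝ) (x : E n) : E n :=
  WithLp.toLp 2 (M.mulVec x.ofLp)

/-- `e(t) = exp(2π√-1 t)`. -/
def e (t : ℝ) : ℂ := Complex.exp (2 * Real.pi * Complex.I * t)

/-- Rapidly decreasing functions on the lattice `ℤ^ι`. -/
def SchwartzSeq (ι : Type) [Fintype ι] : Submodule ℂ ((ι → ℤ) → ℂ) where
  carrier := {u | ∀ N : ℕ, ∃ C : ℝ, ∀ m, (1 + ‖m‖) ^ N * ‖u m‖ ≤ C}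
  zero_mem' := fun N => ⟨0, fun m => by simp⟩
  add_mem' := by
    intro u w hu hw N
    obtain ⟨C, hC⟩ := hu N
    obtain ⟨D, hD⟩ := hw N
    refine ⟨C + D, fun m => ?_⟩
    have h : (1 + ‖m‖) ^ N * ‖u m + w m‖ ≤ (1 + ‖m‖) ^ N * (‖u m‖ + ‖w m‖) := by
      gcongr
      exact norm_add_le _ _
    have h1 := hC m
    have h2 := hD m
    rw [mul_add] at h
    exact h.trans (add_le_add h1 h2)
  smul_mem' := by
    intro c u hu N
    obtain ⟨C, hC⟩ := hu N
    refine ⟨‖c‖ * C, fun m => ?_⟩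
    have h := mul_le_mul_of_nonneg_left (hC m) (norm_nonneg c)
    simp only [Pi.smul_apply, norm_smul]
    linarith

/-- The sublattice `B ℤⁿ`. -/
abbrev latticeImage {n : ℕ} (B : Matrix (Fin n) (Fin n) ℤ) : Submodule ℤ (Fin n → ℤ) :=
  LinearMap.range B.mulVecLin

/-- The Schwartz space `𝒮(ℝⁿ × ℤⁿ / B ℤⁿ)` (for nondegenerate `B`, so that the quotient is
finite). -/
abbrev Schw (n : ℕ) (B : Matrix (Fin n) (Fin n) ℤ) : Type :=
  ((Fin n → ℤ) ⧸ latticeImage B) → 𝓢(E n, ℂ)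

/-- The value `ξ(x; μ)`. -/
def Schw.eval {n : ℕ} {B : Matrix (Fin n) (Fin n) ℤ} (ξ : Schw n B) (μ : Fin n → ℤ) (x : E n) : ℂ :=
  ξ (Submodule.Quotient.mk μ) x

/-- The Moyal product `f exp((√-1 / 4π) ∂⃖ θ ∂⃗) g`, computed on plane waves. -/
def moyal {n : ℕ} (θ : Matrix (Fin n) (Fin n) ℝ) (f g : E n → ℂ) (x : E n) : ℂ :=
  ∫ k : E n, ∫ l : E n, 𝓕 f k * 𝓕 g l * e (-(1 / 2) * ⟪k, act θ l⟫) * e ⟪k + l, x⟫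

/-! ### The three types of deformation -/

/-- A noncommutative parameter of Type `θ₁`, `θ₂` or `θ₃`. -/
inductive Deformation (n : ℕ) : Type where
  | type1 (θ : Matrix (Fin n) (Fin n) ℝ) (skew : θ.transpose = -θ) : Deformation n
  | type2 (θ : Matrix (Fin n) (Fin n) ℝ) : Deformation n
  | type3 (θ : Matrix (Fin n) (Fin n) ℝ) (skew : θ.transpose = -θ) : Deformation n

namespace Deformation

variable {n : ℕ}

/-- The parameter of the noncommutative torus with generators
`U_j U_k = exp(-2π√-1 θ^{jk}) U_k U_j`. -/
def param : Deformation n → Matrix (Idx n) (Idx n) ℝ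
  | type1 θ _ => Matrix.fromBlocks θ 0 0 0
  | type2 θ => Matrix.fromBlocks 0 (-θ) θ.transpose 0
  | type3 θ _ => Matrix.fromBlocks 0 0 0 (-θ)

/-- The matrix `𝒞_a θ + 𝒟_a` for `g_a` with blocks `1, 0, F_{a,0}, 1` and
`F_{a,0}` with blocks `0, A_a, -A_a, 0`. -/
def denom (D : Deformation n) (A : Matrix (Fin n) (Fin n) ℤ) : Matrix (Idx n) (Idx n) ℝ :=
  Matrix.fromBlocks 0 (toReal A) (-toReal A) 0 * D.param + 1

/-- The parameter `θ_a = g_a(θ)` of the endomorphism algebra of the basic module of `A_a`. -/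
def objParam (D : Deformation n) (A : Matrix (Fin n) (Fin n) ℤ) : Matrix (Idx n) (Idx n) ℝ :=
  D.param * (D.denom A)⁻¹

/-- The normalization `√|det(𝒞_a θ + 𝒟_a)|` of the trace. -/
def traceFactor (D : Deformation n) (A : Matrix (Fin n) (Fin n) ℤ) : ℝ :=
  Real.sqrt |(D.denom A).det|

/-- The assumption `det(1 + θ₂ A_a) ≠ 0` made for Type `θ₂`. -/
def Admissible (D : Deformation n) (A : Matrix (Fin n) (Fin n) ℤ) : Prop :=
  match D with
  | type1 _ _ => True
  | type2 θ => (1 + θ * toReal A).det ≠ 0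
  | type3 _ _ => True

/-- The curvature `F_a`; for Type `θ₂` and nondegenerate `A`,
`(1 + Aθ₂)⁻¹ A = (A⁻¹ + θ₂)⁻¹` and `(1 + Aθ₂ᵗ)⁻¹ A = (A⁻¹ + θ₂ᵗ)⁻¹`. -/
def curv (D : Deformation n) (A : Matrix (Fin n) (Fin n) ℤ) : Matrix (Idx n) (Idx n) ℝ :=
  match D with
  | type1 θ _ => Matrix.fromBlocks 0 (toReal A) (-toReal A) (toReal A * θ * toReal A)
  | type2 θ => Matrix.fromBlocks 0 ((1 + toReal A * θ.transpose)⁻¹ * toReal A) (-((1 + toReal A * θ)⁻¹ * toReal A)) 0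
  | type3 θ _ => Matrix.fromBlocks (-(toReal A * θ * toReal A)) (toReal A) (-toReal A) 0

/-- The `2n × 2n` matrix expressing the connection `(∇_1, …, ∇_{2n})` on `Hom(a, b)`, `a ≠ b`,
through `(∂_x, 2π√-1 x)`. -/
def connMatrix (D : Deformation n) (Aa Ab : Matrix (Fin n) (Fin n) ℤ) :
    Matrix (Idx n) (Idx n) ℝ :=
  match D with
  | type1 θ _ => Matrix.fromBlocks 1 0 ((1 / 2 : ℝ) • (toReal (Aa + Ab) * θ)) (-toReal (Ab - Aa))
  | type2 θ => Matrix.fromBlocks 1 0 0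
      (-((1 + toReal Ab * θ)⁻¹ * toReal Ab) + (1 + toReal Aa * θ)⁻¹ * toReal Aa)
  | type3 θ _ => Matrix.fromBlocks 1 (-((1 / 2 : ℝ) • (toReal (Aa + Ab) * θ * toReal (Ab - Aa))))
      0 (-toReal (Ab - Aa))

/-- `(ξ_{ab} U_m)(x; μ)` for `m = (k, v)`, where
`U_m = U_1^{k_1} ⋯ U_n^{k_n} U_{1̄}^{v_1} ⋯ U_{n̄}^{v_n} exp(π√-1 ∑_{i<j} m_i m_j θ_a^{ij})`.
For Type `θ₁`, `f * exp(2π√-1 k·x)` is `f(x - θ₁k/2) exp(2π√-1 k·x)`. -/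
def rightAct (D : Deformation n) (Aa Ab : Matrix (Fin n) (Fin n) ℤ) (ξ : Schw n (Ab - Aa))
    (m : Idx n → ℤ) (μ : Fin n → ℤ) (x : E n) : ℂ :=
  let B := (toReal (Ab - Aa))⁻¹
  let k : E n := vec (fun i => m (Sum.inl i))
  let v : Fin n → ℤ := fun i => m (Sum.inr i)
  match D with
  | type1 θ _ => e ⟪k, x + act B (vec μ)⟫ *
      ξ.eval (μ - v) (x + act B (vec v) - (1 / 2 : ℝ) • act θ k)
  | type2 θ => e ((1 / 2) * ⟪k, act ((1 + θ * toReal Aa)⁻¹ * θ) (vec v)⟫) *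
      e ⟪k, act (1 + θ * toReal Aa)⁻¹ x + act B (vec μ)⟫ *
      ξ.eval (μ - v) (x + act ((1 + θ * toReal Ab) * B) (vec v))
  | type3 θ _ => e ⟪k, x + act B (vec μ)⟫ *
      e (-(1 / 2) * ⟪x, act (toReal (Ab - Aa) * θ) (vec v)⟫) *
      ξ.eval (μ - v) (x + act B (vec v))

/-- `(Z_m ξ_{ab})(x; μ)` for `m = (k, v)`, where
`Z_m = Z_1^{k_1} ⋯ Z_n^{k_n} Z_{1̄}^{v_1} ⋯ Z_{n̄}^{v_n} exp(π√-1 ∑_{i<j} m_i m_j θ_b^{ij})`.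
For Type `θ₁`, `exp(2π√-1 k·x) * f` is `exp(2π√-1 k·x) f(x + θ₁k/2)`. -/
def leftAct (D : Deformation n) (Aa Ab : Matrix (Fin n) (Fin n) ℤ) (ξ : Schw n (Ab - Aa))
    (m : Idx n → ℤ) (μ : Fin n → ℤ) (x : E n) : ℂ :=
  let B := (toReal (Ab - Aa))⁻¹
  let k : E n := vec (fun i => m (Sum.inl i))
  let v : Fin n → ℤ := fun i => m (Sum.inr i)
  match D with
  | type1 θ _ => e ⟪k, x + act B (vec μ)⟫ *
      ξ.eval (μ - v) (x + act B (vec v) + (1 / 2 : ℝ) • act θ k)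
  | type2 θ => e (-(1 / 2) * ⟪k, act ((1 + θ * toReal Ab)⁻¹ * θ) (vec v)⟫) *
      e ⟪k, act (1 + θ * toReal Ab)⁻¹ x + act B (vec μ)⟫ *
      ξ.eval (μ - v) (x + act ((1 + θ * toReal Aa) * B) (vec v))
  | type3 θ _ => e ⟪k, x + act B (vec μ)⟫ *
      e ((1 / 2) * ⟪x, act (toReal (Ab - Aa) * θ) (vec v)⟫) *
      ξ.eval (μ - v) (x + act B (vec v))

/-- The pointwise product of two functions on `ℝⁿ` in the pairing: the Moyal product for
Type `θ₁`, the usual product for the others. -/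
def mulFun (D : Deformation n) (f g : E n → ℂ) (x : E n) : ℂ :=
  match D with
  | type1 θ _ => moyal θ f g x
  | type2 _ => f x * g x
  | type3 _ _ => f x * g x

/-- The term with index `u ∈ ℤⁿ` of the lattice sum `m(ξ_{bc}, ξ_{ab})(x, ρ)`. -/
def compTerm (D : Deformation n) (Aa Ab Ac : Matrix (Fin n) (Fin n) ℤ)
    (ξ : Schw n (Ac - Ab)) (ζ : Schw n (Ab - Aa)) (ρ : Fin n → ℤ) (x : E n) (u : Fin n → ℤ) : ℂ :=
  let w : E n := vec u - act (toReal (Ab - Aa) * (toReal (Ac - Aa))⁻¹) (vec ρ)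
  match D with
  | type1 θ _ => moyal θ
      (fun y => ξ.eval (-u + ρ) (y + act (toReal (Ac - Ab))⁻¹ w))
      (fun y => ζ.eval u (y - act (toReal (Ab - Aa))⁻¹ w)) x
  | type2 θ =>
      ξ.eval (-u + ρ) (x + act ((1 + θ * toReal Ac) * (toReal (Ac - Ab))⁻¹) w) *
        ζ.eval u (x - act ((1 + θ * toReal Aa) * (toReal (Ab - Aa))⁻¹) w)
  | type3 θ _ =>
      let x' := x + act (toReal (Ac - Ab))⁻¹ w
      let x'' := x - act (toReal (Ab - Aa))⁻¹ w
      ξ.eval (-u + ρ) x' *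
        e ((1 / 2) * ⟪x', act (toReal (Ac - Ab) * θ * toReal (Ab - Aa)) x''⟫) * ζ.eval u x''

/-- The coefficient of `U_m` in `m(ξ_{ba}, ξ_{ab}) ∈ T_{θ_a}`, i.e. the normalized
`∑_{μ ∈ ℤⁿ/A_{ab}ℤⁿ} ∫ ξ_{ba}(x, μ) * (ξ_{ab} U_{-m})(x, -μ) dx`; the summand does not depend on
the representative chosen for `μ`. -/
def pairCoeff (D : Deformation n) (Aa Ab : Matrix (Fin n) (Fin n) ℤ)
    (ξ : Schw n (Aa - Ab)) (ζ : Schw n (Ab - Aa)) (m : Idx n → ℤ) : ℂ :=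
  ((D.traceFactor Aa)⁻¹ : ℂ) * ∑ᶠ q : (Fin n → ℤ) ⧸ latticeImage (Ab - Aa),
    let μ : Fin n → ℤ := Function.surjInv (Submodule.mkQ_surjective (latticeImage (Ab - Aa))) q
    ∫ x : E n, D.mulFun (ξ.eval μ) (D.rightAct Aa Ab ζ (-m) (-μ)) x

/-- The value of `m^t θ m'`. -/
def bil (θ : Matrix (Idx n) (Idx n) ℝ) (m m' : Idx n → ℤ) : ℝ :=
  (fun i => (m i : ℝ)) ⬝ᵥ θ.mulVec (fun i => (m' i : ℝ))

end Deformation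

/-! ### The deformed categories of line bundles -/

section Model

variable {n : ℕ} {Ob : Type u}

/-- `Hom(a, b)`: the noncommutative torus (rapidly decreasing coefficients `u_m`) if `a = b`, and
`𝒮(ℝⁿ × ℤⁿ / A_{ab} ℤⁿ)`, `A_{ab} = A_b - A_a`, if `a ≠ b`. It is realized inside the product of
the two spaces by asking that the irrelevant component vanish. If an object `o` has `A_o = 0`, then
`Hom(o, a)` is the basic module `E_a = 𝒮(ℝⁿ × ℤⁿ / A_a ℤⁿ)` of `a`. -/
def HomSpace (A : Ob → Matrix (Fin n) (Fin n) ℤ) (a b : Ob) :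
    Submodule ℂ (SchwartzSeq (Idx n) × Schw n (A b - A a)) where
  carrier := {p | (a ≠ b → p.1 = 0) ∧ (a = b → p.2 = 0)}
  zero_mem' := ⟨fun _ => rfl, fun _ => rfl⟩
  add_mem' := by
    rintro p q ⟨hp, hp'⟩ ⟨hq, hq'⟩
    exact ⟨fun h => by simp [hp h, hq h], fun h => by simp [hp' h, hq' h]⟩
  smul_mem' := by
    rintro c p ⟨hp, hp'⟩
    exact ⟨fun h => by simp [hp h], fun h => by simp [hp' h]⟩

variable {A : Ob → Matrix (Fin n) (Fin n) ℤ} {a b : Ob}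

/-- The coefficient of `U_m` of an element of `Hom(a, a)`. -/
def coeff (ξ : HomSpace A a b) (m : Idx n → ℤ) : ℂ := ξ.val.1.val m

/-- The Schwartz function underlying an element of `Hom(a, b)`, `a ≠ b`. -/
def fn (ξ : HomSpace A a b) : Schw n (A b - A a) := ξ.val.2

/-- The explicit formulas for the identities, compositions, connections, curvatures and traces of
the pre-category of line bundles `{A_a}` on the noncommutative torus with parameter `D`. -/
structure IsLineBundleModel (D : Deformation n) (A : Ob → Matrix (Fin n) (Fin n) ℤ)
    (P : PreCategoryData n Ob (fun a b => HomSpace A a b)) : Prop where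
  one_coeff : ∀ a m, coeff (P.one a) m = Pi.single (M := fun _ => ℂ) (0 : Idx n → ℤ) 1 m
  /-- the product of the noncommutative torus `T_{θ_a}`,
  `U_m U_{m'} = exp(-π√-1 m^t θ_a m') U_{m+m'}` -/
  comp_torus : ∀ (a : Ob) (u w : HomSpace A a a) (m : Idx n → ℤ),
    HasSum (fun l : Idx n → ℤ => coeff u l * coeff w (m - l) *
        e (-(1 / 2) * Deformation.bil (D.objParam (A a)) l (m - l)))
      (coeff (P.comp a a a u w) m)
  /-- the right action of `T_{θ_a}` -/
  comp_right : ∀ (a b : Ob), a ≠ b → ∀ (ξ : HomSpace A a b) (u : HomSpace A a a)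
    (μ : Fin n → ℤ) (x : E n),
    HasSum (fun m : Idx n → ℤ => coeff u m * D.rightAct (A a) (A b) (fn ξ) m μ x)
      ((fn (P.comp a a b ξ u)).eval μ x)
  /-- the left action of `T_{θ_b}` -/
  comp_left : ∀ (a b : Ob), a ≠ b → ∀ (u : HomSpace A b b) (ξ : HomSpace A a b)
    (μ : Fin n → ℤ) (x : E n),
    HasSum (fun m : Idx n → ℤ => coeff u m * D.leftAct (A a) (A b) (fn ξ) m μ x)
      ((fn (P.comp a b b u ξ)).eval μ x)
  /-- the trace-type pairing `Hom(b, a) ⊗ Hom(a, b) → T_{θ_a}` -/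
  comp_pairing : ∀ (a b : Ob), a ≠ b → ∀ (ξ : HomSpace A b a) (ζ : HomSpace A a b)
    (m : Idx n → ℤ),
    coeff (P.comp a b a ξ ζ) m = D.pairCoeff (A a) (A b) (fn ξ) (fn ζ) m
  /-- the general composition -/
  comp_general : ∀ (a b c : Ob), a ≠ b → b ≠ c → a ≠ c →
    ∀ (ξ : HomSpace A b c) (ζ : HomSpace A a b) (ρ : Fin n → ℤ) (x : E n),
    HasSum (D.compTerm (A a) (A b) (A c) (fn ξ) (fn ζ) ρ x) ((fn (P.comp a b c ξ ζ)).eval ρ x)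
  /-- the derivations of `T_{θ_a}`: `∇_j U_m = 2π√-1 ((𝒞_a θ + 𝒟_a)⁻¹ m)_j U_m` -/
  nabla_torus : ∀ (a : Ob) (j : Idx n) (u : HomSpace A a a) (m : Idx n → ℤ),
    coeff (P.nabla a a j u) m =
      2 * Real.pi * Complex.I * (((D.denom (A a))⁻¹.mulVec (fun i => (m i : ℝ)) j : ℝ) : ℂ) *
        coeff u m
  /-- the constant curvature connection on `Hom(a, b)`, `a ≠ b` -/
  nabla_general : ∀ (a b : Ob), a ≠ b → ∀ (j : Idx n) (ξ : HomSpace A a b)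
    (μ : Fin n → ℤ) (x : E n),
    (fn (P.nabla a b j ξ)).eval μ x =
      ∑ p : Fin n, (D.connMatrix (A a) (A b) j (Sum.inl p) : ℂ) *
          fderiv ℝ ((fn ξ).eval μ) x (EuclideanSpace.single p 1) +
      ∑ p : Fin n, (D.connMatrix (A a) (A b) j (Sum.inr p) : ℂ) *
          (2 * Real.pi * Complex.I * (x p : ℂ)) * (fn ξ).eval μ x
  F_eq : ∀ a, P.F a = D.curv (A a)
  Tr_eq : ∀ (a : Ob) (u : HomSpace A a a), P.Tr a u = (D.traceFactor (A a) : ℂ) * coeff u 0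

end Model

end NCTori

end

open scoped TensorProduct SchwartzMap FourierTransform RealInnerProductSpace

noncomputable section

namespace NCTori

universe u v

/-! ### Graded commutativity and Poincaré duality in the Grassmann algebra -/

section Grassmann

variable {n : ℕ}

/-! The proof rewrites every morphism as an equivariant family: a function `f u X` of `u ∈ ℤⁿ` and
`X ∈ ℝⁿ`, smooth in `X`, rapidly decreasing in `u`, and invariant under `(u, X) ↦ (u + A_ab v, X +
D_a v)` with `D_a = 1 + θ A_a`. For `a ≠ b` such a family amounts to finitely many Schwartz
functions (`unfold`). For `a = b` it is periodic in `X`, that is, an element of the noncommutative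
torus summed as a Fourier series in half of its indices (`tor`). In this language the torus product,
the two actions, the pairing and the general composition are one and the same twisted convolution,
`(f * g)(ρ, X) = ∑_u f(ρ - u, X + θ u) g(u, X) e(φ(ρ - u, u, X))`, so the axioms need almost no case
distinction between equal and distinct objects.

The phase is `φ(v, u, X) = ½ ⟨L_bc(v, X + θ u), κ L_ab(u, X)⟩` with `κ` skew, `L_ab(u, X) = (K_a -
K_b) X + (1 - K_b θ) u` and `K_a = A_a D_a⁻¹`. The function `L` is equivariant (`lin_eqv`) and
additive along compositions, `L_bc(v, X + θ u) + L_ab(u, X) = L_ac(v + u, X)` (`lin_add`). A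
bilinear form evaluated on an additive quantity is a cocycle (`phase_cocycle`), and this is
associativity (`conv_assoc`). Additivity also makes multiplication by a component of `L` a
derivation of the composition (`lf_mul_conv`); a partial derivative becomes one after adding the
component of `L` that compensates the derivative of the phase (`conn_conv`). The commutators of
these operators are constant (`conn_comm`).

The trace integrates `f 0` over a period cell. Unfolding the cell integral of a lattice sum into
integrals over `ℝⁿ` (`setIntegral_cube_tsum`) yields the pairing. Skewness of `κ` removes the phase
there, a translation by `θ u` gives symmetry, and pairing a family with the conjugate of its
reflection gives an L² norm, hence nondegeneracy (`eq_zero_of_trF_conv`).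

Type `θ₂` is the case `κ = 0`; Type `θ₃` is the case `θ = 0`, `κ = θ₃`. Type `θ₁` is the Fourier
transform of the case `θ = 0`, `κ = -θ₁`: the transform `dualFam` exchanges derivatives with the
invariant coordinates and turns the phase into a shift by half of `θ₁ l` against the frequency `l`,
which is the Moyal product (`hasSum_moyalModel_integral`, `moyal_eq_integral`). The axioms are
transported along these isomorphisms, so what remains for each type is to match the explicit
formulas. For the pairing only the coefficient of `U_0` has to be matched; associativity supplies
the others (`pairing_of_coeff_zero`).

The passage to a cyclic CDG category is formal. Antisymmetry of the one-forms turns `d²` into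
curvature, Poincaré duality in the Grassmann algebra gives nondegeneracy of `η`, and the vanishing
of the trace on derivatives plays the role of Stokes' theorem. Uniqueness holds because every
structure map is prescribed by an equation or by the value of a convergent sum. -/

theorem ι_mul_of_mem (x : Fin n → ℂ) {l : ℕ} {y : Grassmann n} (hy : y ∈ ⋀[ℂ]^l (Fin n → ℂ)) :
    ExteriorAlgebra.ι ℂ x * y = (-1 : ℂ) ^ l • (y * ExteriorAlgebra.ι ℂ x) := by
  induction hy using Submodule.pow_induction_on_left' with
  | algebraMap r => simp [Algebra.commutes]
  | add y z i hy hz ihy ihz => rw [mul_add, add_mul, ihy, ihz, smul_add]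
  | mem_mul m hm i y hy ih =>
    obtain ⟨w, rfl⟩ := hm
    have h : ExteriorAlgebra.ι ℂ x * ExteriorAlgebra.ι ℂ w =
        -(ExteriorAlgebra.ι ℂ w * ExteriorAlgebra.ι ℂ x) :=
      eq_neg_of_add_eq_zero_left (ExteriorAlgebra.ι_add_mul_swap x w)
    rw [← mul_assoc, h, neg_mul, mul_assoc, ih, mul_smul_comm, ← mul_assoc, pow_succ]
    simp

theorem mul_comm_of_mem {k l : ℕ} {x y : Grassmann n} (hx : x ∈ ⋀[ℂ]^k (Fin n → ℂ))
    (hy : y ∈ ⋀[ℂ]^l (Fin n → ℂ)) : x * y = (-1 : ℂ) ^ (k * l) • (y * x) := by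
  induction hx using Submodule.pow_induction_on_left' with
  | algebraMap r => simp [Algebra.commutes]
  | add y z i hy hz ihy ihz => rw [mul_add, add_mul, ihy, ihz, smul_add]
  | mem_mul m hm i x hx ih =>
    obtain ⟨w, rfl⟩ := hm
    rw [mul_assoc, ih, mul_smul_comm, ← mul_assoc, ι_mul_of_mem w hy, smul_mul_assoc, smul_smul,
      ← pow_add, mul_assoc, Nat.succ_mul]

theorem dzbar_mem (i : Fin n) : dzbar i ∈ ⋀[ℂ]^1 (Fin n → ℂ) := by
  change _ ∈ LinearMap.range (ExteriorAlgebra.ι ℂ) ^ 1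
  rw [pow_one]
  exact ⟨_, rfl⟩

theorem mul_mem_exteriorPower {k l : ℕ} {x y : Grassmann n} (hx : x ∈ ⋀[ℂ]^k (Fin n → ℂ))
    (hy : y ∈ ⋀[ℂ]^l (Fin n → ℂ)) : x * y ∈ ⋀[ℂ]^(k + l) (Fin n → ℂ) := by
  change _ ∈ LinearMap.range (ExteriorAlgebra.ι ℂ) ^ (k + l)
  rw [pow_add]
  exact Submodule.mul_mem_mul hx hy

theorem dzbar_mul_dzbar_swap (i j : Fin n) : dzbar i * dzbar j = -(dzbar j * dzbar i) :=
  eq_neg_of_add_eq_zero_left (ExteriorAlgebra.ι_add_mul_swap _ _)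

/-- The functional is assembled from alternating maps that are zero in every degree except `n`, and
the monomials of length `k` span the degree `k` piece. -/
theorem topCoeff_eq_zero {k : ℕ} (hk : k ≠ n) {x : Grassmann n} (hx : x ∈ ⋀[ℂ]^k (Fin n → ℂ)) :
    topCoeff n x = 0 := by
  rw [← ExteriorAlgebra.ιMulti_span_fixedDegree] at hx
  induction hx using Submodule.span_induction with
  | mem x hx =>
    obtain ⟨v, rfl⟩ := hx
    rw [topCoeff, ExteriorAlgebra.liftAlternating_apply_ιMulti, Pi.single_eq_of_ne hk]
    rfl
  | zero => simp
  | add x y _ _ hx hy => simp [hx, hy]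
  | smul c x _ hx => simp [hx]

/-- The basis of the Grassmann algebra by ordered monomials in the `dz̄^i`. -/
abbrev grassmannBasis (n : ℕ) : Module.Basis (Finset (Fin n)) ℂ (Grassmann n) :=
  (Pi.basisFun ℂ (Fin n)).ExteriorAlgebra

theorem grassmannBasis_mem (s : Finset (Fin n)) :
    grassmannBasis n s ∈ ⋀[ℂ]^s.card (Fin n → ℂ) := by
  rw [grassmannBasis, ExteriorAlgebra.basis_apply]
  rw [← ExteriorAlgebra.ιMulti_span_fixedDegree]
  exact Submodule.subset_span ⟨_, rfl⟩

/-- The top monomial is a wedge of all basis vectors in some order, so its coefficient is the sign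
of a permutation. Only its nonvanishing matters later. -/
theorem topCoeff_univ : topCoeff n (grassmannBasis n Finset.univ) ≠ 0 := by
  have hc : (Finset.univ : Finset (Fin n)).card = n := by simp
  rw [grassmannBasis, ExteriorAlgebra.basis_apply_ofCard _ hc, ExteriorAlgebra.ιMulti_family,
    topCoeff, ExteriorAlgebra.liftAlternating_apply_ιMulti, Pi.single_eq_same]
  intro h0
  set g : Fin n → Fin n := ⇑(Set.powersetCard.ofFinEmbEquiv.symm (Set.powersetCard.ofCard hc))
    with hg
  have hinj : Function.Injective g :=
    (Set.powersetCard.ofFinEmbEquiv.symm (Set.powersetCard.ofCard hc)).injective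
  have hb : Function.Bijective g := Finite.injective_iff_bijective.mp hinj
  have h1 := Matrix.det_permute (Equiv.ofBijective g hb) (1 : Matrix (Fin n) (Fin n) ℂ)
  have h2 : ((⇑(Pi.basisFun ℂ (Fin n)) ∘ g : Fin n → Fin n → ℂ) : Matrix (Fin n) (Fin n) ℂ) =
      (1 : Matrix (Fin n) (Fin n) ℂ).submatrix (Equiv.ofBijective g hb) id := by
    ext i j
    simp [Matrix.one_apply, Pi.single_apply, eq_comm]
  change Matrix.det ((⇑(Pi.basisFun ℂ (Fin n)) ∘ g : Fin n → Fin n → ℂ) : Matrix (Fin n) (Fin n) ℂ)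
    = 0 at h0
  rw [h2, h1] at h0
  simp only [Matrix.det_one, mul_one] at h0
  rcases Int.units_eq_one_or (Equiv.Perm.sign (Equiv.ofBijective g hb)) with h | h <;>
    rw [h] at h0 <;> simp at h0

/-- Poincaré duality on monomials: overlapping monomials multiply to zero, disjoint ones of the
wrong total size miss the top degree, and complementary ones give the top monomial up to sign. -/
theorem topCoeff_basis_mul (s t : Finset (Fin n)) :
    topCoeff n (grassmannBasis n s * grassmannBasis n t) ≠ 0 ↔ t = sᶜ := by
  constructor
  · intro h
    by_contra hne
    apply h
    by_cases hd : Disjoint s t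
    · apply topCoeff_eq_zero (k := s.card + t.card) _
        (mul_mem_exteriorPower (grassmannBasis_mem s) (grassmannBasis_mem t))
      intro hcard
      apply hne
      apply Finset.eq_of_subset_of_card_le
      · exact le_compl_iff_disjoint_left.mpr hd
      · rw [Finset.card_compl, Fintype.card_fin]
        omega
    · have := ExteriorAlgebra.basis_mul_of_not_disjoint (Pi.basisFun ℂ (Fin n))
        (⟨s, rfl⟩ : Set.powersetCard (Fin n) s.card) (⟨t, rfl⟩ : Set.powersetCard (Fin n) t.card) hd
      rw [grassmannBasis]
      erw [this]
      simp
  · rintro rfl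
    have hd : Disjoint s sᶜ := disjoint_compl_right
    have := ExteriorAlgebra.basis_mul_of_disjoint (Pi.basisFun ℂ (Fin n))
        (s := (⟨s, rfl⟩ : Set.powersetCard (Fin n) s.card))
        (t := (⟨sᶜ, rfl⟩ : Set.powersetCard (Fin n) sᶜ.card)) hd
    have hu : ((Set.powersetCard.disjUnion (s := (⟨s, rfl⟩ : Set.powersetCard (Fin n) s.card))
        (t := (⟨sᶜ, rfl⟩ : Set.powersetCard (Fin n) sᶜ.card)) hd :) : Finset (Fin n)) = Finset.univ := by
      simp
    rw [hu] at this
    erw [this]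
    intro h0
    rcases Int.units_eq_one_or (Set.powersetCard.permOfDisjoint (s := (⟨s, rfl⟩ : Set.powersetCard (Fin n) s.card))
        (t := (⟨sᶜ, rfl⟩ : Set.powersetCard (Fin n) sᶜ.card)) hd).sign with h | h <;>
      rw [h] at h0 <;> simp at h0 <;> exact topCoeff_univ h0

end Grassmann

/-! ### The cyclic CDG category of a pre-category -/

namespace PreCategoryData

variable {n : ℕ} {Ob : Type u} {H : Ob → Ob → Type v}
  [∀ a b, AddCommGroup (H a b)] [∀ a b, Module ℂ (H a b)]
  {P : PreCategoryData n Ob H} {τ : Matrix (Fin n) (Fin n) ℂ}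

theorem gr_ofNat (a b : Ob) (k : ℕ) : (P.toCDG τ).gr a b (k : ℤ) =
    LinearMap.range (TensorProduct.map (LinearMap.id (R := ℂ) (M := H a b))
          (⋀[ℂ]^k (Fin n → ℂ)).subtype) := rfl

theorem gr_negSucc (a b : Ob) (k : ℕ) : (P.toCDG τ).gr a b (Int.negSucc k) = ⊥ := rfl

theorem tmul_mem_gr {a b : Ob} {k : ℕ} (h : H a b) {x : Grassmann n}
    (hx : x ∈ ⋀[ℂ]^k (Fin n → ℂ)) : h ⊗ₜ[ℂ] x ∈ (P.toCDG τ).gr a b (k : ℤ) := by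
  rw [gr_ofNat]
  exact ⟨h ⊗ₜ ⟨x, hx⟩, rfl⟩

/-- Reduces a linear statement about a graded piece to pure tensors with a homogeneous form. In
negative degrees the piece is zero, so `h0` is enough. -/
theorem gr_induction {a b : Ob} {k : ℤ} {p : ∀ v, v ∈ (P.toCDG τ).gr a b k → Prop}
    (h0 : p 0 (Submodule.zero_mem _))
    (hadd : ∀ v w hv hw, p v hv → p w hw → p (v + w) (Submodule.add_mem _ hv hw))
    (hpure : ∀ (j : ℕ) (hj : k = j) (h : H a b) (x : Grassmann n) (hx : x ∈ ⋀[ℂ]^j (Fin n → ℂ)),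
      p (h ⊗ₜ x) (hj ▸ tmul_mem_gr h hx)) {v : H a b ⊗[ℂ] Grassmann n}
    (hv : v ∈ (P.toCDG τ).gr a b k) : p v hv := by
  cases k with
  | ofNat k =>
    obtain ⟨w, rfl⟩ := id hv
    induction w using TensorProduct.induction_on with
    | zero => simpa using h0
    | tmul h x => exact hpure k rfl h x x.2
    | add v w ihv ihw =>
      simp only [map_add]
      exact hadd _ _ _ _ (ihv ⟨v, rfl⟩) (ihw ⟨w, rfl⟩)
  | negSucc k =>
    have h := id hv
    rw [gr_negSucc, Submodule.mem_bot] at h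
    subst h
    exact h0

theorem d_tmul (a b : Ob) (h : H a b) (x : Grassmann n) :
    (P.toCDG τ).d a b (h ⊗ₜ x) = ∑ i, P.nablaBar τ a b i h ⊗ₜ[ℂ] (dzbar i * x) := by
  simp [toCDG, LinearMap.sum_apply]

theorem m_tmul (a b c : Ob) (h : H b c) (g : H a b) (x y : Grassmann n) :
    (P.toCDG τ).m a b c (h ⊗ₜ x) (g ⊗ₜ y) = P.comp a b c h g ⊗ₜ[ℂ] (x * y) := rfl

theorem eta_tmul (a b : Ob) (h : H b a) (g : H a b) (x y : Grassmann n) :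
    P.eta a b (h ⊗ₜ x) (g ⊗ₜ y) = P.Tr a (P.comp a b a h g) * topCoeff n (x * y) := rfl

theorem eta_eq (a b : Ob) (v : H b a ⊗[ℂ] Grassmann n) (w : H a b ⊗[ℂ] Grassmann n) :
    P.eta a b v w = P.integral a ((P.toCDG τ).m a b a v w) := rfl

theorem potential_mem (a : Ob) : P.potential τ a ∈ ⋀[ℂ]^2 (Fin n → ℂ) :=
  Submodule.smul_mem _ _ (Submodule.sum_mem _ fun i _ => Submodule.sum_mem _ fun j _ =>
    Submodule.smul_mem _ _ (mul_mem_exteriorPower (dzbar_mem i) (dzbar_mem j)))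

-- Tensoring the degree projections of the Grassmann algebra with the identity gives operators `Q k`
-- that fix the piece `k` and kill the others, whence independence. Spanning comes from decomposing
-- the form in each pure tensor.
variable (P τ) in
theorem gr_isInternal (a b : Ob) : DirectSum.IsInternal ((P.toCDG τ).gr a b) := by
  classical
  let π : ℕ → Grassmann n →ₗ[ℂ] Grassmann n := fun k =>
    GradedAlgebra.proj (fun i : ℕ => ⋀[ℂ]^i (Fin n → ℂ)) k
  have hπ : ∀ (k j : ℕ) (x : Grassmann n), x ∈ ⋀[ℂ]^j (Fin n → ℂ) →
      π k x = if k = j then x else 0 := by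
    intro k j x hx
    simp only [π, GradedAlgebra.proj_apply]
    split_ifs with h
    · subst h
      exact DirectSum.decompose_of_mem_same _ hx
    · exact DirectSum.decompose_of_mem_ne _ hx (Ne.symm h)
  let Q : ℤ → (H a b ⊗[ℂ] Grassmann n) →ₗ[ℂ] (H a b ⊗[ℂ] Grassmann n)
    | Int.ofNat k => TensorProduct.map LinearMap.id (π k)
    | Int.negSucc _ => 0
  have hQ : ∀ (k j : ℤ) (v : H a b ⊗[ℂ] Grassmann n), v ∈ (P.toCDG τ).gr a b j →
      Q k v = if k = j then v else 0 := by
    intro k j v hv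
    induction hv using gr_induction with
    | h0 => simp
    | hadd v w _ _ hv hw => rw [map_add, hv, hw]; split_ifs <;> simp
    | hpure l hl h x hx =>
      subst hl
      cases k with
      | ofNat k =>
        have := hπ k l x hx
        simp only [Q, TensorProduct.map_tmul, LinearMap.id_apply, this, Int.ofNat_eq_natCast,
          Nat.cast_inj]
        split_ifs <;> simp
      | negSucc k => simp [Q]
  apply DirectSum.isInternal_submodule_of_iSupIndep_of_iSup_eq_top
  · intro i
    rw [Submodule.disjoint_def]
    intro x hx hx'
    have h1 : (⨆ j, ⨆ (_ : j ≠ i), (P.toCDG τ).gr a b j) ≤ LinearMap.ker (Q i) := by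
      refine iSup₂_le fun j hj v hv => ?_
      rw [LinearMap.mem_ker, hQ i j v hv, if_neg (Ne.symm hj)]
    have h2 := hQ i i x hx
    rw [if_pos rfl] at h2
    rw [← h2]
    exact h1 hx'
  · rw [eq_top_iff]
    rintro v -
    induction v using TensorProduct.induction_on with
    | zero => exact Submodule.zero_mem _
    | add v w hv hw => exact Submodule.add_mem _ hv hw
    | tmul h x =>
      rw [← DirectSum.sum_support_decompose (fun i : ℕ => ⋀[ℂ]^i (Fin n → ℂ)) x,
        TensorProduct.tmul_sum]
      refine Submodule.sum_mem _ fun k _ => ?_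
      exact Submodule.mem_iSup_of_mem (k : ℤ) (tmul_mem_gr h (SetLike.coe_mem _))

theorem nablaBar_leibniz (hP : P.IsPreCategory) (a b c : Ob) (i : Fin n) (ξ : H b c) (ζ : H a b) :
    P.nablaBar τ a c i (P.comp a b c ξ ζ) =
      P.comp a b c (P.nablaBar τ b c i ξ) ζ + P.comp a b c ξ (P.nablaBar τ a b i ζ) := by
  simp only [nablaBar, LinearMap.sum_apply, LinearMap.smul_apply, hP.leibniz, smul_add,
    Finset.sum_add_distrib, map_sum, map_smul]

/-- The Leibniz rule for `1 · 1 = 1` reads `∇̄ 1 = ∇̄ 1 + ∇̄ 1`. -/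
theorem nablaBar_one (hP : P.IsPreCategory) (a : Ob) (i : Fin n) :
    P.nablaBar τ a a i (P.one a) = 0 := by
  have h := nablaBar_leibniz (τ := τ) hP a a a i (P.one a) (P.one a)
  rw [hP.one_comp, hP.comp_one, hP.one_comp] at h
  simpa using h

theorem nablaBar_comm (hP : P.IsPreCategory) (a b : Ob) (i j : Fin n) (ξ : H a b) :
    P.nablaBar τ a b i (P.nablaBar τ a b j ξ) - P.nablaBar τ a b j (P.nablaBar τ a b i ξ) =
      (-(2 * Real.pi * Complex.I) *
        ((dbarCoeff τ * (P.F b).map Complex.ofReal * (dbarCoeff τ).transpose) i j -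
        (dbarCoeff τ * (P.F a).map Complex.ofReal * (dbarCoeff τ).transpose) i j)) • ξ := by
  have h1 : ∀ i j : Fin n, P.nablaBar τ a b i (P.nablaBar τ a b j ξ) =
      ∑ k, ∑ l, (dbarCoeff τ i k * dbarCoeff τ j l) • P.nabla a b k (P.nabla a b l ξ) := by
    intro i j
    simp only [nablaBar, LinearMap.sum_apply, LinearMap.smul_apply, map_sum, map_smul,
      Finset.smul_sum, smul_smul]
    rw [Finset.sum_comm]
    refine Finset.sum_congr rfl fun k _ => Finset.sum_congr rfl fun l _ => ?_
    rw [mul_comm]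
  have h2 : ∀ M : Matrix (Idx n) (Idx n) ℝ,
      (dbarCoeff τ * M.map Complex.ofReal * (dbarCoeff τ).transpose) i j =
        ∑ k, ∑ l, dbarCoeff τ i k * dbarCoeff τ j l * (M k l : ℂ) := by
    intro M
    rw [Matrix.mul_apply, Finset.sum_comm]
    refine Finset.sum_congr rfl fun l _ => ?_
    rw [Matrix.mul_apply, Finset.sum_mul]
    refine Finset.sum_congr rfl fun k _ => ?_
    simp only [Matrix.map_apply, Matrix.transpose_apply]
    ring
  -- Interchanging the sums in the second product pairs both expansions along the same coefficients,
  -- leaving the commutators `[∇_k, ∇_l]`.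
  rw [h1, h1 j i, Finset.sum_comm (f := fun k l => (dbarCoeff τ j k * dbarCoeff τ i l) •
    P.nabla a b k (P.nabla a b l ξ)), ← Finset.sum_sub_distrib, h2, h2, ← Finset.sum_sub_distrib,
    Finset.mul_sum, Finset.sum_smul]
  refine Finset.sum_congr rfl fun k _ => ?_
  rw [← Finset.sum_sub_distrib, ← Finset.sum_sub_distrib, Finset.mul_sum, Finset.sum_smul]
  refine Finset.sum_congr rfl fun l _ => ?_
  rw [mul_comm (dbarCoeff τ j l), ← smul_sub, hP.curvature, smul_smul]
  congr 1
  push_cast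
  ring

/-- Most axioms reduce to pure tensors. The sign in the Leibniz rule comes from moving `dz̄^i` past
a form of degree `k`, and `d²` is the curvature because antisymmetry of `dz̄^i dz̄^j` selects
commutators. -/
theorem toCDG_isCDGCategory (hP : P.IsPreCategory) : (P.toCDG τ).IsCDGCategory where
  grading := gr_isInternal P τ
  f_mem a := tmul_mem_gr _ (potential_mem a)
  d_mem a b k v hv := by
    induction hv using gr_induction with
    | h0 => simp
    | hadd v w _ _ hv hw => rw [map_add]; exact Submodule.add_mem _ hv hw
    | hpure j hj h x hx =>
      subst hj
      rw [d_tmul, add_comm]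
      refine Submodule.sum_mem _ fun i _ => ?_
      exact_mod_cast tmul_mem_gr (k := 1 + j) _ (mul_mem_exteriorPower (dzbar_mem i) hx)
  m_mem a b c k l v hv w hw := by
    induction hv using gr_induction with
    | h0 => simp
    | hadd v v' _ _ hv hv' => rw [map_add]; exact Submodule.add_mem _ hv hv'
    | hpure j hj h x hx =>
      induction hw using gr_induction with
      | h0 => simp
      | hadd v v' _ _ hv hv' => rw [map_add]; exact Submodule.add_mem _ hv hv'
      | hpure j' hj' g y hy =>
        subst hj hj'
        rw [m_tmul]
        exact_mod_cast tmul_mem_gr _ (mul_mem_exteriorPower hx hy)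
  d_f a := by
    change (P.toCDG τ).d a a (P.one a ⊗ₜ P.potential τ a) = 0
    rw [d_tmul]
    exact Finset.sum_eq_zero fun i _ => by rw [nablaBar_one hP, TensorProduct.zero_tmul]
  d_d a b v := by
    induction v using TensorProduct.induction_on with
    | zero => simp
    | add v w hv hw =>
      simp only [map_add, LinearMap.add_apply] at hv hw ⊢
      rw [hv, hw]; abel
    | tmul h x =>
      change _ = (P.toCDG τ).m a b b (P.one b ⊗ₜ P.potential τ b) (h ⊗ₜ x) -
        (P.toCDG τ).m a a b (h ⊗ₜ x) (P.one a ⊗ₜ P.potential τ a)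
      -- The potential is an even form, hence central, so both curvature terms can be written with
      -- the form on the left.
      have hc : x * P.potential τ a = P.potential τ a * x := by
        induction x using DirectSum.Decomposition.inductionOn
            (fun i : ℕ => ⋀[ℂ]^i (Fin n → ℂ)) with
        | zero => simp
        | homogeneous y =>
          rw [mul_comm_of_mem y.2 (potential_mem (P := P) (τ := τ) a)]
          simp
        | add y z hy hz => rw [add_mul, mul_add, hy, hz]
      rw [m_tmul, m_tmul, hP.one_comp, hP.comp_one, hc, ← TensorProduct.tmul_sub, ← sub_mul]
      set S := (P.toCDG τ).d a b ((P.toCDG τ).d a b (h ⊗ₜ x)) with hS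
      have hS1 : S = ∑ i, ∑ j, P.nablaBar τ a b i (P.nablaBar τ a b j h) ⊗ₜ[ℂ]
          (dzbar i * dzbar j * x) := by
        rw [hS, d_tmul, map_sum, Finset.sum_comm]
        refine Finset.sum_congr rfl fun j _ => ?_
        rw [d_tmul]
        simp only [mul_assoc]
      have hS2 : S = -∑ i, ∑ j, P.nablaBar τ a b j (P.nablaBar τ a b i h) ⊗ₜ[ℂ]
          (dzbar i * dzbar j * x) := by
        rw [hS1, Finset.sum_comm, ← Finset.sum_neg_distrib]
        refine Finset.sum_congr rfl fun i _ => ?_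
        rw [← Finset.sum_neg_distrib]
        refine Finset.sum_congr rfl fun j _ => ?_
        rw [dzbar_mul_dzbar_swap j i, neg_mul, TensorProduct.tmul_neg]
      -- Adding the two expressions of `S`, which differ by exchanging `i` and `j`, leaves only
      -- commutators. The factor 2 accounts for the `-2πi` in the curvature against the `-πi` in the
      -- potential.
      have hS3 : (2 : ℂ) • S = (2 : ℂ) • (h ⊗ₜ[ℂ] ((P.potential τ b - P.potential τ a) * x)) := by
        rw [two_smul ℂ S]
        nth_rw 1 [hS1]
        rw [hS2, ← sub_eq_add_neg, ← Finset.sum_sub_distrib]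
        simp only [← Finset.sum_sub_distrib, ← TensorProduct.sub_tmul, nablaBar_comm hP]
        simp only [potential, ← Finset.sum_sub_distrib, ← sub_smul,
          Finset.sum_mul, TensorProduct.tmul_sum, smul_mul_assoc, TensorProduct.tmul_smul,
          Finset.smul_sum, smul_smul, TensorProduct.smul_tmul']
        refine Finset.sum_congr rfl fun i _ => Finset.sum_congr rfl fun j _ => ?_
        congr 2
        ring
      exact smul_right_injective _ (two_ne_zero' ℂ) hS3
  leibniz a b c k v hv w := by
    induction hv using gr_induction with
    | h0 => simp
    | hadd v v' _ _ hv hv' =>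
      simp only [map_add, LinearMap.add_apply, smul_add] at hv hv' ⊢
      rw [hv, hv']; abel
    | hpure j hj h x hx =>
      subst hj
      induction w using TensorProduct.induction_on with
      | zero => simp
      | add v w hv hw =>
        simp only [map_add, smul_add] at hv hw ⊢
        rw [hv, hw]; abel
      | tmul g y =>
        rw [m_tmul, d_tmul, d_tmul, d_tmul]
        simp only [map_sum, LinearMap.sum_apply, m_tmul, Finset.smul_sum,
          ← Finset.sum_add_distrib]
        refine Finset.sum_congr rfl fun i _ => ?_
        rw [nablaBar_leibniz hP, TensorProduct.add_tmul, mul_assoc, zpow_natCast,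
          ← TensorProduct.tmul_smul, ← mul_assoc x, ← smul_mul_assoc]
        have : (-1 : ℂ) ^ j • (x * dzbar i) = dzbar i * x := by
          rw [dzbar, ι_mul_of_mem _ hx]
        rw [this, mul_assoc]
  assoc a b c e v w z := by
    induction v using TensorProduct.induction_on with
    | zero => simp
    | add v v' hv hv' => simp only [map_add, LinearMap.add_apply] at hv hv' ⊢; rw [hv, hv']
    | tmul h x =>
    induction w using TensorProduct.induction_on with
    | zero => simp
    | add v v' hv hv' => simp only [map_add, LinearMap.add_apply] at hv hv' ⊢; rw [hv, hv']
    | tmul g y =>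
    induction z using TensorProduct.induction_on with
    | zero => simp
    | add v v' hv hv' => simp only [map_add] at hv hv' ⊢; rw [hv, hv']
    | tmul f z => simp only [m_tmul, hP.comp_assoc, mul_assoc]

/-- The analogue of Stokes' theorem, with the vanishing of the trace on derivatives as its only
input. -/
theorem integral_d (hTr : ∀ a j u, P.Tr a (P.nabla a a j u) = 0) (a : Ob)
    (v : H a a ⊗[ℂ] Grassmann n) : P.integral a ((P.toCDG τ).d a a v) = 0 := by
  induction v using TensorProduct.induction_on with
  | zero => simp
  | add v w hv hw => rw [map_add, map_add, hv, hw, add_zero]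
  | tmul h x =>
    rw [d_tmul, map_sum]
    refine Finset.sum_eq_zero fun i _ => ?_
    simp [integral, nablaBar, LinearMap.sum_apply, hTr]

theorem eta_symm (hP : P.IsPreCategory) (a b : Ob) (k l : ℤ) {v : H b a ⊗[ℂ] Grassmann n}
    (hv : v ∈ (P.toCDG τ).gr b a k) {w : H a b ⊗[ℂ] Grassmann n}
    (hw : w ∈ (P.toCDG τ).gr a b l) : P.eta a b v w = (-1 : ℂ) ^ (k * l) * P.eta b a w v := by
  induction hv using gr_induction with
  | h0 => simp
  | hadd v v' _ _ hv hv' => simp only [map_add, LinearMap.add_apply, mul_add] at hv hv' ⊢; rw [hv, hv']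
  | hpure j hj h x hx =>
    induction hw using gr_induction with
    | h0 => simp
    | hadd v v' _ _ hv hv' =>
      simp only [map_add, LinearMap.add_apply, mul_add] at hv hv' ⊢; rw [hv, hv']
    | hpure j' hj' g y hy =>
      subst hj hj'
      rw [eta_tmul, eta_tmul, mul_comm_of_mem hx hy, hP.trace_comm, map_smul, smul_eq_mul]
      norm_cast
      ring

/-- Expand `v` in monomials. Testing against `ζ` times the monomial of the complement of `s`
isolates the coefficient at `s`, to which separation by the trace applies. -/
theorem eq_zero_of_eta {a b : Ob} (hsep : ∀ ξ : H b a, (∀ ζ : H a b,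
      P.Tr a (P.comp a b a ξ ζ) = 0) → ξ = 0) (v : H b a ⊗[ℂ] Grassmann n)
    (hv : ∀ w, P.eta a b v w = 0) : v = 0 := by
  classical
  obtain ⟨c, rfl⟩ := TensorProduct.eq_repr_basis_right (grassmannBasis n) v
  apply Finset.sum_eq_zero
  intro s _
  have hs : c s = 0 := by
    apply hsep
    intro ζ
    have h := hv (ζ ⊗ₜ grassmannBasis n sᶜ)
    rw [Finsupp.sum, map_sum, LinearMap.sum_apply] at h
    simp only [eta_tmul] at h
    rw [Finset.sum_eq_single s] at h
    · exact (mul_eq_zero.mp h).resolve_right ((topCoeff_basis_mul s sᶜ).mpr rfl)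
    · intro t _ ht
      have : topCoeff n (grassmannBasis n t * grassmannBasis n sᶜ) = 0 := by
        by_contra h0
        exact ht (compl_injective ((topCoeff_basis_mul t sᶜ).mp h0)).symm
      rw [this, mul_zero]
    · intro hs
      rw [Finsupp.notMem_support_iff.mp hs]
      simp
  simp only [hs, TensorProduct.zero_tmul]

theorem eta_eq_zero_of_degree {a b : Ob} {k l : ℤ} (hkl : k + l ≠ n)
    {v : H b a ⊗[ℂ] Grassmann n} (hv : v ∈ (P.toCDG τ).gr b a k) {w : H a b ⊗[ℂ] Grassmann n}
    (hw : w ∈ (P.toCDG τ).gr a b l) : P.eta a b v w = 0 := by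
  induction hv using gr_induction with
  | h0 => simp
  | hadd v v' _ _ hv hv' => rw [map_add, LinearMap.add_apply, hv, hv', add_zero]
  | hpure j hj h x hx =>
    induction hw using gr_induction with
    | h0 => simp
    | hadd v v' _ _ hv hv' => rw [map_add, hv, hv', add_zero]
    | hpure j' hj' g y hy =>
      subst hj hj'
      rw [eta_tmul, topCoeff_eq_zero (k := j + j') (by omega) (mul_mem_exteriorPower hx hy),
        mul_zero]

theorem eta_nondegenerate (hP : P.IsPreCategory) (a b : Ob) : (P.eta a b).Nondegenerate := by
  -- Only the component of `w` of degree `n - k` pairs with `v`, so a single sign works for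
  -- inhomogeneous `w`. The grading does not involve `τ`, which may therefore be taken to be `0`.
  have hsymm : ∀ (k : ℤ) (w : H a b ⊗[ℂ] Grassmann n), ∀ v ∈ (P.toCDG 0).gr b a k,
      P.eta b a w v = (-1 : ℂ) ^ ((n - k) * k) * P.eta a b v w := by
    intro k w v hv
    have hw : w ∈ ⨆ k, (P.toCDG 0).gr a b k := by
      rw [(gr_isInternal P 0 a b).submodule_iSup_eq_top]; trivial
    induction hw using Submodule.iSup_induction' with
    | mem l w hw =>
      by_cases hkl : k + l = n
      · rw [eta_symm hP b a l k hw hv, show l = n - k by omega]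
      · rw [eta_eq_zero_of_degree hkl hv hw, eta_eq_zero_of_degree (by omega) hw hv, mul_zero]
    | zero => simp
    | add x y _ _ hx hy => rw [map_add, map_add, LinearMap.add_apply, hx, hy, mul_add]
  constructor
  · intro v hv
    exact eq_zero_of_eta (fun ξ hξ => (hP.trace_nondegenerate a b).1 ξ hξ) v hv
  · intro w hw
    refine eq_zero_of_eta (fun ξ hξ => (hP.trace_nondegenerate b a).1 ξ hξ) w fun v => ?_
    have hv : v ∈ ⨆ k, (P.toCDG 0).gr b a k := by
      rw [(gr_isInternal P 0 b a).submodule_iSup_eq_top]; trivial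
    induction hv using Submodule.iSup_induction' with
    | mem l v hv => rw [hsymm l w v hv, hw, mul_zero]
    | zero => simp
    | add x y _ _ hx hy => rw [map_add, hx, hy, add_zero]

/-- Invariance under `d` is Stokes applied to the product of `v` and `w`. Cyclicity is graded
symmetry of `η` followed by associativity. -/
theorem toCDG_isCyclicCDGCategory (hP : P.IsPreCategory)
    (hTr : ∀ a j u, P.Tr a (P.nabla a a j u) = 0) :
    (P.toCDG τ).IsCyclicCDGCategory P.eta (-(n : ℤ)) where
  toIsCDGCategory := toCDG_isCDGCategory hP
  η_nondegenerate := eta_nondegenerate hP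
  η_degree a b k l hkl v hv w hw := eta_eq_zero_of_degree (by omega) hv hw
  η_symm a b k l v hv w hw := eta_symm hP a b k l hv hw
  η_d a b k v hv w := by
    rw [eta_eq (τ := τ), eta_eq (τ := τ), ← smul_eq_mul, ← map_smul, ← map_add,
      ← (toCDG_isCDGCategory hP).leibniz a b a k v hv w, integral_d hTr]
  η_cyclic a b c i j k x hx y hy z hz := by
    have hm := (toCDG_isCDGCategory (τ := τ) hP).m_mem c a b j k y hy z hz
    rw [← eta_symm hP c b i (j + k) hx hm, eta_eq (τ := τ), eta_eq (τ := τ),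
      (toCDG_isCDGCategory hP).assoc]

end PreCategoryData

/-! ### Uniqueness of the model -/

section Uniqueness

variable {n : ℕ} {Ob : Type u} {A : Ob → Matrix (Fin n) (Fin n) ℤ} {a b : Ob}

theorem Schw.ext_eval {B : Matrix (Fin n) (Fin n) ℤ} {ξ ζ : Schw n B}
    (h : ∀ μ x, ξ.eval μ x = ζ.eval μ x) : ξ = ζ := by
  funext q
  obtain ⟨μ, rfl⟩ := Submodule.Quotient.mk_surjective _ q
  exact SchwartzMap.ext (h μ)

theorem homSpace_ext {ξ ζ : HomSpace A a b} (h1 : a = b → ∀ m, coeff ξ m = coeff ζ m)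
    (h2 : a ≠ b → ∀ μ x, (fn ξ).eval μ x = (fn ζ).eval μ x) : ξ = ζ := by
  apply Subtype.ext
  apply Prod.ext
  · by_cases h : a = b
    · exact Subtype.ext (funext (h1 h))
    · rw [ξ.2.1 h, ζ.2.1 h]
  · by_cases h : a = b
    · rw [ξ.2.2 h, ζ.2.2 h]
    · exact Schw.ext_eval (h2 h)

/-- One component of a morphism always vanishes, and on the other each structure map is given by an
explicit value or by `HasSum`, whose limit is unique. -/
theorem IsLineBundleModel.unique {D : Deformation n}
    {P Q : PreCategoryData n Ob (fun a b => HomSpace A a b)} (hP : IsLineBundleModel D A P)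
    (hQ : IsLineBundleModel D A Q) : P = Q := by
  have h1 : P.one = Q.one := by
    funext a
    exact homSpace_ext (fun _ m => by rw [hP.one_coeff, hQ.one_coeff]) (fun h => absurd rfl h)
  have h2 : P.comp = Q.comp := by
    funext a b c
    refine LinearMap.ext fun ξ => LinearMap.ext fun ζ => homSpace_ext ?_ ?_
    · rintro rfl m
      by_cases hab : a = b
      · subst hab
        exact (hP.comp_torus a ξ ζ m).unique (hQ.comp_torus a ξ ζ m)
      · rw [hP.comp_pairing a b hab, hQ.comp_pairing a b hab]
    · intro hac μ x
      by_cases hab : a = b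
      · subst hab
        exact (hP.comp_right a c hac ξ ζ μ x).unique (hQ.comp_right a c hac ξ ζ μ x)
      · by_cases hbc : b = c
        · subst hbc
          exact (hP.comp_left a b hac ξ ζ μ x).unique (hQ.comp_left a b hac ξ ζ μ x)
        · exact (hP.comp_general a b c hab hbc hac ξ ζ μ x).unique
            (hQ.comp_general a b c hab hbc hac ξ ζ μ x)
  have h3 : P.nabla = Q.nabla := by
    funext a b j
    refine LinearMap.ext fun ξ => homSpace_ext ?_ ?_
    · rintro rfl m
      rw [hP.nabla_torus, hQ.nabla_torus]
    · intro hab μ x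
      rw [hP.nabla_general a b hab, hQ.nabla_general a b hab]
  have h4 : P.F = Q.F := funext fun a => by rw [hP.F_eq, hQ.F_eq]
  have h5 : P.Tr = Q.Tr := funext fun a => LinearMap.ext fun u => by rw [hP.Tr_eq, hQ.Tr_eq]
  cases P
  cases Q
  simp only at h1 h2 h3 h4 h5
  subst h1 h2 h3 h4 h5
  rfl

/-- The derivations multiply the coefficient at `m` by a linear function of `m`, which vanishes at
`m = 0`, the only coefficient seen by the trace. -/
theorem IsLineBundleModel.trace_nabla {D : Deformation n}
    {P : PreCategoryData n Ob (fun a b => HomSpace A a b)} (hP : IsLineBundleModel D A P)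
    (a : Ob) (j : Idx n) (u : HomSpace A a a) : P.Tr a (P.nabla a a j u) = 0 := by
  rw [hP.Tr_eq, hP.nabla_torus]
  have : (fun i : Idx n => (((0 : Idx n → ℤ) i : ℤ) : ℝ)) = 0 := by ext; simp
  rw [this, Matrix.mulVec_zero]
  simp

end Uniqueness

/-! ### Matrices acting on `ℝⁿ`, lattice vectors and phases -/

section Basics

variable {n : ℕ}

theorem act_apply (M : Matrix (Fin n) (Fin n) ℝ) (x : E n) (i : Fin n) :
    act M x i = ∑ j, M i j * x j := rfl

/-- `act M` as a continuous linear map. -/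
def actL (M : Matrix (Fin n) (Fin n) ℝ) : E n →L[ℝ] E n :=
  LinearMap.toContinuousLinearMap
    { toFun := act M
      map_add' := fun x y => by ext i; simp [act_apply, mul_add, Finset.sum_add_distrib]
      map_smul' := fun c x => by
        ext i; simp only [act_apply, PiLp.smul_apply, smul_eq_mul, Finset.mul_sum, RingHom.id_apply]
        exact Finset.sum_congr rfl fun j _ => by ring }

theorem actL_apply (M : Matrix (Fin n) (Fin n) ℝ) (x : E n) : actL M x = act M x := rfl

theorem act_add (M : Matrix (Fin n) (Fin n) ℝ) (x y : E n) : act M (x + y) = act M x + act M y :=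
  (actL M).map_add x y

theorem act_sub (M : Matrix (Fin n) (Fin n) ℝ) (x y : E n) : act M (x - y) = act M x - act M y :=
  (actL M).map_sub x y

theorem act_neg (M : Matrix (Fin n) (Fin n) ℝ) (x : E n) : act M (-x) = -act M x :=
  (actL M).map_neg x

theorem act_smul (M : Matrix (Fin n) (Fin n) ℝ) (c : ℝ) (x : E n) : act M (c • x) = c • act M x :=
  (actL M).map_smul c x

theorem act_zero (M : Matrix (Fin n) (Fin n) ℝ) : act M (0 : E n) = 0 := (actL M).map_zero

theorem act_mul (M N : Matrix (Fin n) (Fin n) ℝ) (x : E n) : act (M * N) x = act M (act N x) := by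
  simp [act, Matrix.mulVec_mulVec]

theorem one_act (x : E n) : act (1 : Matrix (Fin n) (Fin n) ℝ) x = x := by
  simp [act]

theorem zero_act (x : E n) : act (0 : Matrix (Fin n) (Fin n) ℝ) x = 0 := by
  ext i; simp [act_apply]

theorem add_act (M N : Matrix (Fin n) (Fin n) ℝ) (x : E n) :
    act (M + N) x = act M x + act N x := by
  ext i; simp [act_apply, add_mul, Finset.sum_add_distrib]

theorem sub_act (M N : Matrix (Fin n) (Fin n) ℝ) (x : E n) :
    act (M - N) x = act M x - act N x := by
  ext i; simp [act_apply, sub_mul, Finset.sum_sub_distrib]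

theorem neg_act (M : Matrix (Fin n) (Fin n) ℝ) (x : E n) : act (-M) x = -act M x := by
  ext i; simp [act_apply]

theorem smul_act (c : ℝ) (M : Matrix (Fin n) (Fin n) ℝ) (x : E n) :
    act (c • M) x = c • act M x := by
  ext i; simp [act_apply, Finset.mul_sum, mul_assoc]

theorem inner_eq_sum (x y : E n) : ⟪x, y⟫ = ∑ i, x i * y i := by
  simp only [PiLp.inner_apply, RCLike.inner_apply, conj_trivial, mul_comm]

theorem inner_act (M : Matrix (Fin n) (Fin n) ℝ) (x y : E n) :
    ⟪x, act M y⟫ = ⟪act M.transpose x, y⟫ := by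
  simp only [inner_eq_sum, act_apply, Finset.mul_sum, Finset.sum_mul, Matrix.transpose_apply]
  rw [Finset.sum_comm]
  exact Finset.sum_congr rfl fun i _ => Finset.sum_congr rfl fun j _ => by ring

theorem inner_act_skew {κ : Matrix (Fin n) (Fin n) ℝ} (hκ : κ.transpose = -κ) (x y : E n) :
    ⟪x, act κ y⟫ = -⟪y, act κ x⟫ := by
  rw [inner_act, hκ, neg_act, inner_neg_left, real_inner_comm]

theorem inner_act_self {κ : Matrix (Fin n) (Fin n) ℝ} (hκ : κ.transpose = -κ) (x : E n) :
    ⟪x, act κ x⟫ = 0 := by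
  have := inner_act_skew hκ x x
  linarith

theorem act_inv_act {M : Matrix (Fin n) (Fin n) ℝ} (h : M.det ≠ 0) (x : E n) :
    act M⁻¹ (act M x) = x := by
  rw [← act_mul, Matrix.nonsing_inv_mul _ (isUnit_iff_ne_zero.mpr h), one_act]

theorem act_act_inv {M : Matrix (Fin n) (Fin n) ℝ} (h : M.det ≠ 0) (x : E n) :
    act M (act M⁻¹ x) = x := by
  rw [← act_mul, Matrix.mul_nonsing_inv _ (isUnit_iff_ne_zero.mpr h), one_act]

theorem act_single (M : Matrix (Fin n) (Fin n) ℝ) (p i : Fin n) :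
    act M (EuclideanSpace.single p 1) i = M i p := by
  simp [act_apply]

theorem norm_act_le (M : Matrix (Fin n) (Fin n) ℝ) (x : E n) : ‖act M x‖ ≤ ‖actL M‖ * ‖x‖ :=
  (actL M).le_opNorm x

/-! Lattice vectors. -/

theorem vec_apply (u : Fin n → ℤ) (i : Fin n) : vec u i = u i := rfl

@[simp] theorem vec_zero : vec (0 : Fin n → ℤ) = 0 := by ext i; simp [vec_apply]

theorem vec_add (u v : Fin n → ℤ) : vec (u + v) = vec u + vec v := by ext i; simp [vec_apply]

theorem vec_sub (u v : Fin n → ℤ) : vec (u - v) = vec u - vec v := by ext i; simp [vec_apply]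

theorem vec_neg (u : Fin n → ℤ) : vec (-u) = -vec u := by ext i; simp [vec_apply]

theorem vec_mulVec (B : Matrix (Fin n) (Fin n) ℤ) (v : Fin n → ℤ) :
    vec (B.mulVec v) = act (toReal B) (vec v) := by
  ext i
  simp [vec_apply, act_apply, toReal, Matrix.mulVec, dotProduct]

theorem inner_vec_vec (u v : Fin n → ℤ) : ∃ k : ℤ, ⟪vec u, vec v⟫ = k :=
  ⟨∑ i, u i * v i, by simp [inner_eq_sum, vec_apply]⟩

theorem norm_vec_le (u : Fin n → ℤ) : ‖vec u‖ ≤ (n : ℝ) * ‖u‖ := by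
  have h1 : ‖vec u‖ ≤ ∑ i, ‖EuclideanSpace.single i (u i : ℝ)‖ := by
    refine le_trans (le_of_eq ?_) (norm_sum_le _ _)
    congr 1
    ext j
    simp [vec_apply, Finset.sum_apply]
  refine h1.trans ?_
  have h2 : ∀ i ∈ (Finset.univ : Finset (Fin n)), ‖EuclideanSpace.single i (u i : ℝ)‖ ≤ ‖u‖ := by
    intro i _
    simpa [Int.norm_eq_abs] using norm_le_pi_norm u i
  simpa using Finset.sum_le_sum h2

theorem norm_le_norm_vec (u : Fin n → ℤ) : ‖u‖ ≤ ‖vec u‖ := by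
  rw [pi_norm_le_iff_of_nonneg (norm_nonneg _)]
  intro i
  have := PiLp.norm_apply_le (vec u) i
  simpa [vec_apply, Int.norm_eq_abs] using this

theorem toReal_add (A B : Matrix (Fin n) (Fin n) ℤ) : toReal (A + B) = toReal A + toReal B := by
  ext i j; simp [toReal]

theorem toReal_sub (A B : Matrix (Fin n) (Fin n) ℤ) : toReal (A - B) = toReal A - toReal B := by
  ext i j; simp [toReal]

theorem toReal_neg (A : Matrix (Fin n) (Fin n) ℤ) : toReal (-A) = -toReal A := by
  ext i j; simp [toReal]

theorem toReal_zero : toReal (0 : Matrix (Fin n) (Fin n) ℤ) = 0 := by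
  ext i j; simp [toReal]

theorem det_toReal (A : Matrix (Fin n) (Fin n) ℤ) : (toReal A).det = (A.det : ℝ) :=
  ((Int.castRingHom ℝ).map_det A).symm

theorem det_toReal_ne_zero {A : Matrix (Fin n) (Fin n) ℤ} (h : A.det ≠ 0) :
    (toReal A).det ≠ 0 := by
  rw [det_toReal]; exact_mod_cast h

theorem transpose_toReal {A : Matrix (Fin n) (Fin n) ℤ} (h : A.IsSymm) :
    (toReal A).transpose = toReal A := by
  ext i j
  simp only [toReal, Matrix.transpose_apply, Matrix.map_apply]
  rw [h.apply]

/-! Phases. -/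

theorem e_zero : e 0 = 1 := by simp [e]

theorem e_add (s t : ℝ) : e (s + t) = e s * e t := by
  rw [e, e, e, ← Complex.exp_add]
  push_cast
  ring_nf

theorem e_int (k : ℤ) : e k = 1 := by
  rw [e, Complex.exp_eq_one_iff]
  exact ⟨k, by push_cast; ring⟩

theorem e_add_int (t : ℝ) (k : ℤ) : e (t + k) = e t := by
  rw [e_add, e_int, mul_one]

theorem e_eq_of_sub_int {s t : ℝ} (h : ∃ k : ℤ, s - t = k) : e s = e t := by
  obtain ⟨k, hk⟩ := h
  rw [show s = t + k by linarith, e_add_int]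

@[simp] theorem norm_e (t : ℝ) : ‖e t‖ = 1 := by
  rw [e, show (2 * Real.pi * Complex.I * t : ℂ) = ((2 * Real.pi * t : ℝ) : ℂ) * Complex.I by
    push_cast; ring, Complex.norm_exp_ofReal_mul_I]

theorem e_ne_zero (t : ℝ) : e t ≠ 0 := Complex.exp_ne_zero _

theorem continuous_e : Continuous e := by
  unfold e
  fun_prop

theorem hasDerivAt_e (t : ℝ) : HasDerivAt e (2 * Real.pi * Complex.I * e t) t := by
  have h : HasDerivAt (fun t : ℝ => (2 * Real.pi * Complex.I * t : ℂ)) (2 * Real.pi * Complex.I) t := by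
    simpa using (Complex.ofRealCLM.hasDerivAt (x := t)).const_mul (2 * Real.pi * Complex.I)
  have := h.cexp
  change HasDerivAt (fun t : ℝ => Complex.exp (2 * Real.pi * Complex.I * t)) _ t
  convert this using 1
  rw [e, mul_comm]

end Basics

/-! ### Summability over lattices -/

section Summability

variable {ι : Type} [Fintype ι]

theorem one_add_norm_add_le {V : Type*} [SeminormedAddCommGroup V] (u v : V) :
    1 + ‖u + v‖ ≤ (1 + ‖u‖) * (1 + ‖v‖) := by
  have := norm_add_le u v
  nlinarith [norm_nonneg u, norm_nonneg v, mul_nonneg (norm_nonneg u) (norm_nonneg v)]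

theorem one_le_one_add_norm {V : Type*} [SeminormedAddCommGroup V] (u : V) : 1 ≤ 1 + ‖u‖ := by
  have := norm_nonneg u
  linarith

variable (ι) in
/-- An exponent for which `∑ (1 + ‖u‖)^(-r)` converges over `ℤ^ι`. -/
def sumExp : ℕ := Fintype.card ι + 1

theorem summable_sumExp : Summable (fun u : ι → ℤ => ((1 + ‖u‖) ^ sumExp ι)⁻¹) := by
  classical
  let b := Pi.basisFun ℝ ι
  let L : Submodule ℤ (ι → ℝ) := Submodule.span ℤ (Set.range b)
  have hmem : ∀ u : ι → ℤ, (fun i => (u i : ℝ)) ∈ L := by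
    intro u
    have : (fun i => (u i : ℝ)) = ∑ i, u i • b i := by
      ext j
      simp [b, Finset.sum_apply, Pi.single_apply]
    rw [this]
    exact Submodule.sum_mem _ fun i _ =>
      Submodule.smul_mem _ _ (Submodule.subset_span ⟨i, rfl⟩)
  have hrank : Module.finrank ℤ L < sumExp ι := by
    have h := ZLattice.rank ℝ L
    rw [h]
    simp [sumExp]
  have hs := ZLattice.summable_norm_pow_inv L (sumExp ι) hrank
  have hinj : Function.Injective (fun u : ι → ℤ => (⟨fun i => (u i : ℝ), hmem u⟩ : L)) := by
    intro u v h
    funext i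
    have h2 : (u i : ℝ) = v i := congrFun (Subtype.ext_iff.mp h) i
    exact_mod_cast h2
  have hs' := hs.comp_injective hinj
  have hnorm : ∀ u : ι → ℤ, ‖(⟨fun i => (u i : ℝ), hmem u⟩ : L)‖ = ‖u‖ := by
    intro u
    change ‖(fun i => (u i : ℝ))‖ = ‖u‖
    apply le_antisymm
    · rw [pi_norm_le_iff_of_nonneg (norm_nonneg _)]
      intro i
      simpa [Int.norm_eq_abs] using norm_le_pi_norm u i
    · rw [pi_norm_le_iff_of_nonneg (norm_nonneg _)]
      intro i
      simpa [Int.norm_eq_abs] using norm_le_pi_norm (fun i => (u i : ℝ)) i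
  -- The known series has terms `‖u‖⁻¹ ^ r`, which take the default value `0` at `u = 0`; the
  -- indicator covers that term.
  have h0 : Summable (fun u : ι → ℤ => if u = 0 then (1 : ℝ) else 0) :=
    summable_of_ne_finset_zero (s := {0}) (fun u hu => by simp at hu; simp [hu])
  refine Summable.of_nonneg_of_le (fun u => by positivity) (fun u => ?_) (hs'.add h0)
  simp only [Function.comp_apply, hnorm]
  by_cases hu : u = 0
  · subst hu
    simp [sumExp]
  · rw [if_neg hu, add_zero]
    have : 0 < ‖u‖ := norm_pos_iff.mpr hu
    rw [inv_pow]
    apply inv_anti₀ (by positivity)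
    gcongr
    linarith

end Summability

/-! ### Smooth rapidly decreasing families of functions -/

section SmoothRapid

variable {n : ℕ}

/-- The linear map `E n → ℂ` with prescribed values on the standard basis. -/
def gradL : (Fin n → ℂ) →L[ℝ] (E n →L[ℝ] ℂ) :=
  LinearMap.toContinuousLinearMap
    { toFun := fun c => ∑ p, (EuclideanSpace.proj p : E n →L[ℝ] ℝ).smulRight (c p)
      map_add' := fun c d => by
        ext x
        simp [Finset.sum_add_distrib]
      map_smul' := fun r c => by
        ext x
        simp only [_root_.sum_apply, ContinuousLinearMap.smulRight_apply,
          _root_.smul_apply, Pi.smul_apply, RingHom.id_apply, Finset.smul_sum]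
        exact Finset.sum_congr rfl fun p _ => smul_comm _ _ _ }

theorem gradL_apply (c : Fin n → ℂ) (x : E n) : gradL c x = ∑ p, (x p : ℂ) * c p := by
  change (∑ p, (EuclideanSpace.proj p : E n →L[ℝ] ℝ).smulRight (c p)) x = _
  simp

theorem gradL_single (c : Fin n → ℂ) (p : Fin n) : gradL c (EuclideanSpace.single p 1) = c p := by
  classical
  rw [gradL_apply, Finset.sum_eq_single p]
  · simp
  · intro q _ hq
    simp [hq]
  · simp

theorem eq_gradL (l : E n →L[ℝ] ℂ) : l = gradL (fun p => l (EuclideanSpace.single p 1)) := by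
  ext x
  rw [gradL_apply]
  have hx : x = ∑ p, x p • EuclideanSpace.single p (1 : ℝ) := by
    ext i
    simp [Finset.sum_apply, Pi.single_apply]
  conv_lhs => rw [hx]
  simp only [map_sum, map_smul, Complex.real_smul]

theorem _root_.HasFDerivAt.to_gradL {f : E n → ℂ} {l : E n →L[ℝ] ℂ} {X : E n}
    (h : HasFDerivAt f l X) {c : Fin n → ℂ} (hc : ∀ p, l (EuclideanSpace.single p 1) = c p) :
    HasFDerivAt f (gradL c) X := by
  refine h.congr_fderiv ?_
  rw [eq_gradL l]
  exact congrArg gradL (funext hc)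

/-- Differentiability is local, so summable domination of the partial derivatives on each ball
justifies termwise differentiation. -/
theorem hasFDerivAt_tsum_gradL {ι : Type*} {t : ι → E n → ℂ} {s : ι → Fin n → E n → ℂ}
    (ht : ∀ i X, HasFDerivAt (t i) (gradL (fun p => s i p X)) X)
    (hb : ∀ R : ℝ, ∃ b : ι → ℝ, Summable b ∧ ∀ i p X, ‖X‖ ≤ R → ‖s i p X‖ ≤ b i)
    (h0 : ∀ X, Summable fun i => t i X) (X : E n) :
    HasFDerivAt (fun X => ∑' i, t i X) (gradL (fun p => ∑' i, s i p X)) X := by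
  obtain ⟨b, hb, hsb⟩ := hb (‖X‖ + 1)
  have hball : ∀ Y ∈ Metric.ball X 1, ‖Y‖ ≤ ‖X‖ + 1 := by
    intro Y hY
    rw [Metric.mem_ball, dist_eq_norm] at hY
    have : ‖Y‖ ≤ ‖X‖ + ‖Y - X‖ := by simpa using norm_add_le X (Y - X)
    linarith
  have hX : X ∈ Metric.ball X 1 := Metric.mem_ball_self one_pos
  have h := hasFDerivAt_tsum_of_isPreconnected (𝕜 := ℝ) (u := fun i => ‖(gradL : (Fin n → ℂ) →L[ℝ] _)‖ * |b i|)
    (f := t) (f' := fun i X => gradL (fun p => s i p X)) (hb.abs.mul_left _) Metric.isOpen_ball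
    (convex_ball X 1).isPreconnected (fun i Y _ => ht i Y) (fun i Y hY => ?_) hX (h0 X) hX
  · refine h.congr_fderiv ?_
    have hs : HasSum (fun i => (fun p => s i p X)) (fun p => ∑' i, s i p X) := by
      rw [Pi.hasSum]
      intro p
      exact (Summable.of_norm_bounded hb (fun i => hsb i p X (by linarith))).hasSum
    exact ((gradL (n := n)).hasSum hs).tsum_eq
  · refine (ContinuousLinearMap.le_opNorm _ _).trans ?_
    gcongr
    rw [pi_norm_le_iff_of_nonneg (abs_nonneg _)]
    exact fun p => (hsb i p Y (hball Y hY)).trans (le_abs_self _)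

/-- Rapid decrease along the lattice with polynomial growth along `ℝⁿ`. -/
def Dec (f : (Fin n → ℤ) → E n → ℂ) : Prop :=
  ∀ N : ℕ, ∃ (C : ℝ) (M : ℕ), ∀ u X, (1 + ‖u‖) ^ N * ‖f u X‖ ≤ C * (1 + ‖X‖) ^ M

/-- The partial derivatives of a family of functions. -/
def pd (p : Fin n) (f : (Fin n → ℤ) → E n → ℂ) : (Fin n → ℤ) → E n → ℂ :=
  fun u X => fderiv ℝ (f u) X (EuclideanSpace.single p 1)

theorem hasFDerivAt_pd {f : (Fin n → ℤ) → E n → ℂ} (hf : ∀ u, Differentiable ℝ (f u))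
    (u : Fin n → ℤ) (X : E n) : HasFDerivAt (f u) (gradL fun p => pd p f u X) X := by
  have h := (hf u X).hasFDerivAt
  rwa [eq_gradL (fderiv ℝ (f u) X)] at h

theorem pd_eq {f : (Fin n → ℤ) → E n → ℂ} {s : Fin n → (Fin n → ℤ) → E n → ℂ}
    (h : ∀ u X, HasFDerivAt (f u) (gradL fun p => s p u X) X) (p : Fin n) : pd p f = s p := by
  funext u X
  rw [pd, (h u X).fderiv, gradL_single]

theorem pd_add {f g : (Fin n → ℤ) → E n → ℂ} (hf : ∀ u, Differentiable ℝ (f u))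
    (hg : ∀ u, Differentiable ℝ (g u)) (p : Fin n) : pd p (f + g) = pd p f + pd p g := by
  funext u X
  change fderiv ℝ (f u + g u) X _ = _
  rw [fderiv_add (hf u X) (hg u X)]
  rfl

theorem pd_smul {f : (Fin n → ℤ) → E n → ℂ} (hf : ∀ u, Differentiable ℝ (f u))
    (c : ℂ) (p : Fin n) : pd p (c • f) = c • pd p f := by
  funext u X
  change fderiv ℝ (c • f u) X _ = _
  rw [fderiv_const_smul (hf u X)]
  rfl

/-- Families of smooth functions all of whose derivatives are rapidly decreasing along the lattice
with polynomial growth along `ℝⁿ`. -/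
def SR (f : (Fin n → ℤ) → E n → ℂ) : Prop :=
  ∃ S : Set ((Fin n → ℤ) → E n → ℂ), f ∈ S ∧
    ∀ g ∈ S, (∀ u, Differentiable ℝ (g u)) ∧ Dec g ∧ ∀ p, pd p g ∈ S

theorem SR.differentiable {f : (Fin n → ℤ) → E n → ℂ} (hf : SR f) (u : Fin n → ℤ) :
    Differentiable ℝ (f u) := by
  obtain ⟨S, hS, h⟩ := hf
  exact (h f hS).1 u

theorem SR.continuous {f : (Fin n → ℤ) → E n → ℂ} (hf : SR f) (u : Fin n → ℤ) :
    Continuous (f u) := (hf.differentiable u).continuous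

theorem SR.dec {f : (Fin n → ℤ) → E n → ℂ} (hf : SR f) : Dec f := by
  obtain ⟨S, hS, h⟩ := hf
  exact (h f hS).2.1

theorem SR.pd {f : (Fin n → ℤ) → E n → ℂ} (hf : SR f) (p : Fin n) : SR (pd p f) := by
  obtain ⟨S, hS, h⟩ := hf
  exact ⟨S, (h f hS).2.2 p, h⟩

theorem Dec.const_nonneg {f : (Fin n → ℤ) → E n → ℂ} {N M : ℕ} {C : ℝ}
    (h : ∀ u X, (1 + ‖u‖) ^ N * ‖f u X‖ ≤ C * (1 + ‖X‖) ^ M) : 0 ≤ C := by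
  have := h 0 0
  simp only [norm_zero, add_zero, one_pow, one_mul, mul_one] at this
  exact (norm_nonneg _).trans this

theorem Dec.add {f g : (Fin n → ℤ) → E n → ℂ} (hf : Dec f) (hg : Dec g) : Dec (f + g) := by
  intro N
  obtain ⟨C, M, h⟩ := hf N
  obtain ⟨C', M', h'⟩ := hg N
  have hC := Dec.const_nonneg h
  have hC' := Dec.const_nonneg h'
  refine ⟨C + C', M + M', fun u X => ?_⟩
  have h1 := one_le_one_add_norm X
  calc (1 + ‖u‖) ^ N * ‖f u X + g u X‖ ≤ (1 + ‖u‖) ^ N * (‖f u X‖ + ‖g u X‖) := by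
        gcongr; exact norm_add_le _ _
    _ ≤ C * (1 + ‖X‖) ^ M + C' * (1 + ‖X‖) ^ M' := by rw [mul_add]; exact add_le_add (h u X) (h' u X)
    _ ≤ C * (1 + ‖X‖) ^ (M + M') + C' * (1 + ‖X‖) ^ (M + M') := by
        gcongr <;> first | exact h1 | omega
    _ = _ := by ring

theorem Dec.smul {f : (Fin n → ℤ) → E n → ℂ} (hf : Dec f) (c : ℂ) : Dec (c • f) := by
  intro N
  obtain ⟨C, M, h⟩ := hf N
  refine ⟨‖c‖ * C, M, fun u X => ?_⟩
  have := mul_le_mul_of_nonneg_left (h u X) (norm_nonneg c)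
  simp only [Pi.smul_apply, norm_smul]
  linarith

theorem Dec.zero : Dec (0 : (Fin n → ℤ) → E n → ℂ) := fun N => ⟨0, 0, fun u X => by simp⟩

/-- The main tool for `SR`, which is a coinductive notion: it is enough to find generators whose
partial derivatives are linear combinations of generators. Derivative formulas that are sums of
terms of the same shape can then be used directly. -/
theorem SR.of_mem_span {T : Set ((Fin n → ℤ) → E n → ℂ)}
    (hT : ∀ g ∈ T, (∀ u, Differentiable ℝ (g u)) ∧ Dec g ∧ ∀ p, NCTori.pd p g ∈ Submodule.span ℂ T)
    {f : (Fin n → ℤ) → E n → ℂ} (hf : f ∈ Submodule.span ℂ T) : SR f := by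
  refine ⟨Submodule.span ℂ T, hf, fun g hg => ?_⟩
  induction hg using Submodule.span_induction with
  | mem g hg => exact hT g hg
  | zero =>
    refine ⟨fun u => differentiable_const (c := (0 : ℂ)), Dec.zero, fun p => ?_⟩
    have : NCTori.pd p (0 : (Fin n → ℤ) → E n → ℂ) = 0 := by
      funext u X
      have h0 : (0 : (Fin n → ℤ) → E n → ℂ) u = fun _ => 0 := rfl
      rw [NCTori.pd, h0]
      simp
    rw [this]
    exact Submodule.zero_mem _
  | add g h _ _ hg hh =>
    refine ⟨fun u => (hg.1 u).add (hh.1 u), hg.2.1.add hh.2.1, fun p => ?_⟩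
    rw [pd_add hg.1 hh.1]
    exact Submodule.add_mem _ (hg.2.2 p) (hh.2.2 p)
  | smul c g _ hg =>
    refine ⟨fun u => (hg.1 u).const_smul c, hg.2.1.smul c, fun p => ?_⟩
    rw [pd_smul hg.1]
    exact Submodule.smul_mem _ _ (hg.2.2 p)

theorem SR.of_span_self {f : (Fin n → ℤ) → E n → ℂ}
    (hf : f ∈ Submodule.span ℂ {f : (Fin n → ℤ) → E n → ℂ | SR f}) : SR f :=
  SR.of_mem_span (fun _ hg => ⟨SR.differentiable hg, SR.dec hg,
    fun p => Submodule.subset_span (SR.pd hg p)⟩) hf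

theorem SR.add {f g : (Fin n → ℤ) → E n → ℂ} (hf : SR f) (hg : SR g) : SR (f + g) :=
  SR.of_span_self (Submodule.add_mem _ (Submodule.subset_span hf) (Submodule.subset_span hg))

theorem SR.smul {f : (Fin n → ℤ) → E n → ℂ} (hf : SR f) (c : ℂ) : SR (c • f) :=
  SR.of_span_self (Submodule.smul_mem _ _ (Submodule.subset_span hf))

theorem SR.zero : SR (0 : (Fin n → ℤ) → E n → ℂ) := SR.of_span_self (Submodule.zero_mem _)

/-- Affine functions of `(u, X)`. -/
def IsAff (l : (Fin n → ℤ) → E n → ℂ) : Prop :=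
  ∃ (a c : ℂ) (α β : E n), ∀ u X, l u X = a * ((⟪α, X⟫ + ⟪β, vec u⟫ : ℝ) : ℂ) + c

theorem Dec.aff_mul {l f : (Fin n → ℤ) → E n → ℂ} (hl : IsAff l) (hf : Dec f) : Dec (l * f) := by
  obtain ⟨a, c, α, β, hl⟩ := hl
  intro N
  -- The extra power of `1 + ‖u‖` pays for the growth of `l` in `u`; its growth in `X` is allowed
  -- and raises `M` by one.
  obtain ⟨C, M, h⟩ := hf (N + 1)
  have hC := Dec.const_nonneg h
  set K : ℝ := ‖a‖ * (‖α‖ + ‖β‖ * n) + ‖c‖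
  refine ⟨K * C, M + 1, fun u X => ?_⟩
  have h1 : ‖l u X‖ ≤ K * (1 + ‖X‖) * (1 + ‖u‖) := by
    have e1 : |⟪α, X⟫ + ⟪β, vec u⟫| ≤ ‖α‖ * ‖X‖ + ‖β‖ * (n * ‖u‖) :=
      (abs_add_le _ _).trans (add_le_add (abs_real_inner_le_norm _ _)
        ((abs_real_inner_le_norm _ _).trans (by gcongr; exact norm_vec_le u)))
    have e2 : ‖l u X‖ ≤ ‖a‖ * (‖α‖ * ‖X‖ + ‖β‖ * (n * ‖u‖)) + ‖c‖ := by
      rw [hl]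
      refine (norm_add_le _ _).trans ?_
      rw [norm_mul, Complex.norm_real, Real.norm_eq_abs]
      gcongr
    have p1 := norm_nonneg X
    have p2 := norm_nonneg u
    have e3 : ‖α‖ * ‖X‖ + ‖β‖ * (n * ‖u‖) ≤ (‖α‖ + ‖β‖ * n) * ((1 + ‖X‖) * (1 + ‖u‖)) := by
      have q1 : ‖X‖ ≤ (1 + ‖X‖) * (1 + ‖u‖) := by nlinarith
      have q2 : ‖u‖ ≤ (1 + ‖X‖) * (1 + ‖u‖) := by nlinarith
      calc ‖α‖ * ‖X‖ + ‖β‖ * (n * ‖u‖) = ‖α‖ * ‖X‖ + (‖β‖ * n) * ‖u‖ := by ring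
        _ ≤ ‖α‖ * ((1 + ‖X‖) * (1 + ‖u‖)) + (‖β‖ * n) * ((1 + ‖X‖) * (1 + ‖u‖)) := by gcongr
        _ = _ := by ring
    have q3 : (1 : ℝ) ≤ (1 + ‖X‖) * (1 + ‖u‖) := by nlinarith
    calc ‖l u X‖ ≤ ‖a‖ * ((‖α‖ + ‖β‖ * n) * ((1 + ‖X‖) * (1 + ‖u‖))) +
          ‖c‖ * ((1 + ‖X‖) * (1 + ‖u‖)) := by
          refine e2.trans (add_le_add (by gcongr) ?_)
          exact le_mul_of_one_le_right (norm_nonneg c) q3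
      _ = _ := by ring
  have hK : 0 ≤ K := by positivity
  calc (1 + ‖u‖) ^ N * ‖l u X * f u X‖ ≤ (1 + ‖u‖) ^ N * (K * (1 + ‖X‖) * (1 + ‖u‖) * ‖f u X‖) := by
        rw [norm_mul]; gcongr
    _ = K * (1 + ‖X‖) * ((1 + ‖u‖) ^ (N + 1) * ‖f u X‖) := by ring
    _ ≤ K * (1 + ‖X‖) * (C * (1 + ‖X‖) ^ M) :=
        mul_le_mul_of_nonneg_left (h u X) (by positivity)
    _ = _ := by ring

theorem SR.aff_mul {l f : (Fin n → ℤ) → E n → ℂ} (hl : IsAff l) (hf : SR f) : SR (l * f) := by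
  obtain ⟨a, c, α, β, hl'⟩ := id hl
  -- The derivative of `l * f` is a constant multiple of `f` plus `l` times a derivative of `f`, so
  -- these two kinds of generators suffice.
  let T : Set ((Fin n → ℤ) → E n → ℂ) := {f | SR f} ∪ {g | ∃ f, SR f ∧ g = l * f}
  refine SR.of_mem_span (T := T) ?_ (Submodule.subset_span (Or.inr ⟨f, hf, rfl⟩))
  rintro g (hg | ⟨f, hf, rfl⟩)
  · exact ⟨SR.differentiable hg, SR.dec hg, fun p => Submodule.subset_span (Or.inl (SR.pd hg p))⟩
  · have hlu : ∀ u X, HasFDerivAt (l u) (gradL fun p => a * (α p : ℂ)) X := by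
      intro u X
      have h1 : HasFDerivAt (fun X : E n => ⟪α, X⟫) (innerSL ℝ α) X := (innerSL ℝ α).hasFDerivAt
      have h2 := ((Complex.ofRealCLM.hasFDerivAt.comp X (h1.add_const ⟪β, vec u⟫)).const_mul a).add_const c
      have h3 : (l u) = fun X => a * (Complex.ofRealCLM (⟪α, X⟫ + ⟪β, vec u⟫)) + c := by
        funext Y; rw [hl']; rfl
      rw [h3]
      refine h2.to_gradL fun p => ?_
      simp [inner_eq_sum]
    have hd : ∀ u X, HasFDerivAt ((l * f) u)
        (gradL fun p => (((a * (α p : ℂ)) • f + l * NCTori.pd p f :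
          (Fin n → ℤ) → E n → ℂ)) u X) X := by
      intro u X
      have := (hlu u X).mul (hasFDerivAt_pd hf.differentiable u X)
      refine this.to_gradL fun p => ?_
      simp [gradL_single]
      ring
    refine ⟨fun u X => (hd u X).differentiableAt, hf.dec.aff_mul hl, fun p => ?_⟩
    rw [pd_eq hd p]
    exact Submodule.add_mem _ (Submodule.smul_mem _ _ (Submodule.subset_span (Or.inl hf)))
      (Submodule.subset_span (Or.inr ⟨_, hf.pd p, rfl⟩))

end SmoothRapid

/-! ### Twisted convolution of smooth rapidly decreasing families -/

section Convolution

variable {n : ℕ} {θ : Matrix (Fin n) (Fin n) ℝ}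
  {φ : (Fin n → ℤ) → (Fin n → ℤ) → E n → ℝ} {f g h : (Fin n → ℤ) → E n → ℂ}

/-- The translation by `θ u`. -/
def sh (θ : Matrix (Fin n) (Fin n) ℝ) (u : Fin n → ℤ) : E n := act θ (vec u)

theorem sh_add (u v : Fin n → ℤ) : sh θ (u + v) = sh θ u + sh θ v := by
  rw [sh, vec_add, act_add]; rfl

/-- The summand of the twisted convolution. -/
def convTerm (θ : Matrix (Fin n) (Fin n) ℝ) (φ : (Fin n → ℤ) → (Fin n → ℤ) → E n → ℝ)
    (f g : (Fin n → ℤ) → E n → ℂ) (ρ : Fin n → ℤ) (u : Fin n → ℤ) (X : E n) : ℂ :=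
  f (ρ - u) (X + sh θ u) * g u X * e (φ (ρ - u) u X)

/-- The twisted convolution. -/
def conv (θ : Matrix (Fin n) (Fin n) ℝ) (φ : (Fin n → ℤ) → (Fin n → ℤ) → E n → ℝ)
    (f g : (Fin n → ℤ) → E n → ℂ) (ρ : Fin n → ℤ) (X : E n) : ℂ :=
  ∑' u, convTerm θ φ f g ρ u X

theorem norm_convTerm (ρ u : Fin n → ℤ) (X : E n) :
    ‖convTerm θ φ f g ρ u X‖ = ‖f (ρ - u) (X + sh θ u)‖ * ‖g u X‖ := by
  rw [convTerm, norm_mul, norm_mul, norm_e, mul_one]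

variable (θ) in
theorem exists_sh_bound : ∃ T : ℝ, 1 ≤ T ∧ ∀ (u : Fin n → ℤ) (X : E n),
    1 + ‖X + sh θ u‖ ≤ (1 + ‖X‖) * (T * (1 + ‖u‖)) := by
  refine ⟨1 + ‖actL θ‖ * n, by linarith [mul_nonneg (norm_nonneg (actL θ)) (Nat.cast_nonneg (α := ℝ) n)],
    fun u X => ?_⟩
  refine (one_add_norm_add_le _ _).trans ?_
  gcongr
  have h1 : ‖sh θ u‖ ≤ ‖actL θ‖ * (n * ‖u‖) :=
    (norm_act_le _ _).trans (by gcongr; exact norm_vec_le u)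
  have := norm_nonneg u
  have := norm_nonneg (actL θ)
  nlinarith [mul_nonneg (norm_nonneg (actL θ)) (Nat.cast_nonneg (α := ℝ) n)]

theorem Dec.conv_bound (hf : Dec f) (hg : Dec g) (N : ℕ) : ∃ (C : ℝ) (M : ℕ), 0 ≤ C ∧ ∀ ρ u X,
    (1 + ‖ρ‖) ^ N * ‖convTerm θ φ f g ρ u X‖ ≤
      C * (1 + ‖X‖) ^ M * ((1 + ‖u‖) ^ sumExp (Fin n))⁻¹ := by
  obtain ⟨T, hT, hsh⟩ := exists_sh_bound θ
  obtain ⟨C1, M1, h1⟩ := hf N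
  -- The decay of `g` in `u` is spent three times: `N` to move the weight from `ρ` to `ρ - u`, `M1`
  -- to absorb the growth of `f` at the shifted point, and `sumExp` to make the sum over `u`
  -- converge.
  obtain ⟨C2, M2, h2⟩ := hg (N + M1 + sumExp (Fin n))
  have hC1 := Dec.const_nonneg h1
  have hC2 := Dec.const_nonneg h2
  refine ⟨C1 * T ^ M1 * C2, M1 + M2, by positivity, fun ρ u X => ?_⟩
  rw [norm_convTerm]
  have hρ : (1 + ‖ρ‖) ^ N ≤ (1 + ‖ρ - u‖) ^ N * (1 + ‖u‖) ^ N := by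
    rw [← mul_pow]
    gcongr
    simpa using one_add_norm_add_le (ρ - u) u
  have e1 : (1 + ‖ρ - u‖) ^ N * ‖f (ρ - u) (X + sh θ u)‖ ≤
      C1 * ((1 + ‖X‖) * (T * (1 + ‖u‖))) ^ M1 :=
    (h1 _ _).trans (mul_le_mul_of_nonneg_left (pow_le_pow_left₀ (by positivity) (hsh u X) _) hC1)
  have e2 : ‖g u X‖ ≤ C2 * (1 + ‖X‖) ^ M2 * ((1 + ‖u‖) ^ (N + M1 + sumExp (Fin n)))⁻¹ := by
    rw [← div_eq_mul_inv, le_div_iff₀ (by positivity), mul_comm]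
    exact h2 u X
  calc (1 + ‖ρ‖) ^ N * (‖f (ρ - u) (X + sh θ u)‖ * ‖g u X‖)
      ≤ ((1 + ‖ρ - u‖) ^ N * (1 + ‖u‖) ^ N) * (‖f (ρ - u) (X + sh θ u)‖ * ‖g u X‖) := by gcongr
    _ = ((1 + ‖ρ - u‖) ^ N * ‖f (ρ - u) (X + sh θ u)‖) * ((1 + ‖u‖) ^ N * ‖g u X‖) := by ring
    _ ≤ (C1 * ((1 + ‖X‖) * (T * (1 + ‖u‖))) ^ M1) * ((1 + ‖u‖) ^ N *
        (C2 * (1 + ‖X‖) ^ M2 * ((1 + ‖u‖) ^ (N + M1 + sumExp (Fin n)))⁻¹)) := by gcongr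
    _ = _ := by
      have : (1 + ‖u‖) ≠ 0 := by have := norm_nonneg u; positivity
      generalize 1 + ‖u‖ = a at *
      generalize 1 + ‖X‖ = b at *
      simp only [mul_pow, pow_add]
      field_simp

theorem Dec.summable_norm_convTerm (hf : Dec f) (hg : Dec g) (ρ : Fin n → ℤ) (X : E n) :
    Summable fun u => ‖convTerm θ φ f g ρ u X‖ := by
  obtain ⟨C, M, -, h⟩ := Dec.conv_bound (θ := θ) (φ := φ) hf hg 0
  refine Summable.of_nonneg_of_le (fun u => norm_nonneg _) (fun u => ?_)
    (summable_sumExp.mul_left (C * (1 + ‖X‖) ^ M))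
  simpa using h ρ u X

theorem Dec.summable_convTerm (hf : Dec f) (hg : Dec g) (ρ : Fin n → ℤ) (X : E n) :
    Summable fun u => convTerm θ φ f g ρ u X := (hf.summable_norm_convTerm hg ρ X).of_norm

theorem Dec.hasSum_conv (hf : Dec f) (hg : Dec g) (ρ : Fin n → ℤ) (X : E n) :
    HasSum (fun u => convTerm θ φ f g ρ u X) (conv θ φ f g ρ X) :=
  (hf.summable_convTerm hg ρ X).hasSum

theorem Dec.conv (hf : Dec f) (hg : Dec g) : Dec (conv θ φ f g) := by
  intro N
  obtain ⟨C, M, hC, h⟩ := Dec.conv_bound (θ := θ) (φ := φ) hf hg N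
  refine ⟨C * ∑' u : Fin n → ℤ, ((1 + ‖u‖) ^ sumExp (Fin n))⁻¹, M, fun ρ X => ?_⟩
  have h1 : ‖NCTori.conv θ φ f g ρ X‖ ≤ ∑' u, ‖convTerm θ φ f g ρ u X‖ :=
    norm_tsum_le_tsum_norm (hf.summable_norm_convTerm hg ρ X)
  calc (1 + ‖ρ‖) ^ N * ‖NCTori.conv θ φ f g ρ X‖
      ≤ (1 + ‖ρ‖) ^ N * ∑' u, ‖convTerm θ φ f g ρ u X‖ := by gcongr
    _ = ∑' u, (1 + ‖ρ‖) ^ N * ‖convTerm θ φ f g ρ u X‖ := by rw [tsum_mul_left]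
    _ ≤ ∑' u : Fin n → ℤ, C * (1 + ‖X‖) ^ M * ((1 + ‖u‖) ^ sumExp (Fin n))⁻¹ :=
        Summable.tsum_le_tsum (fun u => h ρ u X)
          ((hf.summable_norm_convTerm hg ρ X).mul_left _) (summable_sumExp.mul_left _)
    _ = _ := by rw [tsum_mul_left]; ring

theorem conv_add_left {f' : (Fin n → ℤ) → E n → ℂ} (hf : Dec f) (hf' : Dec f') (hg : Dec g) :
    conv θ φ (f + f') g = conv θ φ f g + conv θ φ f' g := by
  funext ρ X
  rw [Pi.add_apply, Pi.add_apply, conv, conv, conv,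
    ← (hf.summable_convTerm hg ρ X).tsum_add (hf'.summable_convTerm hg ρ X)]
  exact tsum_congr fun u => by simp only [convTerm, Pi.add_apply]; ring

theorem conv_add_right {g' : (Fin n → ℤ) → E n → ℂ} (hf : Dec f) (hg : Dec g) (hg' : Dec g') :
    conv θ φ f (g + g') = conv θ φ f g + conv θ φ f g' := by
  funext ρ X
  rw [Pi.add_apply, Pi.add_apply, conv, conv, conv,
    ← (hf.summable_convTerm hg ρ X).tsum_add (hf.summable_convTerm hg' ρ X)]
  exact tsum_congr fun u => by simp only [convTerm, Pi.add_apply]; ring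

theorem conv_smul_left (c : ℂ) : conv θ φ (c • f) g = c • conv θ φ f g := by
  funext ρ X
  rw [Pi.smul_apply, Pi.smul_apply, conv, conv, smul_eq_mul, ← tsum_mul_left]
  exact tsum_congr fun u => by simp only [convTerm, Pi.smul_apply, smul_eq_mul]; ring

theorem conv_smul_right (c : ℂ) : conv θ φ f (c • g) = c • conv θ φ f g := by
  funext ρ X
  rw [Pi.smul_apply, Pi.smul_apply, conv, conv, smul_eq_mul, ← tsum_mul_left]
  exact tsum_congr fun u => by simp only [convTerm, Pi.smul_apply, smul_eq_mul]; ring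

/-- The phase `e(φ)` has logarithmic derivative a sum of affine functions of the two arguments. -/
def PhaseDeriv (θ : Matrix (Fin n) (Fin n) ℝ) (φ : (Fin n → ℤ) → (Fin n → ℤ) → E n → ℝ)
    (l₁ l₂ : Fin n → (Fin n → ℤ) → E n → ℂ) : Prop :=
  ∀ v u X, HasFDerivAt (fun X => e (φ v u X))
    (gradL fun p => (l₁ p v (X + sh θ u) + l₂ p u X) * e (φ v u X)) X

variable {l₁ l₂ : Fin n → (Fin n → ℤ) → E n → ℂ}

/-- The logarithmic derivative of the phase splits into a function of the first pair of arguments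
plus a function of the second, and each part can be absorbed into its factor. The derivative of a
convolution is thus a sum of two convolutions. -/
theorem SR.hasFDerivAt_conv (hφ : PhaseDeriv θ φ l₁ l₂) (hl₁ : ∀ p, IsAff (l₁ p))
    (hl₂ : ∀ p, IsAff (l₂ p)) (hf : SR f) (hg : SR g) (ρ : Fin n → ℤ) (X : E n) :
    HasFDerivAt (conv θ φ f g ρ) (gradL fun p => (conv θ φ (NCTori.pd p f + l₁ p * f) g +
      conv θ φ f (NCTori.pd p g + l₂ p * g)) ρ X) X := by
  have hf' : ∀ p, Dec (NCTori.pd p f + l₁ p * f) := fun p => ((hf.pd p).add (hf.aff_mul (hl₁ p))).dec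
  have hg' : ∀ p, Dec (NCTori.pd p g + l₂ p * g) := fun p => ((hg.pd p).add (hg.aff_mul (hl₂ p))).dec
  have h := hasFDerivAt_tsum_gradL (t := fun u X => convTerm θ φ f g ρ u X)
    (s := fun u p X => convTerm θ φ (NCTori.pd p f + l₁ p * f) g ρ u X +
      convTerm θ φ f (NCTori.pd p g + l₂ p * g) ρ u X) ?_ ?_
      (hf.dec.summable_convTerm hg.dec ρ) X
  · refine h.congr_fderiv (congrArg gradL (funext fun p => ?_))
    exact ((hf' p).summable_convTerm hg.dec ρ X).tsum_add (hf.dec.summable_convTerm (hg' p) ρ X)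
  · intro u Y
    have h1 : HasFDerivAt (fun Y => f (ρ - u) (Y + sh θ u))
        (gradL fun p => NCTori.pd p f (ρ - u) (Y + sh θ u)) Y := by
      have := hasFDerivAt_pd hf.differentiable (ρ - u) (Y + sh θ u)
      exact (hasFDerivAt_comp_add_right (sh θ u)).mpr this
    have h2 := (h1.mul (hasFDerivAt_pd hg.differentiable u Y)).mul (hφ (ρ - u) u Y)
    refine h2.to_gradL fun p => ?_
    simp only [_root_.add_apply, _root_.smul_apply, gradL_single, smul_eq_mul, convTerm,
      Pi.add_apply, Pi.mul_apply]
    ring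
  · intro R
    choose C1 M1 hC1 h1 using fun p => Dec.conv_bound (θ := θ) (φ := φ) (hf' p) hg.dec 0
    choose C2 M2 hC2 h2 using fun p => Dec.conv_bound (θ := θ) (φ := φ) hf.dec (hg' p) 0
    refine ⟨fun u => (∑ p, (C1 p * (1 + |R|) ^ M1 p + C2 p * (1 + |R|) ^ M2 p)) *
      ((1 + ‖u‖) ^ sumExp (Fin n))⁻¹, summable_sumExp.mul_left _, fun u p Y hY => ?_⟩
    have hY' : ‖Y‖ ≤ |R| := hY.trans (le_abs_self R)
    have hp : C1 p * (1 + |R|) ^ M1 p + C2 p * (1 + |R|) ^ M2 p ≤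
        ∑ p, (C1 p * (1 + |R|) ^ M1 p + C2 p * (1 + |R|) ^ M2 p) :=
      Finset.single_le_sum (f := fun p => C1 p * (1 + |R|) ^ M1 p + C2 p * (1 + |R|) ^ M2 p)
        (fun q _ => by have := hC1 q; have := hC2 q; positivity) (Finset.mem_univ p)
    have a1 := h1 p ρ u Y
    have a2 := h2 p ρ u Y
    simp only [pow_zero, one_mul] at a1 a2
    refine (norm_add_le _ _).trans ((add_le_add a1 a2).trans ?_)
    rw [← add_mul]
    refine mul_le_mul_of_nonneg_right (le_trans ?_ hp) (by positivity)
    have := hC1 p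
    have := hC2 p
    gcongr

theorem SR.conv (hφ : PhaseDeriv θ φ l₁ l₂) (hl₁ : ∀ p, IsAff (l₁ p))
    (hl₂ : ∀ p, IsAff (l₂ p)) (hf : SR f) (hg : SR g) : SR (conv θ φ f g) := by
  -- By the derivative formula, the span of all convolutions of such families is stable under
  -- partial derivatives.
  let T : Set ((Fin n → ℤ) → E n → ℂ) := {k | ∃ f g, SR f ∧ SR g ∧ k = NCTori.conv θ φ f g}
  refine SR.of_mem_span (T := T) ?_ (Submodule.subset_span ⟨f, g, hf, hg, rfl⟩)
  rintro k ⟨f, g, hf, hg, rfl⟩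
  have hd := SR.hasFDerivAt_conv hφ hl₁ hl₂ hf hg
  refine ⟨fun u X => (hd u X).differentiableAt, hf.dec.conv hg.dec, fun p => ?_⟩
  rw [pd_eq (s := fun p => NCTori.conv θ φ (NCTori.pd p f + l₁ p * f) g +
      NCTori.conv θ φ f (NCTori.pd p g + l₂ p * g)) hd]
  exact Submodule.add_mem _
    (Submodule.subset_span ⟨_, _, (hf.pd p).add (hf.aff_mul (hl₁ p)), hg, rfl⟩)
    (Submodule.subset_span ⟨_, _, hf, (hg.pd p).add (hg.aff_mul (hl₂ p)), rfl⟩)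

/-- Both sides are the same absolutely convergent double series, summed over `(u, w)` and over `(s,
u)` with `s = u + w`; the cocycle identity says that the phases agree. -/
theorem conv_assoc {φ₁ φ₂ φ₃ φ₄ : (Fin n → ℤ) → (Fin n → ℤ) → E n → ℝ} (hf : Dec f) (hg : Dec g)
    (hh : Dec h) (hcocycle : ∀ v w u X,
      φ₁ v w (X + sh θ u) + φ₂ (v + w) u X = φ₃ w u X + φ₄ v (w + u) X) :
    conv θ φ₂ (conv θ φ₁ f g) h = conv θ φ₄ f (conv θ φ₃ g h) := by
  funext ρ X
  let t : (Fin n → ℤ) → (Fin n → ℤ) → ℂ := fun u w =>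
    f (ρ - u - w) (X + sh θ u + sh θ w) * g w (X + sh θ u) * h u X *
      e (φ₁ (ρ - u - w) w (X + sh θ u) + φ₂ (ρ - u) u X)
  have hsum : Summable (Function.uncurry t) := by
    obtain ⟨T, hT, hsh⟩ := exists_sh_bound θ
    obtain ⟨C1, M1, h1⟩ := hf 0
    -- The argument of `f` is shifted by both `u` and `w`, and that of `g` by `u`. So `g` must
    -- absorb `M1` powers of `1 + ‖w‖`, and `h` must absorb `M1 + M2` powers of `1 + ‖u‖`.
    obtain ⟨C2, M2, h2⟩ := hg (M1 + sumExp (Fin n))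
    obtain ⟨C3, M3, h3⟩ := hh (M1 + M2 + sumExp (Fin n))
    have hC1 := Dec.const_nonneg h1
    have hC2 := Dec.const_nonneg h2
    have hC3 := Dec.const_nonneg h3
    have hb := (summable_sumExp (ι := Fin n)).mul_of_nonneg (summable_sumExp (ι := Fin n))
      (fun _ => by positivity) (fun _ => by positivity)
    refine Summable.of_norm_bounded (hb.mul_left (C1 * T ^ M1 * T ^ M1 * C2 * T ^ M2 * C3 *
      (1 + ‖X‖) ^ (M1 + M2 + M3))) ?_
    rintro ⟨u, w⟩
    have e1 : ‖f (ρ - u - w) (X + sh θ u + sh θ w)‖ ≤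
        C1 * ((1 + ‖X‖) * (T * (1 + ‖u‖)) * (T * (1 + ‖w‖))) ^ M1 := by
      have := h1 (ρ - u - w) (X + sh θ u + sh θ w)
      rw [pow_zero, one_mul] at this
      refine this.trans ?_
      gcongr
      exact (hsh w _).trans (by gcongr; exact hsh u X)
    have e2 : ‖g w (X + sh θ u)‖ ≤ C2 * ((1 + ‖X‖) * (T * (1 + ‖u‖))) ^ M2 *
        ((1 + ‖w‖) ^ (M1 + sumExp (Fin n)))⁻¹ := by
      rw [← div_eq_mul_inv, le_div_iff₀ (by positivity), mul_comm]
      refine (h2 _ _).trans ?_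
      gcongr
      exact hsh u X
    have e3 : ‖h u X‖ ≤ C3 * (1 + ‖X‖) ^ M3 * ((1 + ‖u‖) ^ (M1 + M2 + sumExp (Fin n)))⁻¹ := by
      rw [← div_eq_mul_inv, le_div_iff₀ (by positivity), mul_comm]
      exact h3 u X
    simp only [Function.uncurry, t, norm_mul, norm_e, mul_one]
    calc _ ≤ C1 * ((1 + ‖X‖) * (T * (1 + ‖u‖)) * (T * (1 + ‖w‖))) ^ M1 *
          (C2 * ((1 + ‖X‖) * (T * (1 + ‖u‖))) ^ M2 * ((1 + ‖w‖) ^ (M1 + sumExp (Fin n)))⁻¹) *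
          (C3 * (1 + ‖X‖) ^ M3 * ((1 + ‖u‖) ^ (M1 + M2 + sumExp (Fin n)))⁻¹) := by gcongr
      _ = _ := by
        have p1 : (1 + ‖u‖) ≠ 0 := by have := norm_nonneg u; positivity
        have p2 : (1 + ‖w‖) ≠ 0 := by have := norm_nonneg w; positivity
        generalize 1 + ‖u‖ = a at *
        generalize 1 + ‖w‖ = b at *
        generalize 1 + ‖X‖ = c at *
        simp only [mul_pow, pow_add]
        field_simp
  have hl : conv θ φ₂ (conv θ φ₁ f g) h ρ X = ∑' u, ∑' w, t u w := by
    refine tsum_congr fun u => ?_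
    rw [convTerm, conv, ← tsum_mul_right, ← tsum_mul_right]
    refine tsum_congr fun w => ?_
    simp only [convTerm, t, e_add]
    ring
  have hr : conv θ φ₄ f (conv θ φ₃ g h) ρ X = ∑' s, ∑' u, t u (s - u) := by
    refine tsum_congr fun s => ?_
    rw [convTerm, conv, ← tsum_mul_left, ← tsum_mul_right]
    refine tsum_congr fun u => ?_
    have hc := hcocycle (ρ - s) (s - u) u X
    simp only [sub_add_cancel] at hc
    have i1 : ρ - u - (s - u) = ρ - s := by abel
    have i2 : ρ - s + (s - u) = ρ - u := by abel
    have i3 : X + sh θ u + sh θ (s - u) = X + sh θ s := by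
      rw [add_assoc, ← sh_add, add_sub_cancel]
    simp only [convTerm, t, i1, i3]
    rw [i2] at hc
    rw [hc, e_add]
    ring
  rw [hl, hr]
  have h1 : ∑' u, ∑' w, t u w = ∑' q : (Fin n → ℤ) × (Fin n → ℤ), Function.uncurry t q :=
    hsum.tsum_prod.symm
  -- Sends `(s, u)` to `(u, s - u)`, matching the two orders of summation.
  let σ : (Fin n → ℤ) × (Fin n → ℤ) ≃ (Fin n → ℤ) × (Fin n → ℤ) :=
    { toFun := fun q => (q.2, q.1 - q.2)
      invFun := fun q => (q.1 + q.2, q.1)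
      left_inv := fun q => by simp
      right_inv := fun q => by simp }
  have h2 : ∑' s, ∑' u, t u (s - u) = ∑' q : (Fin n → ℤ) × (Fin n → ℤ), Function.uncurry t (σ q) :=
    ((σ.summable_iff.mpr hsum).tsum_prod).symm
  rw [h1, h2, σ.tsum_eq]

/-- Equivariance of `f` under the translations `(u, X) ↦ (u + B v, X + D v)`, `v ∈ ℤⁿ`. -/
def Eqv (D : Matrix (Fin n) (Fin n) ℝ) (B : Matrix (Fin n) (Fin n) ℤ)
    (f : (Fin n → ℤ) → E n → ℂ) : Prop :=
  ∀ v u X, f (u + B.mulVec v) (X + act D (vec v)) = f u X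

theorem Eqv.pd {D : Matrix (Fin n) (Fin n) ℝ} {B : Matrix (Fin n) (Fin n) ℤ} (hf : Eqv D B f)
    (p : Fin n) : Eqv D B (pd p f) := by
  intro v u X
  have : f u = fun X => f (u + B.mulVec v) (X + act D (vec v)) := funext fun X => (hf v u X).symm
  rw [NCTori.pd, NCTori.pd, this, fderiv_comp_add_right]

/-- Translating the summation index by `B_ab z` compensates the translation of `ρ` and `X`: the
shift `θ B_ab z` turns `D_a z` into `D_b z`, which is the period of `f`. -/
theorem Eqv.conv {Da Db : Matrix (Fin n) (Fin n) ℝ} {Bab Bbc Bac : Matrix (Fin n) (Fin n) ℤ}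
    (hf : Eqv Db Bbc f) (hg : Eqv Da Bab g) (hD : Db = Da + θ * toReal Bab) (hB : Bac = Bbc + Bab)
    (hφ : ∀ z v u X, φ (v + Bbc.mulVec z) (u + Bab.mulVec z) (X + act Da (vec z)) = φ v u X) :
    Eqv Da Bac (conv θ φ f g) := by
  intro z ρ X
  rw [NCTori.conv, NCTori.conv, ← (Equiv.addRight (Bab.mulVec z)).tsum_eq]
  refine tsum_congr fun u => ?_
  have i1 : ρ + Bac.mulVec z - (u + Bab.mulVec z) = ρ - u + Bbc.mulVec z := by
    rw [hB, Matrix.add_mulVec]; abel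
  have i2 : X + act Da (vec z) + sh θ (u + Bab.mulVec z) = X + sh θ u + act Db (vec z) := by
    rw [sh_add, hD, add_act, act_mul, ← vec_mulVec]
    simp only [sh]
    abel
  rw [Equiv.coe_addRight, convTerm, convTerm, i1, i2, hf, hg, hφ]

end Convolution

/-! ### Periodic functions and Fourier coefficients -/

section Torus

open MeasureTheory

variable {n : ℕ}

/-- The normalized Haar measure on the circle. -/
local instance : MeasureSpace UnitAddCircle := ⟨AddCircle.haarAddCircle⟩

local instance : Measure.IsAddHaarMeasure (volume : Measure UnitAddCircle) :=
  inferInstanceAs (Measure.IsAddHaarMeasure AddCircle.haarAddCircle)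

local instance : IsProbabilityMeasure (volume : Measure UnitAddCircle) :=
  inferInstanceAs (IsProbabilityMeasure AddCircle.haarAddCircle)

/-- The unit cube. -/
def cube (n : ℕ) : Set (E n) := {x | ∀ i, x i ∈ Set.Ioc (0 : ℝ) 1}

theorem measurableSet_cube : MeasurableSet (cube n) := by
  have : cube n = ⋂ i, (fun x : E n => x i) ⁻¹' Set.Ioc (0 : ℝ) 1 := by
    ext x; simp [cube]
  rw [this]
  exact MeasurableSet.iInter fun i => (by fun_prop : Measurable fun x : E n => x i) measurableSet_Ioc

theorem norm_le_of_mem_cube {x : E n} (hx : x ∈ cube n) : ‖x‖ ≤ n := by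
  have h1 : ‖x‖ ≤ ∑ i, ‖EuclideanSpace.single i (x i)‖ := by
    refine le_trans (le_of_eq ?_) (norm_sum_le _ _)
    congr 1
    ext j
    simp [Finset.sum_apply, Pi.single_apply]
  refine h1.trans ?_
  have h2 : ∀ i ∈ (Finset.univ : Finset (Fin n)), ‖EuclideanSpace.single i (x i)‖ ≤ 1 := by
    intro i _
    have := hx i
    rw [PiLp.norm_single, Real.norm_eq_abs, abs_le]
    constructor <;> linarith [this.1, this.2]
  simpa using Finset.sum_le_sum h2

theorem setIntegral_cube_eq (f : E n → ℂ) : ∫ x in cube n, f x =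
    ∫ x : Fin n → ℝ in {x : Fin n → ℝ | ∀ i, x i ∈ Set.Ioc ((0 : Fin n → ℝ) i) ((0 : Fin n → ℝ) i + 1)},
      f (WithLp.toLp 2 x) := by
  have h := (PiLp.volume_preserving_toLp (Fin n)).setIntegral_preimage_emb
    (MeasurableEquiv.toLp 2 (Fin n → ℝ)).measurableEmbedding f (cube n)
  rw [← h]
  congr 2
  ext x
  simp [cube]

theorem volume_cube : volume (cube n) = 1 := by
  rw [← (PiLp.volume_preserving_toLp (Fin n)).measure_preimage measurableSet_cube.nullMeasurableSet]
  have : (WithLp.toLp 2 ⁻¹' cube n : Set (Fin n → ℝ)) = Set.univ.pi fun _ => Set.Ioc (0 : ℝ) 1 := by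
    ext x; simp [cube, Set.mem_pi]
  rw [this, Real.volume_pi_Ioc]
  simp

instance : IsFiniteMeasure (volume.restrict (cube n)) :=
  ⟨by rw [Measure.restrict_apply_univ, volume_cube]; exact ENNReal.one_lt_top⟩

theorem Continuous.integrableOn_cube {f : E n → ℂ} (hf : Continuous f) :
    IntegrableOn f (cube n) := by
  refine (hf.continuousOn.integrableOn_compact (isCompact_closedBall (0 : E n) n)).mono_set ?_
  intro x hx
  simpa using norm_le_of_mem_cube hx

/-- Invariance under translations by `ℤⁿ`. -/
def Per (f : E n → ℂ) : Prop := ∀ v X, f (X + vec v) = f X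

/-- The class in the torus. -/
def toTorus (x : E n) : UnitAddTorus (Fin n) := fun i => (x i : UnitAddCircle)

theorem exists_lift {f : E n → ℂ} (hf : Continuous f) (hp : Per f) :
    ∃ F : C(UnitAddTorus (Fin n), ℂ), ∀ x, F (toTorus x) = f x := by
  have hq : IsOpenQuotientMap (toTorus (n := n)) := by
    have h1 : IsOpenQuotientMap (Pi.map fun _ : Fin n => ((↑) : ℝ → UnitAddCircle)) :=
      IsOpenQuotientMap.piMap fun _ => QuotientAddGroup.isOpenQuotientMap_mk
    exact h1.comp (PiLp.homeomorph 2 (fun _ : Fin n => ℝ)).isOpenQuotientMap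
  have hfac : Function.FactorsThrough f (toTorus (n := n)) := by
    intro x y hxy
    have h : ∀ i, ∃ k : ℤ, (k : ℝ) = x i - y i := by
      intro i
      have h1 : ((x i : ℝ) : UnitAddCircle) = (y i : ℝ) := congrFun hxy i
      have h2 : ((x i - y i : ℝ) : UnitAddCircle) = 0 := by
        rw [AddCircle.coe_sub, h1, sub_self]
      obtain ⟨k, hk⟩ := (AddCircle.coe_eq_zero_iff 1).mp h2
      exact ⟨k, by simpa using hk⟩
    choose k hk using h
    have : x = y + vec k := by
      ext i
      simp [vec_apply, hk]
    rw [this, hp]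
  exact ⟨hq.isQuotientMap.lift (f := ⟨toTorus, hq.continuous⟩) ⟨f, hf⟩ hfac, fun x =>
    DFunLike.congr_fun (hq.isQuotientMap.lift_comp (f := ⟨toTorus, hq.continuous⟩) ⟨f, hf⟩ hfac) x⟩

theorem mFourier_toTorus (k : Fin n → ℤ) (x : E n) :
    UnitAddTorus.mFourier k (toTorus x) = e ⟪vec k, x⟫ := by
  simp only [UnitAddTorus.mFourier, ContinuousMap.coe_mk, toTorus, fourier_coe_apply, e,
    ← Complex.exp_sum, inner_eq_sum, vec_apply]
  congr 1
  push_cast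
  rw [Finset.mul_sum]
  exact Finset.sum_congr rfl fun i _ => by ring

/-- The Fourier coefficients of a periodic function. -/
def torusCoeff (f : E n → ℂ) (k : Fin n → ℤ) : ℂ := ∫ x in cube n, e (-⟪vec k, x⟫) * f x

theorem integral_toTorus (F : UnitAddTorus (Fin n) → ℂ) :
    ∫ t, F t = ∫ x in cube n, F (toTorus x) := by
  rw [UnitAddTorus.integral_preimage F 0, setIntegral_cube_eq]
  rfl

theorem torusCoeff_eq_mFourierCoeff {f : E n → ℂ} {F : C(UnitAddTorus (Fin n), ℂ)}
    (hF : ∀ x, F (toTorus x) = f x) (k : Fin n → ℤ) :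
    torusCoeff f k = UnitAddTorus.mFourierCoeff F k := by
  refine Eq.trans ?_ (integral_toTorus fun t => UnitAddTorus.mFourier (-k) t • F t).symm
  rw [torusCoeff]
  congr 1
  funext x
  rw [mFourier_toTorus, hF, vec_neg, inner_neg_left, smul_eq_mul]

theorem hasSum_torusCoeff {f : E n → ℂ} (hf : Continuous f) (hp : Per f)
    (hs : Summable (torusCoeff f)) (x : E n) :
    HasSum (fun k => torusCoeff f k * e ⟪vec k, x⟫) (f x) := by
  obtain ⟨F, hF⟩ := exists_lift hf hp
  have h1 : torusCoeff f = UnitAddTorus.mFourierCoeff F :=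
    funext fun k => torusCoeff_eq_mFourierCoeff hF k
  have h := UnitAddTorus.hasSum_mFourier_series_apply_of_summable (f := F) (h1 ▸ hs) (toTorus x)
  rw [hF] at h
  simpa only [mFourier_toTorus, smul_eq_mul, ← h1] using h

/-- The cube integral of a periodic function is an integral over the torus, where Haar measure is
translation invariant. -/
theorem setIntegral_cube_add {f : E n → ℂ} (hf : Continuous f) (hp : Per f) (y : E n) :
    ∫ x in cube n, f (x + y) = ∫ x in cube n, f x := by
  obtain ⟨F, hF⟩ := exists_lift hf hp
  have h1 := integral_add_right_eq_self (μ := (volume : Measure (UnitAddTorus (Fin n))))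
    (fun t => F t) (toTorus y)
  rw [integral_toTorus, integral_toTorus] at h1
  simp only [hF] at h1
  rw [← h1]
  congr 1
  funext x
  rw [← hF]
  rfl

theorem Per.norm_le {f : E n → ℂ} (hf : Continuous f) (hp : Per f) : ∃ C, ∀ x, ‖f x‖ ≤ C := by
  obtain ⟨F, hF⟩ := exists_lift hf hp
  exact ⟨‖F‖, fun x => by rw [← hF]; exact F.norm_coe_le_norm _⟩

/-- The integral of a translate of `f` over the cube does not depend on the translation.
Differentiating along the `p`-th direction at `0` gives the claim. -/
theorem setIntegral_cube_deriv {f : E n → ℂ} {g : Fin n → E n → ℂ} (hp : Per f)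
    (hd : ∀ X, HasFDerivAt f (gradL fun p => g p X) X) (p : Fin n) (hg : Continuous (g p)) :
    ∫ x in cube n, g p x = 0 := by
  have hf : Continuous f := continuous_iff_continuousAt.mpr fun X => (hd X).continuousAt
  -- The derivative inherits periodicity and so is bounded; the bound dominates the integrand below.
  have hgp : Per (g p) := by
    intro v X
    have h1 : HasFDerivAt f (gradL fun p => g p (X + vec v)) X := by
      have h2 := (hasFDerivAt_comp_add_right (vec v)).mpr (hd (X + vec v))
      exact h2.congr_of_eventuallyEq (Filter.Eventually.of_forall fun Y => (hp v Y).symm)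
    have h3 := h1.unique (hd X)
    have := congrArg (fun l : E n →L[ℝ] ℂ => l (EuclideanSpace.single p 1)) h3
    simpa only [gradL_single] using this
  obtain ⟨C, hC⟩ := Per.norm_le hg hgp
  let ep : E n := EuclideanSpace.single p 1
  have hline : ∀ (X : E n) (s : ℝ), HasDerivAt (fun s : ℝ => f (X + s • ep)) (g p (X + s • ep)) s := by
    intro X s
    have h1 : HasDerivAt (fun s : ℝ => X + s • ep) ep s := by
      simpa using ((hasDerivAt_id s).smul_const ep).const_add X
    have h2 := (hd (X + s • ep)).comp_hasDerivAt s h1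
    rwa [gradL_single] at h2
  have h := (hasDerivAt_integral_of_dominated_loc_of_deriv_le (μ := volume.restrict (cube n))
    (F := fun s X => f (X + s • ep)) (F' := fun s X => g p (X + s • ep)) (x₀ := (0 : ℝ))
    (s := Set.univ) (bound := fun _ => C) Filter.univ_mem
    (Filter.Eventually.of_forall fun s => by
      exact (hf.comp (by fun_prop : Continuous fun X : E n => X + s • ep)).aestronglyMeasurable)
    (Continuous.integrableOn_cube (hf.comp (by fun_prop)))
    (hg.comp (by fun_prop : Continuous fun X : E n => X + (0 : ℝ) • ep)).aestronglyMeasurable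
    (Filter.Eventually.of_forall fun X s _ => hC _)
    (integrable_const C)
    (Filter.Eventually.of_forall fun X s _ => hline X s)).2
  have hconst : (fun s : ℝ => ∫ X in cube n, f (X + s • ep)) = fun _ => ∫ X in cube n, f X :=
    funext fun s => setIntegral_cube_add hf hp _
  rw [hconst] at h
  have h0 := h.unique (hasDerivAt_const (0 : ℝ) _)
  simpa using h0

theorem hasFDerivAt_character (w : E n) (X : E n) :
    HasFDerivAt (fun X => e ⟪w, X⟫) (gradL fun p => (2 * Real.pi * Complex.I * (w p : ℂ)) * e ⟪w, X⟫) X := by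
  have h1 : HasFDerivAt (fun X : E n => ⟪w, X⟫) (innerSL ℝ w) X := (innerSL ℝ w).hasFDerivAt
  have h2 := (hasDerivAt_e ⟪w, X⟫).hasFDerivAt.comp X h1
  refine h2.to_gradL fun p => ?_
  simp [inner_eq_sum]
  ring

theorem per_character (k : Fin n → ℤ) : Per (fun X : E n => e ⟪vec k, X⟫) := by
  intro v X
  obtain ⟨j, hj⟩ := inner_vec_vec k v
  simp only [inner_add_right, hj, e_add_int]

theorem continuous_character (w : E n) : Continuous (fun X : E n => e ⟪w, X⟫) :=
  continuous_e.comp (by fun_prop)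

theorem torusCoeff_deriv {f : E n → ℂ} {g : Fin n → E n → ℂ} (hp : Per f)
    (hd : ∀ X, HasFDerivAt f (gradL fun p => g p X) X) (p : Fin n) (hg : Continuous (g p))
    (k : Fin n → ℤ) :
    torusCoeff (g p) k = 2 * Real.pi * Complex.I * k p * torusCoeff f k := by
  have hf : Continuous f := continuous_iff_continuousAt.mpr fun X => (hd X).continuousAt
  -- Integration by parts: the product of `f` with a character is periodic, so its derivative
  -- integrates to zero.
  have h := setIntegral_cube_deriv (f := fun X => e ⟪vec (-k), X⟫ * f X)
    (g := fun p X => e ⟪vec (-k), X⟫ * g p X -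
      2 * Real.pi * Complex.I * k p * (e ⟪vec (-k), X⟫ * f X))
    (fun v X => by simp only [hp v X, per_character (-k) v X])
    (fun X => ?_) p (((continuous_character _).mul hg).sub
      (continuous_const.mul ((continuous_character _).mul hf)))
  · rw [integral_sub, integral_const_mul, sub_eq_zero] at h
    · simpa only [torusCoeff, vec_neg, inner_neg_left] using h
    · exact Continuous.integrableOn_cube ((continuous_character _).mul hg)
    · exact Continuous.integrableOn_cube (continuous_const.mul ((continuous_character _).mul hf))
  · refine ((hasFDerivAt_character (vec (-k)) X).mul (hd X)).to_gradL fun q => ?_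
    simp [gradL_single, vec_apply]
    ring

/-- If `k` and `l` differ in the coordinate `p`, the derivative along `p` multiplies the coefficient
by two different numbers, `2πi k_p` and `2πi l_p`, so the coefficient vanishes. -/
theorem torusCoeff_character (k l : Fin n → ℤ) :
    torusCoeff (fun X => e ⟪vec l, X⟫) k = if k = l then 1 else 0 := by
  split_ifs with h
  · subst h
    simp only [torusCoeff, ← e_add, neg_add_cancel, e_zero]
    simp [Measure.real, volume_cube]
  · obtain ⟨p, hp⟩ := Function.ne_iff.mp h
    have h1 := torusCoeff_deriv (per_character l) (hasFDerivAt_character (vec l)) p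
      (continuous_const.mul (continuous_character _)) k
    have h2 : torusCoeff (fun X => (2 * Real.pi * Complex.I * ((vec l) p : ℂ)) * e ⟪vec l, X⟫) k =
        2 * Real.pi * Complex.I * l p * torusCoeff (fun X => e ⟪vec l, X⟫) k := by
      rw [torusCoeff, torusCoeff, ← integral_const_mul]
      congr 1
      funext x
      simp only [vec_apply]
      push_cast
      ring
    rw [h2, ← sub_eq_zero, ← sub_mul, ← mul_sub] at h1
    refine (mul_eq_zero.mp h1).resolve_left ?_
    have : ((l p : ℂ) - k p) ≠ 0 := by
      rw [sub_ne_zero]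
      exact_mod_cast hp.symm
    exact mul_ne_zero Complex.two_pi_I_ne_zero this

theorem torusCoeff_of_hasSum {c : (Fin n → ℤ) → ℂ} (hc : Summable fun k => ‖c k‖) {f : E n → ℂ}
    (hf : ∀ x, HasSum (fun k => c k * e ⟪vec k, x⟫) (f x)) (k : Fin n → ℤ) :
    torusCoeff f k = c k := by
  have h1 : ∀ x, e (-⟪vec k, x⟫) * f x = ∑' l, e (-⟪vec k, x⟫) * (c l * e ⟪vec l, x⟫) :=
    fun x => ((hf x).mul_left _).tsum_eq.symm
  have hint : ∀ l, Integrable (fun x => e (-⟪vec k, x⟫) * (c l * e ⟪vec l, x⟫))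
      (volume.restrict (cube n)) := fun l => by
    refine Continuous.integrableOn_cube ((continuous_e.comp (by fun_prop)).mul
      (continuous_const.mul (continuous_character _)))
  have h2 := hasSum_integral_of_summable_integral_norm hint (by
    simpa [norm_mul, Measure.real, volume_cube] using hc)
  have h3 : (fun l => ∫ x in cube n, e (-⟪vec k, x⟫) * (c l * e ⟪vec l, x⟫)) =
      fun l => if l = k then c k else 0 := by
    funext l
    have := torusCoeff_character k l
    rw [torusCoeff] at this
    have h4 : ∫ x in cube n, e (-⟪vec k, x⟫) * (c l * e ⟪vec l, x⟫) =
        c l * ∫ x in cube n, e (-⟪vec k, x⟫) * e ⟪vec l, x⟫ := by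
      rw [← integral_const_mul]
      congr 1
      funext x
      ring
    rw [h4, this]
    by_cases hkl : k = l
    · subst hkl; simp
    · rw [if_neg hkl, if_neg (Ne.symm hkl), mul_zero]
  rw [h3] at h2
  rw [torusCoeff]
  simp only [h1]
  exact h2.unique (hasSum_ite_eq k (c k))

/-- Decomposition of an integral over `ℝⁿ` into translates of the unit cube. -/
theorem hasSum_integral_cube {g : E n → ℂ} (hg : Integrable g) :
    HasSum (fun v : Fin n → ℤ => ∫ x in cube n, g (x + vec v)) (∫ x, g x) := by
  let S : (Fin n → ℤ) → Set (E n) := fun v => (fun x => x + vec (-v)) ⁻¹' cube n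
  have hmem : ∀ v x, x ∈ S v ↔ ∀ i, (v i : ℝ) < x i ∧ x i ≤ v i + 1 := by
    intro v x
    simp only [S, cube, Set.mem_preimage, Set.mem_ofPred_eq, Set.mem_Ioc, PiLp.add_apply, vec_apply,
      Pi.neg_apply, Int.cast_neg]
    refine forall_congr' fun i => ?_
    constructor <;> rintro ⟨h1, h2⟩ <;> constructor <;> linarith
  have hU : ⋃ v, S v = Set.univ := by
    rw [Set.eq_univ_iff_forall]
    intro x
    rw [Set.mem_iUnion]
    refine ⟨fun i => ⌈x i⌉ - 1, (hmem _ x).mpr fun i => ?_⟩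
    have h1 := Int.ceil_lt_add_one (x i)
    have h2 := Int.le_ceil (x i)
    push_cast
    constructor <;> linarith
  have hd : Pairwise (Function.onFun Disjoint S) := by
    intro v w hvw
    rw [Function.onFun, Set.disjoint_left]
    intro x hv hw
    apply hvw
    funext i
    have h1 := (hmem v x).mp hv i
    have h2 := (hmem w x).mp hw i
    have h3 : (v i : ℝ) < w i + 1 := by linarith
    have h4 : (w i : ℝ) < v i + 1 := by linarith
    norm_cast at h3 h4
    omega
  have h := hasSum_integral_iUnion (μ := volume) (f := g)
    (fun v => measurableSet_cube.preimage (by fun_prop : Measurable fun x : E n => x + vec (-v))) hd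
    (by rw [hU]; exact hg.integrableOn)
  rw [hU, setIntegral_univ] at h
  have hfun : (fun v : Fin n → ℤ => ∫ x in cube n, g (x + vec v)) = fun v => ∫ x in S v, g x := by
    funext v
    have := (measurePreserving_add_right (volume : Measure (E n)) (vec (-v))).setIntegral_preimage_emb
      (measurableEmbedding_addRight (vec (-v))) (fun x => g (x + vec v)) (cube n)
    rw [← this]
    simp only [S, vec_neg, neg_add_cancel_right]
  rw [hfun]
  exact h

theorem integral_comp_act {D : Matrix (Fin n) (Fin n) ℝ} (hD : D.det ≠ 0) (g : E n → ℂ) :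
    ∫ x, g (act D x) = (|D.det|⁻¹ : ℝ) * ∫ x, g x := by
  have hdet : LinearMap.det (actL D : E n →ₗ[ℝ] E n) = D.det := by
    rw [← LinearMap.det_toLin' D,
      ← LinearMap.det_conj (Matrix.toLin' D) (WithLp.linearEquiv 2 ℝ (Fin n → ℝ)).symm]
    rfl
  have hne : LinearMap.det (actL D : E n →ₗ[ℝ] E n) ≠ 0 := by rwa [hdet]
  have h := Measure.map_linearMap_addHaar_eq_smul_addHaar (volume : Measure (E n)) hne
  let L : E n ≃L[ℝ] E n := (LinearEquiv.ofIsUnitDet (f := (actL D : E n →ₗ[ℝ] E n))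
    (v := (EuclideanSpace.basisFun (Fin n) ℝ).toBasis) (v' := (EuclideanSpace.basisFun (Fin n) ℝ).toBasis)
    (by
      rw [LinearMap.det_toMatrix]
      exact isUnit_iff_ne_zero.mpr hne)).toContinuousLinearEquiv
  have hL : ∀ x, L x = act D x := fun x => rfl
  have h2 : ∫ x, g (act D x) = ∫ y, g y ∂(Measure.map (actL D : E n →ₗ[ℝ] E n) volume) :=
    ((L.toHomeomorph.measurableEmbedding).integral_map g).symm
  rw [h2, h, hdet, integral_smul_measure, ENNReal.toReal_ofReal (abs_nonneg _), abs_inv,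
    Complex.real_smul]

end Torus

/-! ### Equivariant families -/

section Equivariant

open MeasureTheory

variable {n : ℕ} {f g : (Fin n → ℤ) → E n → ℂ} {D : Matrix (Fin n) (Fin n) ℝ}
  {B : Matrix (Fin n) (Fin n) ℤ}

theorem Eqv.add (hf : Eqv D B f) (hg : Eqv D B g) : Eqv D B (f + g) := fun v u X => by
  simp only [Pi.add_apply, hf v u X, hg v u X]

theorem Eqv.smul (hf : Eqv D B f) (c : ℂ) : Eqv D B (c • f) := fun v u X => by
  simp only [Pi.smul_apply, hf v u X]

variable (D B) in
/-- Equivariant families of smooth rapidly decreasing functions. -/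
def RF : Submodule ℂ ((Fin n → ℤ) → E n → ℂ) where
  carrier := {f | SR f ∧ Eqv D B f}
  zero_mem' := ⟨SR.zero, fun _ _ _ => rfl⟩
  add_mem' := fun hf hg => ⟨hf.1.add hg.1, hf.2.add hg.2⟩
  smul_mem' := fun c _ hf => ⟨hf.1.smul c, hf.2.smul c⟩

theorem Dec.mul (hf : Dec f) (hg : Dec g) : Dec (f * g) := by
  intro N
  obtain ⟨C, M, h⟩ := hf N
  obtain ⟨C', M', h'⟩ := hg 0
  have hC := Dec.const_nonneg h
  refine ⟨C * C', M + M', fun u X => ?_⟩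
  have h1 := h u X
  have h2 := h' u X
  rw [pow_zero, one_mul] at h2
  calc (1 + ‖u‖) ^ N * ‖f u X * g u X‖ = ((1 + ‖u‖) ^ N * ‖f u X‖) * ‖g u X‖ := by
        rw [norm_mul]; ring
    _ ≤ (C * (1 + ‖X‖) ^ M) * (C' * (1 + ‖X‖) ^ M') := by gcongr
    _ = _ := by ring

theorem exists_one_add_norm_act_le (M : Matrix (Fin n) (Fin n) ℝ) :
    ∃ T : ℝ, 1 ≤ T ∧ ∀ X, 1 + ‖act M X‖ ≤ T * (1 + ‖X‖) := by
  refine ⟨1 + ‖actL M‖, by linarith [norm_nonneg (actL M)], fun X => ?_⟩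
  have := norm_act_le M X
  nlinarith [norm_nonneg X, norm_nonneg (actL M)]

theorem Dec.comp_act (hf : Dec f) (M : Matrix (Fin n) (Fin n) ℝ) :
    Dec fun u X => f u (act M X) := by
  obtain ⟨T, hT, h1⟩ := exists_one_add_norm_act_le M
  intro N
  obtain ⟨C, K, h⟩ := hf N
  have hC := Dec.const_nonneg h
  refine ⟨C * T ^ K, K, fun u X => (h u _).trans ?_⟩
  rw [mul_assoc, ← mul_pow]
  gcongr
  exact h1 X

theorem hasFDerivAt_comp_act (hf : ∀ u, Differentiable ℝ (f u)) (M : Matrix (Fin n) (Fin n) ℝ)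
    (u : Fin n → ℤ) (y X : E n) : HasFDerivAt (fun X => f u (act M X + y))
      (gradL fun p => ∑ q, (M q p : ℂ) * pd q f u (act M X + y)) X := by
  have h1 : HasFDerivAt (fun X => act M X + y) (actL M) X := (actL M).hasFDerivAt.add_const y
  refine ((hasFDerivAt_pd hf u (act M X + y)).comp X h1).to_gradL fun p => ?_
  rw [ContinuousLinearMap.comp_apply, actL_apply, gradL_apply]
  simp only [act_single]

theorem SR.comp_act (hf : SR f) (M : Matrix (Fin n) (Fin n) ℝ) :
    SR fun u X => f u (act M X) := by
  let T : Set ((Fin n → ℤ) → E n → ℂ) := {k | ∃ f, SR f ∧ k = fun u X => f u (act M X)}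
  refine SR.of_mem_span (T := T) ?_ (Submodule.subset_span ⟨f, hf, rfl⟩)
  rintro k ⟨f, hf, rfl⟩
  have hd : ∀ u X, HasFDerivAt (fun X => f u (act M X))
      (gradL fun p => (∑ q, (M q p : ℂ) • (fun u X => NCTori.pd q f u (act M X)) :
        (Fin n → ℤ) → E n → ℂ) u X) X := by
    intro u X
    have := hasFDerivAt_comp_act hf.differentiable M u 0 X
    simp only [add_zero] at this
    refine this.congr_fderiv (congrArg gradL (funext fun p => ?_))
    simp [Finset.sum_apply]
  refine ⟨fun u X => (hd u X).differentiableAt, hf.dec.comp_act M, fun p => ?_⟩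
  rw [pd_eq (f := fun u X => f u (act M X)) hd p]
  exact Submodule.sum_mem _ fun q _ => Submodule.smul_mem _ _
    (Submodule.subset_span ⟨_, hf.pd q, rfl⟩)

theorem Eqv.comp_act (hf : Eqv D B f) : Eqv 1 B fun u X => f u (act D X) := by
  intro v u X
  simp only [act_add, one_act, hf v u]

theorem exists_cube_translate (X : E n) : ∃ (v : Fin n → ℤ) (r : E n), ‖r‖ ≤ n ∧ X = r + vec v := by
  refine ⟨fun i => ⌈X i⌉ - 1, X - vec (fun i => ⌈X i⌉ - 1), norm_le_of_mem_cube fun i => ?_, by simp⟩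
  have h1 := Int.ceil_lt_add_one (X i)
  have h2 := Int.le_ceil (X i)
  simp only [PiLp.sub_apply, vec_apply, Int.cast_sub, Int.cast_one, Set.mem_Ioc]
  constructor <;> linarith

/-- Equivariance moves `X` into a bounded fundamental domain, where polynomial growth is harmless.
What survives is decay in the invariant quantity `u - B D⁻¹ X`. -/
theorem Dec.strong (hf : Dec f) (he : Eqv D B f) (hD : D.det ≠ 0) (N : ℕ) :
    ∃ C : ℝ, 0 ≤ C ∧
      ∀ u X, (1 + ‖vec u - act (toReal B * D⁻¹) X‖) ^ N * ‖f u X‖ ≤ C := by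
  obtain ⟨C, M, h⟩ := hf N
  have hC := Dec.const_nonneg h
  obtain ⟨T, hT, h1⟩ := exists_one_add_norm_act_le D
  obtain ⟨T', hT', h1'⟩ := exists_one_add_norm_act_le (toReal B)
  refine ⟨((1 + (n : ℝ)) * (T' * (1 + n))) ^ N * (C * (T * (1 + n)) ^ M), by positivity,
    fun u X => ?_⟩
  -- The vector `v` is chosen so that `D⁻¹ X - v` lies in the unit cube.
  obtain ⟨v, r, hr, hX⟩ := exists_cube_translate (act D⁻¹ X)
  have hX' : X = act D r + act D (vec v) := by rw [← act_add, ← hX, act_act_inv hD]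
  have e1 : f u X = f (u - B.mulVec v) (act D r) := by
    conv_lhs => rw [hX', ← sub_add_cancel u (B.mulVec v)]
    exact he v _ _
  have e2 : vec u - act (toReal B * D⁻¹) X = vec (u - B.mulVec v) - act (toReal B) r := by
    rw [act_mul, hX, act_add, vec_sub, vec_mulVec]
    abel
  have e3 : 1 + ‖vec u - act (toReal B * D⁻¹) X‖ ≤
      ((1 + (n : ℝ)) * (T' * (1 + n))) * (1 + ‖u - B.mulVec v‖) := by
    rw [e2, sub_eq_add_neg]
    refine (one_add_norm_add_le _ _).trans ?_
    rw [norm_neg]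
    have a1 := norm_vec_le (u - B.mulVec v)
    have a2 : 1 + ‖vec (u - B.mulVec v)‖ ≤ (1 + (n : ℝ)) * (1 + ‖u - B.mulVec v‖) := by
      nlinarith [norm_nonneg (u - B.mulVec v), (Nat.cast_nonneg n : (0 : ℝ) ≤ n)]
    have a3 : 1 + ‖act (toReal B) r‖ ≤ T' * (1 + n) := (h1' r).trans (by gcongr)
    calc _ ≤ ((1 + (n : ℝ)) * (1 + ‖u - B.mulVec v‖)) * (T' * (1 + n)) := by gcongr
      _ = _ := by ring
  rw [e1]
  have a4 := h (u - B.mulVec v) (act D r)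
  have a5 : 1 + ‖act D r‖ ≤ T * (1 + n) := (h1 r).trans (by gcongr)
  calc _ ≤ (((1 + (n : ℝ)) * (T' * (1 + n))) * (1 + ‖u - B.mulVec v‖)) ^ N *
        ‖f (u - B.mulVec v) (act D r)‖ := by gcongr
    _ = ((1 + (n : ℝ)) * (T' * (1 + n))) ^ N *
        ((1 + ‖u - B.mulVec v‖) ^ N * ‖f (u - B.mulVec v) (act D r)‖) := by
      rw [mul_pow, mul_assoc]
    _ ≤ _ := by
      refine mul_le_mul_of_nonneg_left (a4.trans ?_) (by positivity)
      gcongr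

/-- For nondegenerate `B`, equivariant families are rapidly decreasing on `ℝⁿ`. -/
theorem Dec.decay (hf : Dec f) (he : Eqv D B f) (hD : D.det ≠ 0) (hB : B.det ≠ 0) (N : ℕ)
    (u : Fin n → ℤ) : ∃ C : ℝ, ∀ X, (1 + ‖X‖) ^ N * ‖f u X‖ ≤ C := by
  obtain ⟨C, hC, h⟩ := hf.strong he hD N
  have hB' := det_toReal_ne_zero hB
  obtain ⟨T, hT, h1⟩ := exists_one_add_norm_act_le (D * (toReal B)⁻¹)
  refine ⟨(T * (1 + ‖vec u‖)) ^ N * C, fun X => ?_⟩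
  -- For invertible `B` the point `X` is recovered from `u` and the invariant quantity, so decay in
  -- the latter is decay in `X` for fixed `u`.
  have e1 : X = act (D * (toReal B)⁻¹) (vec u - (vec u - act (toReal B * D⁻¹) X)) := by
    rw [sub_sub_cancel, act_mul, act_mul, act_inv_act hB', act_act_inv hD]
  have e2 : 1 + ‖X‖ ≤ (T * (1 + ‖vec u‖)) * (1 + ‖vec u - act (toReal B * D⁻¹) X‖) := by
    conv_lhs => rw [e1]
    refine (h1 _).trans ?_
    rw [mul_assoc]
    gcongr
    rw [sub_eq_add_neg]
    exact (one_add_norm_add_le _ _).trans (by rw [norm_neg])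
  calc _ ≤ ((T * (1 + ‖vec u‖)) * (1 + ‖vec u - act (toReal B * D⁻¹) X‖)) ^ N * ‖f u X‖ := by
        gcongr
    _ = (T * (1 + ‖vec u‖)) ^ N * ((1 + ‖vec u - act (toReal B * D⁻¹) X‖) ^ N * ‖f u X‖) := by
      rw [mul_pow, mul_assoc]
    _ ≤ _ := by gcongr; exact h u X

theorem integrable_of_decay {g : E n → ℂ} (hg : Continuous g)
    (h : ∀ N : ℕ, ∃ C : ℝ, ∀ X, (1 + ‖X‖) ^ N * ‖g X‖ ≤ C) : Integrable g := by
  obtain ⟨C, h⟩ := h (n + 1)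
  have hi : Integrable (fun X : E n => (1 + ‖X‖) ^ (-((n + 1 : ℕ) : ℝ))) :=
    integrable_one_add_norm (by simp)
  refine (hi.const_mul C).mono' hg.aestronglyMeasurable (Filter.Eventually.of_forall fun X => ?_)
  rw [Real.rpow_neg (by positivity), Real.rpow_natCast, ← div_eq_mul_inv,
    le_div_iff₀ (by positivity), mul_comm]
  exact h X

theorem Dec.bound_of_norm_le (hf : Dec f) (R : ℝ) : ∃ b : (Fin n → ℤ) → ℝ, Summable b ∧
    ∀ u X, ‖X‖ ≤ R → ‖f u X‖ ≤ b u := by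
  obtain ⟨C, M, h⟩ := hf (sumExp (Fin n))
  have hC := Dec.const_nonneg h
  refine ⟨fun u => (C * (1 + |R|) ^ M) * ((1 + ‖u‖) ^ sumExp (Fin n))⁻¹,
    summable_sumExp.mul_left _, fun u X hX => ?_⟩
  beta_reduce
  rw [← div_eq_mul_inv, le_div_iff₀ (by positivity), mul_comm]
  refine (h u X).trans ?_
  have : ‖X‖ ≤ |R| := hX.trans (le_abs_self R)
  gcongr

theorem Dec.summable (hf : Dec f) (X : E n) : Summable fun u => f u X := by
  obtain ⟨b, hb, h⟩ := hf.bound_of_norm_le ‖X‖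
  exact Summable.of_norm_bounded hb fun u => h u X le_rfl

theorem Dec.continuous_tsum (hf : Dec f) (hc : ∀ u, Continuous (f u)) :
    Continuous fun X => ∑' u, f u X := by
  rw [continuous_iff_continuousAt]
  intro X
  obtain ⟨b, hb, h⟩ := hf.bound_of_norm_le (‖X‖ + 1)
  have : ContinuousOn (fun X => ∑' u, f u X) (Metric.closedBall 0 (‖X‖ + 1)) :=
    continuousOn_tsum (fun u => (hc u).continuousOn) hb fun u Y hY => h u Y (by simpa using hY)
  refine this.continuousAt (Filter.mem_of_superset (Metric.ball_mem_nhds X one_pos) fun Y hY => ?_)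
  rw [Metric.mem_ball, dist_eq_norm] at hY
  have : ‖Y‖ ≤ ‖X‖ + ‖Y - X‖ := by simpa using norm_add_le X (Y - X)
  simp only [Metric.mem_closedBall, dist_zero_right]
  linarith

theorem Dec.hasSum_setIntegral_cube (hf : Dec f) (hc : ∀ u, Continuous (f u)) :
    HasSum (fun u => ∫ X in cube n, f u X) (∫ X in cube n, ∑' u, f u X) := by
  obtain ⟨b, hb, h⟩ := hf.bound_of_norm_le n
  refine hasSum_integral_of_summable_integral_norm (fun u => Continuous.integrableOn_cube (hc u)) ?_
  refine Summable.of_nonneg_of_le (fun u => integral_nonneg fun X => norm_nonneg _) (fun u => ?_) hb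
  have h1 : ∫ X in cube n, ‖f u X‖ ≤ ∫ X in cube n, b u :=
    setIntegral_mono_on (Continuous.integrableOn_cube (hc u)).norm (integrable_const _)
      measurableSet_cube fun X hX => h u X (norm_le_of_mem_cube hX)
  simpa [Measure.real, volume_cube] using h1

theorem finite_quotient (hB : B.det ≠ 0) : Finite ((Fin n → ℤ) ⧸ latticeImage B) := by
  refine Submodule.finiteQuotientOfFreeOfRankEq _ ?_
  refine LinearMap.finrank_range_of_inj ?_
  rw [injective_iff_map_eq_zero]
  intro v hv
  exact Matrix.eq_zero_of_mulVec_eq_zero hB hv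

/-- A section of the quotient map. -/
def rep (q : (Fin n → ℤ) ⧸ latticeImage B) : Fin n → ℤ :=
  Function.surjInv (Submodule.mkQ_surjective (latticeImage B)) q

theorem mk_rep (q : (Fin n → ℤ) ⧸ latticeImage B) : Submodule.Quotient.mk (rep q) = q :=
  Function.surjInv_eq (Submodule.mkQ_surjective (latticeImage B)) q

/-- Every lattice vector is uniquely a representative plus an element of `B ℤⁿ`. -/
def repEquiv (hB : B.det ≠ 0) :
    (((Fin n → ℤ) ⧸ latticeImage B) × (Fin n → ℤ)) ≃ (Fin n → ℤ) :=
  Equiv.ofBijective (fun x => rep x.1 + B.mulVec x.2) <| by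
    have key : ∀ (q : (Fin n → ℤ) ⧸ latticeImage B) v,
        (Submodule.Quotient.mk (rep q + B.mulVec v) : (Fin n → ℤ) ⧸ latticeImage B) = q := by
      intro q v
      have h : (Submodule.Quotient.mk (B.mulVec v) : (Fin n → ℤ) ⧸ latticeImage B) = 0 :=
        (Submodule.Quotient.mk_eq_zero (latticeImage B)).mpr ⟨v, rfl⟩
      rw [Submodule.Quotient.mk_add, mk_rep, h, add_zero]
    constructor
    · rintro ⟨q, v⟩ ⟨q', v'⟩ h
      have h' : rep q + B.mulVec v = rep q' + B.mulVec v' := h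
      have hq : q = q' := by rw [← key q v, ← key q' v', h']
      subst hq
      have h2 : B.mulVec (v - v') = 0 := by
        rw [Matrix.mulVec_sub, sub_eq_zero]
        exact add_left_cancel h'
      rw [Prod.mk.injEq]
      exact ⟨rfl, sub_eq_zero.mp (Matrix.eq_zero_of_mulVec_eq_zero hB h2)⟩
    · intro u
      have h : (Submodule.Quotient.mk u : (Fin n → ℤ) ⧸ latticeImage B) =
          Submodule.Quotient.mk (rep (Submodule.Quotient.mk u)) := (mk_rep _).symm
      rw [Submodule.Quotient.eq] at h
      obtain ⟨v, hv⟩ := h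
      refine ⟨(Submodule.Quotient.mk u, v), ?_⟩
      change rep _ + B.mulVec v = u
      rw [← Matrix.mulVecLin_apply, hv]
      abel

/-- Unfolding: the integral over the torus of the sum over the lattice of an equivariant family. -/
theorem setIntegral_cube_tsum {k : (Fin n → ℤ) → E n → ℂ} (hk : Dec k) (hc : ∀ u, Continuous (k u))
    (he : Eqv 1 B k) (hB : B.det ≠ 0) :
    ∫ X in cube n, ∑' u, k u X =
      ∑ᶠ q : (Fin n → ℤ) ⧸ latticeImage B, ∫ X, k (rep q) X := by
  have := finite_quotient hB
  have := Fintype.ofFinite ((Fin n → ℤ) ⧸ latticeImage B)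
  have h1 := hk.hasSum_setIntegral_cube hc
  have h2 := (repEquiv hB).hasSum_iff.mpr h1
  have hint : ∀ q : (Fin n → ℤ) ⧸ latticeImage B, Integrable (k (rep q)) := fun q =>
    integrable_of_decay (hc _) fun N => hk.decay he (by simp) hB N _
  have h3 : ∀ q : (Fin n → ℤ) ⧸ latticeImage B,
      HasSum (fun v : Fin n → ℤ => ∫ X in cube n, k (repEquiv hB (q, v)) X) (∫ X, k (rep q) X) := by
    intro q
    -- By equivariance, raising the index by `B v` translates the argument by `-v`; hence the sign
    -- change before the translated cubes are assembled into `ℝⁿ`.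
    have h := (Equiv.neg (Fin n → ℤ)).hasSum_iff.mpr (hasSum_integral_cube (hint q))
    have hfun : (fun v : Fin n → ℤ => ∫ X in cube n, k (repEquiv hB (q, v)) X) =
        (fun v : Fin n → ℤ => ∫ X in cube n, k (rep q) (X + vec v)) ∘ Equiv.neg (Fin n → ℤ) := ?_
    · rw [hfun]; exact h
    funext v
    change _ = ∫ X in cube n, k (rep q) (X + vec (-v))
    congr 1
    funext X
    have := he v (rep q) (X + vec (-v))
    rw [one_act, vec_neg, neg_add_cancel_right] at this
    rw [vec_neg, ← this]
    rfl
  rw [finsum_eq_sum_of_fintype]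
  exact (h2.prod_fiberwise h3).unique (hasSum_fintype _)

theorem finsum_rep_eq {k : (Fin n → ℤ) → ℂ} (hk : ∀ u v, k (u + B.mulVec v) = k u)
    (r : ((Fin n → ℤ) ⧸ latticeImage B) → (Fin n → ℤ))
    (hr : ∀ q, Submodule.Quotient.mk (r q) = q) : ∀ q, k (r q) = k (rep q) := by
  intro q
  have h : (Submodule.Quotient.mk (r q) : (Fin n → ℤ) ⧸ latticeImage B) =
      Submodule.Quotient.mk (rep q) := by rw [hr, mk_rep]
  rw [Submodule.Quotient.eq] at h
  obtain ⟨v, hv⟩ := h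
  rw [← hk (rep q) v, ← Matrix.mulVecLin_apply, hv]
  congr 1
  abel

end Equivariant

/-! ### Schwartz functions as equivariant families -/

section Unfolding

variable {n : ℕ} {D : Matrix (Fin n) (Fin n) ℝ} {B : Matrix (Fin n) (Fin n) ℤ}

/-- A function all of whose iterated partial derivatives are rapidly decreasing is Schwartz. -/
theorem exists_schwartzMap {S : Set (E n → ℂ)}
    (hS : ∀ g ∈ S, Differentiable ℝ g ∧ (∀ N : ℕ, ∃ C : ℝ, ∀ X, (1 + ‖X‖) ^ N * ‖g X‖ ≤ C) ∧
      ∀ p, (fun X => fderiv ℝ g X (EuclideanSpace.single p 1)) ∈ S) {g : E n → ℂ} (hg : g ∈ S) :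
    ∃ ψ : 𝓢(E n, ℂ), ∀ X, ψ X = g X := by
  -- Writing the Fréchet derivative through its partial derivatives lets both inductions on the
  -- order stay inside `S`.
  have hfd : ∀ g : E n → ℂ, fderiv ℝ g = fun X => ∑ p,
      ((gradL (n := n)).comp (ContinuousLinearMap.single ℝ (fun _ : Fin n => ℂ) p))
        (fderiv ℝ g X (EuclideanSpace.single p 1)) := by
    intro g
    funext X
    conv_lhs => rw [eq_gradL (fderiv ℝ g X)]
    simp only [ContinuousLinearMap.comp_apply, ContinuousLinearMap.single_apply]
    rw [← map_sum, Finset.univ_sum_single]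
  have hsm : ∀ k : ℕ, ∀ g ∈ S, ContDiff ℝ k g := by
    intro k
    induction k with
    | zero => exact fun g hg => contDiff_zero.mpr (hS g hg).1.continuous
    | succ k ih =>
      intro g hg
      rw [show ((k + 1 : ℕ) : WithTop ℕ∞) = (k : WithTop ℕ∞) + 1 by norm_cast]
      refine contDiff_succ_iff_fderiv.mpr ⟨(hS g hg).1, by simp, ?_⟩
      rw [hfd g]
      exact ContDiff.sum fun p _ => (ContinuousLinearMap.contDiff _).comp (ih _ ((hS g hg).2.2 p))
  have hdec : ∀ k : ℕ, ∀ g ∈ S, ∀ N : ℕ, ∃ C : ℝ, ∀ X,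
      (1 + ‖X‖) ^ N * ‖iteratedFDeriv ℝ k g X‖ ≤ C := by
    intro k
    induction k with
    | zero => intro g hg N; simpa using (hS g hg).2.1 N
    | succ k ih =>
      intro g hg N
      choose C hC using fun p => ih _ ((hS g hg).2.2 p) N
      let Lp := fun p => (gradL (n := n)).comp (ContinuousLinearMap.single ℝ (fun _ : Fin n => ℂ) p)
      refine ⟨∑ p, ‖Lp p‖ * C p, fun X => ?_⟩
      have h1 : ∀ p ∈ (Finset.univ : Finset (Fin n)), ContDiffAt ℝ k
          (fun X => Lp p (fderiv ℝ g X (EuclideanSpace.single p 1))) X := fun p _ =>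
        ((ContinuousLinearMap.contDiff _).comp (hsm k _ ((hS g hg).2.2 p))).contDiffAt
      rw [← norm_iteratedFDeriv_fderiv, hfd g, iteratedFDeriv_fun_sum_apply h1]
      refine (mul_le_mul_of_nonneg_left (norm_sum_le _ _) (by positivity)).trans ?_
      rw [Finset.mul_sum]
      refine Finset.sum_le_sum fun p _ => ?_
      have h2 := (Lp p).norm_iteratedFDeriv_comp_left
        (hsm k _ ((hS g hg).2.2 p)).contDiffAt (x := X) le_rfl
      calc _ ≤ (1 + ‖X‖) ^ N * (‖Lp p‖ * ‖iteratedFDeriv ℝ k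
            (fun X => fderiv ℝ g X (EuclideanSpace.single p 1)) X‖) := by gcongr; exact h2
        _ = ‖Lp p‖ * ((1 + ‖X‖) ^ N * ‖iteratedFDeriv ℝ k
            (fun X => fderiv ℝ g X (EuclideanSpace.single p 1)) X‖) := by ring
        _ ≤ _ := by gcongr; exact hC p X
  refine ⟨⟨g, contDiff_infty.mpr fun k => hsm k g hg, fun k m => ?_⟩, fun X => rfl⟩
  obtain ⟨C, hC⟩ := hdec m g hg k
  refine ⟨C, fun X => le_trans ?_ (hC X)⟩
  gcongr
  linarith [norm_nonneg X]

theorem RF.exists_schwartzMap (hD : D.det ≠ 0) (hB : B.det ≠ 0) {f : (Fin n → ℤ) → E n → ℂ}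
    (hf : f ∈ RF D B) (u : Fin n → ℤ) (y : E n) :
    ∃ ψ : 𝓢(E n, ℂ), ∀ X, ψ X = f u (X + y) := by
  refine NCTori.exists_schwartzMap (S := {g | ∃ f ∈ RF D B, g = fun X => f u (X + y)}) ?_
    ⟨f, hf, rfl⟩
  rintro g ⟨f, hf, rfl⟩
  have hd : ∀ X, HasFDerivAt (fun X => f u (X + y)) (gradL fun p => pd p f u (X + y)) X := fun X =>
    (hasFDerivAt_comp_add_right y).mpr (hasFDerivAt_pd hf.1.differentiable u (X + y))
  refine ⟨fun X => (hd X).differentiableAt, fun N => ?_, fun p =>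
    ⟨pd p f, ⟨hf.1.pd p, hf.2.pd p⟩, funext fun X => by rw [(hd X).fderiv, gradL_single]⟩⟩
  obtain ⟨C, hC⟩ := hf.1.dec.decay hf.2 hD hB N u
  refine ⟨(1 + ‖y‖) ^ N * C, fun X => ?_⟩
  have h1 : 1 + ‖X‖ ≤ (1 + ‖y‖) * (1 + ‖X + y‖) := by
    have := one_add_norm_add_le (X + y) (-y)
    rw [add_neg_cancel_right, norm_neg] at this
    linarith
  calc _ ≤ ((1 + ‖y‖) * (1 + ‖X + y‖)) ^ N * ‖f u (X + y)‖ := by gcongr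
    _ = (1 + ‖y‖) ^ N * ((1 + ‖X + y‖) ^ N * ‖f u (X + y)‖) := by rw [mul_pow, mul_assoc]
    _ ≤ _ := by gcongr; exact hC (X + y)

theorem Schw.eval_add_mulVec (ξ : Schw n B) (u v : Fin n → ℤ) (x : E n) :
    ξ.eval (u + B.mulVec v) x = ξ.eval u x := by
  have h : (Submodule.Quotient.mk (u + B.mulVec v) : (Fin n → ℤ) ⧸ latticeImage B) =
      Submodule.Quotient.mk u := by
    rw [Submodule.Quotient.eq]
    exact ⟨v, by rw [Matrix.mulVecLin_apply]; abel⟩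
  rw [Schw.eval, Schw.eval, h]

/-- The equivariant family attached to a Schwartz function on `ℝⁿ × ℤⁿ/B ℤⁿ`. -/
def unfold (D : Matrix (Fin n) (Fin n) ℝ) (ξ : Schw n B) (u : Fin n → ℤ) (X : E n) : ℂ :=
  ξ.eval u (X - act (D * (toReal B)⁻¹) (vec u))

theorem eval_eq_unfold (ξ : Schw n B) (μ : Fin n → ℤ) (x : E n) :
    ξ.eval μ x = unfold D ξ μ (x + act (D * (toReal B)⁻¹) (vec μ)) := by
  rw [unfold, add_sub_cancel_right]

theorem eqv_unfold (hB : B.det ≠ 0) (ξ : Schw n B) : Eqv D B (unfold D ξ) := by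
  intro v u X
  rw [unfold, unfold, Schw.eval_add_mulVec, vec_add, act_add, act_mul _ _ (vec (B.mulVec v)),
    vec_mulVec, act_inv_act (det_toReal_ne_zero hB)]
  congr 1
  abel

/-- The partial derivatives of a Schwartz function. -/
def Schw.pd (p : Fin n) (ξ : Schw n B) : Schw n B :=
  fun q => LineDeriv.lineDerivOp (EuclideanSpace.single p (1 : ℝ)) (ξ q)

theorem Schw.eval_pd (p : Fin n) (ξ : Schw n B) (u : Fin n → ℤ) (x : E n) :
    (ξ.pd p).eval u x = fderiv ℝ (ξ.eval u) x (EuclideanSpace.single p 1) :=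
  SchwartzMap.lineDerivOp_apply_eq_fderiv _ _ _

theorem Schw.differentiable (ξ : Schw n B) (u : Fin n → ℤ) : Differentiable ℝ (ξ.eval u) :=
  (ξ (Submodule.Quotient.mk u)).differentiable

theorem hasFDerivAt_unfold (ξ : Schw n B) (u : Fin n → ℤ) (X : E n) :
    HasFDerivAt (unfold D ξ u) (gradL fun p => unfold D (ξ.pd p) u X) X := by
  have h := (ξ.differentiable u (X - act (D * (toReal B)⁻¹) (vec u))).hasFDerivAt
  rw [sub_eq_add_neg] at h
  have h2 := (hasFDerivAt_comp_add_right (-act (D * (toReal B)⁻¹) (vec u))).mpr h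
  simp only [← sub_eq_add_neg] at h2
  exact h2.to_gradL fun p => (Schw.eval_pd p ξ u _).symm

/-- With `x = X - D B⁻¹ u`, the index `u` is controlled by `X` and `x` together. Schwartz decay in
`x` becomes decay in `u`, at the cost of growth in `X`. -/
theorem dec_unfold (hD : D.det ≠ 0) (hB : B.det ≠ 0) (ξ : Schw n B) : Dec (unfold D ξ) := by
  intro N
  have := finite_quotient hB
  have := Fintype.ofFinite ((Fin n → ℤ) ⧸ latticeImage B)
  have hB' := det_toReal_ne_zero hB
  have h : ∀ q : (Fin n → ℤ) ⧸ latticeImage B, ∃ C : ℝ, ∀ x, (1 + ‖x‖) ^ N * ‖ξ q x‖ ≤ C := by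
    intro q
    refine ⟨2 ^ N * (Finset.Iic (N, 0)).sup (fun m => SchwartzMap.seminorm ℝ m.1 m.2) (ξ q),
      fun x => ?_⟩
    have := SchwartzMap.one_add_le_sup_seminorm_apply (𝕜 := ℝ) (m := (N, 0)) (k := N) (n := 0)
      le_rfl le_rfl (ξ q) x
    rwa [norm_iteratedFDeriv_zero] at this
  choose C hC using h
  have hC0 : ∀ q, 0 ≤ C q := fun q => le_trans (by positivity) (hC q 0)
  obtain ⟨T, hT, hT1⟩ := exists_one_add_norm_act_le (toReal B * D⁻¹)
  refine ⟨T ^ N * ∑ q, C q, N, fun u X => ?_⟩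
  set x := X - act (D * (toReal B)⁻¹) (vec u) with hx
  have e1 : vec u = act (toReal B * D⁻¹) (X - x) := by
    rw [hx, sub_sub_cancel, act_mul, act_mul, act_inv_act hD, act_act_inv hB']
  have e2 : 1 + ‖u‖ ≤ T * (1 + ‖X‖) * (1 + ‖x‖) := by
    have h1 := norm_le_norm_vec u
    have h2 := hT1 (X - x)
    rw [← e1] at h2
    have h3 := one_add_norm_add_le X (-x)
    rw [norm_neg, ← sub_eq_add_neg] at h3
    have h4 : T * (1 + ‖X - x‖) ≤ T * ((1 + ‖X‖) * (1 + ‖x‖)) := by gcongr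
    linarith
  calc (1 + ‖u‖) ^ N * ‖unfold D ξ u X‖
      ≤ (T * (1 + ‖X‖) * (1 + ‖x‖)) ^ N * ‖ξ (Submodule.Quotient.mk u) x‖ := by
        gcongr
        exact le_of_eq rfl
    _ = T ^ N * (1 + ‖X‖) ^ N * ((1 + ‖x‖) ^ N * ‖ξ (Submodule.Quotient.mk u) x‖) := by
        rw [mul_pow, mul_pow]; ring
    _ ≤ T ^ N * (1 + ‖X‖) ^ N * ∑ q, C q := by
        gcongr
        exact (hC _ x).trans (Finset.single_le_sum (fun q _ => hC0 q) (Finset.mem_univ _))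
    _ = _ := by ring

theorem unfold_mem (hD : D.det ≠ 0) (hB : B.det ≠ 0) (ξ : Schw n B) : unfold D ξ ∈ RF D B := by
  refine ⟨SR.of_mem_span (T := Set.range (unfold D (B := B))) ?_
    (Submodule.subset_span ⟨ξ, rfl⟩), eqv_unfold hB ξ⟩
  rintro _ ⟨ξ, rfl⟩
  refine ⟨fun u X => (hasFDerivAt_unfold ξ u X).differentiableAt, dec_unfold hD hB ξ, fun p => ?_⟩
  rw [pd_eq (s := fun p => unfold D (ξ.pd p)) (hasFDerivAt_unfold ξ) p]
  exact Submodule.subset_span ⟨_, rfl⟩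

/-- An equivariant family is determined by its members at representatives of `ℤⁿ / B ℤⁿ`, and
`RF.exists_schwartzMap` says that their translates are Schwartz. -/
theorem exists_unfold_eq (hD : D.det ≠ 0) (hB : B.det ≠ 0) {f : (Fin n → ℤ) → E n → ℂ}
    (hf : f ∈ RF D B) : ∃ ξ : Schw n B, unfold D ξ = f := by
  choose ξ hξ using fun q : (Fin n → ℤ) ⧸ latticeImage B =>
    RF.exists_schwartzMap hD hB hf (rep q) (act (D * (toReal B)⁻¹) (vec (rep q)))
  refine ⟨ξ, funext fun u => funext fun X => ?_⟩
  obtain ⟨⟨q, v⟩, rfl⟩ := (repEquiv hB).surjective u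
  have h1 : repEquiv hB (q, v) = rep q + B.mulVec v := rfl
  have h2 := eqv_unfold (D := D) hB ξ v (rep q) (X - act D (vec v))
  have h3 := hf.2 v (rep q) (X - act D (vec v))
  rw [sub_add_cancel] at h2 h3
  rw [h1, h2, h3, unfold, Schw.eval, mk_rep, hξ, sub_add_cancel]

end Unfolding

/-! ### Elements of noncommutative tori as equivariant families -/

section TorusSeries

variable {n : ℕ} {D N : Matrix (Fin n) (Fin n) ℝ}

/-- The index `(k, v)` of `U_1^{k_1} ⋯ U_n^{k_n} U_{1̄}^{v_1} ⋯ U_{n̄}^{v_n}`. -/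
def idx (k v : Fin n → ℤ) : Idx n → ℤ := Sum.elim k v

theorem idx_inl (k v : Fin n → ℤ) : (fun i => idx k v (Sum.inl i)) = k := rfl

theorem idx_inr (k v : Fin n → ℤ) : (fun i => idx k v (Sum.inr i)) = v := rfl

theorem idx_eta (m : Idx n → ℤ) : idx (fun i => m (Sum.inl i)) (fun i => m (Sum.inr i)) = m :=
  Sum.elim_comp_inl_inr m

/-- Splitting of the index. -/
def idxEquiv : (Fin n → ℤ) × (Fin n → ℤ) ≃ (Idx n → ℤ) where
  toFun x := idx x.1 x.2
  invFun m := (fun i => m (Sum.inl i), fun i => m (Sum.inr i))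
  left_inv _ := rfl
  right_inv m := idx_eta m

theorem norm_le_norm_idx_left (k v : Fin n → ℤ) : ‖k‖ ≤ ‖idx k v‖ :=
  (pi_norm_le_iff_of_nonneg (norm_nonneg _)).mpr fun i => norm_le_pi_norm (idx k v) (Sum.inl i)

theorem norm_le_norm_idx_right (k v : Fin n → ℤ) : ‖v‖ ≤ ‖idx k v‖ :=
  (pi_norm_le_iff_of_nonneg (norm_nonneg _)).mpr fun i => norm_le_pi_norm (idx k v) (Sum.inr i)

theorem one_add_norm_idx_le (k v : Fin n → ℤ) : 1 + ‖idx k v‖ ≤ (1 + ‖k‖) * (1 + ‖v‖) := by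
  have h : ‖idx k v‖ ≤ ‖k‖ + ‖v‖ := by
    refine (pi_norm_le_iff_of_nonneg (by positivity)).mpr ?_
    rintro (i | i)
    · exact (norm_le_pi_norm k i).trans (by linarith [norm_nonneg v])
    · exact (norm_le_pi_norm v i).trans (by linarith [norm_nonneg k])
  nlinarith [mul_nonneg (norm_nonneg k) (norm_nonneg v)]

theorem schwartzSeq_bound (w : SchwartzSeq (Idx n)) (M : ℕ) : ∃ C : ℝ, 0 ≤ C ∧ ∀ k v,
    (1 + ‖v‖) ^ M * ‖w.val (idx k v)‖ ≤ C * ((1 + ‖k‖) ^ sumExp (Fin n))⁻¹ := by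
  obtain ⟨C, hC⟩ := w.2 (M + sumExp (Fin n))
  refine ⟨C, le_trans (by positivity) (hC 0), fun k v => ?_⟩
  rw [← div_eq_mul_inv, le_div_iff₀ (by positivity)]
  refine le_trans ?_ (hC (idx k v))
  rw [pow_add, mul_right_comm]
  have := norm_le_norm_idx_left k v
  have := norm_le_norm_idx_right k v
  gcongr

theorem schwartzSeq_summable_norm_idx (w : SchwartzSeq (Idx n)) (v : Fin n → ℤ) :
    Summable fun k => ‖w.val (idx k v)‖ := by
  obtain ⟨C, -, hC⟩ := schwartzSeq_bound w 0
  refine Summable.of_nonneg_of_le (fun k => norm_nonneg _) (fun k => ?_)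
    (summable_sumExp.mul_left C)
  simpa using hC k v

/-- Multiplication by a coordinate. -/
def schwartzSeq_coordMul {ι : Type} [Fintype ι] (j : ι) (w : SchwartzSeq ι) : SchwartzSeq ι :=
  ⟨fun m => (m j : ℂ) * w.val m, fun M => by
    obtain ⟨C, hC⟩ := w.2 (M + 1)
    refine ⟨C, fun m => le_trans ?_ (hC m)⟩
    rw [norm_mul, pow_succ, mul_assoc]
    have h : ‖(m j : ℂ)‖ ≤ 1 + ‖m‖ := by
      have := norm_le_pi_norm m j
      rw [Int.norm_eq_abs] at this
      rw [Complex.norm_intCast]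
      linarith
    gcongr⟩

/-- The family of periodic functions attached to an element of a noncommutative torus. -/
def tor (N D' : Matrix (Fin n) (Fin n) ℝ) (w : SchwartzSeq (Idx n)) (v : Fin n → ℤ) (X : E n) : ℂ :=
  ∑' k, w.val (idx k v) * e ((1 / 2) * ⟪vec k, act N (vec v)⟫) * e ⟪vec k, act D' X⟫

variable {D' : Matrix (Fin n) (Fin n) ℝ}

theorem summable_tor (w : SchwartzSeq (Idx n)) (v : Fin n → ℤ) (X : E n) :
    Summable fun k => w.val (idx k v) * e ((1 / 2) * ⟪vec k, act N (vec v)⟫) *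
      e ⟪vec k, act D' X⟫ := by
  refine Summable.of_norm ?_
  simpa [norm_mul] using schwartzSeq_summable_norm_idx w v

theorem hasSum_tor (w : SchwartzSeq (Idx n)) (v : Fin n → ℤ) (X : E n) :
    HasSum (fun k => w.val (idx k v) * e ((1 / 2) * ⟪vec k, act N (vec v)⟫) *
      e ⟪vec k, act D' X⟫) (tor N D' w v X) := (summable_tor w v X).hasSum

theorem dec_tor (w : SchwartzSeq (Idx n)) : Dec (tor N D' w) := by
  intro M
  obtain ⟨C, -, hC⟩ := schwartzSeq_bound w M
  refine ⟨∑' k : Fin n → ℤ, C * ((1 + ‖k‖) ^ sumExp (Fin n))⁻¹, 0, fun v X => ?_⟩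
  rw [pow_zero, mul_one]
  have hs : Summable fun k => ‖w.val (idx k v) * e ((1 / 2) * ⟪vec k, act N (vec v)⟫) *
      e ⟪vec k, act D' X⟫‖ := by simpa [norm_mul] using schwartzSeq_summable_norm_idx w v
  calc (1 + ‖v‖) ^ M * ‖tor N D' w v X‖ ≤ (1 + ‖v‖) ^ M * ∑' k, ‖w.val (idx k v) *
        e ((1 / 2) * ⟪vec k, act N (vec v)⟫) * e ⟪vec k, act D' X⟫‖ := by
        gcongr; exact norm_tsum_le_tsum_norm hs
    _ = ∑' k, (1 + ‖v‖) ^ M * ‖w.val (idx k v) *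
        e ((1 / 2) * ⟪vec k, act N (vec v)⟫) * e ⟪vec k, act D' X⟫‖ := by rw [tsum_mul_left]
    _ ≤ _ := by
      refine Summable.tsum_le_tsum (fun k => ?_) (hs.mul_left _) (summable_sumExp.mul_left _)
      simpa [norm_mul] using hC k v

/-- Differentiating a character brings down the coordinates of `k`, so the derivative of a torus
series is a combination of torus series whose coefficients are multiplied by coordinates. -/
theorem hasFDerivAt_tor (w : SchwartzSeq (Idx n)) (v : Fin n → ℤ) (X : E n) :
    HasFDerivAt (tor N D' w v) (gradL fun p =>
      (∑ q, (2 * Real.pi * Complex.I * D' q p) • tor N D' (schwartzSeq_coordMul (Sum.inl q) w) :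
        (Fin n → ℤ) → E n → ℂ) v X) X := by
  let s : (Fin n → ℤ) → Fin n → E n → ℂ := fun k p X => ∑ q, (2 * Real.pi * Complex.I * D' q p) *
    ((schwartzSeq_coordMul (Sum.inl q) w).val (idx k v) * e ((1 / 2) * ⟪vec k, act N (vec v)⟫) *
      e ⟪vec k, act D' X⟫)
  have h := hasFDerivAt_tsum_gradL (t := fun k X => w.val (idx k v) *
    e ((1 / 2) * ⟪vec k, act N (vec v)⟫) * e ⟪vec k, act D' X⟫) (s := s) ?_ ?_ (summable_tor w v) X
  · refine h.congr_fderiv (congrArg gradL (funext fun p => ?_))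
    simp only [Finset.sum_apply, Pi.smul_apply, smul_eq_mul]
    exact (hasSum_sum fun q _ => (hasSum_tor _ v X).mul_left _).tsum_eq
  · intro k Y
    have h1 : HasFDerivAt (fun X : E n => ⟪vec k, act D' X⟫) ((innerSL ℝ (vec k)).comp (actL D')) Y :=
      ((innerSL ℝ (vec k)).comp (actL D')).hasFDerivAt
    have h2 := ((hasDerivAt_e ⟪vec k, act D' Y⟫).hasFDerivAt.comp Y h1).const_mul
      (w.val (idx k v) * e ((1 / 2) * ⟪vec k, act N (vec v)⟫))
    refine h2.to_gradL fun p => ?_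
    have h3 : ⟪vec k, act D' (EuclideanSpace.single p 1)⟫ = ∑ q, (k q : ℝ) * D' q p := by
      rw [inner_eq_sum]
      simp only [act_single, vec_apply]
    simp only [s, schwartzSeq_coordMul, idx, Sum.elim_inl, _root_.smul_apply, smul_eq_mul,
      ContinuousLinearMap.comp_apply, innerSL_apply_apply, actL_apply, h3,
      Complex.real_smul, ContinuousLinearMap.toSpanSingleton_apply]
    push_cast
    simp only [Finset.sum_mul, Finset.mul_sum]
    exact Finset.sum_congr rfl fun q _ => by ring
  · intro R
    refine ⟨fun k => ∑ p, ∑ q, ‖(2 * Real.pi * Complex.I * D' q p : ℂ)‖ *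
      ‖(schwartzSeq_coordMul (Sum.inl q) w).val (idx k v)‖, summable_sum fun p _ => summable_sum fun q _ =>
        (schwartzSeq_summable_norm_idx (schwartzSeq_coordMul (Sum.inl q) w) v).mul_left _, fun k p Y _ => ?_⟩
    refine (norm_sum_le _ _).trans (le_trans ?_ (Finset.single_le_sum (f := fun p =>
      ∑ q, ‖(2 * Real.pi * Complex.I * D' q p : ℂ)‖ *
      ‖(schwartzSeq_coordMul (Sum.inl q) w).val (idx k v)‖) (fun p _ => Finset.sum_nonneg fun q _ => by
        positivity) (Finset.mem_univ p)))
    refine Finset.sum_le_sum fun q _ => ?_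
    rw [norm_mul, norm_mul _ (e _), norm_e, mul_one, norm_mul _ (e _), norm_e, mul_one]

theorem tor_mem (hD : D.det ≠ 0) (w : SchwartzSeq (Idx n)) : tor N D⁻¹ w ∈ RF D 0 := by
  refine ⟨SR.of_mem_span (T := Set.range (tor N D⁻¹)) ?_ (Submodule.subset_span ⟨w, rfl⟩), ?_⟩
  · rintro _ ⟨w, rfl⟩
    refine ⟨fun v X => (hasFDerivAt_tor w v X).differentiableAt, dec_tor w, fun p => ?_⟩
    rw [pd_eq (s := fun p => ∑ q, (2 * Real.pi * Complex.I * D⁻¹ q p) •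
      tor N D⁻¹ (schwartzSeq_coordMul (Sum.inl q) w)) (hasFDerivAt_tor w) p]
    exact Submodule.sum_mem _ fun q _ => Submodule.smul_mem _ _ (Submodule.subset_span ⟨_, rfl⟩)
  · intro z v X
    rw [Matrix.zero_mulVec, add_zero, tor, tor]
    refine tsum_congr fun k => ?_
    obtain ⟨j, hj⟩ := inner_vec_vec k z
    rw [act_add, act_inv_act hD, inner_add_right, hj, e_add_int]

theorem per_of_eqv {g : (Fin n → ℤ) → E n → ℂ} (hg : Eqv 1 0 g) (v : Fin n → ℤ) : Per (g v) := by
  intro z X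
  have := hg z v X
  rwa [Matrix.zero_mulVec, add_zero, one_act] at this

theorem one_add_norm_le_sum (k : Fin n → ℤ) : 1 + ‖k‖ ≤ 1 + ∑ p, |(k p : ℝ)| := by
  gcongr
  refine (pi_norm_le_iff_of_nonneg (by positivity)).mpr fun i => ?_
  rw [Int.norm_eq_abs]
  exact Finset.single_le_sum (f := fun p => |(k p : ℝ)|) (fun p _ => abs_nonneg _)
    (Finset.mem_univ i)

theorem norm_torusCoeff_le {f : E n → ℂ} {C : ℝ} (h : ∀ X, ‖X‖ ≤ n → ‖f X‖ ≤ C)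
    (k : Fin n → ℤ) : ‖torusCoeff f k‖ ≤ C := by
  have := MeasureTheory.norm_setIntegral_le_of_norm_le_const (μ := MeasureTheory.volume)
    (s := cube n) (f := fun x => e (-⟪vec k, x⟫) * f x) (C := C)
    (by rw [volume_cube]; exact ENNReal.one_lt_top)
    fun x hx => by rw [norm_mul, norm_e, one_mul]; exact h x (norm_le_of_mem_cube hx)
  rw [torusCoeff]
  simpa [MeasureTheory.Measure.real, volume_cube] using this

theorem abs_mul_norm_torusCoeff_le {g : (Fin n → ℤ) → E n → ℂ} (hg : g ∈ RF 1 0) (p : Fin n)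
    (k v : Fin n → ℤ) : |(k p : ℝ)| * ‖torusCoeff (g v) k‖ ≤ ‖torusCoeff (pd p g v) k‖ := by
  rw [torusCoeff_deriv (g := fun p => pd p g v) (per_of_eqv hg.2 v)
    (fun X => hasFDerivAt_pd hg.1.differentiable v X) p ((hg.1.pd p).continuous v), norm_mul]
  refine mul_le_mul_of_nonneg_right ?_ (norm_nonneg _)
  rw [norm_mul, norm_mul, norm_mul, Complex.norm_I, Complex.norm_real, Complex.norm_intCast,
    Real.norm_eq_abs, abs_of_pos Real.pi_pos, mul_one, Complex.norm_ofNat]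
  -- The factor `2π` is at least `1` and is simply discarded.
  have := Real.pi_gt_three
  nlinarith [abs_nonneg (k p : ℝ)]

/-- Induction on `K`: each integration by parts trades a power of `1 + ‖k‖` for a derivative of `g`,
which is again in the same space. Decay in `v` is present from the start. -/
theorem torusCoeff_bound (K M : ℕ) : ∀ g ∈ RF (n := n) 1 0, ∃ C : ℝ, ∀ k v,
    (1 + ‖k‖) ^ K * ((1 + ‖v‖) ^ M * ‖torusCoeff (g v) k‖) ≤ C := by
  induction K with
  | zero =>
    intro g hg
    obtain ⟨C, L, h⟩ := hg.1.dec M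
    have hC := Dec.const_nonneg h
    refine ⟨C * (1 + n) ^ L, fun k v => ?_⟩
    rw [pow_zero, one_mul, mul_comm, ← le_div_iff₀ (by positivity)]
    refine norm_torusCoeff_le (fun X hX => ?_) k
    rw [le_div_iff₀ (by positivity), mul_comm]
    exact (h v X).trans (by gcongr)
  | succ K ih =>
    intro g hg
    obtain ⟨C, hC⟩ := ih g hg
    choose C' hC' using fun p => ih (pd p g) ⟨hg.1.pd p, hg.2.pd p⟩
    refine ⟨C + ∑ p, C' p, fun k v => ?_⟩
    have h1 : (1 + ‖k‖) * ‖torusCoeff (g v) k‖ ≤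
        ‖torusCoeff (g v) k‖ + ∑ p, ‖torusCoeff (pd p g v) k‖ := by
      calc _ ≤ (1 + ∑ p, |(k p : ℝ)|) * ‖torusCoeff (g v) k‖ := by
            exact mul_le_mul_of_nonneg_right (one_add_norm_le_sum k) (norm_nonneg _)
        _ = ‖torusCoeff (g v) k‖ + ∑ p, |(k p : ℝ)| * ‖torusCoeff (g v) k‖ := by
            rw [add_mul, one_mul, Finset.sum_mul]
        _ ≤ _ := by
          gcongr with p
          exact abs_mul_norm_torusCoeff_le hg p k v
    calc (1 + ‖k‖) ^ (K + 1) * ((1 + ‖v‖) ^ M * ‖torusCoeff (g v) k‖)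
        = (1 + ‖k‖) ^ K * ((1 + ‖v‖) ^ M * ((1 + ‖k‖) * ‖torusCoeff (g v) k‖)) := by ring
      _ ≤ (1 + ‖k‖) ^ K * ((1 + ‖v‖) ^ M * (‖torusCoeff (g v) k‖ +
          ∑ p, ‖torusCoeff (pd p g v) k‖)) := by gcongr
      _ = (1 + ‖k‖) ^ K * ((1 + ‖v‖) ^ M * ‖torusCoeff (g v) k‖) +
          ∑ p, (1 + ‖k‖) ^ K * ((1 + ‖v‖) ^ M * ‖torusCoeff (pd p g v) k‖) := by
          rw [mul_add, mul_add, Finset.mul_sum, Finset.mul_sum]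
      _ ≤ _ := add_le_add (hC k v) (Finset.sum_le_sum fun p _ => hC' p k v)

theorem RF.comp_act {B : Matrix (Fin n) (Fin n) ℤ} {f : (Fin n → ℤ) → E n → ℂ} (hf : f ∈ RF D B) :
    (fun u X => f u (act D X)) ∈ RF 1 B := ⟨hf.1.comp_act D, hf.2.comp_act⟩

theorem summable_torusCoeff {g : (Fin n → ℤ) → E n → ℂ} (hg : g ∈ RF 1 0) (v : Fin n → ℤ) :
    Summable (torusCoeff (g v)) := by
  obtain ⟨C, hC⟩ := torusCoeff_bound (sumExp (Fin n)) 0 g hg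
  refine Summable.of_norm_bounded (summable_sumExp.mul_left C) fun k => ?_
  rw [← div_eq_mul_inv, le_div_iff₀ (by positivity), mul_comm]
  simpa using hC k v

theorem tor_coeff (hD : D.det ≠ 0) (w : SchwartzSeq (Idx n)) (k v : Fin n → ℤ) :
    torusCoeff (fun Y => tor N D⁻¹ w v (act D Y)) k =
      w.val (idx k v) * e ((1 / 2) * ⟪vec k, act N (vec v)⟫) := by
  refine torusCoeff_of_hasSum
    (c := fun k => w.val (idx k v) * e ((1 / 2) * ⟪vec k, act N (vec v)⟫))
    (by simpa [norm_mul] using schwartzSeq_summable_norm_idx w v) (fun Y => ?_) k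
  have := hasSum_tor (N := N) (D' := D⁻¹) w v (act D Y)
  rwa [act_inv_act hD] at this

/-- Fourier inversion in `Y = D⁻¹ X`. The coefficients of the torus element are the Fourier
coefficients with the half phase of `tor` removed. -/
theorem exists_tor_eq (hD : D.det ≠ 0) {f : (Fin n → ℤ) → E n → ℂ} (hf : f ∈ RF D 0) :
    ∃ w : SchwartzSeq (Idx n), tor N D⁻¹ w = f := by
  have hg := RF.comp_act hf
  let c : (Idx n → ℤ) → ℂ := fun m =>
    e (-((1 / 2) * ⟪vec fun i => m (Sum.inl i), act N (vec fun i => m (Sum.inr i))⟫)) *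
      torusCoeff (fun Y => f (fun i => m (Sum.inr i)) (act D Y)) fun i => m (Sum.inl i)
  refine ⟨⟨c, fun M => ?_⟩, funext fun v => funext fun X => ?_⟩
  · obtain ⟨C, hC⟩ := torusCoeff_bound M M _ hg
    refine ⟨C, fun m => le_trans ?_ (hC (fun i => m (Sum.inl i)) (fun i => m (Sum.inr i)))⟩
    rw [norm_mul, norm_e, one_mul, ← mul_assoc, ← mul_pow]
    gcongr
    have := one_add_norm_idx_le (fun i => m (Sum.inl i)) (fun i => m (Sum.inr i))
    rwa [idx_eta] at this
  · have h := hasSum_torusCoeff (hg.1.continuous v) (per_of_eqv hg.2 v) (summable_torusCoeff hg v)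
      (act D⁻¹ X)
    rw [act_act_inv hD] at h
    refine Eq.trans (tsum_congr fun k => ?_) h.tsum_eq
    simp only [c, idx_inl, idx_inr]
    rw [mul_right_comm (e _), ← e_add, neg_add_cancel, e_zero, one_mul]

end TorusSeries

/-! ### The pre-category of equivariant families -/

section Phases

variable {n : ℕ} (θ κ : Matrix (Fin n) (Fin n) ℝ)

/-- `1 + θ A`. -/
def dmat (A : Matrix (Fin n) (Fin n) ℤ) : Matrix (Fin n) (Fin n) ℝ := 1 + θ * toReal A

/-- `A (1 + θ A)⁻¹`. -/
def kmat (A : Matrix (Fin n) (Fin n) ℤ) : Matrix (Fin n) (Fin n) ℝ := toReal A * (dmat θ A)⁻¹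

/-- The equivariant linear function `(K_a - K_b) X + (1 - K_b θ) u`. -/
def lin (Aa Ab : Matrix (Fin n) (Fin n) ℤ) (u : Fin n → ℤ) (X : E n) : E n :=
  act (kmat θ Aa - kmat θ Ab) X + act (1 - kmat θ Ab * θ) (vec u)

/-- The phase of the composition. -/
def phase (Aa Ab Ac : Matrix (Fin n) (Fin n) ℤ) (v u : Fin n → ℤ) (X : E n) : ℝ :=
  (1 / 2) * ⟪lin θ Ab Ac v (X + sh θ u), act κ (lin θ Aa Ab u X)⟫

variable {θ κ} {Aa Ab Ac Ad : Matrix (Fin n) (Fin n) ℤ}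

theorem dmat_eq_add : dmat θ Ab = dmat θ Aa + θ * toReal (Ab - Aa) := by
  rw [dmat, dmat, toReal_sub, Matrix.mul_sub]
  abel

theorem kmat_mul_dmat (ha : (dmat θ Aa).det ≠ 0) : kmat θ Aa * dmat θ Aa = toReal Aa := by
  rw [kmat, Matrix.mul_assoc, Matrix.nonsing_inv_mul _ (isUnit_iff_ne_zero.mpr ha), Matrix.mul_one]

/-- The terms in `K_b` cancel. This additivity is the source of the cocycle identity and of the
Leibniz rule. -/
theorem lin_add (v u : Fin n → ℤ) (X : E n) :
    lin θ Ab Ac v (X + sh θ u) + lin θ Aa Ab u X = lin θ Aa Ac (v + u) X := by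
  simp only [lin, sub_act, act_add, one_act, act_mul, sh, vec_add]
  abel

theorem lin_self (X : E n) : lin θ Aa Aa 0 X = 0 := by
  rw [lin, sub_self, zero_act, vec_zero, act_zero, add_zero]

theorem lin_swap (u : Fin n → ℤ) (X : E n) :
    lin θ Ab Aa (-u) (X + sh θ u) = -lin θ Aa Ab u X := by
  have := lin_add (θ := θ) (Aa := Aa) (Ab := Ab) (Ac := Aa) (-u) u X
  rw [neg_add_cancel, lin_self] at this
  exact eq_neg_of_add_eq_zero_left this

theorem lin_eqv (ha : (dmat θ Aa).det ≠ 0) (hb : (dmat θ Ab).det ≠ 0) (z u : Fin n → ℤ) (X : E n) :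
    lin θ Aa Ab (u + (Ab - Aa).mulVec z) (X + act (dmat θ Aa) (vec z)) = lin θ Aa Ab u X := by
  -- Equivariance is this matrix identity, a consequence of `K_a D_a = A_a`, `K_b D_b = A_b` and
  -- `D_b = D_a + θ A_ab`.
  have h : (kmat θ Aa - kmat θ Ab) * dmat θ Aa + (1 - kmat θ Ab * θ) * toReal (Ab - Aa) = 0 := by
    have h1 : kmat θ Ab * dmat θ Aa = toReal Ab - kmat θ Ab * θ * toReal (Ab - Aa) := by
      rw [← kmat_mul_dmat hb, dmat_eq_add (Aa := Aa) (Ab := Ab), Matrix.mul_add, ← Matrix.mul_assoc]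
      abel
    rw [Matrix.sub_mul, Matrix.sub_mul, kmat_mul_dmat ha, h1, toReal_sub, Matrix.one_mul]
    abel
  have h2 := congrArg (fun M => act M (vec z)) h
  simp only [add_act, act_mul, zero_act, ← vec_mulVec] at h2
  rw [lin, lin, act_add, vec_add, act_add, ← add_zero (act (kmat θ Aa - kmat θ Ab) X +
    act (1 - kmat θ Ab * θ) (vec u)), ← h2]
  abel

theorem phase_eqv (ha : (dmat θ Aa).det ≠ 0) (hb : (dmat θ Ab).det ≠ 0) (hc : (dmat θ Ac).det ≠ 0)
    (z v u : Fin n → ℤ) (X : E n) : phase θ κ Aa Ab Ac (v + (Ac - Ab).mulVec z)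
      (u + (Ab - Aa).mulVec z) (X + act (dmat θ Aa) (vec z)) = phase θ κ Aa Ab Ac v u X := by
  have h : X + act (dmat θ Aa) (vec z) + sh θ (u + (Ab - Aa).mulVec z) =
      X + sh θ u + act (dmat θ Ab) (vec z) := by
    rw [dmat_eq_add (Aa := Aa) (Ab := Ab), add_act, act_mul, ← vec_mulVec, sh_add]
    simp only [sh]
    abel
  rw [phase, phase, h, lin_eqv ha hb, lin_eqv hb hc]

/-- With `p, q, r` the values of `L` on the three morphisms and `β` the bilinear form of the phase,
additivity of `L` reduces this to `β(p, q) + β(p + q, r) = β(q, r) + β(p, q + r)`. -/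
theorem phase_cocycle (v w u : Fin n → ℤ) (X : E n) :
    phase θ κ Ab Ac Ad v w (X + sh θ u) + phase θ κ Aa Ab Ad (v + w) u X =
      phase θ κ Aa Ab Ac w u X + phase θ κ Aa Ac Ad v (w + u) X := by
  have h : X + sh θ (w + u) = X + sh θ u + sh θ w := by rw [sh_add]; abel
  simp only [phase, ← lin_add (Ab := Ac) (Ac := Ad), ← lin_add (Aa := Aa) (Ab := Ab) (Ac := Ac), h,
    inner_add_left, inner_add_right, act_add]
  ring

/-- The two values of `L` are opposite and `κ` is skew. As a result no phase enters the trace of a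
composition. -/
theorem phase_swap (hκ : κ.transpose = -κ) (u : Fin n → ℤ) (X : E n) :
    phase θ κ Aa Ab Aa (-u) u X = 0 := by
  rw [phase, lin_swap, inner_neg_left, inner_act_self hκ, neg_zero, mul_zero]

theorem phase_zero_left (u : Fin n → ℤ) (X : E n) : phase θ κ Aa Ab Ab 0 u X = 0 := by
  rw [phase, lin_self, inner_zero_left, mul_zero]

theorem phase_zero_right (v : Fin n → ℤ) (X : E n) : phase θ κ Aa Aa Ab v 0 X = 0 := by
  rw [phase, lin_self, act_zero, inner_zero_right, mul_zero]

variable (θ Aa Ab) in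
/-- The multiplication operators in the connections. -/
def lf (w : E n) (u : Fin n → ℤ) (X : E n) : ℂ :=
  2 * Real.pi * Complex.I * (⟪w, lin θ Aa Ab u X⟫ : ℝ)

theorem lf_add (w w' : E n) : lf θ Aa Ab (w + w') = lf θ Aa Ab w + lf θ Aa Ab w' := by
  funext u X
  simp only [lf, inner_add_left, Pi.add_apply]
  push_cast
  ring

theorem isAff_lf (w : E n) : IsAff (lf θ Aa Ab w) :=
  ⟨2 * Real.pi * Complex.I, 0, act (kmat θ Aa - kmat θ Ab).transpose w,
    act (1 - kmat θ Ab * θ).transpose w, fun u X => by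
      rw [lf, lin, inner_add_right, inner_act, inner_act, add_zero]⟩

theorem hasFDerivAt_inner_lin (w : E n) (u : Fin n → ℤ) (X : E n) :
    HasFDerivAt (fun X => ⟪w, lin θ Aa Ab u X⟫)
      ((innerSL ℝ w).comp (actL (kmat θ Aa - kmat θ Ab))) X := by
  have h : (fun X => ⟪w, lin θ Aa Ab u X⟫) = fun X =>
      (innerSL ℝ w).comp (actL (kmat θ Aa - kmat θ Ab)) X + ⟪w, act (1 - kmat θ Ab * θ) (vec u)⟫ := by
    funext X
    rw [lin, inner_add_right]
    rfl
  rw [h]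
  exact (ContinuousLinearMap.hasFDerivAt _).add_const _

theorem hasFDerivAt_lf (w : E n) (u : Fin n → ℤ) (X : E n) :
    HasFDerivAt (lf θ Aa Ab w u) (gradL fun p => 2 * Real.pi * Complex.I *
      (⟪w, act (kmat θ Aa - kmat θ Ab) (EuclideanSpace.single p 1)⟫ : ℝ)) X :=
  ((Complex.ofRealCLM.hasFDerivAt.comp X (hasFDerivAt_inner_lin w u X)).const_mul
    (2 * Real.pi * Complex.I)).to_gradL fun _ => rfl

theorem lf_eqv (ha : (dmat θ Aa).det ≠ 0) (hb : (dmat θ Ab).det ≠ 0) (w : E n) :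
    Eqv (dmat θ Aa) (Ab - Aa) (lf θ Aa Ab w) := fun z u X => by rw [lf, lf, lin_eqv ha hb]

theorem RF.lf_mul (ha : (dmat θ Aa).det ≠ 0) (hb : (dmat θ Ab).det ≠ 0) (w : E n)
    {f : (Fin n → ℤ) → E n → ℂ} (hf : f ∈ RF (dmat θ Aa) (Ab - Aa)) :
    lf θ Aa Ab w * f ∈ RF (dmat θ Aa) (Ab - Aa) :=
  ⟨hf.1.aff_mul (isAff_lf w), fun z u X => by
    simp only [Pi.mul_apply, lf_eqv ha hb w z u X, hf.2 z u X]⟩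

/-- The phase is half the pairing of two affine functions of `X`, so each of the two terms of its
derivative is linear in the value of `L` on one of the morphisms. Skewness of `κ` brings the second
term to the same form as the first. -/
theorem phaseDeriv (hκ : κ.transpose = -κ) : PhaseDeriv θ (phase θ κ Aa Ab Ac)
    (fun p => lf θ Ab Ac (act κ (act ((1 / 2 : ℝ) • (kmat θ Aa - kmat θ Ab))
      (EuclideanSpace.single p 1))))
    (fun p => lf θ Aa Ab (-act κ (act ((1 / 2 : ℝ) • (kmat θ Ab - kmat θ Ac))
      (EuclideanSpace.single p 1)))) := by
  intro v u X
  have h1 : HasFDerivAt (fun X => lin θ Ab Ac v (X + sh θ u)) (actL (kmat θ Ab - kmat θ Ac)) X := by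
    have h : (fun X => lin θ Ab Ac v (X + sh θ u)) = fun X => actL (kmat θ Ab - kmat θ Ac) X +
        lin θ Ab Ac v (sh θ u) := by
      funext X
      rw [lin, lin, act_add, add_assoc]
      rfl
    rw [h]
    exact (ContinuousLinearMap.hasFDerivAt _).add_const _
  have h2 : HasFDerivAt (fun X => act κ (lin θ Aa Ab u X))
      ((actL κ).comp (actL (kmat θ Aa - kmat θ Ab))) X := by
    have h : (fun X => act κ (lin θ Aa Ab u X)) = fun X =>
        (actL κ).comp (actL (kmat θ Aa - kmat θ Ab)) X + act κ (lin θ Aa Ab u 0) := by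
      funext X
      rw [lin, lin, act_zero, zero_add, act_add]
      rfl
    rw [h]
    exact (ContinuousLinearMap.hasFDerivAt _).add_const _
  have h3 := (h1.inner ℝ h2).const_mul (1 / 2 : ℝ)
  have h4 := (hasDerivAt_e (phase θ κ Aa Ab Ac v u X)).hasFDerivAt.comp X h3
  refine h4.to_gradL fun p => ?_
  have e1 : ⟪lin θ Ab Ac v (X + sh θ u), act κ (act (kmat θ Aa - kmat θ Ab)
      (EuclideanSpace.single p 1))⟫ = ⟪act κ (act (kmat θ Aa - kmat θ Ab)
      (EuclideanSpace.single p 1)), lin θ Ab Ac v (X + sh θ u)⟫ := real_inner_comm _ _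
  have e2 : ⟪act (kmat θ Ab - kmat θ Ac) (EuclideanSpace.single p 1), act κ (lin θ Aa Ab u X)⟫ =
      -⟪act κ (act (kmat θ Ab - kmat θ Ac) (EuclideanSpace.single p 1)), lin θ Aa Ab u X⟫ := by
    rw [inner_act, hκ, neg_act, inner_neg_left]
  simp only [ContinuousLinearMap.comp_apply, _root_.smul_apply, fderivInnerCLM_apply,
    ContinuousLinearMap.prod_apply, actL_apply, ContinuousLinearMap.toSpanSingleton_apply, lf, e1, e2,
    smul_act, act_smul, inner_neg_left, inner_smul_left, smul_eq_mul, Complex.real_smul]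
  push_cast
  simp only [conj_trivial]
  push_cast
  ring

end Phases

/-! ### Composition, connections and curvature of equivariant families -/

section FamilyCategory

variable {n : ℕ} {θ κ : Matrix (Fin n) (Fin n) ℝ} {Aa Ab Ac Ad : Matrix (Fin n) (Fin n) ℤ}
  {f g h : (Fin n → ℤ) → E n → ℂ}

theorem RF.conv (hκ : κ.transpose = -κ) (ha : (dmat θ Aa).det ≠ 0) (hb : (dmat θ Ab).det ≠ 0)
    (hc : (dmat θ Ac).det ≠ 0) (hf : f ∈ RF (dmat θ Ab) (Ac - Ab))
    (hg : g ∈ RF (dmat θ Aa) (Ab - Aa)) :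
    conv θ (phase θ κ Aa Ab Ac) f g ∈ RF (dmat θ Aa) (Ac - Aa) :=
  ⟨hf.1.conv (phaseDeriv hκ) (fun _ => isAff_lf _) (fun _ => isAff_lf _) hg.1,
    hf.2.conv hg.2 dmat_eq_add (by abel) (phase_eqv ha hb hc)⟩

theorem pd_conv (hκ : κ.transpose = -κ) (hf : SR f) (hg : SR g) (p : Fin n) :
    pd p (conv θ (phase θ κ Aa Ab Ac) f g) =
      conv θ (phase θ κ Aa Ab Ac) (pd p f + lf θ Ab Ac (act κ (act ((1 / 2 : ℝ) •
        (kmat θ Aa - kmat θ Ab)) (EuclideanSpace.single p 1))) * f) g +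
      conv θ (phase θ κ Aa Ab Ac) f (pd p g + lf θ Aa Ab (-act κ (act ((1 / 2 : ℝ) •
        (kmat θ Ab - kmat θ Ac)) (EuclideanSpace.single p 1))) * g) :=
  pd_eq (s := fun p => conv θ (phase θ κ Aa Ab Ac) (pd p f + lf θ Ab Ac (act κ (act ((1 / 2 : ℝ) •
        (kmat θ Aa - kmat θ Ab)) (EuclideanSpace.single p 1))) * f) g +
      conv θ (phase θ κ Aa Ab Ac) f (pd p g + lf θ Aa Ab (-act κ (act ((1 / 2 : ℝ) •
        (kmat θ Ab - kmat θ Ac)) (EuclideanSpace.single p 1))) * g))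
    (SR.hasFDerivAt_conv (phaseDeriv hκ) (fun _ => isAff_lf _) (fun _ => isAff_lf _) hf hg) p

/-- Term by term, the value of `L` on the composite is the sum of its values on the two factors. -/
theorem lf_mul_conv (hf : SR f) (hg : SR g) (w : E n) :
    lf θ Aa Ac w * conv θ (phase θ κ Aa Ab Ac) f g =
      conv θ (phase θ κ Aa Ab Ac) (lf θ Ab Ac w * f) g +
        conv θ (phase θ κ Aa Ab Ac) f (lf θ Aa Ab w * g) := by
  funext ρ X
  rw [Pi.add_apply, Pi.add_apply, Pi.mul_apply, Pi.mul_apply, conv, conv, conv, ← tsum_mul_left,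
    ← ((hf.aff_mul (isAff_lf w)).dec.summable_convTerm hg.dec ρ X).tsum_add
      (hf.dec.summable_convTerm (hg.aff_mul (isAff_lf w)).dec ρ X)]
  refine tsum_congr fun u => ?_
  have h := lin_add (θ := θ) (Aa := Aa) (Ab := Ab) (Ac := Ac) (ρ - u) u X
  rw [sub_add_cancel] at h
  simp only [convTerm, Pi.mul_apply, lf, ← h, inner_add_right]
  push_cast
  ring

/-- The vectors defining the connection. -/
def connVec (θ κ : Matrix (Fin n) (Fin n) ℝ) (Aa Ab : Matrix (Fin n) (Fin n) ℤ) (p : Fin n) : E n :=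
  -act κ (act ((1 / 2 : ℝ) • (kmat θ Aa + kmat θ Ab)) (EuclideanSpace.single p 1))

/-- The connection on equivariant families. -/
def conn (θ κ : Matrix (Fin n) (Fin n) ℝ) (Aa Ab : Matrix (Fin n) (Fin n) ℤ) (j : Idx n)
    (f : (Fin n → ℤ) → E n → ℂ) : (Fin n → ℤ) → E n → ℂ :=
  match j with
  | Sum.inl p => pd p f + lf θ Aa Ab (connVec θ κ Aa Ab p) * f
  | Sum.inr p => lf θ Aa Ab (EuclideanSpace.single p 1) * f

theorem RF.conn (ha : (dmat θ Aa).det ≠ 0) (hb : (dmat θ Ab).det ≠ 0) (j : Idx n)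
    (hf : f ∈ RF (dmat θ Aa) (Ab - Aa)) : conn θ κ Aa Ab j f ∈ RF (dmat θ Aa) (Ab - Aa) := by
  cases j with
  | inl p => exact Submodule.add_mem _ ⟨hf.1.pd p, hf.2.pd p⟩ (RF.lf_mul ha hb _ hf)
  | inr p => exact RF.lf_mul ha hb _ hf

/-- The corrections in `pd_conv` are exactly the differences of connection vectors: `κ ½(K_a - K_b)`
is the vector of `(b, c)` minus that of `(a, c)`, and `-κ ½(K_b - K_c)` is the vector of `(a, b)`
minus that of `(a, c)`. The common vector of `(a, c)` is distributed by `lf_mul_conv`. -/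
theorem conn_conv (hκ : κ.transpose = -κ) (j : Idx n) (hf : SR f) (hg : SR g) :
    conn θ κ Aa Ac j (conv θ (phase θ κ Aa Ab Ac) f g) =
      conv θ (phase θ κ Aa Ab Ac) (conn θ κ Ab Ac j f) g +
        conv θ (phase θ κ Aa Ab Ac) f (conn θ κ Aa Ab j g) := by
  cases j with
  | inl p =>
    have hlf : ∀ {Aa Ab : Matrix (Fin n) (Fin n) ℤ} (w : E n) {f : (Fin n → ℤ) → E n → ℂ},
        SR f → Dec (lf θ Aa Ab w * f) := fun w f hf => (hf.aff_mul (isAff_lf w)).dec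
    have e1 : connVec θ κ Ab Ac p = act κ (act ((1 / 2 : ℝ) • (kmat θ Aa - kmat θ Ab))
        (EuclideanSpace.single p 1)) + connVec θ κ Aa Ac p := by
      simp only [connVec, smul_act, add_act, sub_act, act_smul, act_add, act_sub]
      module
    have e2 : connVec θ κ Aa Ab p = -act κ (act ((1 / 2 : ℝ) • (kmat θ Ab - kmat θ Ac))
        (EuclideanSpace.single p 1)) + connVec θ κ Aa Ac p := by
      simp only [connVec, smul_act, add_act, sub_act, act_smul, act_add, act_sub]
      module
    simp only [conn, e1, e2, lf_add, add_mul]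
    rw [pd_conv hκ hf hg, lf_mul_conv hf hg, ← add_assoc (pd p f), ← add_assoc (pd p g),
      conv_add_left ((hf.pd p).dec.add (hlf _ hf)) (hlf _ hf) hg.dec,
      conv_add_right hf.dec ((hg.pd p).dec.add (hlf _ hg)) (hlf _ hg)]
    abel
  | inr p => exact lf_mul_conv hf hg _

theorem pd_lf_mul (hf : SR f) (w : E n) (p : Fin n) : pd p (lf θ Aa Ab w * f) =
    (2 * Real.pi * Complex.I *
      (⟪w, act (kmat θ Aa - kmat θ Ab) (EuclideanSpace.single p 1)⟫ : ℝ) : ℂ) • f +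
      lf θ Aa Ab w * pd p f := by
  refine pd_eq (s := fun p => (2 * Real.pi * Complex.I *
      (⟪w, act (kmat θ Aa - kmat θ Ab) (EuclideanSpace.single p 1)⟫ : ℝ) : ℂ) • f +
      lf θ Aa Ab w * pd p f) (fun u X => ?_) p
  refine ((hasFDerivAt_lf w u X).mul (hasFDerivAt_pd hf.differentiable u X)).to_gradL fun p => ?_
  simp only [_root_.add_apply, _root_.smul_apply, gradL_single, smul_eq_mul, Pi.add_apply,
    Pi.smul_apply, Pi.mul_apply]
  ring

/-- Stability of `SR` under partial derivatives gives `C^k` regularity for every `k`, hence symmetry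
of the second derivative. -/
theorem pd_comm (hf : SR f) (p q : Fin n) : pd p (pd q f) = pd q (pd p f) := by
  funext u X
  have hc : ContDiff ℝ 2 (f u) := by
    have key : ∀ k : ℕ, ∀ g : (Fin n → ℤ) → E n → ℂ, SR g → ContDiff ℝ k (g u) := by
      intro k
      induction k with
      | zero => exact fun g hg => contDiff_zero.mpr (hg.continuous u)
      | succ k ih =>
        intro g hg
        rw [show ((k + 1 : ℕ) : WithTop ℕ∞) = (k : WithTop ℕ∞) + 1 by norm_cast]
        refine contDiff_succ_iff_fderiv.mpr ⟨hg.differentiable u, by simp, ?_⟩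
        have h : fderiv ℝ (g u) = fun X => gradL fun p => pd p g u X :=
          funext fun X => (hasFDerivAt_pd hg.differentiable u X).fderiv
        rw [h]
        exact (gradL (n := n)).contDiff.comp (contDiff_pi.mpr fun p => ih _ (hg.pd p))
    exact_mod_cast key 2 f hf
  have h1 : ∀ p q : Fin n, pd p (pd q f) u X =
      fderiv ℝ (fderiv ℝ (f u)) X (EuclideanSpace.single p 1) (EuclideanSpace.single q 1) := by
    intro p q
    have hd : DifferentiableAt ℝ (fderiv ℝ (f u)) X :=
      ((hc.fderiv_right (m := 1) (by norm_num)).differentiable (by norm_num)) X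
    change fderiv ℝ (fun Y => fderiv ℝ (f u) Y (EuclideanSpace.single q 1)) X
      (EuclideanSpace.single p 1) = _
    rw [fderiv_clm_apply hd (differentiableAt_const _)]
    simp
  rw [h1, h1]
  exact (hc.contDiffAt.isSymmSndFDerivAt (by simp)) _ _

/-- The curvature matrix `F_a` of the pre-category of equivariant families. -/
def curvMat (θ κ : Matrix (Fin n) (Fin n) ℝ) (A : Matrix (Fin n) (Fin n) ℤ) :
    Matrix (Idx n) (Idx n) ℝ :=
  Matrix.fromBlocks (-((kmat θ A).transpose * κ * kmat θ A)) (kmat θ A).transpose (-kmat θ A) 0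

theorem curvMat_skew (hκ : κ.transpose = -κ) (A : Matrix (Fin n) (Fin n) ℤ) :
    (curvMat θ κ A).transpose = -curvMat θ κ A := by
  rw [curvMat, Matrix.fromBlocks_transpose, Matrix.fromBlocks_neg]
  simp [Matrix.transpose_mul, hκ, Matrix.mul_assoc]

theorem conn_comm (hκ : κ.transpose = -κ) (i j : Idx n) (hf : SR f) :
    conn θ κ Aa Ab i (conn θ κ Aa Ab j f) - conn θ κ Aa Ab j (conn θ κ Aa Ab i f) =
      (-(2 * Real.pi * Complex.I) *
        ((curvMat θ κ Ab i j - curvMat θ κ Aa i j : ℝ) : ℂ)) • f := by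
  have hS : ∀ w : E n, SR (lf θ Aa Ab w * f) := fun w => hf.aff_mul (isAff_lf w)
  have hpa : ∀ (p : Fin n) {f g : (Fin n → ℤ) → E n → ℂ}, SR f → SR g →
      pd p (f + g) = pd p f + pd p g := fun p f g hf hg => pd_add hf.differentiable hg.differentiable p
  have hin : ∀ (M : Matrix (Fin n) (Fin n) ℝ) (p q : Fin n),
      ⟪EuclideanSpace.single p 1, act M (EuclideanSpace.single q 1)⟫ = M p q := by
    intro M p q
    rw [EuclideanSpace.inner_single_left, act_single]
    simp
  have hcv : ∀ (M : Matrix (Fin n) (Fin n) ℝ) (p q : Fin n),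
      ⟪connVec θ κ Aa Ab p, act M (EuclideanSpace.single q 1)⟫ =
        (1 / 2) * ((kmat θ Aa + kmat θ Ab).transpose * κ * M) p q := by
    intro M p q
    rw [connVec, smul_act, act_smul, inner_neg_left, inner_smul_left, ← act_mul, real_inner_comm,
      inner_act, ← act_mul, real_inner_comm, hin, Matrix.transpose_mul, hκ, Matrix.mul_neg,
      Matrix.neg_mul, Matrix.neg_apply, conj_trivial]
    ring
  funext u X
  cases i with
  | inl p =>
    cases j with
    | inl q =>
      -- Antisymmetrizing `½ (K_a + K_b)ᵗ κ (K_a - K_b)` cancels the mixed products and leaves a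
      -- difference of one term per object. This is why the curvature of `Hom(a, b)` splits as `F_b
      -- - F_a`.
      have h0 : (1 / 2) * ((kmat θ Aa + kmat θ Ab).transpose * κ * (kmat θ Aa - kmat θ Ab)) q p -
          (1 / 2) * ((kmat θ Aa + kmat θ Ab).transpose * κ * (kmat θ Aa - kmat θ Ab)) p q =
          -(curvMat θ κ Ab (Sum.inl p) (Sum.inl q) - curvMat θ κ Aa (Sum.inl p) (Sum.inl q)) := by
        have hs : ∀ K L : Matrix (Fin n) (Fin n) ℝ, (K.transpose * κ * L) q p =
            -(L.transpose * κ * K) p q := by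
          intro K L
          rw [← Matrix.transpose_apply (K.transpose * κ * L) p q, Matrix.transpose_mul,
            Matrix.transpose_mul, hκ, Matrix.transpose_transpose, Matrix.neg_mul, Matrix.mul_neg,
            Matrix.neg_apply, Matrix.mul_assoc]
        simp only [curvMat, Matrix.fromBlocks_apply₁₁, Matrix.transpose_add, Matrix.add_mul,
          Matrix.mul_sub, Matrix.add_apply, Matrix.sub_apply, Matrix.neg_apply, hs]
        ring
      have h1 := congrArg (fun t : ℝ => (t : ℂ)) h0
      simp only [conn]
      rw [hpa p (hf.pd q) (hS _), hpa q (hf.pd p) (hS _), pd_lf_mul hf, pd_lf_mul hf,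
        pd_comm hf p q, hcv, hcv]
      simp only [Pi.sub_apply, Pi.add_apply, Pi.mul_apply, Pi.smul_apply, smul_eq_mul]
      push_cast at h1 ⊢
      linear_combination (2 * Real.pi * Complex.I * f u X) * h1
    | inr q =>
      simp only [conn]
      rw [pd_lf_mul hf, hin]
      simp only [Pi.sub_apply, Pi.add_apply, Pi.mul_apply, Pi.smul_apply, smul_eq_mul, curvMat,
        Matrix.fromBlocks_apply₁₂, Matrix.transpose_apply, Matrix.sub_apply]
      push_cast
      ring
  | inr p =>
    cases j with
    | inl q =>
      simp only [conn]
      rw [pd_lf_mul hf, hin]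
      simp only [Pi.sub_apply, Pi.add_apply, Pi.mul_apply, Pi.smul_apply, smul_eq_mul, curvMat,
        Matrix.fromBlocks_apply₂₁, Matrix.neg_apply, Matrix.sub_apply]
      push_cast
      ring
    | inr q =>
      simp only [conn, curvMat, Matrix.fromBlocks_apply₂₂, Matrix.zero_apply, sub_zero,
        Pi.sub_apply, Pi.mul_apply, Pi.smul_apply, Complex.ofReal_zero, mul_zero, zero_smul]
      ring

/-- The unit family. -/
def oneFam : (Fin n → ℤ) → E n → ℂ := fun u _ => if u = 0 then 1 else 0

theorem oneFam_mem (D : Matrix (Fin n) (Fin n) ℝ) : oneFam ∈ RF D (Aa - Aa) := by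
  have hd : ∀ (u : Fin n → ℤ) (X : E n), HasFDerivAt (oneFam u)
      (gradL fun p => ((fun _ => 0 : Fin n → (Fin n → ℤ) → E n → ℂ)) p u X) X := by
    intro u X
    exact (hasFDerivAt_const (if u = 0 then (1 : ℂ) else 0) X).to_gradL fun p => rfl
  refine ⟨SR.of_mem_span (T := {oneFam}) ?_ (Submodule.subset_span rfl), ?_⟩
  · rintro _ rfl
    refine ⟨fun u X => (hd u X).differentiableAt, fun N => ⟨1, 0, fun u X => ?_⟩, fun p => ?_⟩
    · by_cases hu : u = 0
      · simp [oneFam, hu]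
      · simp [oneFam, hu]
    · rw [pd_eq hd p]
      exact Submodule.zero_mem _
  · intro v u X
    rw [sub_self, Matrix.zero_mulVec, add_zero]
    rfl

theorem oneFam_conv : conv θ (phase θ κ Aa Ab Ab) oneFam f = f := by
  funext ρ X
  rw [conv, tsum_eq_single ρ]
  · rw [convTerm, sub_self, phase_zero_left, e_zero, oneFam, if_pos rfl, one_mul, mul_one]
  · intro u hu
    rw [convTerm, oneFam, if_neg (sub_ne_zero.mpr (Ne.symm hu)), zero_mul, zero_mul]

theorem conv_oneFam : conv θ (phase θ κ Aa Aa Ab) f oneFam = f := by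
  funext ρ X
  rw [conv, tsum_eq_single 0]
  · rw [convTerm, phase_zero_right, e_zero, oneFam, if_pos rfl, mul_one, mul_one, sub_zero, sh,
      vec_zero, act_zero, add_zero]
  · intro u hu
    rw [convTerm, oneFam, if_neg hu, mul_zero, zero_mul]

end FamilyCategory

/-! ### Trace, symmetry and nondegeneracy for equivariant families -/

section FamilyTrace

open MeasureTheory

variable {n : ℕ} {θ κ : Matrix (Fin n) (Fin n) ℝ} {Aa Ab Ac Ad : Matrix (Fin n) (Fin n) ℤ}
  {f g h : (Fin n → ℤ) → E n → ℂ}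

/-- The reflection of a family. -/
def refl (θ : Matrix (Fin n) (Fin n) ℝ) (f : (Fin n → ℤ) → E n → ℂ) (u : Fin n → ℤ) (X : E n) : ℂ :=
  f (-u) (X + sh θ u)

/-- The reflection shifts the argument by `θ u`, so plain decay of `f` with polynomial growth in `X`
is not enough. The invariant decay of `Dec.strong` is used instead, and `u` is recovered from the
invariant quantity by inverting `1 - B D_b⁻¹ θ`. -/
theorem dec_refl (ha : (dmat θ Aa).det ≠ 0) (hb : (dmat θ Ab).det ≠ 0) (hf : Dec f)
    (he : Eqv (dmat θ Ab) (Aa - Ab) f) : Dec (refl θ f) := by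
  intro N
  obtain ⟨C, hC, h⟩ := hf.strong he hb N
  set B := toReal (Ab - Aa) with hB
  have hB' : toReal (Aa - Ab) = -B := by rw [hB, ← toReal_neg, neg_sub]
  -- The explicit inverse comes from the resolvent identity `D_a⁻¹ θ B D_b⁻¹ = D_a⁻¹ - D_b⁻¹`, where
  -- `θ B = D_b - D_a`.
  have hW : (1 + B * (dmat θ Aa)⁻¹ * θ) * (1 - B * (dmat θ Ab)⁻¹ * θ) = 1 := by
    have h1 : (dmat θ Aa)⁻¹ * (θ * B) * (dmat θ Ab)⁻¹ = (dmat θ Aa)⁻¹ - (dmat θ Ab)⁻¹ := by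
      have h2 : θ * B = dmat θ Ab - dmat θ Aa := by
        rw [dmat_eq_add (Aa := Aa) (Ab := Ab), add_sub_cancel_left]
      rw [h2, Matrix.mul_sub, Matrix.sub_mul, Matrix.nonsing_inv_mul _ (isUnit_iff_ne_zero.mpr ha),
        Matrix.one_mul, Matrix.mul_assoc, Matrix.mul_nonsing_inv _ (isUnit_iff_ne_zero.mpr hb),
        Matrix.mul_one]
    have h3 : B * (dmat θ Aa)⁻¹ * θ * (B * (dmat θ Ab)⁻¹ * θ) =
        B * ((dmat θ Aa)⁻¹ - (dmat θ Ab)⁻¹) * θ := by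
      rw [← h1]
      simp only [Matrix.mul_assoc]
    rw [Matrix.add_mul, Matrix.mul_sub, Matrix.mul_sub, Matrix.one_mul, Matrix.one_mul,
      Matrix.mul_one, h3, Matrix.mul_sub, Matrix.sub_mul]
    abel
  obtain ⟨T, hT, hT1⟩ := exists_one_add_norm_act_le (1 + B * (dmat θ Aa)⁻¹ * θ)
  obtain ⟨T', hT', hT1'⟩ := exists_one_add_norm_act_le (B * (dmat θ Ab)⁻¹)
  refine ⟨(T * T') ^ N * C, N, fun u X => ?_⟩
  set y := vec (-u) - act (toReal (Aa - Ab) * (dmat θ Ab)⁻¹) (X + sh θ u) with hy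
  have e1 : vec u = act (1 + B * (dmat θ Aa)⁻¹ * θ) (-y + act (B * (dmat θ Ab)⁻¹) X) := by
    have h1 : -y + act (B * (dmat θ Ab)⁻¹) X = act (1 - B * (dmat θ Ab)⁻¹ * θ) (vec u) := by
      rw [hy, hB', Matrix.neg_mul, neg_act, act_add, sub_act, one_act, act_mul _ θ, vec_neg]
      simp only [sh]
      abel
    rw [h1, ← act_mul, hW, one_act]
  have e2 : 1 + ‖u‖ ≤ T * T' * (1 + ‖X‖) * (1 + ‖y‖) := by
    have h1 := norm_le_norm_vec u
    have h2 := hT1 (-y + act (B * (dmat θ Ab)⁻¹) X)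
    rw [← e1] at h2
    have h3 := one_add_norm_add_le (-y) (act (B * (dmat θ Ab)⁻¹) X)
    rw [norm_neg] at h3
    calc 1 + ‖u‖ ≤ 1 + ‖vec u‖ := by gcongr
      _ ≤ T * ((1 + ‖y‖) * (1 + ‖act (B * (dmat θ Ab)⁻¹) X‖)) := h2.trans (by gcongr)
      _ ≤ T * ((1 + ‖y‖) * (T' * (1 + ‖X‖))) := by gcongr; exact hT1' X
      _ = _ := by ring
  calc (1 + ‖u‖) ^ N * ‖refl θ f u X‖ ≤ (T * T' * (1 + ‖X‖) * (1 + ‖y‖)) ^ N *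
        ‖f (-u) (X + sh θ u)‖ := by
        gcongr
        exact le_of_eq rfl
    _ = ((T * T') ^ N * (1 + ‖X‖) ^ N) * ((1 + ‖y‖) ^ N * ‖f (-u) (X + sh θ u)‖) := by
      rw [mul_pow, mul_pow, mul_assoc]
    _ ≤ ((T * T') ^ N * (1 + ‖X‖) ^ N) * C := by
      gcongr
      exact h (-u) (X + sh θ u)
    _ = _ := by ring

theorem refl_mem (ha : (dmat θ Aa).det ≠ 0) (hb : (dmat θ Ab).det ≠ 0)
    (hf : f ∈ RF (dmat θ Ab) (Aa - Ab)) : refl θ f ∈ RF (dmat θ Aa) (Ab - Aa) := by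
  constructor
  · refine SR.of_mem_span (T := {k | ∃ f ∈ RF (dmat θ Ab) (Aa - Ab), k = refl θ f}) ?_
      (Submodule.subset_span ⟨f, hf, rfl⟩)
    rintro _ ⟨f, hf, rfl⟩
    have hd : ∀ u X, HasFDerivAt (refl θ f u) (gradL fun p => refl θ (pd p f) u X) X := fun u X =>
      (hasFDerivAt_comp_add_right (sh θ u)).mpr
        (hasFDerivAt_pd hf.1.differentiable (-u) (X + sh θ u))
    refine ⟨fun u X => (hd u X).differentiableAt, dec_refl ha hb hf.1.dec hf.2, fun p => ?_⟩
    rw [pd_eq (s := fun p => refl θ (pd p f)) hd p]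
    exact Submodule.subset_span ⟨_, ⟨hf.1.pd p, hf.2.pd p⟩, rfl⟩
  · intro z u X
    have h1 : -(u + (Ab - Aa).mulVec z) = -u + (Aa - Ab).mulVec z := by
      rw [← neg_sub Aa Ab, Matrix.neg_mulVec]
      abel
    have h2 : X + act (dmat θ Aa) (vec z) + sh θ (u + (Ab - Aa).mulVec z) =
        X + sh θ u + act (dmat θ Ab) (vec z) := by
      rw [dmat_eq_add (Aa := Aa) (Ab := Ab), add_act, act_mul, ← vec_mulVec, sh_add]
      simp only [sh]
      abel
    rw [refl, refl, h1, h2, hf.2]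

/-- The complex conjugate of a family. -/
def conjFam (f : (Fin n → ℤ) → E n → ℂ) (u : Fin n → ℤ) (X : E n) : ℂ := starRingEnd ℂ (f u X)

theorem conjFam_mem {D : Matrix (Fin n) (Fin n) ℝ} {B : Matrix (Fin n) (Fin n) ℤ}
    (hf : f ∈ RF D B) : conjFam f ∈ RF D B := by
  refine ⟨?_, fun z u X => by rw [conjFam, conjFam, hf.2]⟩
  refine SR.of_mem_span (T := {k | ∃ f, SR f ∧ k = conjFam f}) ?_
      (Submodule.subset_span ⟨f, hf.1, rfl⟩)
  rintro _ ⟨f, hf, rfl⟩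
  have hd : ∀ u X, HasFDerivAt (conjFam f u) (gradL fun p => conjFam (pd p f) u X) X := fun u X =>
    (Complex.conjCLE.toContinuousLinearMap.hasFDerivAt.comp X
      (hasFDerivAt_pd hf.differentiable u X)).to_gradL fun p => by
        rw [ContinuousLinearMap.comp_apply, gradL_single]
        rfl
  refine ⟨fun u X => (hd u X).differentiableAt, fun N => ?_, fun p => ?_⟩
  · obtain ⟨C, M, h⟩ := hf.dec N
    exact ⟨C, M, fun u X => by rw [conjFam, RCLike.norm_conj]; exact h u X⟩
  · rw [pd_eq (s := fun p => conjFam (pd p f)) hd p]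
    exact Submodule.subset_span ⟨_, hf.pd p, rfl⟩

/-- The trace of a family. -/
def trF (θ : Matrix (Fin n) (Fin n) ℝ) (A : Matrix (Fin n) (Fin n) ℤ)
    (f : (Fin n → ℤ) → E n → ℂ) : ℂ :=
  (|(dmat θ A).det| : ℝ) * ∫ Y in cube n, f 0 (act (dmat θ A) Y)

/-- The integrand of the trace pairing. -/
def pairKer (θ : Matrix (Fin n) (Fin n) ℝ) (D : Matrix (Fin n) (Fin n) ℝ)
    (f g : (Fin n → ℤ) → E n → ℂ) (u : Fin n → ℤ) (Y : E n) : ℂ :=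
  refl θ f u (act D Y) * g u (act D Y)

theorem trF_conv (hκ : κ.transpose = -κ) : trF θ Aa (conv θ (phase θ κ Aa Ab Aa) f g) =
    (|(dmat θ Aa).det| : ℝ) * ∫ Y in cube n, ∑' u, pairKer θ (dmat θ Aa) f g u Y := by
  rw [trF]
  congr 2
  funext Y
  refine tsum_congr fun u => ?_
  rw [convTerm, zero_sub, phase_swap hκ, e_zero, mul_one]
  rfl

theorem dec_pairKer (ha : (dmat θ Aa).det ≠ 0) (hb : (dmat θ Ab).det ≠ 0)
    (hf : f ∈ RF (dmat θ Ab) (Aa - Ab)) (hg : g ∈ RF (dmat θ Aa) (Ab - Aa)) :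
    Dec (pairKer θ (dmat θ Aa) f g) :=
  (((refl_mem ha hb hf).1.comp_act _).dec).mul ((hg.1.comp_act _).dec)

theorem continuous_pairKer (ha : (dmat θ Aa).det ≠ 0) (hb : (dmat θ Ab).det ≠ 0)
    (hf : f ∈ RF (dmat θ Ab) (Aa - Ab)) (hg : g ∈ RF (dmat θ Aa) (Ab - Aa)) (u : Fin n → ℤ) :
    Continuous (pairKer θ (dmat θ Aa) f g u) :=
  (((refl_mem ha hb hf).1.comp_act _).continuous u).mul ((hg.1.comp_act _).continuous u)

theorem eqv_pairKer (ha : (dmat θ Aa).det ≠ 0) (hb : (dmat θ Ab).det ≠ 0)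
    (hf : f ∈ RF (dmat θ Ab) (Aa - Ab)) (hg : g ∈ RF (dmat θ Aa) (Ab - Aa)) :
    Eqv 1 (Ab - Aa) (pairKer θ (dmat θ Aa) f g) := by
  intro z u X
  have h1 := (refl_mem ha hb hf).2.comp_act z u X
  have h2 := hg.2.comp_act z u X
  simp only at h1 h2
  rw [pairKer, pairKer, h1, h2]

theorem Dec.comp_neg (hf : Dec f) : Dec fun u X => f (-u) X := by
  intro N
  obtain ⟨C, M, h⟩ := hf N
  exact ⟨C, M, fun u X => by have := h (-u) X; rwa [norm_neg] at this⟩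

/-- Unfold the cell integral, then substitute `X = D_a Y`; the Jacobian cancels the normalization
`|det D_a|`. -/
theorem trF_conv_eq_finsum (hκ : κ.transpose = -κ) (ha : (dmat θ Aa).det ≠ 0)
    (hb : (dmat θ Ab).det ≠ 0) (hB : (Ab - Aa).det ≠ 0)
    (hf : f ∈ RF (dmat θ Ab) (Aa - Ab)) (hg : g ∈ RF (dmat θ Aa) (Ab - Aa)) :
    trF θ Aa (conv θ (phase θ κ Aa Ab Aa) f g) =
      ∑ᶠ q : (Fin n → ℤ) ⧸ latticeImage (Ab - Aa), ∫ X, refl θ f (rep q) X * g (rep q) X := by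
  have := finite_quotient hB
  have := Fintype.ofFinite ((Fin n → ℤ) ⧸ latticeImage (Ab - Aa))
  rw [trF_conv hκ, setIntegral_cube_tsum (dec_pairKer ha hb hf hg) (continuous_pairKer ha hb hf hg)
    (eqv_pairKer ha hb hf hg) hB, finsum_eq_sum_of_fintype, finsum_eq_sum_of_fintype,
    Finset.mul_sum]
  refine Finset.sum_congr rfl fun q _ => ?_
  have h := integral_comp_act ha (fun X => refl θ f (rep q) X * g (rep q) X)
  simp only [pairKer]
  rw [h, ← mul_assoc, ← Complex.ofReal_mul, mul_inv_cancel₀ (abs_ne_zero.mpr ha),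
    Complex.ofReal_one, one_mul]

/-- The trace at `b` unfolds to the expression found at `a` after replacing `u` by `-u` and
translating the integration variable by `θ u`. This is the trace symmetry for distinct objects. -/
theorem trF_conv_eq_finsum_swap (hκ : κ.transpose = -κ) (ha : (dmat θ Aa).det ≠ 0)
    (hb : (dmat θ Ab).det ≠ 0) (hB : (Ab - Aa).det ≠ 0)
    (hf : f ∈ RF (dmat θ Ab) (Aa - Ab)) (hg : g ∈ RF (dmat θ Aa) (Ab - Aa)) :
    trF θ Ab (conv θ (phase θ κ Ab Aa Ab) g f) =
      ∑ᶠ q : (Fin n → ℤ) ⧸ latticeImage (Ab - Aa), ∫ X, refl θ f (rep q) X * g (rep q) X := by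
  have := finite_quotient hB
  have := Fintype.ofFinite ((Fin n → ℤ) ⧸ latticeImage (Ab - Aa))
  have hk : ∀ Y, ∑' u, pairKer θ (dmat θ Ab) g f u Y = ∑' u, pairKer θ (dmat θ Ab) g f (-u) Y :=
    fun Y => ((Equiv.neg (Fin n → ℤ)).tsum_eq _).symm
  have he : Eqv 1 (Ab - Aa) (fun u Y => pairKer θ (dmat θ Ab) g f (-u) Y) := by
    intro z u X
    have h1 : -(u + (Ab - Aa).mulVec z) = -u + (Aa - Ab).mulVec z := by
      rw [← neg_sub Aa Ab, Matrix.neg_mulVec]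
      abel
    beta_reduce
    rw [h1]
    exact eqv_pairKer hb ha hg hf z (-u) X
  rw [trF_conv hκ]
  simp only [hk]
  rw [setIntegral_cube_tsum (dec_pairKer hb ha hg hf).comp_neg
    (fun u => continuous_pairKer hb ha hg hf (-u)) he hB, finsum_eq_sum_of_fintype,
    finsum_eq_sum_of_fintype, Finset.mul_sum]
  refine Finset.sum_congr rfl fun q _ => ?_
  have h := integral_comp_act hb (fun X => refl θ g (-rep q) X * f (-rep q) X)
  simp only [pairKer]
  rw [h, ← mul_assoc, ← Complex.ofReal_mul, mul_inv_cancel₀ (abs_ne_zero.mpr hb),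
    Complex.ofReal_one, one_mul, ← integral_add_right_eq_self _ (sh θ (rep q))]
  congr 1
  funext X
  have h2 : X + sh θ (rep q) + sh θ (-rep q) = X := by
    rw [add_assoc, ← sh_add, add_neg_cancel, sh, vec_zero, act_zero, add_zero]
  rw [refl, refl, neg_neg, h2, mul_comm]

/-- For equal objects the lattice `B ℤⁿ` is zero and there is nothing to unfold. The terms with
indices `u` and `-u` are matched by translation invariance of the cell integral. -/
theorem trF_conv_comm_self (hκ : κ.transpose = -κ) (ha : (dmat θ Aa).det ≠ 0)
    (hf : f ∈ RF (dmat θ Aa) (Aa - Aa)) (hg : g ∈ RF (dmat θ Aa) (Aa - Aa)) :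
    trF θ Aa (conv θ (phase θ κ Aa Aa Aa) f g) = trF θ Aa (conv θ (phase θ κ Aa Aa Aa) g f) := by
  rw [trF_conv hκ, trF_conv hκ]
  congr 1
  have h1 := (dec_pairKer ha ha hf hg).hasSum_setIntegral_cube (continuous_pairKer ha ha hf hg)
  have h2 := (dec_pairKer ha ha hg hf).hasSum_setIntegral_cube (continuous_pairKer ha ha hg hf)
  rw [← (Equiv.neg (Fin n → ℤ)).hasSum_iff] at h2
  refine h1.unique ?_
  have hper : ∀ {f : (Fin n → ℤ) → E n → ℂ}, f ∈ RF (dmat θ Aa) (Aa - Aa) → ∀ (z u : Fin n → ℤ) X,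
      f u (X + act (dmat θ Aa) (vec z)) = f u X := by
    intro f hf z u X
    have := hf.2 z u X
    rwa [sub_self, Matrix.zero_mulVec, add_zero] at this
  have hfun : (fun u => ∫ X in cube n, pairKer θ (dmat θ Aa) f g u X) =
      (fun u => ∫ X in cube n, pairKer θ (dmat θ Aa) g f u X) ∘ Equiv.neg (Fin n → ℤ) := by
    funext u
    have hc : Continuous fun Y => f (-u) (act (dmat θ Aa) Y) * g u (act (dmat θ Aa) Y + sh θ (-u)) :=
      ((hf.1.comp_act _).continuous _).mul ((hg.1.continuous u).comp
        (((actL (dmat θ Aa)).continuous).add continuous_const))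
    rw [Function.comp_apply, Equiv.neg_apply]
    have h := setIntegral_cube_add hc (fun z X => by
      beta_reduce
      rw [act_add, hper hf, add_right_comm, hper hg]) (act (dmat θ Aa)⁻¹ (sh θ u))
    have h3 : ∀ X, act (dmat θ Aa) (X + act (dmat θ Aa)⁻¹ (sh θ u)) = act (dmat θ Aa) X + sh θ u := by
      intro X
      rw [act_add, act_act_inv ha]
    have h4 : ∀ X : E n, X + sh θ u + sh θ (-u) = X := by
      intro X
      rw [add_assoc, ← sh_add, add_neg_cancel, sh, vec_zero, act_zero, add_zero]
    simp only [h3, h4] at h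
    simp only [pairKer, refl, h, neg_neg]
    congr 1
    funext Y
    ring
  rw [hfun]
  exact h2

theorem eq_zero_of_setIntegral_cube {F : E n → ℂ} (hF : Continuous F) (hp : Per F)
    (hn : ∀ X, ∃ r : ℝ, 0 ≤ r ∧ F X = r) (h : ∫ X in cube n, F X = 0) (X : E n) : F X = 0 := by
  -- The given point is moved to the centre of the cube. It is then interior, so vanishing almost
  -- everywhere together with continuity yields vanishing at that point.
  let c : E n := WithLp.toLp 2 fun _ => 1 / 2
  let G : E n → ℝ := fun Y => (F (Y + (X - c))).re
  have hFG : ∀ Y, F (Y + (X - c)) = (G Y : ℂ) := by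
    intro Y
    obtain ⟨r, -, hr⟩ := hn (Y + (X - c))
    simp only [G, hr, Complex.ofReal_re]
  have hG : Continuous G := Complex.continuous_re.comp (hF.comp (by fun_prop))
  have h1 : ∫ Y in cube n, G Y = 0 := by
    have h2 := setIntegral_cube_add hF hp (X - c)
    simp only [hFG] at h2
    rw [h, integral_complex_ofReal] at h2
    exact_mod_cast h2
  have hint : IntegrableOn G (cube n) := by
    have := (Continuous.integrableOn_cube (n := n) (f := fun Y => (G Y : ℂ))
      (Complex.continuous_ofReal.comp hG)).re
    exact this
  have h2 : G =ᵐ[volume.restrict (cube n)] 0 := by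
    refine (integral_eq_zero_iff_of_nonneg (fun Y => ?_) hint).mp h1
    obtain ⟨r, hr0, hr⟩ := hn (Y + (X - c))
    simp only [G, hr, Complex.ofReal_re]
    exact hr0
  let U : Set (E n) := {x | ∀ i, x i ∈ Set.Ioo (0 : ℝ) 1}
  have hU : IsOpen U := by
    have : U = ⋂ i, (fun x : E n => x i) ⁻¹' Set.Ioo (0 : ℝ) 1 := by
      ext x; simp [U]
    rw [this]
    exact isOpen_iInter_of_finite fun i => isOpen_Ioo.preimage (by fun_prop)
  have hsub : U ⊆ cube n := fun x hx i => ⟨(hx i).1, (hx i).2.le⟩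
  have h3 : G =ᵐ[volume.restrict U] 0 := ae_restrict_of_ae_restrict_of_subset hsub h2
  have h4 := Measure.eqOn_open_of_ae_eq h3 hU hG.continuousOn continuousOn_const
  have hc : c ∈ U := fun i => by
    simp only [c]
    norm_num
  have h5 := hFG c
  rw [h4 hc] at h5
  simpa using h5

/-- The integrand becomes the sum over `u` of `|refl f|²`, a nonnegative periodic function with zero
integral, so every term vanishes. Equal objects are included. -/
theorem eq_zero_of_trF_conv (hκ : κ.transpose = -κ) (ha : (dmat θ Aa).det ≠ 0)
    (hb : (dmat θ Ab).det ≠ 0) (hf : f ∈ RF (dmat θ Ab) (Aa - Ab))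
    (h : trF θ Aa (conv θ (phase θ κ Aa Ab Aa) f (conjFam (refl θ f))) = 0) : f = 0 := by
  have hr := refl_mem ha hb hf
  have hg := conjFam_mem hr
  have hker : ∀ u Y, pairKer θ (dmat θ Aa) f (conjFam (refl θ f)) u Y =
      ((‖refl θ f u (act (dmat θ Aa) Y)‖ ^ 2 : ℝ) : ℂ) := by
    intro u Y
    rw [pairKer, conjFam, Complex.mul_conj, Complex.normSq_eq_norm_sq]
  rw [trF_conv hκ, mul_eq_zero] at h
  have h0 := h.resolve_left (by exact_mod_cast abs_ne_zero.mpr ha)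
  have hd := dec_pairKer ha hb hf hg
  have hsum : ∀ Y, Summable fun u => ‖refl θ f u (act (dmat θ Aa) Y)‖ ^ 2 := by
    intro Y
    have := hd.summable Y
    simp only [hker] at this
    exact_mod_cast this
  have h1 := eq_zero_of_setIntegral_cube
    (hd.continuous_tsum (continuous_pairKer ha hb hf hg)) ?_ ?_ h0
  · have h2 : ∀ u X, refl θ f u X = 0 := by
      intro u X
      have h3 := h1 (act (dmat θ Aa)⁻¹ X)
      simp only [hker, act_act_inv ha] at h3
      have hs := hsum (act (dmat θ Aa)⁻¹ X)
      rw [act_act_inv ha] at hs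
      rw [← Complex.ofReal_tsum] at h3
      have h4 := (hasSum_zero_iff_of_nonneg (fun u => by positivity)).mp
        ((Complex.ofReal_eq_zero.mp h3) ▸ hs.hasSum)
      have h5 := congrFun h4 u
      simpa using h5
    funext u X
    have := h2 (-u) (X + sh θ u)
    rw [refl, neg_neg, add_assoc, ← sh_add, add_neg_cancel, sh, vec_zero, act_zero, add_zero] at this
    exact this
  · intro z Y
    beta_reduce
    rw [← (Equiv.addRight ((Ab - Aa).mulVec z)).tsum_eq]
    refine tsum_congr fun u => ?_
    have := eqv_pairKer ha hb hf hg z u Y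
    rwa [one_act] at this
  · intro Y
    refine ⟨∑' u, ‖refl θ f u (act (dmat θ Aa) Y)‖ ^ 2, tsum_nonneg fun u => by positivity, ?_⟩
    rw [Complex.ofReal_tsum]
    exact tsum_congr fun u => hker u Y

end FamilyTrace

/-! ### The pre-category axioms for equivariant families -/

section FamilyCategory

open MeasureTheory

variable {n : ℕ} {Ob : Type u} {θ κ : Matrix (Fin n) (Fin n) ℝ}
  {A : Ob → Matrix (Fin n) (Fin n) ℤ}

/-- The pre-category of equivariant families. -/
def famCat (hκ : κ.transpose = -κ) (hA : ∀ a, (dmat θ (A a)).det ≠ 0) :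
    PreCategoryData n Ob (fun a b => RF (dmat θ (A a)) (A b - A a)) where
  one a := ⟨oneFam, oneFam_mem _⟩
  comp a b c := LinearMap.mk₂ ℂ
    (fun f g => ⟨conv θ (phase θ κ (A a) (A b) (A c)) f.1 g.1,
      RF.conv hκ (hA a) (hA b) (hA c) f.2 g.2⟩)
    (fun f f' g => Subtype.ext (conv_add_left f.2.1.dec f'.2.1.dec g.2.1.dec))
    (fun c f g => Subtype.ext (conv_smul_left c))
    (fun f g g' => Subtype.ext (conv_add_right f.2.1.dec g.2.1.dec g'.2.1.dec))
    (fun c f g => Subtype.ext (conv_smul_right c))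
  nabla a b j :=
    { toFun := fun f => ⟨conn θ κ (A a) (A b) j f.1, RF.conn (hA a) (hA b) j f.2⟩
      map_add' := fun f g => Subtype.ext <| by
        cases j with
        | inl p =>
          change pd p (f.1 + g.1) + _ * (f.1 + g.1) = (pd p f.1 + _ * f.1) + (pd p g.1 + _ * g.1)
          rw [pd_add f.2.1.differentiable g.2.1.differentiable, mul_add]
          abel
        | inr p => exact mul_add _ f.1 g.1
      map_smul' := fun c f => Subtype.ext <| by
        cases j with
        | inl p =>
          change pd p (c • f.1) + _ * (c • f.1) = c • (pd p f.1 + _ * f.1)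
          rw [pd_smul f.2.1.differentiable, mul_smul_comm, smul_add]
        | inr p => exact mul_smul_comm c _ f.1 }
  F a := curvMat θ κ (A a)
  Tr a :=
    { toFun := fun f => trF θ (A a) f.1
      map_add' := fun f g => by
        change trF θ (A a) (f.1 + g.1) = _
        rw [trF, trF, trF, ← mul_add, ← integral_add
          (Continuous.integrableOn_cube ((f.2.1.comp_act _).continuous 0))
          (Continuous.integrableOn_cube ((g.2.1.comp_act _).continuous 0))]
        rfl
      map_smul' := fun c f => by
        change trF θ (A a) (c • f.1) = c * _
        rw [trF, trF, mul_left_comm]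
        congr 1
        exact integral_const_mul _ _ }

/-- Only the trace symmetry distinguishes equal from distinct objects. Separation on one side comes
from the L² norm, and on the other side from the first by symmetry. -/
theorem famCat_isPreCategory (hκ : κ.transpose = -κ) (hA : ∀ a, (dmat θ (A a)).det ≠ 0)
    (hdet : ∀ a b, a ≠ b → (A b - A a).det ≠ 0) : (famCat hκ hA).IsPreCategory := by
  have hcomm : ∀ a b (f : RF (dmat θ (A b)) (A a - A b)) (g : RF (dmat θ (A a)) (A b - A a)),
      (famCat hκ hA).Tr a ((famCat hκ hA).comp a b a f g) =
        (famCat hκ hA).Tr b ((famCat hκ hA).comp b a b g f) := by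
    intro a b f g
    by_cases hab : a = b
    · subst hab
      exact trF_conv_comm_self hκ (hA a) f.2 g.2
    · exact (trF_conv_eq_finsum hκ (hA a) (hA b) (hdet a b hab) f.2 g.2).trans
        (trF_conv_eq_finsum_swap hκ (hA a) (hA b) (hdet a b hab) f.2 g.2).symm
  have hsep : ∀ a b (f : RF (dmat θ (A b)) (A a - A b)),
      (∀ g, (famCat hκ hA).Tr a ((famCat hκ hA).comp a b a f g) = 0) → f = 0 := fun a b f hf =>
    Subtype.ext (eq_zero_of_trF_conv hκ (hA a) (hA b) f.2
      (hf ⟨_, conjFam_mem (refl_mem (hA a) (hA b) f.2)⟩))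
  exact {
    comp_assoc := fun a b c e f g h => Subtype.ext
      (conv_assoc f.2.1.dec g.2.1.dec h.2.1.dec phase_cocycle)
    leibniz := fun a b c j f g => Subtype.ext (conn_conv hκ j f.2.1 g.2.1)
    one_comp := fun a b f => Subtype.ext oneFam_conv
    comp_one := fun a b f => Subtype.ext conv_oneFam
    F_skew := fun a => curvMat_skew hκ _
    curvature := fun a b i j f => Subtype.ext (conn_comm hκ i j f.2.1)
    trace_comm := hcomm
    trace_nondegenerate := fun a b => ⟨fun f hf => hsep a b f hf, fun g hg => hsep b a g fun f => by
      rw [← hcomm]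
      exact hg f⟩ }

end FamilyCategory

/-! ### Transport of pre-categories -/

namespace PreCategoryData

variable {n : ℕ} {Ob : Type u} {H H' : Ob → Ob → Type v}
  [∀ a b, AddCommGroup (H a b)] [∀ a b, Module ℂ (H a b)]
  [∀ a b, AddCommGroup (H' a b)] [∀ a b, Module ℂ (H' a b)]

/-- Transport of a pre-category along isomorphisms of the morphism spaces, up to a change of the
basis of derivations. -/
def transport (Q : PreCategoryData n Ob H') (Ψ : ∀ a b, H a b ≃ₗ[ℂ] H' a b) (σ : Idx n → Idx n)
    (ε : Idx n → ℝ) : PreCategoryData n Ob H where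
  one a := (Ψ a a).symm (Q.one a)
  comp a b c := ((Q.comp a b c).compl₁₂ (Ψ b c).toLinearMap (Ψ a b).toLinearMap).compr₂
    (Ψ a c).symm.toLinearMap
  nabla a b j := (ε j : ℂ) •
    ((Ψ a b).symm.toLinearMap ∘ₗ Q.nabla a b (σ j) ∘ₗ (Ψ a b).toLinearMap)
  F a := Matrix.of fun i j => ε i * ε j * Q.F a (σ i) (σ j)
  Tr a := Q.Tr a ∘ₗ (Ψ a a).toLinearMap

variable {Q : PreCategoryData n Ob H'} {Ψ : ∀ a b, H a b ≃ₗ[ℂ] H' a b} {σ : Idx n → Idx n}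
  {ε : Idx n → ℝ}

theorem transport_one (a : Ob) : Ψ a a ((Q.transport Ψ σ ε).one a) = Q.one a :=
  (Ψ a a).apply_symm_apply _

theorem transport_comp (a b c : Ob) (f : H b c) (g : H a b) :
    Ψ a c ((Q.transport Ψ σ ε).comp a b c f g) = Q.comp a b c (Ψ b c f) (Ψ a b g) :=
  (Ψ a c).apply_symm_apply _

theorem transport_nabla (a b : Ob) (j : Idx n) (f : H a b) :
    Ψ a b ((Q.transport Ψ σ ε).nabla a b j f) = (ε j : ℂ) • Q.nabla a b (σ j) (Ψ a b f) := by
  change Ψ a b ((ε j : ℂ) • (Ψ a b).symm _) = _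
  rw [map_smul, LinearEquiv.apply_symm_apply]
  rfl

theorem transport_Tr (a : Ob) (f : H a a) : (Q.transport Ψ σ ε).Tr a f = Q.Tr a (Ψ a a f) := rfl

/-- Each axiom can be checked after applying the injective maps `Ψ`. Relabelling and rescaling the
derivations changes the curvature matrices compatibly, by `ε i * ε j`. -/
theorem IsPreCategory.transport (hQ : Q.IsPreCategory) (Ψ : ∀ a b, H a b ≃ₗ[ℂ] H' a b)
    (σ : Idx n → Idx n) (ε : Idx n → ℝ) : (Q.transport Ψ σ ε).IsPreCategory where
  comp_assoc a b c e f g h := (Ψ a e).injective <| by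
    simp only [transport_comp, hQ.comp_assoc]
  leibniz a b c j f g := (Ψ a c).injective <| by
    simp only [transport_comp, transport_nabla, map_add, hQ.leibniz, smul_add, map_smul,
      LinearMap.smul_apply]
  one_comp a b f := (Ψ a b).injective <| by rw [transport_comp, transport_one, hQ.one_comp]
  comp_one a b f := (Ψ a b).injective <| by rw [transport_comp, transport_one, hQ.comp_one]
  F_skew a := by
    ext i j
    have := congrFun (congrFun (hQ.F_skew a) (σ i)) (σ j)
    simp only [Matrix.transpose_apply, Matrix.neg_apply] at this
    simp only [PreCategoryData.transport, Matrix.transpose_apply, Matrix.neg_apply, Matrix.of_apply,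
      this]
    ring
  curvature a b i j f := (Ψ a b).injective <| by
    simp only [transport_nabla, map_sub, map_smul]
    rw [smul_comm (ε j : ℂ) (ε i : ℂ), ← smul_sub, ← smul_sub, hQ.curvature, smul_smul, smul_smul]
    congr 1
    simp only [PreCategoryData.transport, Matrix.of_apply]
    push_cast
    ring
  trace_comm a b f g := by rw [transport_Tr, transport_Tr, transport_comp, transport_comp,
    hQ.trace_comm]
  trace_nondegenerate a b := by
    obtain ⟨h1, h2⟩ := hQ.trace_nondegenerate a b
    constructor
    · intro f hf
      rw [← (Ψ b a).map_eq_zero_iff]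
      refine h1 _ fun g => ?_
      have := hf ((Ψ a b).symm g)
      rw [LinearMap.compr₂_apply, transport_Tr, transport_comp, LinearEquiv.apply_symm_apply] at this
      exact this
    · intro g hg
      rw [← (Ψ a b).map_eq_zero_iff]
      refine h2 _ fun f => ?_
      have := hg ((Ψ b a).symm f)
      rw [LinearMap.compr₂_apply, transport_Tr, transport_comp, LinearEquiv.apply_symm_apply] at this
      exact this

end PreCategoryData

/-! ### Morphisms as equivariant families -/

section FamilyEquiv

variable {n : ℕ} {Ob : Type u} {θ : Matrix (Fin n) (Fin n) ℝ}
  {A : Ob → Matrix (Fin n) (Fin n) ℤ} {a b : Ob}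

/-- The family of functions attached to a morphism. -/
def famFun (θ : Matrix (Fin n) (Fin n) ℝ) (ξ : HomSpace A a b) : (Fin n → ℤ) → E n → ℂ :=
  tor ((dmat θ (A a))⁻¹ * θ) (dmat θ (A a))⁻¹ ξ.val.1 + unfold (dmat θ (A a)) (fn ξ)

theorem tor_zero (N D' : Matrix (Fin n) (Fin n) ℝ) : tor N D' 0 = 0 := by
  funext v X
  simp [tor]

theorem unfold_zero {B : Matrix (Fin n) (Fin n) ℤ} (D : Matrix (Fin n) (Fin n) ℝ) :
    unfold D (0 : Schw n B) = 0 := rfl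

theorem famFun_self (ξ : HomSpace A a a) :
    famFun θ ξ = tor ((dmat θ (A a))⁻¹ * θ) (dmat θ (A a))⁻¹ ξ.val.1 := by
  rw [famFun, fn, ξ.2.2 rfl, unfold_zero, add_zero]

theorem famFun_of_ne (hab : a ≠ b) (ξ : HomSpace A a b) :
    famFun θ ξ = unfold (dmat θ (A a)) (fn ξ) := by
  rw [famFun, ξ.2.1 hab, tor_zero, zero_add]

theorem famFun_mem (hA : ∀ a, (dmat θ (A a)).det ≠ 0) (hdet : ∀ a b, a ≠ b → (A b - A a).det ≠ 0)
    (ξ : HomSpace A a b) : famFun θ ξ ∈ RF (dmat θ (A a)) (A b - A a) := by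
  by_cases hab : a = b
  · subst hab
    have h := tor_mem (N := (dmat θ (A a))⁻¹ * θ) (hA a) ξ.val.1
    rw [← sub_self (A a)] at h
    rwa [famFun_self]
  · rw [famFun_of_ne hab]
    exact unfold_mem (hA a) (hdet a b hab) _

theorem tor_add (N D' : Matrix (Fin n) (Fin n) ℝ) (w w' : SchwartzSeq (Idx n)) :
    tor N D' (w + w') = tor N D' w + tor N D' w' := by
  funext v X
  rw [Pi.add_apply, Pi.add_apply]
  refine ((hasSum_tor w v X).add (hasSum_tor w' v X)).tsum_eq.symm.trans
    (tsum_congr fun k => ?_) |>.symm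
  simp only [Submodule.coe_add, Pi.add_apply]
  ring

theorem tor_smul (N D' : Matrix (Fin n) (Fin n) ℝ) (c : ℂ) (w : SchwartzSeq (Idx n)) :
    tor N D' (c • w) = c • tor N D' w := by
  funext v X
  rw [Pi.smul_apply, Pi.smul_apply, smul_eq_mul, tor, tor, ← tsum_mul_left]
  refine tsum_congr fun k => ?_
  simp only [Submodule.coe_smul, Pi.smul_apply, smul_eq_mul]
  ring

theorem coeff_eq (hA : (dmat θ (A a)).det ≠ 0) (ξ : HomSpace A a a) (k v : Fin n → ℤ) :
    torusCoeff (fun Y => famFun θ ξ v (act (dmat θ (A a)) Y)) k =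
      coeff ξ (idx k v) * e ((1 / 2) * ⟪vec k, act ((dmat θ (A a))⁻¹ * θ) (vec v)⟫) := by
  rw [famFun_self]
  exact tor_coeff hA _ k v

theorem eval_fn_eq (hab : a ≠ b) (ξ : HomSpace A a b) (μ : Fin n → ℤ) (x : E n) :
    (fn ξ).eval μ x =
      famFun θ ξ μ (x + act (dmat θ (A a) * (toReal (A b - A a))⁻¹) (vec μ)) := by
  rw [famFun_of_ne hab]
  exact eval_eq_unfold _ _ _

/-- Morphisms are equivalent to equivariant families. -/
def famEquiv (hA : ∀ a, (dmat θ (A a)).det ≠ 0) (hdet : ∀ a b, a ≠ b → (A b - A a).det ≠ 0)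
    (a b : Ob) : HomSpace A a b ≃ₗ[ℂ] RF (dmat θ (A a)) (A b - A a) :=
  LinearEquiv.ofBijective
    { toFun := fun ξ => ⟨famFun θ ξ, famFun_mem hA hdet ξ⟩
      map_add' := fun ξ ζ => Subtype.ext <| by
        change tor _ _ (ξ.val.1 + ζ.val.1) + _ = (tor _ _ ξ.val.1 + _) + (tor _ _ ζ.val.1 + _)
        rw [tor_add, add_add_add_comm]
        rfl
      map_smul' := fun c ξ => Subtype.ext <| by
        change tor _ _ (c • ξ.val.1) + _ = c • (tor _ _ ξ.val.1 + _)
        rw [tor_smul, smul_add]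
        rfl } <| by
    constructor
    · intro ξ ζ h
      have h' : famFun θ ξ = famFun θ ζ := congrArg Subtype.val h
      refine homSpace_ext ?_ ?_
      · rintro rfl m
        have h1 := coeff_eq (hA a) ξ (fun i => m (Sum.inl i)) (fun i => m (Sum.inr i))
        rw [h', coeff_eq (hA a) ζ] at h1
        have h2 := mul_right_cancel₀ (e_ne_zero _) h1
        rwa [idx_eta, eq_comm] at h2
      · intro hab μ x
        rw [eval_fn_eq (θ := θ) hab, eval_fn_eq (θ := θ) hab, h']
    · rintro ⟨f, hf⟩
      by_cases hab : a = b
      · subst hab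
        have hf' := hf
        rw [sub_self] at hf'
        obtain ⟨w, hw⟩ := exists_tor_eq (N := (dmat θ (A a))⁻¹ * θ) (hA a) hf'
        refine ⟨⟨(w, 0), fun h => absurd rfl h, fun _ => rfl⟩, Subtype.ext ?_⟩
        change famFun θ _ = f
        rw [famFun_self]
        exact hw
      · obtain ⟨ξ, hξ⟩ := exists_unfold_eq (hA a) (hdet a b hab) hf
        refine ⟨⟨(0, ξ), fun _ => rfl, fun h => absurd h hab⟩, Subtype.ext ?_⟩
        change famFun θ _ = f
        rw [famFun_of_ne hab]
        exact hξ

end FamilyEquiv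

/-! ### The pairing in terms of its zeroth coefficient -/

section Pairing

open MeasureTheory

variable {n : ℕ} {Ob : Type u} {A : Ob → Matrix (Fin n) (Fin n) ℤ} {D : Deformation n}

/-- The generator `U_m`. -/
def gen (a : Ob) (m : Idx n → ℤ) : HomSpace A a a :=
  ⟨(⟨Pi.single m 1, fun N => ⟨(1 + ‖m‖) ^ N, fun l => by
    by_cases h : l = m
    · subst h; simp
    · rw [Pi.single_eq_of_ne h, norm_zero, mul_zero]; positivity⟩⟩, 0),
    fun h => absurd rfl h, fun _ => rfl⟩

theorem coeff_gen (a : Ob) (m l : Idx n → ℤ) :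
    coeff (gen (A := A) a m) l = if l = m then 1 else 0 := by
  change Pi.single (M := fun _ => ℂ) m 1 l = _
  rw [Pi.single_apply]

/-- The coefficient of `U_m` in an element `t` is the coefficient of `U_0` in `t U_{-m}`, the phase
being trivial by `hskew`. Associativity moves `U_{-m}` onto `ζ`, where the known right action
produces `ζ U_{-m}`. -/
theorem pairing_of_coeff_zero {P : PreCategoryData n Ob (fun a b => HomSpace A a b)}
    (hassoc : ∀ a b c e (ξ : HomSpace A c e) (ζ : HomSpace A b c) (χ : HomSpace A a b),
      P.comp a b e (P.comp b c e ξ ζ) χ = P.comp a c e ξ (P.comp a b c ζ χ))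
    (htorus : ∀ (a : Ob) (u w : HomSpace A a a) (m : Idx n → ℤ),
      HasSum (fun l : Idx n → ℤ => coeff u l * coeff w (m - l) *
        e (-(1 / 2) * Deformation.bil (D.objParam (A a)) l (m - l))) (coeff (P.comp a a a u w) m))
    (hright : ∀ (a b : Ob), a ≠ b → ∀ (ξ : HomSpace A a b) (u : HomSpace A a a)
      (μ : Fin n → ℤ) (x : E n),
      HasSum (fun m : Idx n → ℤ => coeff u m * D.rightAct (A a) (A b) (fn ξ) m μ x)
        ((fn (P.comp a a b ξ u)).eval μ x))
    (hskew : ∀ a m, Deformation.bil (D.objParam (A a)) m (-m) = 0)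
    (hzero : ∀ a b, a ≠ b → ∀ (ξ : HomSpace A b a) (ζ : HomSpace A a b),
      coeff (P.comp a b a ξ ζ) 0 = ((D.traceFactor (A a))⁻¹ : ℂ) *
        ∑ᶠ q : (Fin n → ℤ) ⧸ latticeImage (A b - A a),
          ∫ x, D.mulFun ((fn ξ).eval (rep q)) ((fn ζ).eval (-rep q)) x)
    (a b : Ob) (hab : a ≠ b) (ξ : HomSpace A b a) (ζ : HomSpace A a b) (m : Idx n → ℤ) :
    coeff (P.comp a b a ξ ζ) m = D.pairCoeff (A a) (A b) (fn ξ) (fn ζ) m := by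
  have h1 := htorus a (P.comp a b a ξ ζ) (gen a (-m)) 0
  have h2 : (fun l : Idx n → ℤ => coeff (P.comp a b a ξ ζ) l * coeff (gen (A := A) a (-m)) (0 - l) *
      e (-(1 / 2) * Deformation.bil (D.objParam (A a)) l (0 - l))) =
      fun l => if l = m then coeff (P.comp a b a ξ ζ) m else 0 := by
    funext l
    rw [coeff_gen, zero_sub]
    simp only [neg_inj]
    split_ifs with h
    · subst h
      rw [hskew, mul_zero, e_zero, mul_one, mul_one]
    · rw [mul_zero, zero_mul]
  rw [h2] at h1
  rw [← h1.unique (hasSum_ite_eq m _), hassoc, hzero a b hab, Deformation.pairCoeff]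
  congr 1
  refine finsum_congr fun q => ?_
  congr 1
  have h3 : (fn (P.comp a a b ζ (gen a (-m)))).eval (-rep q) =
      D.rightAct (A a) (A b) (fn ζ) (-m) (-rep q) := by
    funext x
    have h4 := hright a b hab ζ (gen a (-m)) (-rep q) x
    have h5 : (fun l : Idx n → ℤ => coeff (gen (A := A) a (-m)) l *
        D.rightAct (A a) (A b) (fn ζ) l (-rep q) x) =
        fun l => if l = -m then D.rightAct (A a) (A b) (fn ζ) (-m) (-rep q) x else 0 := by
      funext l
      rw [coeff_gen]
      split_ifs with h
      · rw [h, one_mul]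
      · rw [zero_mul]
    rw [h5] at h4
    exact h4.unique (hasSum_ite_eq _ _)
  rw [h3]
  rfl

theorem finsum_rep_neg {B : Matrix (Fin n) (Fin n) ℤ} {k : (Fin n → ℤ) → ℂ}
    (hk : ∀ u v, k (u + B.mulVec v) = k u) :
    ∑ᶠ q : (Fin n → ℤ) ⧸ latticeImage B, k (rep q) =
      ∑ᶠ q : (Fin n → ℤ) ⧸ latticeImage B, k (-rep q) := by
  rw [← finsum_comp_equiv (Equiv.neg ((Fin n → ℤ) ⧸ latticeImage B))
    (f := fun q => k (-rep q))]
  refine finsum_congr fun q => ?_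
  refine (finsum_rep_eq hk (fun q => -rep (-q)) (fun q => ?_) q).symm
  rw [Submodule.Quotient.mk_neg, mk_rep, neg_neg]

end Pairing

/-! ### Convolution with torus series -/

section TorusActions

open MeasureTheory

variable {n : ℕ} {θ N D D' : Matrix (Fin n) (Fin n) ℝ}
  {φ : (Fin n → ℤ) → (Fin n → ℤ) → E n → ℝ} {f g : (Fin n → ℤ) → E n → ℂ}

theorem schwartzSeq_summable_mul (w : SchwartzSeq (Idx n)) {c : (Idx n → ℤ) → ℂ} {C : ℝ} {M : ℕ}
    (hc : ∀ m, ‖c m‖ ≤ C * (1 + ‖m‖) ^ M) : Summable fun m => w.val m * c m := by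
  obtain ⟨K, hK⟩ := w.2 (M + sumExp (Idx n))
  have hC : 0 ≤ C := by simpa using (norm_nonneg _).trans (hc 0)
  refine Summable.of_norm_bounded (summable_sumExp.mul_left (C * K)) fun m => ?_
  have hm := one_le_one_add_norm m
  rw [norm_mul]
  calc ‖w.val m‖ * ‖c m‖ ≤ ‖w.val m‖ * (C * (1 + ‖m‖) ^ M) := by gcongr; exact hc m
    _ = C * ((1 + ‖m‖) ^ (M + sumExp (Idx n)) * ‖w.val m‖) * ((1 + ‖m‖) ^ sumExp (Idx n))⁻¹ := by
      rw [pow_add]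
      field_simp
    _ ≤ _ := by gcongr; exact hK m

/-- The full series converges absolutely because `c` grows at most polynomially, so its sum may be
computed fibre by fibre over the second group of indices. -/
theorem hasSum_mul_of_fiber (w : SchwartzSeq (Idx n)) {c : (Idx n → ℤ) → ℂ} {C : ℝ} {M : ℕ}
    (hc : ∀ m, ‖c m‖ ≤ C * (1 + ‖m‖) ^ M) {g : (Fin n → ℤ) → ℂ} {s : ℂ}
    (hfib : ∀ v, HasSum (fun k => w.val (idx k v) * c (idx k v)) (g v)) (hg : HasSum g s) :
    HasSum (fun m => w.val m * c m) s := by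
  have h1 := (schwartzSeq_summable_mul w hc).hasSum
  have h2 := ((Equiv.prodComm _ _).trans idxEquiv).hasSum_iff.mpr h1
  have h3 : HasSum g _ := h2.prod_fiberwise hfib
  rwa [h3.unique hg] at h1

theorem norm_inr_le (m : Idx n → ℤ) : ‖fun i => m (Sum.inr i)‖ ≤ ‖m‖ := by
  have := norm_le_norm_idx_right (fun i => m (Sum.inl i)) (fun i => m (Sum.inr i))
  rwa [idx_eta] at this

theorem Dec.shift_bound (hf : Dec f) (X : E n) : ∃ (C : ℝ) (M : ℕ), 0 ≤ C ∧ ∀ u v : Fin n → ℤ,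
    ‖f u (X + sh θ v)‖ ≤ C * (1 + ‖v‖) ^ M := by
  obtain ⟨T, hT, hsh⟩ := exists_sh_bound θ
  obtain ⟨C, M, h⟩ := hf 0
  have hC := Dec.const_nonneg h
  refine ⟨C * ((1 + ‖X‖) * T) ^ M, M, by positivity, fun u v => ?_⟩
  have h1 := h u (X + sh θ v)
  rw [pow_zero, one_mul] at h1
  refine h1.trans ?_
  rw [mul_assoc, ← mul_pow]
  gcongr
  exact (hsh v X).trans (le_of_eq (by ring))

/-- Expanding the torus factor in its Fourier series turns the convolution into a sum over all
indices `m = (k, v)`. This is the source of the right action formulas. -/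
theorem hasSum_conv_tor (hf : Dec f) (w : SchwartzSeq (Idx n)) (ρ : Fin n → ℤ) (X : E n) :
    HasSum (fun m : Idx n → ℤ => w.val m *
      (e ((1 / 2) * ⟪vec fun i => m (Sum.inl i), act N (vec fun i => m (Sum.inr i))⟫) *
        e ⟪vec fun i => m (Sum.inl i), act D' X⟫ *
        f (ρ - fun i => m (Sum.inr i)) (X + sh θ fun i => m (Sum.inr i)) *
        e (φ (ρ - fun i => m (Sum.inr i)) (fun i => m (Sum.inr i)) X)))
      (conv θ φ f (tor N D' w) ρ X) := by
  obtain ⟨C, M, hC, h⟩ := hf.shift_bound (θ := θ) X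
  refine hasSum_mul_of_fiber w (C := C) (M := M) (fun m => ?_) (fun v => ?_)
    (hf.hasSum_conv (dec_tor w) ρ X)
  · simp only [norm_mul, norm_e, one_mul, mul_one]
    refine (h _ _).trans ?_
    gcongr
    exact norm_inr_le m
  · have h1 := ((hasSum_tor (N := N) (D' := D') w v X).mul_left
      (f (ρ - v) (X + sh θ v))).mul_right (e (φ (ρ - v) v X))
    refine h1.congr_fun fun k => ?_
    simp only [idx_inl, idx_inr]
    ring

/-- The counterpart for left actions. The torus index is now `ρ - u`, hence the reindexing by
`Equiv.subLeft`, and the characters are evaluated at the shifted point. -/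
theorem hasSum_tor_conv (hg : Dec g) (w : SchwartzSeq (Idx n)) (ρ : Fin n → ℤ) (X : E n) :
    HasSum (fun m : Idx n → ℤ => w.val m *
      (e ((1 / 2) * ⟪vec fun i => m (Sum.inl i), act N (vec fun i => m (Sum.inr i))⟫) *
        e ⟪vec fun i => m (Sum.inl i), act D' (X + sh θ (ρ - fun i => m (Sum.inr i)))⟫ *
        g (ρ - fun i => m (Sum.inr i)) X *
        e (φ (fun i => m (Sum.inr i)) (ρ - fun i => m (Sum.inr i)) X)))
      (conv θ φ (tor N D' w) g ρ X) := by
  obtain ⟨C, M, hC, h⟩ := hg.shift_bound (θ := θ) X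
  refine hasSum_mul_of_fiber w (C := C) (M := 0) (fun m => ?_) (fun v => ?_)
    ((Equiv.subLeft ρ).hasSum_iff.mpr ((dec_tor w).hasSum_conv hg ρ X))
  · simp only [norm_mul, norm_e, one_mul, mul_one, pow_zero]
    have := h (ρ - fun i => m (Sum.inr i)) 0
    rwa [sh, vec_zero, act_zero, add_zero, norm_zero, add_zero, one_pow, mul_one] at this
  · have h1 := ((hasSum_tor (N := N) (D' := D') w v (X + sh θ (ρ - v))).mul_right
      (g (ρ - v) X)).mul_right (e (φ v (ρ - v) X))
    rw [Function.comp_apply, Equiv.subLeft_apply, convTerm, sub_sub_cancel]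
    refine h1.congr_fun fun k => ?_
    simp only [idx_inl, idx_inr]
    ring

/-- Fourier coefficients of a product are convolutions; only the series of `f` is expanded under the
integral, and that of `g` is read off afterwards. -/
theorem hasSum_torusCoeff_mul {a b : (Fin n → ℤ) → ℂ} (ha : Summable fun k => ‖a k‖)
    (hb : Summable fun k => ‖b k‖) {f g : E n → ℂ} (hf : ∀ x, HasSum (fun k => a k * e ⟪vec k, x⟫) (f x))
    (hg : ∀ x, HasSum (fun k => b k * e ⟪vec k, x⟫) (g x)) (hgc : Continuous g) (k : Fin n → ℤ) :
    HasSum (fun l => a l * b (k - l)) (torusCoeff (fun Y => f Y * g Y) k) := by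
  have h1 : ∀ x, e (-⟪vec k, x⟫) * (f x * g x) =
      ∑' l, a l * (e (-⟪vec (k - l), x⟫) * g x) := fun x => by
    refine (((hf x).mul_right (e (-⟪vec k, x⟫) * g x)).tsum_eq.trans (by ring)).symm.trans
      (tsum_congr fun l => ?_)
    rw [vec_sub, inner_sub_left, neg_sub, sub_eq_add_neg, e_add]
    ring
  have hcont : ∀ l : Fin n → ℤ, Continuous fun x => e (-⟪vec (k - l), x⟫) * g x := fun l =>
    (continuous_e.comp (by fun_prop)).mul hgc
  have hint : ∀ l, Integrable (fun x => a l * (e (-⟪vec (k - l), x⟫) * g x))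
      (volume.restrict (cube n)) := fun l =>
    Continuous.integrableOn_cube (continuous_const.mul (hcont l))
  have h2 := hasSum_integral_of_summable_integral_norm hint (by
    simp only [norm_mul, norm_e, one_mul, integral_const_mul]
    exact ha.mul_right _)
  rw [torusCoeff]
  simp only [h1]
  refine h2.congr_fun fun l => ?_
  rw [integral_const_mul, ← torusCoeff_of_hasSum hb hg (k - l), torusCoeff]

theorem Dec.convTerm (hf : Dec f) (hg : Dec g) (ρ : Fin n → ℤ) :
    Dec fun u X => convTerm θ φ f g ρ u X := by
  obtain ⟨T, hT, hsh⟩ := exists_sh_bound θ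
  intro K
  obtain ⟨C1, M1, h1⟩ := hf 0
  obtain ⟨C2, M2, h2⟩ := hg (K + M1)
  have hC1 := Dec.const_nonneg h1
  have hC2 := Dec.const_nonneg h2
  refine ⟨C1 * T ^ M1 * C2, M1 + M2, fun u X => ?_⟩
  rw [norm_convTerm]
  have h3 := h1 (ρ - u) (X + sh θ u)
  rw [pow_zero, one_mul] at h3
  have h4 : (1 + ‖X + sh θ u‖) ^ M1 ≤ ((1 + ‖X‖) * (T * (1 + ‖u‖))) ^ M1 := by
    gcongr; exact hsh u X
  calc (1 + ‖u‖) ^ K * (‖f (ρ - u) (X + sh θ u)‖ * ‖g u X‖) ≤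
      (1 + ‖u‖) ^ K * ((C1 * ((1 + ‖X‖) * (T * (1 + ‖u‖))) ^ M1) * ‖g u X‖) := by
        gcongr; exact h3.trans (by gcongr)
    _ = C1 * T ^ M1 * (1 + ‖X‖) ^ M1 * ((1 + ‖u‖) ^ (K + M1) * ‖g u X‖) := by
        rw [mul_pow, mul_pow, pow_add]; ring
    _ ≤ C1 * T ^ M1 * (1 + ‖X‖) ^ M1 * (C2 * (1 + ‖X‖) ^ M2) :=
        mul_le_mul_of_nonneg_left (h2 u X) (by positivity)
    _ = _ := by rw [pow_add]; ring

theorem Dec.of_norm_le (hf : Dec f) (h : ∀ u X, ‖g u X‖ ≤ ‖f u X‖) : Dec g := fun N => by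
  obtain ⟨C, M, hC⟩ := hf N
  exact ⟨C, M, fun u X => (mul_le_mul_of_nonneg_left (h u X) (by positivity)).trans (hC u X)⟩

theorem continuous_tor (w : SchwartzSeq (Idx n)) (v : Fin n → ℤ) : Continuous (tor N D' w v) :=
  continuous_iff_continuousAt.mpr fun X => (hasFDerivAt_tor w v X).continuousAt

theorem norm_apply_le (w : SchwartzSeq (Idx n)) : ∃ C : ℝ, ∀ m, ‖w.val m‖ ≤ C := by
  obtain ⟨C, hC⟩ := w.2 0
  exact ⟨C, fun m => by simpa using hC m⟩

/-- The Fourier coefficients of the convolution of two torus series. -/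
theorem hasSum_torusCoeff_conv_tor (hD : D.det ≠ 0) (hN : D⁻¹ * θ = N) (u w : SchwartzSeq (Idx n))
    {ψ : (Fin n → ℤ) → (Fin n → ℤ) → ℝ} (hφ : ∀ v v' X, φ v v' X = ψ v v') (k ρ : Fin n → ℤ) :
    HasSum (fun l : Idx n → ℤ => u.val l * (w.val (idx k ρ - l) *
      e ((1 / 2) * ⟪vec fun i => l (Sum.inl i), act N (vec (ρ - fun i => l (Sum.inr i)))⟫ -
        (1 / 2) * ⟪vec (k - fun i => l (Sum.inl i)), act N (vec fun i => l (Sum.inr i))⟫ +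
        ψ (fun i => l (Sum.inr i)) (ρ - fun i => l (Sum.inr i)))))
      (e (-((1 / 2) * ⟪vec k, act N (vec ρ)⟫)) *
        torusCoeff (fun Y => conv θ φ (tor N D⁻¹ u) (tor N D⁻¹ w) ρ (act D Y)) k) := by
  obtain ⟨C, hC⟩ := norm_apply_le w
  -- The integrand of the Fourier coefficient before summation over `v`; its rapid decrease allows
  -- the sum and the integral to be exchanged.
  let F : (Fin n → ℤ) → E n → ℂ := fun v Y => e (-⟪vec k, Y⟫) *
    convTerm θ φ (tor N D⁻¹ u) (tor N D⁻¹ w) ρ v (act D Y)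
  have hF : Dec F := (((dec_tor u).convTerm (dec_tor w) ρ).comp_act D).of_norm_le
    fun v Y => by rw [norm_mul, norm_e, one_mul]
  have hFc : ∀ v, Continuous (F v) := fun v => by
    simp only [F, convTerm, hφ]
    exact (continuous_e.comp (by fun_prop)).mul
      ((((continuous_tor u _).comp (((actL D).continuous).add continuous_const)).mul
        ((continuous_tor w _).comp (actL D).continuous)).mul continuous_const)
  have hsum := hF.hasSum_setIntegral_cube hFc
  have hF' : ∫ Y in cube n, ∑' v, F v Y =
      torusCoeff (fun Y => conv θ φ (tor N D⁻¹ u) (tor N D⁻¹ w) ρ (act D Y)) k := by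
    rw [torusCoeff]
    simp only [F, tsum_mul_left]
    rfl
  rw [hF'] at hsum
  refine hasSum_mul_of_fiber u (C := C) (M := 0) (fun m => ?_) (fun v => ?_)
    ((Equiv.subLeft ρ).hasSum_iff.mpr (hsum.mul_left _))
  · rw [norm_mul, norm_e, pow_zero, mul_one, mul_one]
    exact hC _
  · rw [Function.comp_apply, Equiv.subLeft_apply]
    have h1 : ∫ Y in cube n, F (ρ - v) Y = e (ψ v (ρ - v)) * torusCoeff (fun Y =>
        tor N D⁻¹ u v (act D Y + sh θ (ρ - v)) * tor N D⁻¹ w (ρ - v) (act D Y)) k := by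
      rw [torusCoeff, ← integral_const_mul]
      refine integral_congr_ae (Filter.Eventually.of_forall fun Y => ?_)
      simp only [F, convTerm, hφ, sub_sub_cancel]
      ring
    have h2 := hasSum_torusCoeff_mul
      (a := fun l => u.val (idx l v) * e ((1 / 2) * ⟪vec l, act N (vec v)⟫) *
        e ⟪vec l, act N (vec (ρ - v))⟫)
      (b := fun l => w.val (idx l (ρ - v)) * e ((1 / 2) * ⟪vec l, act N (vec (ρ - v))⟫))
      (f := fun Y => tor N D⁻¹ u v (act D Y + sh θ (ρ - v)))
      (g := fun Y => tor N D⁻¹ w (ρ - v) (act D Y))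
      (by simpa [norm_mul] using schwartzSeq_summable_norm_idx u v)
      (by simpa [norm_mul] using schwartzSeq_summable_norm_idx w (ρ - v))
      (fun Y => by
        refine (hasSum_tor (N := N) (D' := D⁻¹) u v (act D Y + sh θ (ρ - v))).congr_fun fun l => ?_
        rw [act_add, act_inv_act hD, sh, ← act_mul, hN, inner_add_right, e_add]
        ring)
      (fun Y => by
        refine (hasSum_tor (N := N) (D' := D⁻¹) w (ρ - v) (act D Y)).congr_fun fun l => ?_
        rw [act_inv_act hD])
      ((continuous_tor w _).comp (actL D).continuous) k
    rw [h1]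
    refine ((h2.mul_left _).mul_left _).congr_fun fun l => ?_
    simp only [idx_inl, idx_inr]
    have h3 : idx k ρ - idx l v = idx (k - l) (ρ - v) := by
      ext i
      cases i <;> rfl
    -- The shift by `θ(ρ - v)` contributes `⟨l, N(ρ - v)⟩`. Together with the half phases of the
    -- factors and minus that of the product, it leaves `½⟨l, N(ρ - v)⟩ - ½⟨k - l, N v⟩`, as the
    -- symmetric ordering of the generators requires.
    have h4 : e ((1 / 2) * ⟪vec l, act N (vec (ρ - v))⟫ - (1 / 2) * ⟪vec (k - l), act N (vec v)⟫ +
        ψ v (ρ - v)) = e (-((1 / 2) * ⟪vec k, act N (vec ρ)⟫)) * (e (ψ v (ρ - v)) *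
        (e ((1 / 2) * ⟪vec l, act N (vec v)⟫) * e ⟪vec l, act N (vec (ρ - v))⟫ *
          e ((1 / 2) * ⟪vec (k - l), act N (vec (ρ - v))⟫))) := by
      simp only [← e_add, vec_sub, act_sub, inner_sub_left, inner_sub_right]
      congr 1
      ring
    rw [h3, h4]
    ring

end TorusActions

/-! ### The pre-category of families in terms of Schwartz functions -/

section FamilyModel

open MeasureTheory

variable {n : ℕ} {Ob : Type u} {θ κ : Matrix (Fin n) (Fin n) ℝ}
  {A : Ob → Matrix (Fin n) (Fin n) ℤ} {a b c : Ob}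

/-- The pre-category structure on the spaces of morphisms coming from equivariant families. -/
def famModel (hκ : κ.transpose = -κ) (hA : ∀ a, (dmat θ (A a)).det ≠ 0)
    (hdet : ∀ a b, a ≠ b → (A b - A a).det ≠ 0) :
    PreCategoryData n Ob (fun a b => HomSpace A a b) :=
  (famCat hκ hA).transport (famEquiv hA hdet) id fun _ => 1

theorem famFun_comp (hκ : κ.transpose = -κ) (hA : ∀ a, (dmat θ (A a)).det ≠ 0)
    (hdet : ∀ a b, a ≠ b → (A b - A a).det ≠ 0) (ξ : HomSpace A b c) (ζ : HomSpace A a b) :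
    famFun θ ((famModel hκ hA hdet).comp a b c ξ ζ) =
      conv θ (phase θ κ (A a) (A b) (A c)) (famFun θ ξ) (famFun θ ζ) :=
  congrArg Subtype.val (PreCategoryData.transport_comp (H := fun a b => HomSpace A a b)
    (H' := fun a b => RF (dmat θ (A a)) (A b - A a)) (Q := famCat hκ hA) (Ψ := famEquiv hA hdet) (σ := id) (ε := fun _ => 1) a b c ξ ζ)

theorem famFun_nabla (hκ : κ.transpose = -κ) (hA : ∀ a, (dmat θ (A a)).det ≠ 0)
    (hdet : ∀ a b, a ≠ b → (A b - A a).det ≠ 0) (j : Idx n) (ξ : HomSpace A a b) :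
    famFun θ ((famModel hκ hA hdet).nabla a b j ξ) = conn θ κ (A a) (A b) j (famFun θ ξ) := by
  have := congrArg Subtype.val (PreCategoryData.transport_nabla (H := fun a b => HomSpace A a b)
    (H' := fun a b => RF (dmat θ (A a)) (A b - A a)) (Q := famCat hκ hA) (Ψ := famEquiv hA hdet) (σ := id) (ε := fun _ => 1) a b j ξ)
  rw [Complex.ofReal_one, one_smul] at this
  exact this

theorem famFun_one (hκ : κ.transpose = -κ) (hA : ∀ a, (dmat θ (A a)).det ≠ 0)
    (hdet : ∀ a b, a ≠ b → (A b - A a).det ≠ 0) :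
    famFun θ ((famModel hκ hA hdet).one a) = oneFam :=
  congrArg Subtype.val (PreCategoryData.transport_one (H := fun a b => HomSpace A a b)
    (H' := fun a b => RF (dmat θ (A a)) (A b - A a)) (Q := famCat hκ hA) (Ψ := famEquiv hA hdet) (σ := id) (ε := fun _ => 1) a)

theorem famFun_injective (hA : ∀ a, (dmat θ (A a)).det ≠ 0)
    (hdet : ∀ a b, a ≠ b → (A b - A a).det ≠ 0) {ξ ζ : HomSpace A a b}
    (h : famFun θ ξ = famFun θ ζ) : ξ = ζ := (famEquiv hA hdet a b).injective (Subtype.ext h)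

theorem famFun_gen_zero : famFun θ (gen (A := A) a 0) = oneFam := by
  funext v X
  rw [famFun_self, tor, tsum_eq_single 0]
  · change coeff (gen (A := A) a 0) (idx 0 v) * _ * _ = _
    rw [coeff_gen, vec_zero, inner_zero_left, inner_zero_left, mul_zero, e_zero, mul_one, mul_one,
      oneFam]
    congr 1
    refine propext ⟨fun h => funext fun i => congrFun h (Sum.inr i), ?_⟩
    rintro rfl
    ext i
    cases i <;> rfl
  · intro k hk
    change coeff (gen (A := A) a 0) (idx k v) * _ * _ = _
    rw [coeff_gen, if_neg, zero_mul, zero_mul]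
    exact fun h => hk (funext fun i => congrFun h (Sum.inl i))

theorem famModel_one (hκ : κ.transpose = -κ) (hA : ∀ a, (dmat θ (A a)).det ≠ 0)
    (hdet : ∀ a b, a ≠ b → (A b - A a).det ≠ 0) (a : Ob) (m : Idx n → ℤ) :
    coeff ((famModel hκ hA hdet).one a) m = Pi.single (M := fun _ => ℂ) (0 : Idx n → ℤ) 1 m := by
  have : (famModel hκ hA hdet).one a = gen a 0 :=
    famFun_injective hA hdet ((famFun_one hκ hA hdet).trans famFun_gen_zero.symm)
  rw [this]
  rfl

theorem coeff_eq_torusCoeff (hA : (dmat θ (A a)).det ≠ 0) (ξ : HomSpace A a a) (m : Idx n → ℤ) :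
    coeff ξ m = e (-((1 / 2) * ⟪vec fun i => m (Sum.inl i),
      act ((dmat θ (A a))⁻¹ * θ) (vec fun i => m (Sum.inr i))⟫)) *
      torusCoeff (fun Y => famFun θ ξ (fun i => m (Sum.inr i)) (act (dmat θ (A a)) Y))
        (fun i => m (Sum.inl i)) := by
  rw [coeff_eq hA, idx_eta, mul_left_comm, ← e_add, neg_add_cancel, e_zero, mul_one]

theorem lin_diag {Aa : Matrix (Fin n) (Fin n) ℤ} (v : Fin n → ℤ) (X : E n) :
    lin θ Aa Aa v X = act (1 - kmat θ Aa * θ) (vec v) := by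
  rw [lin, sub_self, zero_act, zero_add]

theorem famModel_torus (hκ : κ.transpose = -κ) (hA : ∀ a, (dmat θ (A a)).det ≠ 0)
    (hdet : ∀ a b, a ≠ b → (A b - A a).det ≠ 0) (u w : HomSpace A a a) (m : Idx n → ℤ) :
    HasSum (fun l : Idx n → ℤ => coeff u l * coeff w (m - l) *
      e ((1 / 2) * ⟪vec fun i => l (Sum.inl i),
          act ((dmat θ (A a))⁻¹ * θ) (vec fun i => (m - l) (Sum.inr i))⟫ -
        (1 / 2) * ⟪vec fun i => (m - l) (Sum.inl i),
          act ((dmat θ (A a))⁻¹ * θ) (vec fun i => l (Sum.inr i))⟫ +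
        (1 / 2) * ⟪act (1 - kmat θ (A a) * θ) (vec fun i => l (Sum.inr i)),
          act κ (act (1 - kmat θ (A a) * θ) (vec fun i => (m - l) (Sum.inr i)))⟫))
      (coeff ((famModel hκ hA hdet).comp a a a u w) m) := by
  have h := hasSum_torusCoeff_conv_tor (θ := θ) (N := (dmat θ (A a))⁻¹ * θ) (φ := phase θ κ (A a) (A a) (A a)) (hA a) rfl u.val.1 w.val.1
    (ψ := fun v v' => (1 / 2) * ⟪act (1 - kmat θ (A a) * θ) (vec v),
          act κ (act (1 - kmat θ (A a) * θ) (vec v'))⟫) (fun v v' X => by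
      simp only [phase, lin_diag]) (fun i => m (Sum.inl i))
    (fun i => m (Sum.inr i))
  rw [coeff_eq_torusCoeff (hA a), famFun_comp, famFun_self, famFun_self]
  refine h.congr_fun fun l => ?_
  rw [idx_eta, mul_assoc]
  rfl

theorem dmat_mul_inv_eq (hab : (A b - A a).det ≠ 0) :
    θ + dmat θ (A a) * (toReal (A b - A a))⁻¹ = dmat θ (A b) * (toReal (A b - A a))⁻¹ := by
  rw [dmat_eq_add (Aa := A a) (Ab := A b), Matrix.add_mul, Matrix.mul_assoc θ,
    Matrix.mul_nonsing_inv _ (isUnit_iff_ne_zero.mpr (det_toReal_ne_zero hab)), Matrix.mul_one,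
    add_comm]

theorem sh_add_act (hab : (A b - A a).det ≠ 0) (v : Fin n → ℤ) :
    sh θ v + act (dmat θ (A a) * (toReal (A b - A a))⁻¹) (vec v) =
      act (dmat θ (A b) * (toReal (A b - A a))⁻¹) (vec v) := by
  rw [sh, ← add_act, dmat_mul_inv_eq hab]

/-- The matrix identity behind equivariance, multiplied by `A_ab⁻¹`, cancels the dependence on `μ`.
In terms of Schwartz functions `L_ab` is therefore just `(K_a - K_b)` applied to the coordinate `y`.
-/
theorem lin_unfold (hab : (A b - A a).det ≠ 0) (ha : (dmat θ (A a)).det ≠ 0)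
    (hb : (dmat θ (A b)).det ≠ 0) (μ : Fin n → ℤ) (y : E n) :
    lin θ (A a) (A b) μ (y + act (dmat θ (A a) * (toReal (A b - A a))⁻¹) (vec μ)) =
      act (kmat θ (A a) - kmat θ (A b)) y := by
  have h : (kmat θ (A a) - kmat θ (A b)) * dmat θ (A a) +
      (1 - kmat θ (A b) * θ) * toReal (A b - A a) = 0 := by
    have h1 : kmat θ (A b) * dmat θ (A a) =
        toReal (A b) - kmat θ (A b) * θ * toReal (A b - A a) := by
      rw [← kmat_mul_dmat hb, dmat_eq_add (Aa := A a) (Ab := A b), Matrix.mul_add,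
        ← Matrix.mul_assoc]
      abel
    rw [Matrix.sub_mul, Matrix.sub_mul, kmat_mul_dmat ha, h1, toReal_sub, Matrix.one_mul]
    abel
  have h2 : (kmat θ (A a) - kmat θ (A b)) * (dmat θ (A a) * (toReal (A b - A a))⁻¹) +
      (1 - kmat θ (A b) * θ) = 0 := by
    have h3 := congrArg (· * (toReal (A b - A a))⁻¹) h
    beta_reduce at h3
    rwa [Matrix.add_mul, Matrix.mul_assoc, Matrix.mul_assoc (1 - _), Matrix.mul_nonsing_inv _
      (isUnit_iff_ne_zero.mpr (det_toReal_ne_zero hab)), Matrix.mul_one, Matrix.zero_mul] at h3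
  have h4 := congrArg (fun M => act M (vec μ)) h2
  beta_reduce at h4
  rw [add_act, act_mul (kmat θ (A a) - kmat θ (A b)), zero_act] at h4
  rw [lin, act_add, add_assoc, h4, add_zero]

theorem famModel_right (hκ : κ.transpose = -κ) (hA : ∀ a, (dmat θ (A a)).det ≠ 0)
    (hdet : ∀ a b, a ≠ b → (A b - A a).det ≠ 0) (hab : a ≠ b) (ξ : HomSpace A a b)
    (u : HomSpace A a a) (μ : Fin n → ℤ) (x : E n) :
    HasSum (fun m : Idx n → ℤ => coeff u m *
      (e ((1 / 2) * ⟪vec fun i => m (Sum.inl i),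
          act ((dmat θ (A a))⁻¹ * θ) (vec fun i => m (Sum.inr i))⟫) *
        e ⟪vec fun i => m (Sum.inl i),
          act (dmat θ (A a))⁻¹ x + act (toReal (A b - A a))⁻¹ (vec μ)⟫ *
        (fn ξ).eval (μ - fun i => m (Sum.inr i))
          (x + act (dmat θ (A b) * (toReal (A b - A a))⁻¹) (vec fun i => m (Sum.inr i))) *
        e ((1 / 2) * ⟪act (kmat θ (A a) - kmat θ (A b))
            (x + act (dmat θ (A b) * (toReal (A b - A a))⁻¹) (vec fun i => m (Sum.inr i))),
          act κ (act (1 - kmat θ (A a) * θ) (vec fun i => m (Sum.inr i)))⟫)))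
      ((fn ((famModel hκ hA hdet).comp a a b ξ u)).eval μ x) := by
  rw [eval_fn_eq (θ := θ) hab, famFun_comp, famFun_self u]
  refine (hasSum_conv_tor (famFun_mem hA hdet ξ).1.dec u.val.1 μ _).congr_fun fun m => ?_
  generalize (fun i => m (Sum.inr i)) = v
  -- The shift by `θ v` and the change of base point from `μ` to `μ - v` combine, since `θ + D_a
  -- A_ab⁻¹ = D_b A_ab⁻¹`. This explains why the factor for `b` appears in an action of the torus of
  -- `a`.
  have h1 : x + act (dmat θ (A a) * (toReal (A b - A a))⁻¹) (vec μ) + sh θ v =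
      x + act (dmat θ (A b) * (toReal (A b - A a))⁻¹) (vec v) +
        act (dmat θ (A a) * (toReal (A b - A a))⁻¹) (vec (μ - v)) := by
    rw [← sh_add_act (hdet a b hab), vec_sub, act_sub]
    abel
  have h2 : act (dmat θ (A a))⁻¹ (x + act (dmat θ (A a) * (toReal (A b - A a))⁻¹) (vec μ)) =
      act (dmat θ (A a))⁻¹ x + act (toReal (A b - A a))⁻¹ (vec μ) := by
    rw [act_add, act_mul, act_inv_act (hA a)]
  rw [phase, h1, h2, lin_unfold (hdet a b hab) (hA a) (hA b), ← eval_fn_eq hab, lin_diag]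
  rfl

theorem famModel_left (hκ : κ.transpose = -κ) (hA : ∀ a, (dmat θ (A a)).det ≠ 0)
    (hdet : ∀ a b, a ≠ b → (A b - A a).det ≠ 0) (hab : a ≠ b) (u : HomSpace A b b)
    (ξ : HomSpace A a b) (μ : Fin n → ℤ) (x : E n) :
    HasSum (fun m : Idx n → ℤ => coeff u m *
      (e (-(1 / 2) * ⟪vec fun i => m (Sum.inl i),
          act ((dmat θ (A b))⁻¹ * θ) (vec fun i => m (Sum.inr i))⟫) *
        e ⟪vec fun i => m (Sum.inl i),
          act (dmat θ (A b))⁻¹ x + act (toReal (A b - A a))⁻¹ (vec μ)⟫ *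
        (fn ξ).eval (μ - fun i => m (Sum.inr i))
          (x + act (dmat θ (A a) * (toReal (A b - A a))⁻¹) (vec fun i => m (Sum.inr i))) *
        e ((1 / 2) * ⟪act (1 - kmat θ (A b) * θ) (vec fun i => m (Sum.inr i)),
          act κ (act (kmat θ (A a) - kmat θ (A b))
            (x + act (dmat θ (A a) * (toReal (A b - A a))⁻¹) (vec fun i => m (Sum.inr i))))⟫)))
      ((fn ((famModel hκ hA hdet).comp a b b u ξ)).eval μ x) := by
  rw [eval_fn_eq (θ := θ) hab, famFun_comp, famFun_self u]
  refine (hasSum_tor_conv (famFun_mem hA hdet ξ).1.dec u.val.1 μ _).congr_fun fun m => ?_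
  generalize (fun i => m (Sum.inr i)) = v
  generalize (fun i => m (Sum.inl i)) = k
  have h1 : x + act (dmat θ (A a) * (toReal (A b - A a))⁻¹) (vec μ) =
      x + act (dmat θ (A a) * (toReal (A b - A a))⁻¹) (vec v) +
        act (dmat θ (A a) * (toReal (A b - A a))⁻¹) (vec (μ - v)) := by
    rw [vec_sub, act_sub]
    abel
  have h2 : act (dmat θ (A b))⁻¹ (x + act (dmat θ (A a) * (toReal (A b - A a))⁻¹) (vec μ) +
      sh θ (μ - v)) = act (dmat θ (A b))⁻¹ x + act (toReal (A b - A a))⁻¹ (vec μ) -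
      act ((dmat θ (A b))⁻¹ * θ) (vec v) := by
    have h3 : x + act (dmat θ (A a) * (toReal (A b - A a))⁻¹) (vec μ) + sh θ (μ - v) =
        x + act (dmat θ (A b) * (toReal (A b - A a))⁻¹) (vec μ) - sh θ v := by
      rw [← sh_add_act (hdet a b hab), sh, vec_sub, act_sub, sh, sh]
      abel
    rw [h3, act_sub, act_add, act_mul, act_inv_act (hA b), act_mul _ θ]
    rfl
  rw [h2, phase, lin_diag, h1, lin_unfold (hdet a b hab) (hA a) (hA b),
    ← eval_fn_eq hab, inner_sub_right]
  -- The shift produces a full phase `-⟨k, N v⟩`, which reverses the sign of the half phase built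
  -- into `tor`.
  have h5 : ∀ s t : ℝ, e ((1 / 2) * t) * e (s - t) = e (-(1 / 2) * t) * e s := fun s t => by
    rw [← e_add, ← e_add]
    congr 1
    ring
  rw [h5]
  rfl

theorem famModel_general (hκ : κ.transpose = -κ) (hA : ∀ a, (dmat θ (A a)).det ≠ 0)
    (hdet : ∀ a b, a ≠ b → (A b - A a).det ≠ 0) (hab : a ≠ b) (hbc : b ≠ c) (hac : a ≠ c)
    (ξ : HomSpace A b c) (ζ : HomSpace A a b) (ρ : Fin n → ℤ) (x : E n) :
    HasSum (fun u : Fin n → ℤ =>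
      let w : E n := vec u - act (toReal (A b - A a) * (toReal (A c - A a))⁻¹) (vec ρ)
      let x' := x + act (dmat θ (A c) * (toReal (A c - A b))⁻¹) w
      let x'' := x - act (dmat θ (A a) * (toReal (A b - A a))⁻¹) w
      (fn ξ).eval (-u + ρ) x' * (fn ζ).eval u x'' *
        e ((1 / 2) * ⟪act (kmat θ (A b) - kmat θ (A c)) x',
          act κ (act (kmat θ (A a) - kmat θ (A b)) x'')⟫))
      ((fn ((famModel hκ hA hdet).comp a b c ξ ζ)).eval ρ x) := by
  rw [eval_fn_eq (θ := θ) hac, famFun_comp]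
  refine ((famFun_mem hA hdet ξ).1.dec.hasSum_conv (famFun_mem hA hdet ζ).1.dec ρ _).congr_fun
    fun u => ?_
  simp only
  set w : E n := vec u - act (toReal (A b - A a) * (toReal (A c - A a))⁻¹) (vec ρ) with hw
  have hBab := isUnit_iff_ne_zero.mpr (det_toReal_ne_zero (hdet a b hab))
  have hBbc := isUnit_iff_ne_zero.mpr (det_toReal_ne_zero (hdet b c hbc))
  have hBac := isUnit_iff_ne_zero.mpr (det_toReal_ne_zero (hdet a c hac))
  set X := x + act (dmat θ (A a) * (toReal (A c - A a))⁻¹) (vec ρ) with hX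
  -- Base points: `X` is `x''` plus the base point of `u` in `Hom(a, b)`, and below `X + θ u` is
  -- `x'` plus the base point of `ρ - u` in `Hom(b, c)`.
  have h1 : X = x - act (dmat θ (A a) * (toReal (A b - A a))⁻¹) w +
      act (dmat θ (A a) * (toReal (A b - A a))⁻¹) (vec u) := by
    have h3 : dmat θ (A a) * (toReal (A b - A a))⁻¹ * (toReal (A b - A a) *
        (toReal (A c - A a))⁻¹) = dmat θ (A a) * (toReal (A c - A a))⁻¹ := by
      rw [Matrix.mul_assoc, ← Matrix.mul_assoc _ (toReal (A b - A a)),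
        Matrix.nonsing_inv_mul _ hBab, Matrix.one_mul]
    rw [hw, act_sub, ← act_mul, h3, hX]
    abel
  have h2 : X + sh θ u = x + act (dmat θ (A c) * (toReal (A c - A b))⁻¹) w +
      act (dmat θ (A b) * (toReal (A c - A b))⁻¹) (vec (ρ - u)) := by
    -- Obtained by splitting `A_ac = A_bc + A_ab` in `D_b A_bc⁻¹ A_ac` and using `D_b = D_a + θ
    -- A_ab` with `θ + D_b A_bc⁻¹ = D_c A_bc⁻¹`.
    have h4 : dmat θ (A b) * (toReal (A c - A b))⁻¹ = dmat θ (A a) * (toReal (A c - A a))⁻¹ +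
        dmat θ (A c) * (toReal (A c - A b))⁻¹ * (toReal (A b - A a) * (toReal (A c - A a))⁻¹) := by
      have h5 : dmat θ (A b) * (toReal (A c - A b))⁻¹ * toReal (A c - A a) = dmat θ (A a) +
          dmat θ (A c) * (toReal (A c - A b))⁻¹ * toReal (A b - A a) := by
        have h6 : toReal (A c - A a) = toReal (A c - A b) + toReal (A b - A a) := by
          rw [← toReal_add, sub_add_sub_cancel]
        rw [h6, Matrix.mul_add, Matrix.mul_assoc, Matrix.nonsing_inv_mul _ hBbc, Matrix.mul_one,
          ← dmat_mul_inv_eq (θ := θ) (hdet b c hbc), Matrix.add_mul, ← add_assoc,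
          ← dmat_eq_add]
      have h7 := congrArg (· * (toReal (A c - A a))⁻¹) h5
      beta_reduce at h7
      rwa [Matrix.mul_assoc, Matrix.mul_nonsing_inv _ hBac, Matrix.mul_one, Matrix.add_mul,
        Matrix.mul_assoc _ (toReal (A b - A a))] at h7
    have h8 := congrArg (fun M => act M (vec ρ)) h4
    beta_reduce at h8
    rw [add_act, act_mul _ (toReal (A b - A a) * (toReal (A c - A a))⁻¹)] at h8
    rw [vec_sub, act_sub _ (vec ρ), h8, hX, hw, act_sub, ← sh_add_act (hdet b c hbc) u]
    abel
  rw [convTerm, phase, h2, lin_unfold (hdet b c hbc) (hA b) (hA c), ← eval_fn_eq hbc, h1,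
    lin_unfold (hdet a b hab) (hA a) (hA b), ← eval_fn_eq hab, neg_add_eq_sub]

end FamilyModel

/-! ### Connections, traces and zeroth pairing coefficients on Schwartz functions -/

section FamilyModelConnections

open MeasureTheory

variable {n : ℕ} {Ob : Type u} {θ κ : Matrix (Fin n) (Fin n) ℝ}
  {A : Ob → Matrix (Fin n) (Fin n) ℤ} {a b c : Ob}

theorem tor_sum {ι : Type*} (N D' : Matrix (Fin n) (Fin n) ℝ) (s : Finset ι) (c : ι → ℂ)
    (w : ι → SchwartzSeq (Idx n)) :
    tor N D' (∑ i ∈ s, c i • w i) = ∑ i ∈ s, c i • tor N D' (w i) := by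
  classical
  induction s using Finset.induction_on with
  | empty => simp only [Finset.sum_empty, tor_zero]
  | insert i s hi ih => rw [Finset.sum_insert hi, Finset.sum_insert hi, tor_add, tor_smul, ih]

theorem tor_coordMul_inr (N D' : Matrix (Fin n) (Fin n) ℝ) (w : SchwartzSeq (Idx n)) (q : Fin n)
    (v : Fin n → ℤ) (X : E n) :
    tor N D' (schwartzSeq_coordMul (Sum.inr q) w) v X = v q * tor N D' w v X := by
  rw [tor, tor, ← tsum_mul_left]
  refine tsum_congr fun k => ?_
  change ((v q : ℂ) * w.val (idx k v)) * _ * _ = _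
  ring

/-- The matrix of the connection on the endomorphisms. -/
def gradMat (θ κ : Matrix (Fin n) (Fin n) ℝ) (A : Matrix (Fin n) (Fin n) ℤ) :
    Matrix (Idx n) (Idx n) ℝ :=
  Matrix.fromBlocks ((dmat θ A)⁻¹).transpose
    ((kmat θ A).transpose * κ * (1 - kmat θ A * θ)) 0 (1 - kmat θ A * θ)

/-- The matrix of the connection on the morphisms between different objects. -/
def connMat (θ κ : Matrix (Fin n) (Fin n) ℝ) (Aa Ab : Matrix (Fin n) (Fin n) ℤ) :
    Matrix (Idx n) (Idx n) ℝ :=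
  Matrix.fromBlocks 1 ((1 / 2 : ℝ) • ((kmat θ Aa + kmat θ Ab).transpose * κ *
    (kmat θ Aa - kmat θ Ab))) 0 (kmat θ Aa - kmat θ Ab)

theorem inner_single (p : Fin n) (x : E n) : ⟪EuclideanSpace.single p (1 : ℝ), x⟫ = x p := by
  simp [EuclideanSpace.inner_single_left]

theorem inner_connVec (hκ : κ.transpose = -κ) (Aa Ab : Matrix (Fin n) (Fin n) ℤ) (p : Fin n)
    (x : E n) : ⟪connVec θ κ Aa Ab p, x⟫ =
      act ((1 / 2 : ℝ) • ((kmat θ Aa + kmat θ Ab).transpose * κ)) x p := by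
  rw [connVec, ← neg_act, ← hκ, ← inner_act, ← inner_single, inner_act, inner_act]
  simp only [act_mul, smul_act, Matrix.transpose_smul, Matrix.transpose_mul,
    Matrix.transpose_transpose, act_smul, inner_smul_left, conj_trivial]

/-- On a diagonal morphism space `L` depends only on the lattice index `v`, while derivatives bring
down `k`. The connection therefore multiplies the coefficient at `(k, v)` by a linear function,
whose matrix is `gradMat`; the half sums of `K` collapse to `K`. -/
theorem conn_tor (hκ : κ.transpose = -κ) {N D' : Matrix (Fin n) (Fin n) ℝ}
    {B : Matrix (Fin n) (Fin n) ℤ} (hD : D' = (dmat θ B)⁻¹) (w : SchwartzSeq (Idx n)) (j : Idx n) :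
    conn θ κ B B j (tor N D' w) = tor N D' (∑ i, (2 * Real.pi * Complex.I * gradMat θ κ B j i : ℂ) •
      schwartzSeq_coordMul i w) := by
  rw [tor_sum, Fintype.sum_sum_type]
  funext v X
  have hlf : ∀ y : E n, lf θ B B y v X =
      2 * Real.pi * Complex.I * (⟪y, act (1 - kmat θ B * θ) (vec v)⟫ : ℝ) := fun y => by
    rw [lf, lin_diag]
  have hact : ∀ (M : Matrix (Fin n) (Fin n) ℝ) (p : Fin n),
      2 * Real.pi * Complex.I * ((act M (vec v) p : ℝ) : ℂ) * tor N D' w v X =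
        (∑ q, (2 * Real.pi * Complex.I * M p q : ℂ) •
          tor N D' (schwartzSeq_coordMul (Sum.inr q) w)) v X := fun M p => by
    simp only [Finset.sum_apply, Pi.smul_apply, smul_eq_mul, tor_coordMul_inr, act_apply, vec_apply]
    push_cast
    rw [Finset.mul_sum, Finset.sum_mul]
    exact Finset.sum_congr rfl fun q _ => by ring
  cases j with
  | inl p =>
    change pd p (tor N D' w) v X + lf θ B B _ v X * tor N D' w v X = _
    rw [pd_eq (hasFDerivAt_tor w) p, hlf, inner_connVec hκ, ← act_mul, hact, Pi.add_apply,
      Pi.add_apply]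
    congr 1
    · rw [hD]
      rfl
    · refine congrFun (congrFun (Finset.sum_congr rfl fun q _ => ?_) v) X
      congr 4
      simp only [gradMat, Matrix.fromBlocks_apply₁₂, ← two_smul ℝ (kmat θ B),
        Matrix.transpose_smul, Matrix.smul_mul, smul_smul]
      norm_num
  | inr p =>
    change lf θ B B _ v X * tor N D' w v X = _
    rw [hlf, inner_single, hact, Pi.add_apply, Pi.add_apply]
    simp only [gradMat, Matrix.fromBlocks_apply₂₁, Matrix.fromBlocks_apply₂₂, Matrix.zero_apply,
      Complex.ofReal_zero, mul_zero, zero_smul, Finset.sum_const_zero, Pi.zero_apply, zero_add]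

theorem famModel_nabla_torus (hκ : κ.transpose = -κ) (hA : ∀ a, (dmat θ (A a)).det ≠ 0)
    (hdet : ∀ a b, a ≠ b → (A b - A a).det ≠ 0) (a : Ob) (j : Idx n) (u : HomSpace A a a)
    (m : Idx n → ℤ) :
    coeff ((famModel hκ hA hdet).nabla a a j u) m = 2 * Real.pi * Complex.I *
      (((gradMat θ κ (A a)).mulVec (fun i => (m i : ℝ)) j : ℝ) : ℂ) * coeff u m := by
  let w : SchwartzSeq (Idx n) := ∑ i, (2 * Real.pi * Complex.I * gradMat θ κ (A a) j i : ℂ) •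
      schwartzSeq_coordMul i u.val.1
  have h : (famModel hκ hA hdet).nabla a a j u =
      ⟨(w, 0), fun h => absurd rfl h, fun _ => rfl⟩ := famFun_injective hA hdet <| by
    rw [famFun_nabla, famFun_self, famFun_self, conn_tor hκ rfl]
  rw [h]
  change w.val m = _ * u.val.1.val m
  simp only [w, Submodule.coe_sum, Submodule.coe_smul, Finset.sum_apply, Pi.smul_apply, smul_eq_mul,
    Matrix.mulVec, dotProduct]
  push_cast
  rw [Finset.mul_sum, Finset.sum_mul]
  refine Finset.sum_congr rfl fun i _ => ?_
  change _ * ((m i : ℂ) * _) = _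
  ring

theorem famModel_nabla_general (hκ : κ.transpose = -κ) (hA : ∀ a, (dmat θ (A a)).det ≠ 0)
    (hdet : ∀ a b, a ≠ b → (A b - A a).det ≠ 0) (hab : a ≠ b) (j : Idx n) (ξ : HomSpace A a b)
    (μ : Fin n → ℤ) (x : E n) :
    (fn ((famModel hκ hA hdet).nabla a b j ξ)).eval μ x =
      ∑ p : Fin n, (connMat θ κ (A a) (A b) j (Sum.inl p) : ℂ) *
          fderiv ℝ ((fn ξ).eval μ) x (EuclideanSpace.single p 1) +
      ∑ p : Fin n, (connMat θ κ (A a) (A b) j (Sum.inr p) : ℂ) *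
          (2 * Real.pi * Complex.I * (x p : ℂ)) * (fn ξ).eval μ x := by
  rw [eval_fn_eq (θ := θ) hab, famFun_nabla]
  set y := act (dmat θ (A a) * (toReal (A b - A a))⁻¹) (vec μ) with hy
  have hlf : ∀ z : E n, lf θ (A a) (A b) z μ (x + y) =
      2 * Real.pi * Complex.I * (⟪z, act (kmat θ (A a) - kmat θ (A b)) x⟫ : ℝ) := fun z => by
    rw [lf, hy, lin_unfold (hdet a b hab) (hA a) (hA b)]
  have hact : ∀ (M : Matrix (Fin n) (Fin n) ℝ) (p : Fin n) (t : ℂ),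
      2 * Real.pi * Complex.I * ((act M x p : ℝ) : ℂ) * t =
        ∑ q, (M p q : ℂ) * (2 * Real.pi * Complex.I * (x q : ℂ)) * t := fun M p t => by
    rw [act_apply]
    push_cast
    rw [Finset.mul_sum, Finset.sum_mul]
    exact Finset.sum_congr rfl fun q _ => by ring
  have hfun : famFun θ ξ μ (x + y) = (fn ξ).eval μ x := (eval_fn_eq hab ξ μ x).symm
  cases j with
  | inl p =>
    change pd p (famFun θ ξ) μ (x + y) + lf θ (A a) (A b) _ μ (x + y) * famFun θ ξ μ (x + y) = _
    rw [hlf, inner_connVec hκ, ← act_mul, hact, hfun]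
    congr 1
    · have h1 : (fn ξ).eval μ = fun x => famFun θ ξ μ (x + y) :=
        funext fun x => eval_fn_eq hab ξ μ x
      rw [h1, fderiv_comp_add_right, pd, Finset.sum_eq_single p]
      · simp [connMat]
      · intro q _ hq
        simp [connMat, Matrix.one_apply_ne hq.symm]
      · exact fun h => absurd (Finset.mem_univ p) h
    · simp only [connMat, Matrix.fromBlocks_apply₁₂, Matrix.smul_mul]
  | inr p =>
    change lf θ (A a) (A b) _ μ (x + y) * famFun θ ξ μ (x + y) = _
    rw [hlf, inner_single, hact, hfun]
    simp only [connMat, Matrix.fromBlocks_apply₂₁, Matrix.fromBlocks_apply₂₂, Matrix.zero_apply,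
      Complex.ofReal_zero, zero_mul, Finset.sum_const_zero, zero_add]

theorem trF_famFun (hA : (dmat θ (A a)).det ≠ 0) (u : HomSpace A a a) :
    trF θ (A a) (famFun θ u) = (|(dmat θ (A a)).det| : ℝ) * coeff u 0 := by
  rw [coeff_eq_torusCoeff hA u 0, trF]
  change _ = _ * (e (-((1 / 2) * ⟪vec 0, _⟫)) * _)
  rw [vec_zero, inner_zero_left, mul_zero, neg_zero, e_zero, one_mul, torusCoeff]
  change _ = _ * ∫ x in cube n, e (-⟪vec 0, x⟫) * famFun θ u 0 _
  simp only [vec_zero, inner_zero_left, neg_zero, e_zero, one_mul]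

theorem famModel_Tr (hκ : κ.transpose = -κ) (hA : ∀ a, (dmat θ (A a)).det ≠ 0)
    (hdet : ∀ a b, a ≠ b → (A b - A a).det ≠ 0) (u : HomSpace A a a) :
    (famModel hκ hA hdet).Tr a u = (|(dmat θ (A a)).det| : ℝ) * coeff u 0 :=
  trF_famFun (hA a) u

/-- The trace is `|det D_a|` times the zeroth coefficient, so the unfolded trace pairing divided by
that determinant gives the formula. Its right side does not involve `κ`, a fact used again for Type
`θ₁`. -/
theorem famModel_coeff_zero (hκ : κ.transpose = -κ) (hA : ∀ a, (dmat θ (A a)).det ≠ 0)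
    (hdet : ∀ a b, a ≠ b → (A b - A a).det ≠ 0) (hab : a ≠ b) (ξ : HomSpace A b a)
    (ζ : HomSpace A a b) :
    coeff ((famModel hκ hA hdet).comp a b a ξ ζ) 0 = ((|(dmat θ (A a)).det| : ℝ) : ℂ)⁻¹ *
      ∑ᶠ q : (Fin n → ℤ) ⧸ latticeImage (A b - A a),
        ∫ x, (fn ξ).eval (rep q) x * (fn ζ).eval (-rep q) x := by
  have h1 := trF_famFun (hA a) ((famModel hκ hA hdet).comp a b a ξ ζ)
  have h0 : ((|(dmat θ (A a)).det| : ℝ) : ℂ) ≠ 0 :=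
    Complex.ofReal_ne_zero.mpr (abs_ne_zero.mpr (hA a))
  rw [famFun_comp, trF_conv_eq_finsum hκ (hA a) (hA b) (hdet a b hab) (famFun_mem hA hdet ξ)
    (famFun_mem hA hdet ζ)] at h1
  rw [eq_inv_mul_iff_mul_eq₀ h0, ← h1]
  have hinv : (toReal (A a - A b))⁻¹ = -(toReal (A b - A a))⁻¹ := by
    refine Matrix.inv_eq_left_inv ?_
    rw [← neg_sub (A b), toReal_neg, neg_mul_neg, Matrix.nonsing_inv_mul _
      (isUnit_iff_ne_zero.mpr (det_toReal_ne_zero (hdet a b hab)))]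
  -- Translating by `D_a A_ab⁻¹ u` removes both base points at once, since the one for `-u` in
  -- `Hom(b, a)` agrees with the shifted one for `u` in `Hom(a, b)`.
  have h2 : ∀ u : Fin n → ℤ, ∫ X, refl θ (famFun θ ξ) u X * famFun θ ζ u X =
      ∫ x, (fn ξ).eval (-u) x * (fn ζ).eval u x := fun u => by
    rw [← integral_add_right_eq_self (fun X => refl θ (famFun θ ξ) u X * famFun θ ζ u X)
      (act (dmat θ (A a) * (toReal (A b - A a))⁻¹) (vec u))]
    congr 1
    funext x
    rw [eval_fn_eq (θ := θ) hab, eval_fn_eq (θ := θ) hab.symm, refl, hinv, vec_neg, act_neg,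
      Matrix.mul_neg, neg_act, neg_neg, add_assoc, add_comm (act _ _) (sh θ u),
      sh_add_act (hdet a b hab)]
  simp only [h2]
  rw [finsum_rep_neg (k := fun u => ∫ x, (fn ξ).eval (-u) x * (fn ζ).eval u x)]
  · simp only [neg_neg]
  · intro u v
    have h3 : -(u + (A b - A a).mulVec v) = -u + (A a - A b).mulVec v := by
      rw [neg_add, ← neg_sub (A b), Matrix.neg_mulVec]
    congr 1
    funext x
    rw [h3, Schw.eval_add_mulVec, Schw.eval_add_mulVec]

theorem famModel_isPreCategory (hκ : κ.transpose = -κ) (hA : ∀ a, (dmat θ (A a)).det ≠ 0)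
    (hdet : ∀ a b, a ≠ b → (A b - A a).det ≠ 0) : (famModel hκ hA hdet).IsPreCategory := by
  unfold famModel
  exact (famCat_isPreCategory hκ hA hdet).transport _ _ _

theorem famModel_F (hκ : κ.transpose = -κ) (hA : ∀ a, (dmat θ (A a)).det ≠ 0)
    (hdet : ∀ a b, a ≠ b → (A b - A a).det ≠ 0) (a : Ob) :
    (famModel hκ hA hdet).F a = curvMat θ κ (A a) := by
  ext i j
  change (1 : ℝ) * 1 * _ = _
  rw [one_mul, one_mul]
  rfl

end FamilyModelConnections

/-! ### Deformations of the second and third type -/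

section LineBundleModels

variable {n : ℕ} {Ob : Type u} {θ : Matrix (Fin n) (Fin n) ℝ}

theorem bil_fromBlocks (P Q R S : Matrix (Fin n) (Fin n) ℝ) (m m' : Idx n → ℤ) :
    Deformation.bil (Matrix.fromBlocks P Q R S) m m' =
      ⟪vec fun i => m (Sum.inl i), act P (vec fun i => m' (Sum.inl i))⟫ +
      ⟪vec fun i => m (Sum.inl i), act Q (vec fun i => m' (Sum.inr i))⟫ +
      ⟪vec fun i => m (Sum.inr i), act R (vec fun i => m' (Sum.inl i))⟫ +
      ⟪vec fun i => m (Sum.inr i), act S (vec fun i => m' (Sum.inr i))⟫ := by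
  simp only [Deformation.bil, dotProduct, Matrix.mulVec, Fintype.sum_sum_type, inner_eq_sum,
    act_apply, vec_apply, Matrix.fromBlocks_apply₁₁, Matrix.fromBlocks_apply₁₂,
    Matrix.fromBlocks_apply₂₁, Matrix.fromBlocks_apply₂₂, mul_add, Finset.sum_add_distrib]
  ring

theorem inner_act_transpose (M : Matrix (Fin n) (Fin n) ℝ) (x y : E n) :
    ⟪x, act M.transpose y⟫ = ⟪y, act M x⟫ := by
  rw [inner_act, Matrix.transpose_transpose, real_inner_comm]

theorem vec_neg_comp {ι : Type} (m : ι → ℤ) (f : Fin n → ι) :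
    (vec fun i => (-m) (f i)) = -vec fun i => m (f i) := vec_neg _

/-- Since `θ(Aθ + 1) = Dθ` and `K D = A`, one has `Kθ(Aθ + 1) = Aθ`. This provides the inverse of `1
+ Aθ` without a separate invertibility argument. -/
theorem one_sub_kmat_mul {A : Matrix (Fin n) (Fin n) ℤ} (hA : (dmat θ A).det ≠ 0) :
    (1 - kmat θ A * θ) * (toReal A * θ + 1) = 1 := by
  have h : kmat θ A * θ * (toReal A * θ + 1) = toReal A * θ := by
    have h1 : θ * (toReal A * θ + 1) = dmat θ A * θ := by
      rw [dmat, Matrix.mul_add, Matrix.add_mul, Matrix.mul_one, Matrix.one_mul, Matrix.mul_assoc,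
        add_comm]
    rw [Matrix.mul_assoc, h1, ← Matrix.mul_assoc, kmat_mul_dmat hA]
  rw [Matrix.sub_mul, h, Matrix.one_mul, add_sub_cancel_left]

theorem transpose_dmat {A : Matrix (Fin n) (Fin n) ℤ} (hs : A.IsSymm) :
    (dmat θ A).transpose = toReal A * θ.transpose + 1 := by
  rw [dmat, Matrix.transpose_add, Matrix.transpose_mul, transpose_toReal hs, Matrix.transpose_one,
    add_comm]

theorem mul_one_sub_kmat {A : Matrix (Fin n) (Fin n) ℤ} (hA : (dmat θ A).det ≠ 0) :
    θ * (1 - kmat θ A * θ) = (dmat θ A)⁻¹ * θ := by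
  have h1 : θ * toReal A = dmat θ A - 1 := by rw [dmat, add_sub_cancel_left]
  rw [Matrix.mul_sub, Matrix.mul_one, kmat, ← Matrix.mul_assoc, ← Matrix.mul_assoc, h1,
    Matrix.sub_mul, Matrix.mul_nonsing_inv _ (isUnit_iff_ne_zero.mpr hA), Matrix.one_mul,
    Matrix.sub_mul, Matrix.one_mul, sub_sub_cancel]

theorem kmat_eq_inv_mul {A : Matrix (Fin n) (Fin n) ℤ} (hA : (dmat θ A).det ≠ 0) :
    kmat θ A = (1 + toReal A * θ)⁻¹ * toReal A := by
  rw [add_comm, Matrix.inv_eq_left_inv (one_sub_kmat_mul hA), Matrix.sub_mul, Matrix.one_mul,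
    Matrix.mul_assoc, show θ * toReal A = dmat θ A - 1 by rw [dmat, add_sub_cancel_left],
    Matrix.mul_sub, kmat_mul_dmat hA, Matrix.mul_one, sub_sub_cancel]

theorem transpose_inv_dmat {A : Matrix (Fin n) (Fin n) ℤ} (hs : A.IsSymm) :
    ((dmat θ A)⁻¹).transpose = (1 + toReal A * θ.transpose)⁻¹ := by
  rw [Matrix.transpose_nonsing_inv, transpose_dmat hs, add_comm]

theorem denom_type2 (A : Matrix (Fin n) (Fin n) ℤ) : (Deformation.type2 θ).denom A =
    Matrix.fromBlocks (toReal A * θ.transpose + 1) 0 0 (toReal A * θ + 1) := by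
  rw [Deformation.denom, Deformation.param, Matrix.fromBlocks_multiply, ← Matrix.fromBlocks_one,
    Matrix.fromBlocks_add]
  simp

theorem denom_type3 (hθ : θ.transpose = -θ) (A : Matrix (Fin n) (Fin n) ℤ) :
    (Deformation.type3 θ hθ).denom A = Matrix.fromBlocks 1 (-(toReal A * θ)) 0 1 := by
  rw [Deformation.denom, Deformation.param, Matrix.fromBlocks_multiply, ← Matrix.fromBlocks_one,
    Matrix.fromBlocks_add]
  simp

/-- The matrix by which connections act on torus coefficients is the one prescribed by the
derivations of the torus. -/
theorem denom_type2_inv {A : Matrix (Fin n) (Fin n) ℤ} (hA : (dmat θ A).det ≠ 0) (hs : A.IsSymm) :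
    ((Deformation.type2 θ).denom A)⁻¹ = gradMat θ 0 A := by
  refine Matrix.inv_eq_left_inv ?_
  rw [denom_type2, gradMat, Matrix.fromBlocks_multiply, ← transpose_dmat hs, ← Matrix.transpose_mul,
    Matrix.mul_nonsing_inv _ (isUnit_iff_ne_zero.mpr hA), one_sub_kmat_mul hA]
  simp

/-- The off-diagonal blocks are built from `D⁻¹θ`, the matrix in the half phase of `tor`, so the two
torus products have the same phase. -/
theorem objParam_type2 {A : Matrix (Fin n) (Fin n) ℤ} (hA : (dmat θ A).det ≠ 0) (hs : A.IsSymm) :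
    (Deformation.type2 θ).objParam A = Matrix.fromBlocks 0 (-((dmat θ A)⁻¹ * θ))
      ((dmat θ A)⁻¹ * θ).transpose 0 := by
  rw [Deformation.objParam, denom_type2_inv hA hs, gradMat, Deformation.param,
    Matrix.fromBlocks_multiply, Matrix.neg_mul θ (1 - _), mul_one_sub_kmat hA, Matrix.transpose_mul]
  simp

/-- The two diagonal blocks have equal determinants, by transposition and by `det(1 + MN) = det(1 +
NM)`. The square root of the determinant is therefore `|det D_a|`. -/
theorem traceFactor_type2 {A : Matrix (Fin n) (Fin n) ℤ} (hs : A.IsSymm) :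
    (Deformation.type2 θ).traceFactor A = |(dmat θ A).det| := by
  have h : (toReal A * θ + 1).det = (dmat θ A).det := by
    rw [dmat, add_comm, Matrix.det_one_add_mul_comm]
  rw [Deformation.traceFactor, denom_type2, Matrix.det_fromBlocks_zero₁₂, ← transpose_dmat hs,
    Matrix.det_transpose, h, abs_mul_self, Real.sqrt_mul_self_eq_abs]

variable {A : Ob → Matrix (Fin n) (Fin n) ℤ}

theorem zero_transpose_eq_neg :
    (0 : Matrix (Fin n) (Fin n) ℝ).transpose = -0 := by rw [Matrix.transpose_zero, neg_zero]

/-- The case `κ = 0`: all phases drop out and only the shifts by `θ u` remain. -/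
theorem isLineBundleModel_type2 (hs : ∀ a, (A a).IsSymm) (hA : ∀ a, (dmat θ (A a)).det ≠ 0)
    (hdet : ∀ a b, a ≠ b → (A b - A a).det ≠ 0) :
    IsLineBundleModel (Deformation.type2 θ) A (famModel zero_transpose_eq_neg hA hdet) := by
  have htorus : ∀ (a : Ob) (u w : HomSpace A a a) (m : Idx n → ℤ),
      HasSum (fun l : Idx n → ℤ => coeff u l * coeff w (m - l) *
        e (-(1 / 2) * Deformation.bil ((Deformation.type2 θ).objParam (A a)) l (m - l)))
      (coeff ((famModel zero_transpose_eq_neg hA hdet).comp a a a u w) m) := fun a u w m => by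
    refine (famModel_torus zero_transpose_eq_neg hA hdet u w m).congr_fun fun l => ?_
    congr 2
    rw [objParam_type2 (hA a) (hs a), bil_fromBlocks, inner_act_transpose]
    simp only [zero_act, inner_zero_right, neg_act, inner_neg_right]
    ring
  have hright : ∀ (a b : Ob), a ≠ b → ∀ (ξ : HomSpace A a b) (u : HomSpace A a a)
      (μ : Fin n → ℤ) (x : E n),
      HasSum (fun m : Idx n → ℤ => coeff u m *
        (Deformation.type2 θ).rightAct (A a) (A b) (fn ξ) m μ x)
        ((fn ((famModel zero_transpose_eq_neg hA hdet).comp a a b ξ u)).eval μ x) :=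
    fun a b hab ξ u μ x => by
      refine (famModel_right zero_transpose_eq_neg hA hdet hab ξ u μ x).congr_fun fun m => ?_
      rw [zero_act, inner_zero_right, mul_zero, e_zero, mul_one]
      rfl
  refine
    { one_coeff := famModel_one _ hA hdet
      comp_torus := htorus
      comp_right := hright
      comp_left := fun a b hab u ξ μ x => ?_
      comp_pairing := fun a b hab ξ ζ m => pairing_of_coeff_zero
        (famModel_isPreCategory _ hA hdet).comp_assoc htorus hright ?_ ?_ a b hab ξ ζ m
      comp_general := fun a b c hab hbc hac ξ ζ ρ x => ?_
      nabla_torus := fun a j u m => ?_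
      nabla_general := fun a b hab j ξ μ x => ?_
      F_eq := fun a => ?_
      Tr_eq := fun a u => ?_ }
  · refine (famModel_left zero_transpose_eq_neg hA hdet hab u ξ μ x).congr_fun fun m => ?_
    rw [zero_act, inner_zero_right, mul_zero, e_zero, mul_one]
    rfl
  · intro a m
    rw [objParam_type2 (hA a) (hs a), bil_fromBlocks, inner_act_transpose]
    simp only [zero_act, inner_zero_right, neg_act, vec_neg_comp, act_neg, inner_neg_right,
      inner_neg_left]
    ring
  · intro a b hab ξ ζ
    rw [famModel_coeff_zero _ hA hdet hab, traceFactor_type2 (hs a)]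
    rfl
  · refine (famModel_general zero_transpose_eq_neg hA hdet hab hbc hac ξ ζ ρ x).congr_fun
      fun u => ?_
    simp only [zero_act, inner_zero_right, mul_zero, e_zero, mul_one]
    rfl
  · rw [famModel_nabla_torus, denom_type2_inv (hA a) (hs a)]
  · rw [famModel_nabla_general _ hA hdet hab]
    have h : (Deformation.type2 θ).connMatrix (A a) (A b) = connMat θ 0 (A a) (A b) := by
      rw [connMat, kmat_eq_inv_mul (hA a), kmat_eq_inv_mul (hA b), Deformation.connMatrix,
        neg_add_eq_sub]
      simp
    rw [h]
  · rw [famModel_F, curvMat, Deformation.curv, ← kmat_eq_inv_mul (hA a)]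
    simp only [Matrix.mul_zero, Matrix.zero_mul, neg_zero]
    rw [kmat, Matrix.transpose_mul, transpose_inv_dmat (hs a), transpose_toReal (hs a)]
  · rw [famModel_Tr, traceFactor_type2 (hs a)]

theorem dmat_zero (B : Matrix (Fin n) (Fin n) ℤ) : dmat 0 B = 1 := by
  rw [dmat, Matrix.zero_mul, add_zero]

theorem kmat_zero (B : Matrix (Fin n) (Fin n) ℤ) : kmat 0 B = toReal B := by
  rw [kmat, dmat_zero, inv_one, Matrix.mul_one]

theorem det_dmat_zero (B : Matrix (Fin n) (Fin n) ℤ) : (dmat 0 B).det ≠ 0 := by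
  rw [dmat_zero, Matrix.det_one]
  exact one_ne_zero

theorem denom_type3_inv (hθ : θ.transpose = -θ) (B : Matrix (Fin n) (Fin n) ℤ) :
    ((Deformation.type3 θ hθ).denom B)⁻¹ = Matrix.fromBlocks 1 (toReal B * θ) 0 1 := by
  refine Matrix.inv_eq_left_inv ?_
  rw [denom_type3, Matrix.fromBlocks_multiply, ← Matrix.fromBlocks_one]
  simp

theorem objParam_type3 (hθ : θ.transpose = -θ) (B : Matrix (Fin n) (Fin n) ℤ) :
    (Deformation.type3 θ hθ).objParam B = Matrix.fromBlocks 0 0 0 (-θ) := by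
  rw [Deformation.objParam, denom_type3_inv, Deformation.param, Matrix.fromBlocks_multiply]
  simp

theorem traceFactor_type3 (hθ : θ.transpose = -θ) (B : Matrix (Fin n) (Fin n) ℤ) :
    (Deformation.type3 θ hθ).traceFactor B = 1 := by
  rw [Deformation.traceFactor, denom_type3, Matrix.det_fromBlocks_zero₂₁]
  simp

/-- The case `θ = 0`, where `D = 1` and `K = A`. There are no shifts, and the phase supplies the
exponential factors; by symmetry of the `A`'s, `⟨L_bc, κ L_ab⟩` becomes the expression with `A_bc θ₃
A_ab`. -/
theorem isLineBundleModel_type3 (hθ : θ.transpose = -θ) (hs : ∀ a, (A a).IsSymm)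
    (hdet : ∀ a b, a ≠ b → (A b - A a).det ≠ 0) :
    IsLineBundleModel (Deformation.type3 θ hθ) A
      (famModel hθ (fun a => det_dmat_zero (A a)) hdet) := by
  have hA := fun a => det_dmat_zero (A a)
  have hB : ∀ a b, (toReal (A b - A a)).transpose = toReal (A b - A a) := fun a b => by
    rw [toReal_sub, Matrix.transpose_sub, transpose_toReal (hs a), transpose_toReal (hs b)]
  have hsub : ∀ a b, toReal (A a) - toReal (A b) = -toReal (A b - A a) := fun a b => by
    rw [toReal_sub, neg_sub]
  have htorus : ∀ (a : Ob) (u w : HomSpace A a a) (m : Idx n → ℤ),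
      HasSum (fun l : Idx n → ℤ => coeff u l * coeff w (m - l) *
        e (-(1 / 2) * Deformation.bil ((Deformation.type3 θ hθ).objParam (A a)) l (m - l)))
      (coeff ((famModel hθ hA hdet).comp a a a u w) m) := fun a u w m => by
    refine (famModel_torus hθ hA hdet u w m).congr_fun fun l => ?_
    congr 2
    rw [objParam_type3, bil_fromBlocks]
    simp only [zero_act, inner_zero_right, neg_act, inner_neg_right, Matrix.mul_zero, sub_zero,
      one_act]
    ring
  have hright : ∀ (a b : Ob), a ≠ b → ∀ (ξ : HomSpace A a b) (u : HomSpace A a a)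
      (μ : Fin n → ℤ) (x : E n),
      HasSum (fun m : Idx n → ℤ => coeff u m *
        (Deformation.type3 θ hθ).rightAct (A a) (A b) (fn ξ) m μ x)
        ((fn ((famModel hθ hA hdet).comp a a b ξ u)).eval μ x) :=
    fun a b hab ξ u μ x => by
      refine (famModel_right hθ hA hdet hab ξ u μ x).congr_fun fun m => ?_
      simp only [dmat_zero, kmat_zero, inv_one, zero_act,
        inner_zero_right, mul_zero, e_zero, one_mul, sub_zero, one_act, Deformation.rightAct]
      generalize (fun i => m (Sum.inr i)) = v
      -- Applying `A_ab` to the shift `A_ab⁻¹ v` returns `v`, whose contribution vanishes by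
      -- skewness. The factor may thus be evaluated at `x` rather than at the shifted point.
      have h : (1 / 2) * ⟪act (toReal (A a) - toReal (A b))
          (x + act (toReal (A b - A a))⁻¹ (vec v)), act θ (vec v)⟫ =
          -(1 / 2) * ⟪x, act (toReal (A b - A a) * θ) (vec v)⟫ := by
        rw [hsub, neg_act, act_add, act_act_inv (det_toReal_ne_zero (hdet a b hab)), inner_neg_left,
          inner_add_left, inner_act_self hθ, add_zero, act_mul, ← hB, ← inner_act, hB]
        ring
      rw [h]
      ring
  refine
    { one_coeff := famModel_one _ hA hdet
      comp_torus := htorus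
      comp_right := hright
      comp_left := fun a b hab u ξ μ x => ?_
      comp_pairing := fun a b hab ξ ζ m => pairing_of_coeff_zero
        (famModel_isPreCategory _ hA hdet).comp_assoc htorus hright ?_ ?_ a b hab ξ ζ m
      comp_general := fun a b c hab hbc hac ξ ζ ρ x => ?_
      nabla_torus := fun a j u m => ?_
      nabla_general := fun a b hab j ξ μ x => ?_
      F_eq := fun a => ?_
      Tr_eq := fun a u => ?_ }
  · refine (famModel_left hθ hA hdet hab u ξ μ x).congr_fun fun m => ?_
    simp only [dmat_zero, kmat_zero, inv_one, zero_act,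
      inner_zero_right, mul_zero, e_zero, one_mul, sub_zero, one_act, Deformation.leftAct]
    generalize (fun i => m (Sum.inr i)) = v
    have h : (1 / 2) * ⟪vec v, act θ (act (toReal (A a) - toReal (A b))
        (x + act (toReal (A b - A a))⁻¹ (vec v)))⟫ =
        (1 / 2) * ⟪x, act (toReal (A b - A a) * θ) (vec v)⟫ := by
      rw [hsub, neg_act, act_add, act_act_inv (det_toReal_ne_zero (hdet a b hab)), act_neg,
        inner_neg_right, act_add, inner_add_right, inner_act_self hθ, add_zero, inner_act_skew hθ,
        neg_neg, act_mul, inner_act (toReal _) x, hB, real_inner_comm]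
    rw [h]
    ring
  · intro a m
    rw [objParam_type3, bil_fromBlocks]
    simp only [zero_act, inner_zero_right, neg_act, vec_neg_comp, act_neg, inner_neg_right,
      inner_act_self hθ, neg_zero, add_zero]
  · intro a b hab ξ ζ
    rw [famModel_coeff_zero _ hA hdet hab, traceFactor_type3, dmat_zero, Matrix.det_one, abs_one]
    rfl
  · refine (famModel_general hθ hA hdet hab hbc hac ξ ζ ρ x).congr_fun fun u => ?_
    simp only [dmat_zero, kmat_zero, Matrix.one_mul, Deformation.compTerm]
    rw [mul_right_comm]
    congr 3
    have h : ∀ y z : E n, ⟪y, act (toReal (A c - A b) * θ * toReal (A b - A a)) z⟫ =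
        ⟪act (toReal (A c - A b)) y, act θ (act (toReal (A b - A a)) z)⟫ := fun y z => by
      rw [act_mul, act_mul, inner_act, hB]
    rw [h, hsub, hsub, neg_act, neg_act, act_neg, inner_neg_neg]
  · rw [famModel_nabla_torus, denom_type3_inv, gradMat, dmat_zero, kmat_zero,
      transpose_toReal (hs a)]
    simp
  · rw [famModel_nabla_general _ hA hdet hab]
    have h : (Deformation.type3 θ hθ).connMatrix (A a) (A b) = connMat 0 θ (A a) (A b) := by
      rw [connMat, kmat_zero, kmat_zero, Deformation.connMatrix, hsub, Matrix.mul_neg, smul_neg,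
        Matrix.transpose_add, transpose_toReal (hs a), transpose_toReal (hs b), toReal_add]
    rw [h]
  · rw [famModel_F, curvMat, Deformation.curv, kmat_zero, transpose_toReal (hs a)]
  · rw [famModel_Tr, traceFactor_type3, dmat_zero, Matrix.det_one, abs_one]

end LineBundleModels

/-! ### The Fourier transform of equivariant families -/

section DualFamily

open MeasureTheory

variable {n : ℕ} {B : Matrix (Fin n) (Fin n) ℤ} {h : (Fin n → ℤ) → E n → ℂ}

/-- The summand of the Zak transform. -/
def zakTerm (B : Matrix (Fin n) (Fin n) ℤ) (h : (Fin n → ℤ) → E n → ℂ) (X : E n) (μ : Fin n → ℤ)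
    (Z : E n) : ℂ := h μ Z * e ⟪vec μ - act (toReal B) Z, X⟫

/-- The Zak transform of a family. -/
def zak (B : Matrix (Fin n) (Fin n) ℤ) (h : (Fin n → ℤ) → E n → ℂ) (X Z : E n) : ℂ :=
  ∑' μ, zakTerm B h X μ Z

/-- The Fourier transform of a family. -/
def dualFam (B : Matrix (Fin n) (Fin n) ℤ) (h : (Fin n → ℤ) → E n → ℂ) (u : Fin n → ℤ) (X : E n) :
    ℂ := torusCoeff (zak B h X) (-u)

/-- Multiplication by the invariant coordinates. -/
def posMul (B : Matrix (Fin n) (Fin n) ℤ) (p : Fin n) (h : (Fin n → ℤ) → E n → ℂ)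
    (μ : Fin n → ℤ) (Z : E n) : ℂ :=
  2 * Real.pi * Complex.I * (((vec μ - act (toReal B) Z) p : ℝ) : ℂ) * h μ Z

theorem inner_act_symm (hB : B.IsSymm) (X Z : E n) :
    ⟪act (toReal B) Z, X⟫ = ⟪act (toReal B) X, Z⟫ := by
  rw [real_inner_comm, inner_act, transpose_toReal hB]

theorem dec_zakTerm (hh : Dec h) (X : E n) : Dec (zakTerm B h X) :=
  hh.of_norm_le fun μ Z => by rw [zakTerm, norm_mul, norm_e, mul_one]

theorem continuous_zakTerm (hh : ∀ μ, Continuous (h μ)) (X : E n) (μ : Fin n → ℤ) :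
    Continuous (zakTerm B h X μ) :=
  (hh μ).mul (continuous_e.comp (Continuous.inner
    (continuous_const.sub (actL (toReal B)).continuous) continuous_const))

theorem eqv_zakTerm (hh : Eqv 1 B h) (X : E n) : Eqv 1 B (zakTerm B h X) := fun v μ Z => by
  rw [zakTerm, zakTerm, hh, one_act, vec_add, vec_mulVec, act_add, add_sub_add_right_eq_sub]

theorem continuous_zak (hd : Dec h) (hc : ∀ μ, Continuous (h μ)) (X : E n) :
    Continuous (zak B h X) := (dec_zakTerm hd X).continuous_tsum (continuous_zakTerm hc X)

theorem per_zak (hh : Eqv 1 B h) (X : E n) : Per (zak B h X) := fun v Z => by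
  rw [zak, zak, ← (Equiv.addRight (B.mulVec v)).tsum_eq]
  refine tsum_congr fun μ => ?_
  have := eqv_zakTerm hh X v μ Z
  rwa [one_act] at this

theorem posMul_mem (hh : h ∈ RF 1 B) (p : Fin n) : posMul B p h ∈ RF 1 B := by
  refine ⟨SR.aff_mul (l := fun μ Z => 2 * Real.pi * Complex.I *
    (((vec μ - act (toReal B) Z) p : ℝ) : ℂ)) ⟨2 * Real.pi * Complex.I, 0,
    -act (toReal B).transpose (EuclideanSpace.single p 1), EuclideanSpace.single p 1,
    fun u X => ?_⟩ hh.1, fun v μ Z => ?_⟩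
  · beta_reduce
    rw [add_zero, inner_neg_left, ← inner_act, inner_single, inner_single, PiLp.sub_apply]
    push_cast
    ring
  · rw [posMul, posMul, hh.2, one_act, vec_add, vec_mulVec, act_add, add_sub_add_right_eq_sub]

theorem hasSum_dualFam (hd : Dec h) (hc : ∀ μ, Continuous (h μ)) (u : Fin n → ℤ) (X : E n) :
    HasSum (fun μ => torusCoeff (zakTerm B h X μ) (-u)) (dualFam B h u X) := by
  have h1 : Dec fun μ Z => e (-⟪vec (-u), Z⟫) * zakTerm B h X μ Z :=
    (dec_zakTerm (B := B) hd X).of_norm_le fun μ Z => by rw [norm_mul, norm_e, one_mul]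
  have h2 := h1.hasSum_setIntegral_cube fun μ => (continuous_e.comp (by fun_prop)).mul
    (continuous_zakTerm hc X μ)
  simp only [tsum_mul_left] at h2
  exact h2

/-- By symmetry of `B` the character depends on `Z` through `⟨B X, Z⟩`, so differentiating it
produces the scalar `-2πi (B X)_p`, common to all terms. -/
theorem hasFDerivAt_zak (hB : B.IsSymm) (hh : h ∈ RF 1 B) (X Z : E n) :
    HasFDerivAt (zak B h X) (gradL fun p => zak B (pd p h) X Z -
      2 * Real.pi * Complex.I * ((act (toReal B) X p : ℝ) : ℂ) * zak B h X Z) Z := by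
  have hs : ∀ p Z, HasSum (fun μ => zakTerm B (pd p h) X μ Z -
      2 * Real.pi * Complex.I * ((act (toReal B) X p : ℝ) : ℂ) * zakTerm B h X μ Z)
      (zak B (pd p h) X Z - 2 * Real.pi * Complex.I * ((act (toReal B) X p : ℝ) : ℂ) *
        zak B h X Z) := fun p Z =>
    ((dec_zakTerm (hh.1.pd p).dec X).summable Z).hasSum.sub
      (((dec_zakTerm hh.1.dec X).summable Z).hasSum.mul_left _)
  have key := hasFDerivAt_tsum_gradL (t := zakTerm B h X) (s := fun μ p Z =>
    zakTerm B (pd p h) X μ Z - 2 * Real.pi * Complex.I * ((act (toReal B) X p : ℝ) : ℂ) *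
      zakTerm B h X μ Z) ?_ ?_ (fun Z => (dec_zakTerm hh.1.dec X).summable Z) Z
  · exact key.congr_fderiv (congrArg gradL (funext fun p => (hs p Z).tsum_eq))
  · intro μ Y
    have h1 : (fun Z => zakTerm B h X μ Z) = fun Z =>
        e ⟪vec μ, X⟫ * (h μ Z * e ⟪-act (toReal B) X, Z⟫) := by
      funext Z
      rw [zakTerm, inner_sub_left, sub_eq_add_neg, e_add, inner_neg_left,
        inner_act_symm hB]
      ring
    have h2 := ((hasFDerivAt_pd hh.1.differentiable μ Y).mul
      (hasFDerivAt_character (-act (toReal B) X) Y)).const_mul (e ⟪vec μ, X⟫)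
    change HasFDerivAt (fun Z => zakTerm B h X μ Z) _ Y
    rw [h1]
    refine h2.to_gradL fun p => ?_
    have h3 : ∀ g : (Fin n → ℤ) → E n → ℂ, zakTerm B g X μ Y =
        e ⟪vec μ, X⟫ * (g μ Y * e ⟪-act (toReal B) X, Y⟫) := fun g => by
      rw [zakTerm, inner_sub_left, sub_eq_add_neg, e_add, inner_neg_left,
        inner_act_symm hB]
      ring
    simp only [h3, _root_.smul_apply, _root_.add_apply, gradL_single, smul_eq_mul, PiLp.neg_apply]
    push_cast
    ring
  · intro R
    choose b hb hbb using fun p => (dec_zakTerm (B := B) (hh.1.pd p).dec X).bound_of_norm_le R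
    obtain ⟨b0, hb0, hbb0⟩ := (dec_zakTerm (B := B) hh.1.dec X).bound_of_norm_le |R|
    have hb0n : ∀ μ, 0 ≤ b0 μ := fun μ =>
      (norm_nonneg _).trans (hbb0 μ 0 (by rw [norm_zero]; exact abs_nonneg R))
    refine ⟨fun μ => ∑ p, (|b p μ| + ‖2 * Real.pi * Complex.I *
      ((act (toReal B) X p : ℝ) : ℂ)‖ * b0 μ), summable_sum fun p _ =>
        (hb p).abs.add (hb0.mul_left _), fun μ p Y hY => ?_⟩
    have h4 : ‖zakTerm B (pd p h) X μ Y - 2 * Real.pi * Complex.I *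
        ((act (toReal B) X p : ℝ) : ℂ) * zakTerm B h X μ Y‖ ≤
        |b p μ| + ‖2 * Real.pi * Complex.I * ((act (toReal B) X p : ℝ) : ℂ)‖ * b0 μ := by
      refine (norm_sub_le _ _).trans (add_le_add ((hbb p μ Y hY).trans (le_abs_self _)) ?_)
      rw [norm_mul]
      exact mul_le_mul_of_nonneg_left (hbb0 μ Y (hY.trans (le_abs_self R))) (norm_nonneg _)
    refine h4.trans (Finset.single_le_sum (f := fun p => |b p μ| + ‖2 * Real.pi * Complex.I *
      ((act (toReal B) X p : ℝ) : ℂ)‖ * b0 μ) (fun p _ => ?_) (Finset.mem_univ p))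
    have := hb0n μ
    positivity

/-- The Fourier transform exchanges derivatives and coordinates. -/
theorem dualFam_pd (hB : B.IsSymm) (hh : h ∈ RF 1 B) (p : Fin n) :
    dualFam B (pd p h) = -posMul B p (dualFam B h) := by
  funext u X
  have hc := continuous_zak (B := B) hh.1.dec hh.1.continuous X
  have hc' := continuous_zak (B := B) (hh.1.pd p).dec (hh.1.pd p).continuous X
  have h1 := torusCoeff_deriv (per_zak hh.2 X) (hasFDerivAt_zak hB hh X) p
    (hc'.sub (continuous_const.mul hc)) (-u)
  have h2 : torusCoeff (fun Z => zak B (pd p h) X Z - 2 * Real.pi * Complex.I *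
      ((act (toReal B) X p : ℝ) : ℂ) * zak B h X Z) (-u) = dualFam B (pd p h) u X -
      2 * Real.pi * Complex.I * ((act (toReal B) X p : ℝ) : ℂ) * dualFam B h u X := by
    simp only [dualFam, torusCoeff]
    have hce : Continuous fun Z : E n => e (-⟪vec (-u), Z⟫) := continuous_e.comp (by fun_prop)
    have hi1 : Integrable (fun Z => e (-⟪vec (-u), Z⟫) * zak B (pd p h) X Z)
      (volume.restrict (cube n)) := Continuous.integrableOn_cube (hce.mul hc')
    have hi2 : Integrable (fun Z => 2 * Real.pi * Complex.I * ((act (toReal B) X p : ℝ) : ℂ) *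
      (e (-⟪vec (-u), Z⟫) * zak B h X Z)) (volume.restrict (cube n)) :=
      Continuous.integrableOn_cube (continuous_const.mul (hce.mul hc))
    rw [← integral_const_mul, ← integral_sub hi1 hi2]
    congr 1
    funext Z
    ring
  rw [h2] at h1
  rw [Pi.neg_apply, Pi.neg_apply, posMul, PiLp.sub_apply, vec_apply]
  change _ = 2 * Real.pi * Complex.I * ((-u) p : ℤ) * dualFam B h u X at h1
  rw [Pi.neg_apply] at h1
  push_cast at h1 ⊢
  linear_combination h1

theorem hasFDerivAt_integral_character {c : E n → ℂ} {φ : E n → E n} (hc : Continuous c)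
    (hφ : Continuous φ) (X : E n) :
    HasFDerivAt (fun X => ∫ Z in cube n, c Z * e ⟪φ Z, X⟫) (gradL fun p =>
      ∫ Z in cube n, c Z * (2 * Real.pi * Complex.I * (φ Z p : ℂ)) * e ⟪φ Z, X⟫) X := by
  have hce : ∀ X : E n, Continuous fun Z => e ⟪φ Z, X⟫ := fun X =>
    continuous_e.comp (hφ.inner continuous_const)
  have hcp : ∀ p, Continuous fun Z => c Z * (2 * Real.pi * Complex.I * (φ Z p : ℂ)) := fun p =>
    hc.mul (continuous_const.mul (Complex.continuous_ofReal.comp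
      ((EuclideanSpace.proj (𝕜 := ℝ) p).continuous.comp hφ)))
  let F' : E n → E n → (E n →L[ℝ] ℂ) := fun X Z =>
    gradL fun p => c Z * (2 * Real.pi * Complex.I * (φ Z p : ℂ)) * e ⟪φ Z, X⟫
  have hF' : Continuous (F' X) :=
    gradL.continuous.comp (continuous_pi fun p => (hcp p).mul (hce X))
  have hb : ∀ X Z, ‖F' X Z‖ ≤ ‖(gradL : (Fin n → ℂ) →L[ℝ] (E n →L[ℝ] ℂ))‖ *
      ∑ p, ‖c Z * (2 * Real.pi * Complex.I * (φ Z p : ℂ))‖ := fun X Z => by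
    refine (ContinuousLinearMap.le_opNorm _ _).trans
      (mul_le_mul_of_nonneg_left ?_ (norm_nonneg _))
    refine (pi_norm_le_iff_of_nonneg (Finset.sum_nonneg fun p _ => norm_nonneg _)).mpr fun p => ?_
    rw [norm_mul, norm_e, mul_one]
    exact Finset.single_le_sum (f := fun p => ‖c Z * (2 * Real.pi * Complex.I * (φ Z p : ℂ))‖)
      (fun p _ => norm_nonneg _) (Finset.mem_univ p)
  have hbi : Integrable (fun Z => ‖(gradL : (Fin n → ℂ) →L[ℝ] (E n →L[ℝ] ℂ))‖ *
      ∑ p, ‖c Z * (2 * Real.pi * Complex.I * (φ Z p : ℂ))‖) (volume.restrict (cube n)) :=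
    (integrable_finsetSum _ fun p _ => (Continuous.integrableOn_cube (hcp p)).norm).const_mul _
  have key := hasFDerivAt_integral_of_dominated_of_fderiv_le (μ := volume.restrict (cube n))
    (F := fun X Z => c Z * e ⟪φ Z, X⟫) (F' := F') (x₀ := X) (s := Set.univ) Filter.univ_mem
    (Filter.Eventually.of_forall fun X => (hc.mul (hce X)).aestronglyMeasurable)
    (Continuous.integrableOn_cube (hc.mul (hce X))) hF'.aestronglyMeasurable
    (Filter.Eventually.of_forall fun Z X _ => hb X Z) hbi
    (Filter.Eventually.of_forall fun Z X _ =>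
      ((hasFDerivAt_character (φ Z) X).const_mul (c Z)).to_gradL fun p => by
        rw [_root_.smul_apply, gradL_single, smul_eq_mul]; ring)
  refine key.to_gradL fun p => ?_
  rw [ContinuousLinearMap.integral_apply
    (hbi.mono' hF'.aestronglyMeasurable (Filter.Eventually.of_forall fun Z => hb X Z))]
  congr 1
  funext Z
  exact gradL_single _ p

/-- The variable `X` enters only through the characters, and differentiating them brings down the
invariant coordinates `μ - B Z`. -/
theorem hasFDerivAt_dualFam (hh : h ∈ RF 1 B) (u : Fin n → ℤ) (X : E n) :
    HasFDerivAt (dualFam B h u) (gradL fun p => dualFam B (posMul B p h) u X) X := by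
  have hsum := fun X => hasSum_dualFam (B := B) hh.1.dec hh.1.continuous u X
  have hp := fun p => (posMul_mem hh p).1
  have key := hasFDerivAt_tsum_gradL (t := fun μ X => torusCoeff (zakTerm B h X μ) (-u))
    (s := fun μ p X => torusCoeff (zakTerm B (posMul B p h) X μ) (-u)) ?_ ?_
    (fun X => (hsum X).summable) X
  · rw [show dualFam B h u = fun X => ∑' μ, torusCoeff (zakTerm B h X μ) (-u) from
      funext fun X => (hsum X).tsum_eq.symm]
    exact key.congr_fderiv (congrArg gradL (funext fun p =>
      (hasSum_dualFam (hp p).dec (hp p).continuous u X).tsum_eq))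
  · intro μ Y
    have h1 := hasFDerivAt_integral_character (c := fun Z => e (-⟪vec (-u), Z⟫) * h μ Z)
      (φ := fun Z => vec μ - act (toReal B) Z) ((continuous_e.comp (by fun_prop)).mul
        (hh.1.continuous μ)) (continuous_const.sub (actL (toReal B)).continuous) Y
    have h2 : (fun X => torusCoeff (zakTerm B h X μ) (-u)) = fun X => ∫ Z in cube n,
        e (-⟪vec (-u), Z⟫) * h μ Z * e ⟪vec μ - act (toReal B) Z, X⟫ := by
      funext X
      simp only [torusCoeff, zakTerm, mul_assoc]
    rw [h2]
    refine h1.congr_fderiv (congrArg gradL (funext fun p => ?_))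
    rw [torusCoeff]
    congr 1
    funext Z
    rw [zakTerm, posMul]
    ring
  · intro R
    choose b hb hbb using fun p => (hp p).dec.bound_of_norm_le n
    refine ⟨fun μ => ∑ p, |b p μ|, summable_sum fun p _ => (hb p).abs, fun μ p Y _ => ?_⟩
    refine (norm_torusCoeff_le (C := b p μ) (fun Z hZ => ?_) _).trans ((le_abs_self _).trans
      (Finset.single_le_sum (f := fun p => |b p μ|) (fun p _ => abs_nonneg _) (Finset.mem_univ p)))
    rw [zakTerm, norm_mul, norm_e, mul_one]
    exact hbb p μ Z hZ

/-- Induction on `N`: multiplication by `u_p` is exchanged for a derivative of `h` and a term `(B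
X)_p`. Decay in `u` thus costs one derivative and one power of `1 + ‖X‖` at each step. -/
theorem dec_dualFam (hB : B.IsSymm) (N : ℕ) : ∀ h ∈ RF 1 B, ∃ (C : ℝ) (M : ℕ), ∀ u X,
    (1 + ‖u‖) ^ N * ‖dualFam B h u X‖ ≤ C * (1 + ‖X‖) ^ M := by
  induction N with
  | zero =>
    intro h hh
    obtain ⟨b, hb, hbb⟩ := hh.1.dec.bound_of_norm_le n
    refine ⟨∑' μ, b μ, 0, fun u X => ?_⟩
    rw [pow_zero, one_mul, pow_zero, mul_one]
    refine norm_torusCoeff_le (fun Z hZ => tsum_of_norm_bounded hb.hasSum fun μ => ?_) _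
    rw [zakTerm, norm_mul, norm_e, mul_one]
    exact hbb μ Z hZ
  | succ N ih =>
    intro h hh
    obtain ⟨C, M, hC⟩ := ih h hh
    choose C' M' hC' using fun p => ih (pd p h) ⟨hh.1.pd p, hh.2.pd p⟩
    have hC0 := Dec.const_nonneg hC
    have hC0' := fun p => Dec.const_nonneg (hC' p)
    obtain ⟨T, hT, hact⟩ := exists_one_add_norm_act_le (toReal B)
    have hcoord : ∀ u X p, |(u p : ℝ)| * ‖dualFam B h u X‖ ≤ ‖dualFam B (pd p h) u X‖ +
        T * (1 + ‖X‖) * ‖dualFam B h u X‖ := fun u X p => by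
      have h1 : ((u p : ℝ) : ℂ) * dualFam B h u X = -(2 * Real.pi * Complex.I)⁻¹ *
          dualFam B (pd p h) u X + ((act (toReal B) X p : ℝ) : ℂ) * dualFam B h u X := by
        have h0 : (2 * Real.pi * Complex.I : ℂ) ≠ 0 := Complex.two_pi_I_ne_zero
        rw [dualFam_pd hB hh, Pi.neg_apply, Pi.neg_apply, posMul, PiLp.sub_apply, vec_apply]
        push_cast
        field_simp
        ring
      have h2 : ‖(2 * Real.pi * Complex.I : ℂ)⁻¹‖ ≤ 1 := by
        rw [norm_inv]
        refine inv_le_one_of_one_le₀ ?_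
        have := Real.pi_gt_three
        simp [abs_of_pos Real.pi_pos]
        linarith
      have h3 : |act (toReal B) X p| ≤ T * (1 + ‖X‖) := by
        have := PiLp.norm_apply_le (act (toReal B) X) p
        rw [Real.norm_eq_abs] at this
        linarith [hact X]
      calc |(u p : ℝ)| * ‖dualFam B h u X‖ = ‖((u p : ℝ) : ℂ) * dualFam B h u X‖ := by
            rw [norm_mul, Complex.norm_real, Real.norm_eq_abs]
        _ ≤ ‖(2 * Real.pi * Complex.I : ℂ)⁻¹‖ * ‖dualFam B (pd p h) u X‖ +
            |act (toReal B) X p| * ‖dualFam B h u X‖ := by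
            rw [h1]
            refine (norm_add_le _ _).trans (le_of_eq ?_)
            rw [norm_mul, norm_neg, norm_mul, Complex.norm_real, Real.norm_eq_abs]
        _ ≤ _ := add_le_add (mul_le_of_le_one_left (norm_nonneg _) h2)
            (mul_le_mul_of_nonneg_right h3 (norm_nonneg _))
    -- A crude common exponent that dominates `M`, `M + 1` and every `M' p`.
    refine ⟨C + ∑ p, (C' p + T * C), M + 1 + ∑ p, M' p, fun u X => ?_⟩
    have hX := one_le_one_add_norm X
    have h1 : (1 + ‖u‖) * ‖dualFam B h u X‖ ≤ ‖dualFam B h u X‖ + ∑ p,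
        (‖dualFam B (pd p h) u X‖ + T * (1 + ‖X‖) * ‖dualFam B h u X‖) := by
      calc _ ≤ (1 + ∑ p, |(u p : ℝ)|) * ‖dualFam B h u X‖ :=
            mul_le_mul_of_nonneg_right (one_add_norm_le_sum u) (norm_nonneg _)
        _ = ‖dualFam B h u X‖ + ∑ p, |(u p : ℝ)| * ‖dualFam B h u X‖ := by
            rw [add_mul, one_mul, Finset.sum_mul]
        _ ≤ _ := by
          gcongr with p
          exact hcoord u X p
    have hpow : ∀ {k : ℕ}, k ≤ M + 1 + ∑ p, M' p →
        (1 + ‖X‖) ^ k ≤ (1 + ‖X‖) ^ (M + 1 + ∑ p, M' p) := fun hk => pow_le_pow_right₀ hX hk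
    calc (1 + ‖u‖) ^ (N + 1) * ‖dualFam B h u X‖
        = (1 + ‖u‖) ^ N * ((1 + ‖u‖) * ‖dualFam B h u X‖) := by ring
      _ ≤ (1 + ‖u‖) ^ N * (‖dualFam B h u X‖ + ∑ p,
          (‖dualFam B (pd p h) u X‖ + T * (1 + ‖X‖) * ‖dualFam B h u X‖)) := by gcongr
      _ = (1 + ‖u‖) ^ N * ‖dualFam B h u X‖ + ∑ p, ((1 + ‖u‖) ^ N * ‖dualFam B (pd p h) u X‖ +
          T * (1 + ‖X‖) * ((1 + ‖u‖) ^ N * ‖dualFam B h u X‖)) := by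
          rw [mul_add, Finset.mul_sum]
          congr 1
          exact Finset.sum_congr rfl fun p _ => by ring
      _ ≤ C * (1 + ‖X‖) ^ M + ∑ p, (C' p * (1 + ‖X‖) ^ M' p +
          T * (1 + ‖X‖) * (C * (1 + ‖X‖) ^ M)) := by
          refine add_le_add (hC u X) (Finset.sum_le_sum fun p _ => add_le_add (hC' p u X) ?_)
          exact mul_le_mul_of_nonneg_left (hC u X) (by positivity)
      _ = C * (1 + ‖X‖) ^ M + ∑ p, (C' p * (1 + ‖X‖) ^ M' p +
          T * C * (1 + ‖X‖) ^ (M + 1)) := by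
          congr 1
          exact Finset.sum_congr rfl fun p _ => by ring
      _ ≤ C * (1 + ‖X‖) ^ (M + 1 + ∑ p, M' p) + ∑ p, (C' p * (1 + ‖X‖) ^ (M + 1 + ∑ p, M' p) +
          T * C * (1 + ‖X‖) ^ (M + 1 + ∑ p, M' p)) := by
          refine add_le_add (mul_le_mul_of_nonneg_left (hpow (by omega)) hC0)
            (Finset.sum_le_sum fun p _ => add_le_add
              (mul_le_mul_of_nonneg_left (hpow ?_) (hC0' p))
              (mul_le_mul_of_nonneg_left (hpow (by omega)) (by positivity)))
          exact (Finset.single_le_sum (f := M') (fun _ _ => Nat.zero_le _)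
            (Finset.mem_univ p)).trans (Nat.le_add_left _ _)
      _ = _ := by
          rw [add_mul, Finset.sum_mul]
          congr 1
          exact Finset.sum_congr rfl fun p _ => by ring

theorem eqv_dualFam (hB : B.IsSymm) : Eqv 1 B (dualFam B h) := fun v u X => by
  rw [dualFam, dualFam, torusCoeff, torusCoeff, one_act]
  congr 1
  funext Z
  rw [zak, zak, ← tsum_mul_left, ← tsum_mul_left]
  refine tsum_congr fun μ => ?_
  rw [zakTerm, zakTerm, mul_left_comm, mul_left_comm (e _), ← e_add, ← e_add]
  congr 1
  -- The two exponents differ by the integer `⟨μ, v⟩`, because `⟨B v, Z⟩` and `⟨B Z, v⟩` cancel by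
  -- symmetry of `B`.
  obtain ⟨k, hk⟩ := inner_vec_vec μ v
  refine e_eq_of_sub_int ⟨k, ?_⟩
  have h1 : ⟪act (toReal B) (vec v), Z⟫ = ⟪act (toReal B) Z, vec v⟫ := inner_act_symm hB _ _
  rw [neg_add, vec_add, vec_neg, vec_neg, vec_mulVec, inner_add_left, inner_neg_left,
    inner_neg_left, inner_add_right, inner_sub_left _ _ (vec v), h1, hk]
  ring

theorem dualFam_mem (hB : B.IsSymm) (hh : h ∈ RF 1 B) : dualFam B h ∈ RF 1 B := by
  refine ⟨⟨{g | ∃ h ∈ RF 1 B, g = dualFam B h}, ⟨h, hh, rfl⟩, ?_⟩, eqv_dualFam hB⟩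
  rintro _ ⟨h, hh, rfl⟩
  exact ⟨fun u X => (hasFDerivAt_dualFam hh u X).differentiableAt,
    fun N => dec_dualFam hB N h hh, fun p => ⟨posMul B p h, posMul_mem hh p,
      pd_eq (s := fun p => dualFam B (posMul B p h)) (hasFDerivAt_dualFam hh) p⟩⟩

theorem pd_dualFam (hh : h ∈ RF 1 B) (p : Fin n) :
    pd p (dualFam B h) = dualFam B (posMul B p h) :=
  pd_eq (s := fun p => dualFam B (posMul B p h)) (hasFDerivAt_dualFam hh) p

/-- Fourier inversion along the lattice. -/
theorem hasSum_dualFam_character (hB : B.IsSymm) (hh : h ∈ RF 1 B) (X Z : E n) :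
    HasSum (fun u => dualFam B h u X * e (-⟪vec u, Z⟫)) (zak B h X Z) := by
  have hs : Summable (torusCoeff (zak B h X)) := by
    rw [← (Equiv.neg (Fin n → ℤ)).summable_iff]
    exact (dualFam_mem hB hh).1.dec.summable X
  have := (Equiv.neg (Fin n → ℤ)).hasSum_iff.mpr (hasSum_torusCoeff
    (continuous_zak hh.1.dec hh.1.continuous X) (per_zak hh.2 X) hs Z)
  refine this.congr_fun fun u => ?_
  rw [Function.comp_apply, Equiv.neg_apply, vec_neg, inner_neg_left]
  rfl

/-- As for the classical Fourier transform, the square is the reflection. Inversion along the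
lattice exhibits the Zak transform of the dual family as the Fourier series with coefficients `h μ
(-Z)`. -/
theorem dualFam_dualFam (hB : B.IsSymm) (hh : h ∈ RF 1 B) (μ : Fin n → ℤ) (Z : E n) :
    dualFam B (dualFam B h) μ Z = h (-μ) (-Z) := by
  rw [dualFam]
  refine torusCoeff_of_hasSum (c := fun μ => h μ (-Z)) (hh.1.dec.summable _).norm (fun X => ?_) _
  have h1 := (hasSum_dualFam_character hB hh X (-Z)).mul_right (e (-⟪act (toReal B) X, Z⟫))
  have h2 : zak B (dualFam B h) Z X = zak B h X (-Z) * e (-⟪act (toReal B) X, Z⟫) := by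
    rw [← h1.tsum_eq, zak]
    refine tsum_congr fun u => ?_
    rw [zakTerm, inner_neg_right, neg_neg, mul_assoc, ← e_add, inner_sub_left, sub_eq_add_neg]
  have h3 := (((dec_zakTerm (B := B) hh.1.dec X).summable (-Z)).hasSum.mul_right
    (e (-⟪act (toReal B) X, Z⟫)))
  change HasSum _ (zak B h X (-Z) * e (-⟪act (toReal B) X, Z⟫)) at h3
  rw [← h2] at h3
  refine h3.congr_fun fun μ => ?_
  rw [zakTerm, mul_assoc, ← e_add, act_neg, sub_neg_eq_add, inner_add_left,
    inner_act_symm hB, add_assoc, add_neg_cancel, add_zero]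

end DualFamily

/-! ### The Fourier transform of a twisted convolution -/

section TwoIndices

variable {n : ℕ} {G : (Fin n → ℤ) → (Fin n → ℤ) → E n → ℂ}

/-- Rapid decrease in two lattice variables. -/
def DecTwo (G : (Fin n → ℤ) → (Fin n → ℤ) → E n → ℂ) : Prop :=
  ∀ N : ℕ, ∃ (C : ℝ) (M : ℕ), ∀ u w X,
    (1 + ‖u‖) ^ N * ((1 + ‖w‖) ^ N * ‖G u w X‖) ≤ C * (1 + ‖X‖) ^ M

theorem DecTwo.apply (hG : DecTwo G) (u : Fin n → ℤ) : Dec (G u) := fun N => by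
  obtain ⟨C, M, h⟩ := hG N
  refine ⟨C, M, fun w X => le_trans ?_ (h u w X)⟩
  refine le_mul_of_one_le_left (by positivity) (one_le_pow₀ ?_)
  linarith [norm_nonneg u]

theorem DecTwo.norm_le (hG : DecTwo G) (N : ℕ) : ∃ (C : ℝ) (M : ℕ), 0 ≤ C ∧ ∀ u w X,
    (1 + ‖u‖) ^ N * ‖G u w X‖ ≤ C * (1 + ‖X‖) ^ M * ((1 + ‖w‖) ^ sumExp (Fin n))⁻¹ := by
  obtain ⟨C, M, h⟩ := hG (N + sumExp (Fin n))
  have hC : 0 ≤ C := by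
    have := h 0 0 0
    simp only [norm_zero, add_zero, one_pow, one_mul, mul_one] at this
    exact (norm_nonneg _).trans this
  refine ⟨C, M, hC, fun u w X => ?_⟩
  rw [← div_eq_mul_inv, le_div_iff₀ (by positivity)]
  refine le_trans ?_ (h u w X)
  have hu : (1 + ‖u‖) ^ N ≤ (1 + ‖u‖) ^ (N + sumExp (Fin n)) :=
    pow_le_pow_right₀ (by linarith [norm_nonneg u]) (Nat.le_add_right _ _)
  have hw : (1 + ‖w‖) ^ sumExp (Fin n) ≤ (1 + ‖w‖) ^ (N + sumExp (Fin n)) :=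
    pow_le_pow_right₀ (by linarith [norm_nonneg w]) (Nat.le_add_left _ _)
  rw [mul_assoc, mul_comm ‖G u w X‖]
  gcongr

theorem DecTwo.summable (hG : DecTwo G) (X : E n) :
    Summable fun x : (Fin n → ℤ) × (Fin n → ℤ) => G x.1 x.2 X := by
  obtain ⟨C, M, hC, h⟩ := hG.norm_le (sumExp (Fin n))
  have hs := (summable_sumExp (ι := Fin n)).mul_of_nonneg (summable_sumExp (ι := Fin n))
    (fun _ => by positivity) (fun _ => by positivity)
  refine Summable.of_norm_bounded (hs.mul_left (C * (1 + ‖X‖) ^ M)) fun x => ?_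
  rw [mul_comm (_⁻¹) (_⁻¹), ← mul_assoc, ← div_eq_mul_inv _ ((1 + ‖x.1‖) ^ _),
    le_div_iff₀ (by positivity), mul_comm]
  exact h x.1 x.2 X

theorem DecTwo.dec_tsum (hG : DecTwo G) : Dec fun u X => ∑' w, G u w X := fun N => by
  obtain ⟨C, M, hC, h⟩ := hG.norm_le N
  refine ⟨C * ∑' w : Fin n → ℤ, ((1 + ‖w‖) ^ sumExp (Fin n))⁻¹, M, fun u X => ?_⟩
  have h1 : (1 + ‖u‖) ^ N * ‖∑' w, G u w X‖ = ‖∑' w, ((1 + ‖u‖) ^ N : ℂ) * G u w X‖ := by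
    rw [tsum_mul_left, norm_mul, norm_pow]
    congr 2
    rw [← Complex.ofReal_one, ← Complex.ofReal_add, Complex.norm_real, Real.norm_of_nonneg]
    positivity
  rw [h1, mul_right_comm]
  refine tsum_of_norm_bounded (summable_sumExp.hasSum.mul_left _) fun w => ?_
  rw [norm_mul, norm_pow, ← Complex.ofReal_one, ← Complex.ofReal_add, Complex.norm_real,
    Real.norm_of_nonneg (by positivity)]
  exact h u w X

end TwoIndices

/-! ### The Zak transform of a twisted convolution -/

section DualConv

open MeasureTheory

variable {n : ℕ} {κ : Matrix (Fin n) (Fin n) ℝ} {Aa Ab Ac : Matrix (Fin n) (Fin n) ℤ}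
  {f g : (Fin n → ℤ) → E n → ℂ}

theorem lin_zero (u : Fin n → ℤ) (X : E n) :
    lin 0 Aa Ab u X = vec u - act (toReal (Ab - Aa)) X := by
  rw [lin, kmat_zero, kmat_zero, Matrix.mul_zero, sub_zero, one_act, toReal_sub, sub_act, sub_act]
  abel

theorem sh_zero (u : Fin n → ℤ) : sh 0 u = 0 := by rw [sh, zero_act]

/-- The summand of the integral kernel of the twisted product. -/
def kerTerm (B : Matrix (Fin n) (Fin n) ℤ) (g : (Fin n → ℤ) → E n → ℂ) (F : E n → ℂ)
    (u w : Fin n → ℤ) (Y : E n) : ℂ :=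
  g w Y * e (-⟪vec u, Y⟫) * F (act (toReal B) Y - vec w)

/-- The plane waves twisted by `f`. -/
def twist (κ : Matrix (Fin n) (Fin n) ℝ) (f : E n → ℂ) (Z l : E n) : ℂ :=
  e ⟪l, Z⟫ * f (Z + (1 / 2 : ℝ) • act κ l)

theorem continuous_twist {f : E n → ℂ} (hf : Continuous f) (Z : E n) :
    Continuous (twist κ f Z) :=
  (continuous_e.comp (continuous_id.inner continuous_const)).mul
    (hf.comp (continuous_const.add (Continuous.const_smul (actL κ).continuous (1 / 2 : ℝ))))

theorem continuous_kerTerm {B : Matrix (Fin n) (Fin n) ℤ} {F : E n → ℂ}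
    (hg : ∀ u, Continuous (g u)) (hF : Continuous F) (u w : Fin n → ℤ) :
    Continuous (kerTerm B g F u w) :=
  ((hg w).mul (continuous_e.comp (by fun_prop))).mul
    (hF.comp ((actL (toReal B)).continuous.sub continuous_const))

theorem decTwo_kerTerm {B : Matrix (Fin n) (Fin n) ℤ} (hf : Dec f) (hg : Dec g)
    (ρ : Fin n → ℤ) (Z : E n) :
    DecTwo fun u w => kerTerm B g (twist κ (f (ρ - u)) Z) u w := fun N => by
  obtain ⟨C1, M1, h1⟩ := hf N
  -- The argument of `f` grows linearly in `w`, so `g` must absorb `M1` further powers of `1 + ‖w‖`.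
  obtain ⟨C2, M2, h2⟩ := hg (N + M1)
  have hC1 := Dec.const_nonneg h1
  have hC2 := Dec.const_nonneg h2
  obtain ⟨T, hT, hact⟩ := exists_one_add_norm_act_le ((1 / 2 : ℝ) • κ)
  obtain ⟨T', hT', hact'⟩ := exists_one_add_norm_act_le (toReal B)
  refine ⟨(1 + ‖ρ‖) ^ N * (C1 * ((1 + ‖Z‖) * (T * (T' * (1 + n)))) ^ M1 * C2), M1 + M2,
    fun u w Y => ?_⟩
  set l := act (toReal B) Y - vec w
  have hw : 1 + ‖vec w‖ ≤ (1 + n) * (1 + ‖w‖) := by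
    have := norm_vec_le w
    nlinarith [norm_nonneg w, (Nat.cast_nonneg n : (0 : ℝ) ≤ n)]
  have hl : 1 + ‖l‖ ≤ (T' * (1 + ‖Y‖)) * ((1 + n) * (1 + ‖w‖)) := by
    have h3 := one_add_norm_add_le (act (toReal B) Y) (-vec w)
    rw [norm_neg, ← sub_eq_add_neg] at h3
    exact h3.trans (mul_le_mul (hact' Y) hw (by positivity) (by positivity))
  have hZ : 1 + ‖Z + (1 / 2 : ℝ) • act κ l‖ ≤
      (1 + ‖Z‖) * (T * (T' * (1 + n))) * ((1 + ‖w‖) * (1 + ‖Y‖)) := by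
    refine (one_add_norm_add_le _ _).trans ?_
    rw [← smul_act]
    have h4 : 1 + ‖act ((1 / 2 : ℝ) • κ) l‖ ≤ T * ((T' * (1 + ‖Y‖)) * ((1 + n) * (1 + ‖w‖))) :=
      (hact l).trans (mul_le_mul_of_nonneg_left hl (by linarith))
    refine (mul_le_mul_of_nonneg_left h4 (by positivity)).trans (le_of_eq ?_)
    ring
  have hu : (1 + ‖u‖) ^ N ≤ (1 + ‖ρ‖) ^ N * (1 + ‖ρ - u‖) ^ N := by
    rw [← mul_pow]
    refine pow_le_pow_left₀ (by positivity) ?_ _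
    have h3 := one_add_norm_add_le ρ (-(ρ - u))
    rwa [norm_neg, neg_sub, add_sub_cancel] at h3
  have hn : ‖kerTerm B g (twist κ (f (ρ - u)) Z) u w Y‖ =
      ‖g w Y‖ * ‖f (ρ - u) (Z + (1 / 2 : ℝ) • act κ l)‖ := by
    rw [kerTerm, twist, norm_mul, norm_mul, norm_mul, norm_e, norm_e, mul_one, one_mul]
  rw [hn]
  calc (1 + ‖u‖) ^ N * ((1 + ‖w‖) ^ N * (‖g w Y‖ * ‖f (ρ - u) (Z + (1 / 2 : ℝ) • act κ l)‖))
      ≤ (1 + ‖ρ‖) ^ N * (1 + ‖ρ - u‖) ^ N *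
        ((1 + ‖w‖) ^ N * (‖g w Y‖ * ‖f (ρ - u) (Z + (1 / 2 : ℝ) • act κ l)‖)) := by gcongr
    _ = (1 + ‖ρ‖) ^ N * ((1 + ‖w‖) ^ N * ‖g w Y‖) *
        ((1 + ‖ρ - u‖) ^ N * ‖f (ρ - u) (Z + (1 / 2 : ℝ) • act κ l)‖) := by ring
    _ ≤ (1 + ‖ρ‖) ^ N * ((1 + ‖w‖) ^ N * ‖g w Y‖) *
        (C1 * ((1 + ‖Z‖) * (T * (T' * (1 + n))) * ((1 + ‖w‖) * (1 + ‖Y‖))) ^ M1) := by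
        refine mul_le_mul_of_nonneg_left ((h1 _ _).trans ?_) (by positivity)
        exact mul_le_mul_of_nonneg_left (pow_le_pow_left₀ (by positivity) hZ _) hC1
    _ = (1 + ‖ρ‖) ^ N * (C1 * ((1 + ‖Z‖) * (T * (T' * (1 + n)))) ^ M1) * (1 + ‖Y‖) ^ M1 *
        ((1 + ‖w‖) ^ (N + M1) * ‖g w Y‖) := by
        rw [mul_pow (_ * _) (_ * _), mul_pow (1 + ‖w‖), pow_add]
        ring
    _ ≤ (1 + ‖ρ‖) ^ N * (C1 * ((1 + ‖Z‖) * (T * (T' * (1 + n)))) ^ M1) * (1 + ‖Y‖) ^ M1 *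
        (C2 * (1 + ‖Y‖) ^ M2) :=
        mul_le_mul_of_nonneg_left (h2 _ _) (by positivity)
    _ = _ := by ring

/-- The summands of the Zak transform of a twisted convolution. -/
theorem zak_conv (hB : (Ac - Ab).IsSymm) (hf : f ∈ RF 1 (Ac - Ab)) (hg : Dec g)
    (ρ : Fin n → ℤ) (Y Z : E n) :
    e (-⟪vec ρ, Y⟫) *
      zak (Ac - Aa) (conv 0 (phase 0 κ Aa Ab Ac) (dualFam (Ac - Ab) f) g) (-Z) Y =
    ∑' u, ∑' w, kerTerm (Ab - Aa) g (twist κ (f (ρ - u)) Z) u w Y := by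
  set f' := dualFam (Ac - Ab) f with hf'
  have hfd : Dec f' := (dualFam_mem hB hf).1.dec
  let T : (Fin n → ℤ) → (Fin n → ℤ) → ℂ := fun σ w => f' σ Y * g w Y *
    e ((1 / 2) * ⟪vec σ - act (toReal (Ac - Ab)) Y, act κ (vec w - act (toReal (Ab - Aa)) Y)⟫) *
    e ⟪vec (σ + w) - act (toReal (Ac - Aa)) Y, -Z⟫
  have hT : Summable fun x : (Fin n → ℤ) × (Fin n → ℤ) => T x.1 x.2 := by
    have h1 := ((hfd.summable Y).norm).mul_of_nonneg ((hg.summable Y).norm)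
      (fun _ => norm_nonneg _) (fun _ => norm_nonneg _)
    refine Summable.of_norm_bounded h1 fun x => ?_
    simp only [T, norm_mul, norm_e, mul_one, le_refl]
  let σ : (Fin n → ℤ) × (Fin n → ℤ) ≃ (Fin n → ℤ) × (Fin n → ℤ) :=
    { toFun := fun x => (x.1 - x.2, x.2)
      invFun := fun x => (x.1 + x.2, x.2)
      left_inv := fun x => by simp
      right_inv := fun x => by simp }
  have hT' : Summable (Function.uncurry fun ρ' w => T (ρ' - w) w) := σ.summable_iff.mpr hT
  have e1 : ∀ ρ', zakTerm (Ac - Aa) (conv 0 (phase 0 κ Aa Ab Ac) f' g) (-Z) ρ' Y =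
      ∑' w, T (ρ' - w) w := fun ρ' => by
    rw [zakTerm, conv, ← tsum_mul_right]
    refine tsum_congr fun w => ?_
    simp only [convTerm, phase, sh_zero, add_zero, lin_zero, T, sub_add_cancel]
  -- For fixed `w` the phase is linear in `σ` and merges with the character at `-Z`, moving the
  -- evaluation point to `Z + ½ κ l` with `l = B_ab Y - w`. The sum over `σ` is then Fourier
  -- inversion for the transform of `f`.
  have e2 : ∀ w, ∑' σ, T σ w = g w Y * (e ⟪act (toReal (Ab - Aa)) Y - vec w, Z⟫ *
      ∑' μ, f μ (Z + (1 / 2 : ℝ) • act κ (act (toReal (Ab - Aa)) Y - vec w)) * e ⟪vec μ, Y⟫) :=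
      fun w => by
    set l := act (toReal (Ab - Aa)) Y - vec w with hl
    set Z' := Z + (1 / 2 : ℝ) • act κ l with hZ'
    have h1 := (hasSum_dualFam_character hB hf Y Z').mul_right (e ⟪act (toReal (Ac - Ab)) Y, Z'⟫)
    have h2 : zak (Ac - Ab) f Y Z' * e ⟪act (toReal (Ac - Ab)) Y, Z'⟫ =
        ∑' μ, f μ Z' * e ⟪vec μ, Y⟫ := by
      rw [zak, ← tsum_mul_right]
      refine tsum_congr fun μ => ?_
      rw [zakTerm, mul_assoc, ← e_add, inner_sub_left, inner_act_symm hB, sub_add_cancel]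
    rw [← h2, ← h1.tsum_eq, ← tsum_mul_left, ← tsum_mul_left]
    refine tsum_congr fun σ => ?_
    have h3 : vec w - act (toReal (Ab - Aa)) Y = -l := by rw [hl, neg_sub]
    have h4 : vec (σ + w) - act (toReal (Ac - Aa)) Y =
        (vec σ - act (toReal (Ac - Ab)) Y) - l := by
      rw [hl, vec_add, ← sub_add_sub_cancel Ac Ab Aa, toReal_add, add_act]
      abel
    have h5 : e ((1 / 2) * ⟪vec σ - act (toReal (Ac - Ab)) Y, act κ (-l)⟫) *
        e ⟪(vec σ - act (toReal (Ac - Ab)) Y) - l, -Z⟫ =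
        e ⟪l, Z⟫ * (e (-⟪vec σ, Z'⟫) * e ⟪act (toReal (Ac - Ab)) Y, Z'⟫) := by
      rw [← e_add, ← e_add, ← e_add, hZ', act_neg, inner_neg_right, inner_neg_right,
        inner_sub_left _ l, inner_sub_left, inner_sub_left, inner_add_right, inner_add_right,
        inner_smul_right, inner_smul_right]
      congr 1
      ring
    change f' σ Y * g w Y * e ((1 / 2) * ⟪vec σ - act (toReal (Ac - Ab)) Y,
      act κ (vec w - act (toReal (Ab - Aa)) Y)⟫) *
      e ⟪vec (σ + w) - act (toReal (Ac - Aa)) Y, -Z⟫ = _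
    rw [h3, h4, mul_assoc, h5]
    ring
  have e3 : ∀ w, e (-⟪vec ρ, Y⟫) * ∑' σ, T σ w =
      ∑' u, kerTerm (Ab - Aa) g (twist κ (f (ρ - u)) Z) u w Y := fun w => by
    rw [e2, ← (Equiv.subLeft ρ).tsum_eq, ← tsum_mul_left, ← tsum_mul_left, ← tsum_mul_left]
    refine tsum_congr fun u => ?_
    rw [Equiv.subLeft_apply, kerTerm, twist, vec_sub, inner_sub_left (vec ρ),
      sub_eq_add_neg ⟪vec ρ, Y⟫, e_add]
    have : e (-⟪vec ρ, Y⟫) * e ⟪vec ρ, Y⟫ = 1 := by rw [← e_add, neg_add_cancel, e_zero]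
    linear_combination (g w Y * e ⟪act (toReal (Ab - Aa)) Y - vec w, Z⟫ * f (ρ - u)
      (Z + (1 / 2 : ℝ) • act κ (act (toReal (Ab - Aa)) Y - vec w)) * e (-⟪vec u, Y⟫)) * this
  have hs : Summable (Function.uncurry fun u w =>
    kerTerm (Ab - Aa) g (twist κ (f (ρ - u)) Z) u w Y) :=
    (decTwo_kerTerm hf.1.dec hg ρ Z).summable Y
  -- Both double series converge absolutely, so the sum over `w` is brought outside on each side and
  -- the inner sums are compared.
  rw [zak, tsum_congr e1, ← hT'.tsum_comm, ← tsum_mul_left, ← hs.tsum_comm]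
  refine tsum_congr fun w => ?_
  rw [← e3, ← (Equiv.subRight w).tsum_eq fun σ => T σ w]
  rfl

/-- The product with integral kernel a transformed family. -/
theorem hasSum_dualFam_conv (hB : (Ac - Ab).IsSymm) (hf : f ∈ RF 1 (Ac - Ab)) (hg : Dec g)
    (hgc : ∀ u, Continuous (g u)) (ρ : Fin n → ℤ) (Z : E n) :
    HasSum (fun u => ∫ Y in cube n, ∑' w, kerTerm (Ab - Aa) g (twist κ (f (ρ - u)) Z) u w Y)
      (dualFam (Ac - Aa) (conv 0 (phase 0 κ Aa Ab Ac) (dualFam (Ac - Ab) f) g) (-ρ) (-Z)) := by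
  have hd := decTwo_kerTerm (κ := κ) (B := Ab - Aa) hf.1.dec hg ρ Z
  have h1 := hd.dec_tsum.hasSum_setIntegral_cube fun u => (hd.apply u).continuous_tsum
    fun w => continuous_kerTerm hgc (continuous_twist (hf.1.continuous _) Z) u w
  simp only [← zak_conv hB hf hg ρ _ Z] at h1
  rw [dualFam, neg_neg]
  exact h1

end DualConv

/-! ### Fourier transforms on `ℝⁿ` and the Moyal product -/

section Moyal

open MeasureTheory

variable {n : ℕ} {θ κ : Matrix (Fin n) (Fin n) ℝ} {f g : E n → ℂ}

theorem fourier_eq_integral (f : E n → ℂ) (w : E n) : 𝓕 f w = ∫ v, e (-⟪v, w⟫) * f v := by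
  rw [Real.fourier_eq']
  congr 1
  funext v
  rw [smul_eq_mul, e]
  congr 2
  push_cast
  ring

theorem fourierInv_eq_integral (f : E n → ℂ) (w : E n) : 𝓕⁻ f w = ∫ v, e ⟪v, w⟫ * f v := by
  rw [Real.fourierInv_eq']
  congr 1
  funext v
  rw [smul_eq_mul, e]
  congr 2
  push_cast
  ring

/-- Continuous integrable functions with an integrable Fourier transform. -/
structure FourierInvertible (f : E n → ℂ) : Prop where
  continuous : Continuous f
  integrable : Integrable f
  integrable_fourier : Integrable (𝓕 f)

theorem FourierInvertible.inversion (hf : FourierInvertible f) (x : E n) :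
    ∫ l, 𝓕 f l * e ⟪l, x⟫ = f x := by
  have h := congrFun (hf.continuous.fourierInv_fourier_eq hf.integrable hf.integrable_fourier) x
  rw [fourierInv_eq_integral] at h
  simpa only [mul_comm] using h

theorem SchwartzMap.fourierInvertible (ψ : 𝓢(E n, ℂ)) : FourierInvertible (ψ : E n → ℂ) :=
  ⟨ψ.continuous, ψ.integrable, (𝓕 ψ).integrable⟩

theorem RF.fourierInvertible {B : Matrix (Fin n) (Fin n) ℤ} {h : (Fin n → ℤ) → E n → ℂ}
    (hB : B.det ≠ 0) (hh : h ∈ RF 1 B) (u : Fin n → ℤ) : FourierInvertible (h u) := by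
  obtain ⟨ψ, hψ⟩ := RF.exists_schwartzMap (by simp) hB hh u 0
  have : h u = ψ := funext fun X => by rw [hψ, add_zero]
  rw [this]
  exact SchwartzMap.fourierInvertible ψ

theorem fourier_comp_add_right (f : E n → ℂ) (c l : E n) :
    𝓕 (fun y => f (y + c)) l = e ⟪l, c⟫ * 𝓕 f l := by
  rw [fourier_eq_integral, fourier_eq_integral, ← integral_const_mul,
    ← integral_add_right_eq_self (fun y => e ⟪l, c⟫ * (e (-⟪y, l⟫) * f y)) c]
  congr 1
  funext y
  rw [← mul_assoc, ← e_add, inner_add_left, real_inner_comm l c, neg_add, add_left_comm,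
    add_neg_cancel, add_zero]

/-- Translation covariance of the Moyal product. -/
theorem moyal_comp_add_right (f g : E n → ℂ) (c x : E n) :
    moyal θ (fun y => f (y + c)) (fun y => g (y + c)) x = moyal θ f g (x + c) := by
  rw [moyal, moyal]
  congr 1
  funext k
  congr 1
  funext l
  rw [fourier_comp_add_right, fourier_comp_add_right, inner_add_right, e_add, inner_add_left k l c,
    e_add]
  ring

/-- Integrating over `k` first is Fourier inversion for `f` at the point `x - ½ θ l`. The result
superposes plane waves twisted by `f`, weighted by the Fourier transform of `g`. -/
theorem moyal_eq_integral (hf : FourierInvertible f) (hg : FourierInvertible g) (x : E n) :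
    moyal θ f g x = ∫ l, 𝓕 g l * twist (-θ) f x l := by
  have hi : Integrable (Function.uncurry fun k l => 𝓕 f k * 𝓕 g l *
      (e (-(1 / 2) * ⟪k, act θ l⟫) * e ⟪k + l, x⟫)) (volume.prod volume) := by
    refine (hf.integrable_fourier.mul_prod hg.integrable_fourier).mul_bdd (c := 1)
      (Continuous.aestronglyMeasurable ?_) (Filter.Eventually.of_forall fun z => ?_)
    · exact (continuous_e.comp (continuous_const.mul
        (continuous_fst.inner ((actL θ).continuous.comp continuous_snd)))).mul
        (continuous_e.comp ((continuous_fst.add continuous_snd).inner continuous_const))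
    · rw [norm_mul, norm_e, norm_e, one_mul]
  simp only [mul_assoc] at hi
  simp only [moyal, mul_assoc]
  rw [integral_integral_swap hi]
  congr 1
  funext l
  rw [twist, ← hf.inversion, ← integral_const_mul, ← integral_const_mul]
  congr 1
  funext k
  have h : e (-(1 / 2) * ⟪k, act θ l⟫) * e ⟪k + l, x⟫ =
      e ⟪l, x⟫ * e ⟪k, x + (1 / 2 : ℝ) • act (-θ) l⟫ := by
    rw [← e_add, ← e_add, neg_act, inner_add_right, inner_smul_right, inner_neg_right,
      inner_add_left]
    congr 1
    ring
  rw [h]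
  ring

/-- The trace property of the Moyal product. -/
theorem integral_moyal (hθ : θ.transpose = -θ) (hf : FourierInvertible f)
    (hg : FourierInvertible g) : ∫ x, moyal θ f g x = ∫ x, f x * g x := by
  have hκ : Continuous fun z : E n × E n => e ⟪z.2, z.1⟫ :=
    continuous_e.comp (continuous_snd.inner continuous_fst)
  have hm : ∀ κ : Matrix (Fin n) (Fin n) ℝ, AEStronglyMeasurable
      (Function.uncurry fun x l => 𝓕 g l * twist κ f x l) (volume.prod volume) := fun κ =>
    hg.integrable_fourier.aestronglyMeasurable.comp_snd.mul
      (Continuous.aestronglyMeasurable (hκ.mul (hf.continuous.comp (continuous_fst.add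
        (Continuous.const_smul ((actL κ).continuous.comp continuous_snd) (1 / 2 : ℝ))))))
  have hn : ∀ (κ : Matrix (Fin n) (Fin n) ℝ) x l, ‖𝓕 g l * twist κ f x l‖ =
      ‖𝓕 g l‖ * ‖f (x + (1 / 2 : ℝ) • act κ l)‖ := fun κ x l => by
    rw [norm_mul, twist, norm_mul, norm_e, one_mul]
  have hi : ∀ κ : Matrix (Fin n) (Fin n) ℝ, Integrable
      (Function.uncurry fun x l => 𝓕 g l * twist κ f x l) (volume.prod volume) := fun κ => by
    refine (integrable_prod_iff' (hm κ)).mpr ⟨Filter.Eventually.of_forall fun l => ?_, ?_⟩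
    · change Integrable fun x => 𝓕 g l * (e ⟪l, x⟫ * f (x + (1 / 2 : ℝ) • act κ l))
      refine ((hf.integrable.comp_add_right _).bdd_mul (c := 1)
        (continuous_character l).aestronglyMeasurable
        (Filter.Eventually.of_forall fun x => ?_)).const_mul _
      rw [norm_e]
    · have h1 : (fun l => ∫ x, ‖Function.uncurry (fun x l => 𝓕 g l * twist κ f x l) (x, l)‖) =
          fun l => ‖𝓕 g l‖ * ∫ x, ‖f x‖ := by
        funext l
        simp only [Function.uncurry, hn]
        rw [integral_const_mul, integral_add_right_eq_self (fun x => ‖f x‖)]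
      rw [h1]
      exact hg.integrable_fourier.norm.mul_const _
  -- For each frequency `l` the translation by `½ θ l` undoes the shift in `f`, and the plane wave
  -- is unchanged because `⟨l, θ l⟩ = 0`.
  have hfib : ∀ l, ∫ x, 𝓕 g l * twist (-θ) f x l = ∫ x, 𝓕 g l * twist 0 f x l := fun l => by
    rw [← integral_add_right_eq_self (fun x => 𝓕 g l * twist (-θ) f x l) ((1 / 2 : ℝ) • act θ l)]
    congr 1
    funext x
    rw [twist, twist, neg_act, smul_neg, zero_act, smul_zero, add_zero, add_neg_cancel_right,
      inner_add_right, inner_smul_right, inner_act_self hθ, mul_zero, add_zero]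
  calc ∫ x, moyal θ f g x = ∫ x, ∫ l, 𝓕 g l * twist (-θ) f x l := by
        simp only [moyal_eq_integral hf hg]
    _ = ∫ l, ∫ x, 𝓕 g l * twist 0 f x l := by
        rw [integral_integral_swap (hi (-θ))]
        simp only [hfib]
    _ = ∫ x, ∫ l, 𝓕 g l * twist 0 f x l := (integral_integral_swap (hi 0)).symm
    _ = ∫ x, f x * g x := by
        congr 1
        funext x
        rw [← hg.inversion x, ← integral_const_mul]
        congr 1
        funext l
        rw [twist, zero_act, smul_zero, add_zero]
        ring

end Moyal

/-! ### Integral kernels given by transformed families -/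

section Kernel

open MeasureTheory

variable {n : ℕ} {κ : Matrix (Fin n) (Fin n) ℝ} {B : Matrix (Fin n) (Fin n) ℤ}
  {g h : (Fin n → ℤ) → E n → ℂ} {F : E n → ℂ}

/-- The integral kernel given by an equivariant family. -/
def latticeKernel (B : Matrix (Fin n) (Fin n) ℤ) (g : (Fin n → ℤ) → E n → ℂ) (u : Fin n → ℤ)
    (l : E n) : ℂ :=
  (|(toReal B).det|⁻¹ : ℝ) * ∑ᶠ q : (Fin n → ℤ) ⧸ latticeImage B,
    g (rep q) (act (toReal B)⁻¹ (l + vec (rep q))) *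
      e (-⟪vec u, act (toReal B)⁻¹ (l + vec (rep q))⟫)

theorem integrable_latticeKernel_summand (hB : B.det ≠ 0) (hg : g ∈ RF 1 B) (u w : Fin n → ℤ) :
    Integrable fun l => g w (act (toReal B)⁻¹ (l + vec w)) *
      e (-⟪vec u, act (toReal B)⁻¹ (l + vec w)⟫) := by
  have hB' := det_toReal_ne_zero hB
  have hd : Dec fun w l => g w (act (toReal B)⁻¹ l) := hg.1.dec.comp_act _
  -- Rescaled by `B⁻¹`, the family is equivariant with period matrix `B`, so the decay result
  -- applies to each of its members.
  have he : Eqv (toReal B) B fun w l => g w (act (toReal B)⁻¹ l) := fun v w l => by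
    have := hg.2 v w (act (toReal B)⁻¹ l)
    rw [one_act] at this
    beta_reduce
    rw [act_add, act_inv_act hB', this]
  have hc : Continuous fun l => g w (act (toReal B)⁻¹ l) :=
    (hg.1.continuous w).comp (actL _).continuous
  have hi := (integrable_of_decay hc fun N => hd.decay he hB' hB N w).comp_add_right (vec w)
  refine hi.mul_bdd (c := 1) (Continuous.aestronglyMeasurable ?_)
    (Filter.Eventually.of_forall fun l => by rw [norm_e])
  exact continuous_e.comp (continuous_const.inner
    ((actL _).continuous.comp (continuous_id.add continuous_const))).neg

theorem continuous_latticeKernel (hB : B.det ≠ 0) (hg : g ∈ RF 1 B) (u : Fin n → ℤ) :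
    Continuous (latticeKernel B g u) := by
  have := finite_quotient hB
  have := Fintype.ofFinite ((Fin n → ℤ) ⧸ latticeImage B)
  have ha : ∀ w : Fin n → ℤ, Continuous fun l : E n => act (toReal B)⁻¹ (l + vec w) := fun w =>
    (actL _).continuous.comp (continuous_id.add continuous_const)
  unfold latticeKernel
  simp only [finsum_eq_sum_of_fintype]
  exact continuous_const.mul (continuous_finsetSum _ fun q _ =>
    ((hg.1.continuous _).comp (ha _)).mul
      (continuous_e.comp (continuous_const.inner (ha _)).neg))

theorem integrable_latticeKernel (hB : B.det ≠ 0) (hg : g ∈ RF 1 B) (u : Fin n → ℤ) :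
    Integrable (latticeKernel B g u) := by
  have := finite_quotient hB
  have := Fintype.ofFinite ((Fin n → ℤ) ⧸ latticeImage B)
  unfold latticeKernel
  simp only [finsum_eq_sum_of_fintype]
  exact (integrable_finsetSum _ fun q _ =>
    integrable_latticeKernel_summand hB hg u (rep q)).const_mul _

/-- Unfold the cell integral, and in each class of `w` substitute `l = B Y - w`. The kernel then
collects the finitely many classes. -/
theorem setIntegral_kerTerm (hB : B.det ≠ 0) (hg : g ∈ RF 1 B) (hF : Continuous F) {C : ℝ}
    (hC : ∀ l, ‖F l‖ ≤ C) (u : Fin n → ℤ) :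
    ∫ Y in cube n, ∑' w, kerTerm B g F u w Y = ∫ l, latticeKernel B g u l * F l := by
  have := finite_quotient hB
  have := Fintype.ofFinite ((Fin n → ℤ) ⧸ latticeImage B)
  have hB' := det_toReal_ne_zero hB
  have hd : Dec (kerTerm B g F u) := by
    refine ((RF 1 B).smul_mem (C : ℂ) hg).1.dec.of_norm_le fun w Y => ?_
    rw [kerTerm, norm_mul, norm_mul, norm_e, mul_one, Pi.smul_apply, Pi.smul_apply, smul_eq_mul,
      norm_mul, Complex.norm_real, mul_comm]
    exact mul_le_mul_of_nonneg_right ((hC _).trans (le_abs_self C)) (norm_nonneg _)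
  have he : Eqv 1 B (kerTerm B g F u) := fun v w Y => by
    have h1 := hg.2 v w Y
    obtain ⟨k, hk⟩ := inner_vec_vec u v
    have h2 : e (-⟪vec u, Y + vec v⟫) = e (-⟪vec u, Y⟫) :=
      e_eq_of_sub_int ⟨-k, by rw [inner_add_right, hk]; push_cast; ring⟩
    rw [one_act] at h1 ⊢
    rw [kerTerm, kerTerm, h1, h2, act_add, vec_add, vec_mulVec, add_sub_add_right_eq_sub]
  rw [setIntegral_cube_tsum hd (continuous_kerTerm hg.1.continuous hF u) he hB]
  have key : ∀ w, ∫ Y, kerTerm B g F u w Y = ∫ l, (|(toReal B).det|⁻¹ : ℝ) *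
      (g w (act (toReal B)⁻¹ (l + vec w)) * e (-⟪vec u, act (toReal B)⁻¹ (l + vec w)⟫) * F l) :=
      fun w => by
    rw [integral_const_mul, ← integral_sub_right_eq_self (fun l =>
      g w (act (toReal B)⁻¹ (l + vec w)) * e (-⟪vec u, act (toReal B)⁻¹ (l + vec w)⟫) * F l)
      (vec w), ← integral_comp_act hB']
    congr 1
    funext Y
    rw [sub_add_cancel, act_inv_act hB', kerTerm]
  simp only [key, latticeKernel, finsum_eq_sum_of_fintype]
  rw [← integral_finsetSum]
  · congr 1
    funext l
    rw [mul_assoc, Finset.sum_mul, Finset.mul_sum]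
  · exact fun q _ => ((integrable_latticeKernel_summand hB hg u (rep q)).mul_bdd
      hF.aestronglyMeasurable (Filter.Eventually.of_forall hC)).const_mul _

/-- Taking `F` to be a plane wave, the kernel integral reproduces the square of the transform and
hence `h u` itself. So `h u` is the inverse Fourier transform of the kernel, and Fourier inversion
concludes. -/
theorem fourier_eq_latticeKernel (hs : B.IsSymm) (hB : B.det ≠ 0) (hh : h ∈ RF 1 B)
    (u : Fin n → ℤ) : 𝓕 (h u) = latticeKernel B (dualFam B h) u := by
  have hg := dualFam_mem hs hh
  have h1 : h u = 𝓕⁻ (latticeKernel B (dualFam B h) u) := by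
    funext Z
    have h2 := dualFam_dualFam hs hh (-u) (-Z)
    rw [neg_neg, neg_neg, dualFam, neg_neg, torusCoeff] at h2
    have h3 := setIntegral_kerTerm hB hg (F := fun l => e ⟪l, Z⟫) (C := 1)
      (continuous_e.comp (by fun_prop)) (fun l => by rw [norm_e]) u
    rw [fourierInv_eq_integral, ← h2]
    simp only [mul_comm (latticeKernel _ _ _ _)] at h3
    rw [← h3]
    congr 1
    funext Y
    rw [zak, ← tsum_mul_left]
    refine tsum_congr fun w => ?_
    rw [zakTerm, kerTerm, inner_neg_right,
      ← inner_neg_left (vec w - act (toReal B) Y) Z, neg_sub]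
    ring
  -- Inversion needs the Fourier transform of the kernel to be integrable; it is the reflection of
  -- `h u`.
  have h4 : Integrable (𝓕 (latticeKernel B (dualFam B h) u)) := by
    have h5 : 𝓕 (latticeKernel B (dualFam B h) u) = fun Z => h u (-Z) := by
      funext Z
      rw [h1, Real.fourierInv_eq_fourier_neg, neg_neg]
    rw [h5]
    exact (RF.fourierInvertible hB hh u).integrable.comp_neg
  rw [h1]
  exact (continuous_latticeKernel hB hg u).fourier_fourierInv_eq
    (integrable_latticeKernel hB hg u) h4

/-- The integral kernel of the transform of a Schwartz function is its Fourier transform. -/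
theorem setIntegral_kerTerm_dualFam (hs : B.IsSymm) (hB : B.det ≠ 0) (hh : h ∈ RF 1 B)
    (hF : Continuous F) {C : ℝ} (hC : ∀ l, ‖F l‖ ≤ C) (u : Fin n → ℤ) :
    ∫ Y in cube n, ∑' w, kerTerm B (dualFam B h) F u w Y = ∫ l, 𝓕 (h u) l * F l := by
  rw [setIntegral_kerTerm hB (dualFam_mem hs hh) hF hC, fourier_eq_latticeKernel hs hB hh]

/-- For `B = 0` the Zak transform is an ordinary Fourier series in `X`, and the transform exchanges
the two lattice indices up to a sign. -/
theorem torusCoeff_dualFam (hB : B = 0) (hh : h ∈ RF 1 B) (w u : Fin n → ℤ) :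
    torusCoeff (dualFam B h w) u = torusCoeff (h u) (-w) := by
  subst hB
  obtain ⟨C, hC⟩ := torusCoeff_bound 0 (sumExp (Fin n)) h hh
  refine torusCoeff_of_hasSum (c := fun u => torusCoeff (h u) (-w)) ?_ (fun X => ?_) u
  · refine Summable.of_norm_bounded (summable_sumExp.mul_left C) fun u => ?_
    rw [norm_norm, ← div_eq_mul_inv, le_div_iff₀ (by positivity), mul_comm]
    simpa using hC (-w) u
  · refine (hasSum_dualFam hh.1.dec hh.1.continuous w X).congr_fun fun μ => ?_
    rw [torusCoeff, torusCoeff, ← integral_mul_const]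
    congr 1
    funext Z
    rw [zakTerm, toReal_zero, zero_act, sub_zero, mul_assoc]

/-- The integral kernel of the transform of an element of a torus is a sum of point masses. -/
theorem hasSum_setIntegral_kerTerm_dualFam (hB : B = 0) (hh : h ∈ RF 1 B) (hF : Continuous F) {C : ℝ}
    (hC : ∀ l, ‖F l‖ ≤ C) (u : Fin n → ℤ) :
    HasSum (fun k => torusCoeff (h u) k * F (vec k))
      (∫ Y in cube n, ∑' w, kerTerm B (dualFam B h) F u w Y) := by
  subst hB
  have hs : (0 : Matrix (Fin n) (Fin n) ℤ).IsSymm := Matrix.isSymm_zero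
  have hg := dualFam_mem hs hh
  have hd : Dec (kerTerm 0 (dualFam 0 h) F u) := by
    refine ((RF 1 0).smul_mem (C : ℂ) hg).1.dec.of_norm_le fun w Y => ?_
    rw [kerTerm, norm_mul, norm_mul, norm_e, mul_one, Pi.smul_apply, Pi.smul_apply, smul_eq_mul,
      norm_mul, Complex.norm_real, mul_comm]
    exact mul_le_mul_of_nonneg_right ((hC _).trans (le_abs_self C)) (norm_nonneg _)
  have h1 := (Equiv.neg (Fin n → ℤ)).hasSum_iff.mpr
    (hd.hasSum_setIntegral_cube (continuous_kerTerm hg.1.continuous hF u))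
  refine h1.congr_fun fun k => ?_
  rw [Function.comp_apply, Equiv.neg_apply, ← neg_neg k, ← torusCoeff_dualFam rfl hh, neg_neg,
    torusCoeff, ← integral_mul_const]
  congr 1
  funext Y
  rw [kerTerm, toReal_zero, zero_act, zero_sub, vec_neg, neg_neg, mul_comm (e _)]

end Kernel

/-! ### The Fourier transform as an automorphism of the morphism spaces -/

section DualEquiv

open MeasureTheory

variable {n : ℕ} {B : Matrix (Fin n) (Fin n) ℤ} {g h : (Fin n → ℤ) → E n → ℂ}

theorem continuous_torusCoeff_integrand {k : E n → ℂ} (hk : Continuous k) (u : Fin n → ℤ) :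
    IntegrableOn (fun x => e (-⟪vec u, x⟫) * k x) (cube n) :=
  Continuous.integrableOn_cube ((continuous_e.comp (by fun_prop)).mul hk)

theorem dualFam_add (hg : g ∈ RF 1 B) (hh : h ∈ RF 1 B) :
    dualFam B (g + h) = dualFam B g + dualFam B h := by
  funext u X
  have h1 : zak B (g + h) X = fun Z => zak B g X Z + zak B h X Z := by
    funext Z
    rw [zak, zak, zak, ← ((dec_zakTerm hg.1.dec X).summable Z).tsum_add
      ((dec_zakTerm hh.1.dec X).summable Z)]
    exact tsum_congr fun μ => add_mul _ _ _
  rw [Pi.add_apply, Pi.add_apply, dualFam, dualFam, dualFam, h1, torusCoeff, torusCoeff, torusCoeff,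
    ← integral_add
      (continuous_torusCoeff_integrand (continuous_zak hg.1.dec hg.1.continuous X) _)
      (continuous_torusCoeff_integrand (continuous_zak hh.1.dec hh.1.continuous X) _)]
  simp only [mul_add]

theorem dualFam_smul (c : ℂ) (h : (Fin n → ℤ) → E n → ℂ) :
    dualFam B (c • h) = c • dualFam B h := by
  funext u X
  have h1 : zak B (c • h) X = fun Z => c * zak B h X Z := by
    funext Z
    rw [zak, zak, ← tsum_mul_left]
    exact tsum_congr fun μ => mul_assoc _ _ _
  rw [Pi.smul_apply, Pi.smul_apply, dualFam, dualFam, h1, torusCoeff, torusCoeff, smul_eq_mul,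
    ← integral_const_mul]
  simp only [mul_left_comm]

theorem dualFam_sum_smul {ι : Type*} (s : Finset ι) (c : ι → ℂ) {k : ι → (Fin n → ℤ) → E n → ℂ}
    (hk : ∀ i, k i ∈ RF 1 B) :
    dualFam B (∑ i ∈ s, c i • k i) = ∑ i ∈ s, c i • dualFam B (k i) := by
  classical
  induction s using Finset.induction_on with
  | empty => simpa using dualFam_smul (B := B) 0 0
  | insert i s hi ih =>
    rw [Finset.sum_insert hi, Finset.sum_insert hi, dualFam_add ((RF 1 B).smul_mem _ (hk i))
      (Submodule.sum_mem _ fun i _ => (RF 1 B).smul_mem _ (hk i)), dualFam_smul, ih]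

theorem dualFam_four (hB : B.IsSymm) (hh : h ∈ RF 1 B) :
    dualFam B (dualFam B (dualFam B (dualFam B h))) = h := by
  funext u X
  rw [dualFam_dualFam hB (dualFam_mem hB (dualFam_mem hB hh)), dualFam_dualFam hB hh, neg_neg,
    neg_neg]

/-- The Fourier transform of equivariant families. -/
def dualEquiv (hB : B.IsSymm) : RF 1 B ≃ₗ[ℂ] RF 1 B where
  toFun h := ⟨dualFam B h.1, dualFam_mem hB h.2⟩
  invFun h := ⟨dualFam B (dualFam B (dualFam B h.1)),
    dualFam_mem hB (dualFam_mem hB (dualFam_mem hB h.2))⟩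
  left_inv h := Subtype.ext (dualFam_four hB h.2)
  right_inv h := Subtype.ext (dualFam_four hB h.2)
  map_add' g h := Subtype.ext (dualFam_add g.2 h.2)
  map_smul' c h := Subtype.ext (dualFam_smul c h.1)

end DualEquiv

/-! ### The Fourier-transformed pre-category and its Moyal compositions -/

section MoyalModel

open MeasureTheory

variable {n : ℕ} {Ob : Type u} {A : Ob → Matrix (Fin n) (Fin n) ℤ} {a b c : Ob}
  {θ : Matrix (Fin n) (Fin n) ℝ}

theorem famFun_zero_mem (hdet : ∀ a b, a ≠ b → (A b - A a).det ≠ 0) (ξ : HomSpace A a b) :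
    famFun 0 ξ ∈ RF 1 (A b - A a) := by
  have h := famFun_mem (fun a => det_dmat_zero (A a)) hdet ξ
  rwa [dmat_zero] at h

theorem isSymm_sub (hs : ∀ a, (A a).IsSymm) (a b : Ob) : (A b - A a).IsSymm := (hs b).sub (hs a)

/-- The Fourier transform of morphisms. -/
def dualHom (hs : ∀ a, (A a).IsSymm) (hdet : ∀ a b, a ≠ b → (A b - A a).det ≠ 0) (a b : Ob) :
    HomSpace A a b ≃ₗ[ℂ] HomSpace A a b :=
  have h : RF (dmat 0 (A a)) (A b - A a) = RF 1 (A b - A a) := by rw [dmat_zero]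
  let Θ := (famEquiv (fun a => det_dmat_zero (A a)) hdet a b).trans (LinearEquiv.ofEq _ _ h)
  (Θ.trans (dualEquiv (isSymm_sub hs a b))).trans Θ.symm

theorem famFun_dualHom (hs : ∀ a, (A a).IsSymm) (hdet : ∀ a b, a ≠ b → (A b - A a).det ≠ 0)
    (ξ : HomSpace A a b) : famFun 0 (dualHom hs hdet a b ξ) = dualFam (A b - A a) (famFun 0 ξ) := by
  have h : RF (dmat 0 (A a)) (A b - A a) = RF 1 (A b - A a) := by rw [dmat_zero]
  exact congrArg Subtype.val (((famEquiv (fun a => det_dmat_zero (A a)) hdet a b).trans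
    (LinearEquiv.ofEq _ _ h)).apply_symm_apply (dualEquiv (isSymm_sub hs a b)
      (((famEquiv (fun a => det_dmat_zero (A a)) hdet a b).trans (LinearEquiv.ofEq _ _ h)) ξ)))

theorem coeff_eq_torusCoeff_zero (ξ : HomSpace A a a) (k v : Fin n → ℤ) :
    torusCoeff (famFun 0 ξ v) k = coeff ξ (idx k v) := by
  have h := coeff_eq (det_dmat_zero (A a)) ξ k v
  simpa only [dmat_zero, one_act, Matrix.mul_zero, zero_act, inner_zero_right, mul_zero, e_zero,
    mul_one] using h

/-- On a noncommutative torus the transform is a quarter turn of the index lattice, which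
interchanges the two groups of generators. -/
theorem coeff_dualHom (hs : ∀ a, (A a).IsSymm) (hdet : ∀ a b, a ≠ b → (A b - A a).det ≠ 0)
    (ξ : HomSpace A a a) (k v : Fin n → ℤ) :
    coeff (dualHom hs hdet a a ξ) (idx k v) = coeff ξ (idx (-v) k) := by
  rw [← coeff_eq_torusCoeff_zero, ← coeff_eq_torusCoeff_zero, famFun_dualHom]
  exact torusCoeff_dualFam (sub_self _) (famFun_zero_mem hdet ξ) v k

theorem neg_transpose_eq (hθ : θ.transpose = -θ) : (-θ).transpose = -(-θ) := by
  rw [Matrix.transpose_neg, hθ]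

/-- The exchange of the two groups of directions. -/
def swapIdx : Idx n → Idx n := Sum.swap

/-- The signs in the exchange of the two groups of directions. -/
def swapSign : Idx n → ℝ := Sum.elim (fun _ => -1) fun _ => 1

/-- The pre-category of Type `θ₁`, the Fourier transform of a pre-category of equivariant
families. -/
def moyalModel (hθ : θ.transpose = -θ) (hs : ∀ a, (A a).IsSymm)
    (hdet : ∀ a b, a ≠ b → (A b - A a).det ≠ 0) :
    PreCategoryData n Ob (fun a b => HomSpace A a b) :=
  (famModel (neg_transpose_eq hθ) (fun a => det_dmat_zero (A a)) hdet).transport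
    (dualHom hs hdet) swapIdx swapSign

theorem moyalModel_isPreCategory (hθ : θ.transpose = -θ) (hs : ∀ a, (A a).IsSymm)
    (hdet : ∀ a b, a ≠ b → (A b - A a).det ≠ 0) : (moyalModel hθ hs hdet).IsPreCategory := by
  unfold moyalModel
  exact (famModel_isPreCategory _ (fun a => det_dmat_zero (A a)) hdet).transport _ _ _

theorem dualHom_one (hθ : θ.transpose = -θ) (hs : ∀ a, (A a).IsSymm)
    (hdet : ∀ a b, a ≠ b → (A b - A a).det ≠ 0) (a : Ob) :
    dualHom hs hdet a a ((moyalModel hθ hs hdet).one a) =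
      (famModel (neg_transpose_eq hθ) (fun a => det_dmat_zero (A a)) hdet).one a :=
  PreCategoryData.transport_one (H := fun a b => HomSpace A a b)
    (H' := fun a b => HomSpace A a b) (Ψ := dualHom hs hdet)
    (Q := famModel (neg_transpose_eq hθ) (fun a => det_dmat_zero (A a)) hdet) a

theorem dualHom_comp (hθ : θ.transpose = -θ) (hs : ∀ a, (A a).IsSymm)
    (hdet : ∀ a b, a ≠ b → (A b - A a).det ≠ 0) (ξ : HomSpace A b c) (ζ : HomSpace A a b) :
    dualHom hs hdet a c ((moyalModel hθ hs hdet).comp a b c ξ ζ) =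
      (famModel (neg_transpose_eq hθ) (fun a => det_dmat_zero (A a)) hdet).comp a b c
        (dualHom hs hdet b c ξ) (dualHom hs hdet a b ζ) :=
  PreCategoryData.transport_comp (H := fun a b => HomSpace A a b)
    (H' := fun a b => HomSpace A a b) (Ψ := dualHom hs hdet)
    (Q := famModel (neg_transpose_eq hθ) (fun a => det_dmat_zero (A a)) hdet) a b c ξ ζ

theorem dualHom_nabla (hθ : θ.transpose = -θ) (hs : ∀ a, (A a).IsSymm)
    (hdet : ∀ a b, a ≠ b → (A b - A a).det ≠ 0) (j : Idx n) (ξ : HomSpace A a b) :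
    dualHom hs hdet a b ((moyalModel hθ hs hdet).nabla a b j ξ) = (swapSign j : ℂ) •
      (famModel (neg_transpose_eq hθ) (fun a => det_dmat_zero (A a)) hdet).nabla a b (swapIdx j)
        (dualHom hs hdet a b ξ) :=
  PreCategoryData.transport_nabla (H := fun a b => HomSpace A a b)
    (H' := fun a b => HomSpace A a b) (Ψ := dualHom hs hdet)
    (Q := famModel (neg_transpose_eq hθ) (fun a => det_dmat_zero (A a)) hdet) a b j ξ

/-- The composition as a sum of twisted products. -/
theorem hasSum_moyalModel_comp (hθ : θ.transpose = -θ) (hs : ∀ a, (A a).IsSymm)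
    (hdet : ∀ a b, a ≠ b → (A b - A a).det ≠ 0) (ξ : HomSpace A b c) (ζ : HomSpace A a b)
    (ρ : Fin n → ℤ) (Z : E n) :
    HasSum (fun u => ∫ Y in cube n, ∑' w, kerTerm (A b - A a)
        (dualFam (A b - A a) (famFun 0 ζ)) (twist (-θ) (famFun 0 ξ (ρ - u)) Z) u w Y)
      (famFun 0 ((moyalModel hθ hs hdet).comp a b c ξ ζ) ρ Z) := by
  have hζ := dualFam_mem (isSymm_sub hs a b) (famFun_zero_mem hdet ζ)
  have h1 := hasSum_dualFam_conv (κ := -θ) (isSymm_sub hs b c) (famFun_zero_mem hdet ξ) hζ.1.dec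
    hζ.1.continuous ρ Z (Aa := A a)
  have h2 := congrArg (famFun 0) (dualHom_comp hθ hs hdet ξ ζ)
  rw [famFun_dualHom, famFun_comp, famFun_dualHom, famFun_dualHom] at h2
  rwa [← h2, dualFam_dualFam (isSymm_sub hs a c) (famFun_zero_mem hdet _), neg_neg, neg_neg] at h1

theorem fn_eval_eq (hab : a ≠ b) (ξ : HomSpace A a b) (μ : Fin n → ℤ) (x : E n) :
    (fn ξ).eval μ x = famFun 0 ξ μ (x + act (toReal (A b - A a))⁻¹ (vec μ)) := by
  rw [eval_fn_eq (θ := 0) hab, dmat_zero, Matrix.one_mul]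

theorem exists_norm_famFun_le (hdet : ∀ a b, a ≠ b → (A b - A a).det ≠ 0) (ξ : HomSpace A a b) :
    ∃ C : ℝ, ∀ μ Z, ‖famFun 0 ξ μ Z‖ ≤ C := by
  have h := famFun_zero_mem hdet ξ
  obtain ⟨C, -, hC⟩ := h.1.dec.strong h.2 (by simp) 0
  exact ⟨C, fun μ Z => by simpa using hC μ Z⟩

theorem norm_twist {f : E n → ℂ} {C : ℝ} (hf : ∀ Z, ‖f Z‖ ≤ C) (Z l : E n) :
    ‖twist θ f Z l‖ ≤ C := by
  rw [twist, norm_mul, norm_e, one_mul]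
  exact hf _

/-- For a Schwartz right factor the summands are Fourier integrals. -/
theorem hasSum_moyalModel_integral (hθ : θ.transpose = -θ) (hs : ∀ a, (A a).IsSymm)
    (hdet : ∀ a b, a ≠ b → (A b - A a).det ≠ 0) (hab : a ≠ b) (ξ : HomSpace A b c)
    (ζ : HomSpace A a b) (ρ : Fin n → ℤ) (Z : E n) :
    HasSum (fun u => ∫ l, 𝓕 (famFun 0 ζ u) l * twist (-θ) (famFun 0 ξ (ρ - u)) Z l)
      (famFun 0 ((moyalModel hθ hs hdet).comp a b c ξ ζ) ρ Z) := by
  obtain ⟨C, hC⟩ := exists_norm_famFun_le hdet ξ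
  refine (hasSum_moyalModel_comp hθ hs hdet ξ ζ ρ Z).congr_fun fun u => ?_
  exact (setIntegral_kerTerm_dualFam (isSymm_sub hs a b) (hdet a b hab) (famFun_zero_mem hdet ζ)
    (continuous_twist ((famFun_zero_mem hdet ξ).1.continuous _) Z)
    (norm_twist (hC _) Z) u).symm

/-- Each summand is a Fourier integral of two Schwartz factors, that is, a Moyal product. The rest
compares base points: translation by `A_ac⁻¹ ρ` turns the members of the families into the
translates in the formula. -/
theorem moyalModel_general (hθ : θ.transpose = -θ) (hs : ∀ a, (A a).IsSymm)
    (hdet : ∀ a b, a ≠ b → (A b - A a).det ≠ 0) (hab : a ≠ b) (hbc : b ≠ c) (hac : a ≠ c)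
    (ξ : HomSpace A b c) (ζ : HomSpace A a b) (ρ : Fin n → ℤ) (x : E n) :
    HasSum ((Deformation.type1 θ hθ).compTerm (A a) (A b) (A c) (fn ξ) (fn ζ) ρ x)
      ((fn ((moyalModel hθ hs hdet).comp a b c ξ ζ)).eval ρ x) := by
  have hab' := det_toReal_ne_zero (hdet a b hab)
  have hbc' := det_toReal_ne_zero (hdet b c hbc)
  have hac' := det_toReal_ne_zero (hdet a c hac)
  rw [fn_eval_eq hac]
  set y := act (toReal (A c - A a))⁻¹ (vec ρ) with hy
  have hρ : vec ρ = act (toReal (A c - A a)) y := (act_act_inv hac' _).symm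
  refine (hasSum_moyalModel_integral hθ hs hdet hab ξ ζ ρ _).congr_fun fun u => ?_
  rw [← moyal_eq_integral (RF.fourierInvertible (hdet b c hbc) (famFun_zero_mem hdet ξ) _)
    (RF.fourierInvertible (hdet a b hab) (famFun_zero_mem hdet ζ) _), ← moyal_comp_add_right]
  have hw : act (toReal (A b - A a) * (toReal (A c - A a))⁻¹) (vec ρ) =
      act (toReal (A b - A a)) y := by rw [act_mul]
  simp only [Deformation.compTerm, fn_eval_eq hab, fn_eval_eq hbc, hw]
  congr 1
  · funext z
    rw [neg_add_eq_sub]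
    congr 1
    have hv : vec u - act (toReal (A b - A a)) y + vec (ρ - u) = act (toReal (A c - A b)) y := by
      rw [vec_sub, hρ, ← sub_add_sub_cancel (A c) (A b) (A a), toReal_add, add_act]
      abel
    rw [add_assoc, ← act_add, hv, act_inv_act hbc']
  · funext z
    congr 1
    rw [sub_add, ← act_sub, sub_sub_cancel_left, act_neg, act_inv_act hab', sub_neg_eq_add]

theorem moyalModel_torus (hθ : θ.transpose = -θ) (hs : ∀ a, (A a).IsSymm)
    (hdet : ∀ a b, a ≠ b → (A b - A a).det ≠ 0) (u w : HomSpace A a a) (m : Idx n → ℤ) :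
    HasSum (fun l : Idx n → ℤ => coeff u l * coeff w (m - l) *
      e (-(1 / 2) * ⟪vec fun i => l (Sum.inl i), act θ (vec fun i => (m - l) (Sum.inl i))⟫))
      (coeff ((moyalModel hθ hs hdet).comp a a a u w) m) := by
  have hcoeff : ∀ (ξ : HomSpace A a a) (l : Idx n → ℤ), coeff ξ l =
      coeff (dualHom hs hdet a a ξ)
        (idx (fun i => l (Sum.inr i)) (-fun i => l (Sum.inl i))) := fun ξ l => by
    rw [coeff_dualHom, neg_neg, idx_eta]
  -- The quarter turn on indices. It carries the phase `-θ` on the second group of indices to `θ` on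
  -- the first.
  let σ : (Idx n → ℤ) ≃ (Idx n → ℤ) :=
    { toFun := fun l => idx (fun i => l (Sum.inr i)) (-fun i => l (Sum.inl i))
      invFun := fun l => idx (-fun i => l (Sum.inr i)) (fun i => l (Sum.inl i))
      left_inv := fun l => by
        change idx (- -fun i => l (Sum.inl i)) (fun i => l (Sum.inr i)) = l
        rw [neg_neg, idx_eta]
      right_inv := fun l => by
        change idx (fun i => l (Sum.inl i)) (- -fun i => l (Sum.inr i)) = l
        rw [neg_neg, idx_eta] }
  have h := σ.hasSum_iff.mpr (famModel_torus (neg_transpose_eq hθ)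
    (fun a => det_dmat_zero (A a)) hdet (dualHom hs hdet a a u) (dualHom hs hdet a a w) (σ m))
  rw [← dualHom_comp] at h
  rw [hcoeff _ m]
  refine h.congr_fun fun l => ?_
  have hsub : σ m - σ l = σ (m - l) := by
    funext i
    rcases i with i | i
    · rfl
    · change -m (Sum.inl i) - -l (Sum.inl i) = -(m (Sum.inl i) - l (Sum.inl i))
      ring
  rw [Function.comp_apply, hsub, hcoeff u, hcoeff w]
  simp only [zero_act, inner_zero_right, mul_zero, sub_zero, zero_add, one_act]
  change _ = coeff (dualHom hs hdet a a u) (σ l) * coeff (dualHom hs hdet a a w) (σ (m - l)) *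
    e ((1 / 2) * ⟪vec (-fun i => l (Sum.inl i)), act (-θ) (vec (-fun i => (m - l) (Sum.inl i)))⟫)
  rw [vec_neg, vec_neg, neg_act, act_neg, neg_neg, inner_neg_left, mul_neg, ← neg_mul]
  rfl

/-- When the right factor is a torus element its kernel is a sum of point masses at lattice
frequencies, so the Fourier integral reduces to a series of twisted plane waves. -/
theorem moyalModel_right (hθ : θ.transpose = -θ) (hs : ∀ a, (A a).IsSymm)
    (hdet : ∀ a b, a ≠ b → (A b - A a).det ≠ 0) (hab : a ≠ b) (ξ : HomSpace A a b)
    (u : HomSpace A a a) (μ : Fin n → ℤ) (x : E n) :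
    HasSum (fun m : Idx n → ℤ => coeff u m *
        (Deformation.type1 θ hθ).rightAct (A a) (A b) (fn ξ) m μ x)
      ((fn ((moyalModel hθ hs hdet).comp a a b ξ u)).eval μ x) := by
  obtain ⟨C, hC⟩ := exists_norm_famFun_le hdet ξ
  rw [fn_eval_eq hab]
  set Z := x + act (toReal (A b - A a))⁻¹ (vec μ) with hZ
  have h1 := hasSum_moyalModel_comp hθ hs hdet ξ u μ Z
  have hu := famFun_zero_mem hdet u
  have h2 := hasSum_mul_of_fiber u.val.1 (c := fun m => twist (-θ)
    (famFun 0 ξ (μ - fun i => m (Sum.inr i))) Z (vec fun i => m (Sum.inl i))) (C := C) (M := 0)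
    (fun m => by rw [pow_zero, mul_one]; exact norm_twist (hC _) _ _) (fun v => ?_) h1
  · refine h2.congr_fun fun m => ?_
    change _ = coeff u m * _
    congr 1
    rw [twist]
    simp only [Deformation.rightAct, fn_eval_eq hab, hZ, neg_act, smul_neg, vec_sub, act_sub]
    congr 2
    abel
  · have h3 := hasSum_setIntegral_kerTerm_dualFam (sub_self _) hu
      (continuous_twist ((famFun_zero_mem hdet ξ).1.continuous (μ - v)) Z)
      (norm_twist (hC _) Z) v (F := twist (-θ) (famFun 0 ξ (μ - v)) Z)
    refine h3.congr_fun fun k => ?_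
    rw [coeff_eq_torusCoeff_zero]
    rfl

theorem moyalModel_left (hθ : θ.transpose = -θ) (hs : ∀ a, (A a).IsSymm)
    (hdet : ∀ a b, a ≠ b → (A b - A a).det ≠ 0) (hab : a ≠ b) (u : HomSpace A b b)
    (ξ : HomSpace A a b) (μ : Fin n → ℤ) (x : E n) :
    HasSum (fun m : Idx n → ℤ => coeff u m *
        (Deformation.type1 θ hθ).leftAct (A a) (A b) (fn ξ) m μ x)
      ((fn ((moyalModel hθ hs hdet).comp a b b u ξ)).eval μ x) := by
  obtain ⟨C, hC⟩ := exists_norm_famFun_le hdet ξ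
  rw [fn_eval_eq hab]
  set Z := x + act (toReal (A b - A a))⁻¹ (vec μ) with hZ
  -- Here the right factor is Schwartz and the torus element sits inside the twist. Its Fourier
  -- series is expanded under the integral, fibre by fibre in `v = μ - u`.
  have h1 := (Equiv.subLeft μ).hasSum_iff.mpr (hasSum_moyalModel_integral hθ hs hdet hab u ξ μ Z)
  have h2 := hasSum_mul_of_fiber u.val.1 (c := fun m => e ⟪vec fun i => m (Sum.inl i), Z⟫ *
    famFun 0 ξ (μ - fun i => m (Sum.inr i)) (Z + (1 / 2 : ℝ) • act θ (vec fun i => m (Sum.inl i))))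
    (C := C) (M := 0)
    (fun m => by rw [pow_zero, mul_one, norm_mul, norm_e, one_mul]; exact hC _ _) (fun v => ?_) h1
  · refine h2.congr_fun fun m => ?_
    change _ = coeff u m * _
    congr 1
    simp only [Deformation.leftAct, fn_eval_eq hab, hZ, vec_sub, act_sub]
    congr 2
    abel
  · rw [Function.comp_apply, Equiv.subLeft_apply, sub_sub_cancel]
    have hξ := RF.fourierInvertible (hdet a b hab) (famFun_zero_mem hdet ξ) (μ - v)
    -- By skewness the shift moves from the character of the torus element to the plane wave of `ξ`,
    -- and Fourier inversion evaluates `ξ` at `Z + ½ θ k`.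
    have hk : ∀ k, ∫ l, 𝓕 (famFun 0 ξ (μ - v)) l * (e ⟪l, Z⟫ *
        (u.val.1.val (idx k v) * e ⟪vec k, Z + (1 / 2 : ℝ) • act (-θ) l⟫)) =
        u.val.1.val (idx k v) * (e ⟪vec k, Z⟫ *
          famFun 0 ξ (μ - v) (Z + (1 / 2 : ℝ) • act θ (vec k))) := fun k => by
      rw [← hξ.inversion, ← integral_const_mul, ← integral_const_mul]
      congr 1
      funext l
      have : e ⟪l, Z⟫ * e ⟪vec k, Z + (1 / 2 : ℝ) • act (-θ) l⟫ =
          e ⟪vec k, Z⟫ * e ⟪l, Z + (1 / 2 : ℝ) • act θ (vec k)⟫ := by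
        rw [← e_add, ← e_add, inner_add_right (vec k) Z, inner_add_right l Z, inner_smul_right,
          inner_smul_right,
          neg_act, inner_neg_right, inner_act_skew hθ (vec k), neg_neg]
        congr 1
        ring
      linear_combination (𝓕 (famFun 0 ξ (μ - v)) l * u.val.1.val (idx k v)) * this
    have hsum : ∀ l, HasSum (fun k => 𝓕 (famFun 0 ξ (μ - v)) l * (e ⟪l, Z⟫ *
        (u.val.1.val (idx k v) * e ⟪vec k, Z + (1 / 2 : ℝ) • act (-θ) l⟫)))
        (𝓕 (famFun 0 ξ (μ - v)) l * twist (-θ) (famFun 0 u v) Z l) := fun l => by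
      have := hasSum_tor (N := (dmat 0 (A b))⁻¹ * 0) (D' := (dmat 0 (A b))⁻¹) u.val.1 v
        (Z + (1 / 2 : ℝ) • act (-θ) l)
      rw [← famFun_self] at this
      simp only [zero_act, inner_zero_right, mul_zero, e_zero, mul_one, dmat_zero, inv_one,
        one_act] at this
      exact (this.mul_left _).mul_left _
    have hint : ∀ k, Integrable fun l => 𝓕 (famFun 0 ξ (μ - v)) l * (e ⟪l, Z⟫ *
        (u.val.1.val (idx k v) * e ⟪vec k, Z + (1 / 2 : ℝ) • act (-θ) l⟫)) := fun k => by
      refine hξ.integrable_fourier.mul_bdd (c := ‖u.val.1.val (idx k v)‖)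
        (Continuous.aestronglyMeasurable ?_) (Filter.Eventually.of_forall fun l => ?_)
      · exact (continuous_e.comp (continuous_id.inner continuous_const)).mul (continuous_const.mul
          (continuous_e.comp (continuous_const.inner (continuous_const.add
            (Continuous.const_smul (actL (-θ)).continuous (1 / 2 : ℝ))))))
      · rw [norm_mul, norm_mul, norm_e, norm_e, one_mul, mul_one]
    have key := hasSum_integral_of_summable_integral_norm hint ?_
    · simp only [hk] at key
      rwa [integral_congr_ae (Filter.Eventually.of_forall fun l => (hsum l).tsum_eq)] at key
    · have hnorm : ∀ k, ∫ l, ‖𝓕 (famFun 0 ξ (μ - v)) l * (e ⟪l, Z⟫ *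
          (u.val.1.val (idx k v) * e ⟪vec k, Z + (1 / 2 : ℝ) • act (-θ) l⟫))‖ =
          (∫ l, ‖𝓕 (famFun 0 ξ (μ - v)) l‖) * ‖u.val.1.val (idx k v)‖ := fun k => by
        rw [← integral_mul_const]
        congr 1
        funext l
        rw [norm_mul, norm_mul, norm_mul, norm_e, norm_e, one_mul, mul_one]
      simp only [hnorm]
      exact (schwartzSeq_summable_norm_idx u.val.1 v).mul_left _

end MoyalModel

/-! ### The model of Type `θ₁` -/

section MoyalLineBundles

open MeasureTheory

variable {n : ℕ} {Ob : Type u} {A : Ob → Matrix (Fin n) (Fin n) ℤ} {a b c : Ob}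
  {θ : Matrix (Fin n) (Fin n) ℝ}

/-- Without deformation the composition is the usual one. -/
theorem moyalModel_zero_comp (hs : ∀ a, (A a).IsSymm)
    (hdet : ∀ a b, a ≠ b → (A b - A a).det ≠ 0) (hab : a ≠ b) (ξ : HomSpace A b c)
    (ζ : HomSpace A a b) :
    (moyalModel (θ := 0) zero_transpose_eq_neg hs hdet).comp a b c ξ ζ =
      (famModel zero_transpose_eq_neg (fun a => det_dmat_zero (A a)) hdet).comp a b c ξ ζ := by
  refine famFun_injective (θ := 0) (fun a => det_dmat_zero (A a)) hdet
    (funext fun ρ => funext fun Z => ?_)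
  rw [famFun_comp]
  refine (hasSum_moyalModel_integral zero_transpose_eq_neg hs hdet hab ξ ζ ρ Z).unique
    (((famFun_zero_mem hdet ξ).1.dec.hasSum_conv (famFun_zero_mem hdet ζ).1.dec ρ Z).congr_fun
      fun u => ?_)
  rw [convTerm, phase, zero_act, inner_zero_right, mul_zero, e_zero, mul_one, sh_zero, add_zero,
    ← (RF.fourierInvertible (hdet a b hab) (famFun_zero_mem hdet ζ) u).inversion Z,
    ← integral_const_mul]
  congr 1
  funext l
  rw [twist, neg_zero, zero_act, smul_zero, add_zero]
  ring

/-- The zeroth coefficient is insensitive to `θ`, so it equals the undeformed pairing. The trace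
property of the Moyal product then reinserts `θ` under the integral. -/
theorem moyalModel_coeff_zero (hθ : θ.transpose = -θ) (hs : ∀ a, (A a).IsSymm)
    (hdet : ∀ a b, a ≠ b → (A b - A a).det ≠ 0) (hab : a ≠ b) (ξ : HomSpace A b a)
    (ζ : HomSpace A a b) :
    coeff ((moyalModel hθ hs hdet).comp a b a ξ ζ) 0 =
      ∑ᶠ q : (Fin n → ℤ) ⧸ latticeImage (A b - A a),
        ∫ x, moyal θ ((fn ξ).eval (rep q)) ((fn ζ).eval (-rep q)) x := by
  have hA := fun a => det_dmat_zero (A a)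
  have h0 : ∀ v : HomSpace A a a, coeff (dualHom hs hdet a a v) 0 = coeff v 0 := fun v => by
    have := coeff_dualHom hs hdet v 0 0
    rwa [neg_zero, show idx (0 : Fin n → ℤ) 0 = 0 from Sum.elim_zero_zero] at this
  have hneg : ((-(0 : Matrix (Fin n) (Fin n) ℝ)).transpose) = -(-0) := by simp
  -- On the transformed side `famModel_coeff_zero` gives the same expression for every `κ`.
  have h1 : coeff ((moyalModel hθ hs hdet).comp a b a ξ ζ) 0 =
      coeff ((moyalModel (θ := 0) zero_transpose_eq_neg hs hdet).comp a b a ξ ζ) 0 := by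
    rw [← h0, dualHom_comp, famModel_coeff_zero _ hA hdet hab, ← h0, dualHom_comp,
      famModel_coeff_zero _ hA hdet hab]
  rw [h1, moyalModel_zero_comp hs hdet hab, famModel_coeff_zero _ hA hdet hab, dmat_zero,
    Matrix.det_one, abs_one, Complex.ofReal_one, inv_one, one_mul]
  refine finsum_congr fun q => ?_
  exact (integral_moyal hθ (SchwartzMap.fourierInvertible _)
    (SchwartzMap.fourierInvertible _)).symm

theorem lf_single_mul (p : Fin n) (Aa Ab : Matrix (Fin n) (Fin n) ℤ)
    (h : (Fin n → ℤ) → E n → ℂ) :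
    lf 0 Aa Ab (EuclideanSpace.single p 1) * h = posMul (Ab - Aa) p h := by
  funext u X
  rw [Pi.mul_apply, Pi.mul_apply, lf, lin_zero, inner_single, posMul]

theorem lf_mul_eq_sum (w : E n) (Aa Ab : Matrix (Fin n) (Fin n) ℤ)
    (h : (Fin n → ℤ) → E n → ℂ) :
    lf 0 Aa Ab w * h = ∑ q, (w q : ℂ) • posMul (Ab - Aa) q h := by
  funext u X
  rw [Pi.mul_apply, Pi.mul_apply, lf, lin_zero, inner_eq_sum]
  simp only [Finset.sum_apply, Pi.smul_apply, smul_eq_mul, posMul]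
  push_cast
  rw [Finset.mul_sum, Finset.sum_mul]
  exact Finset.sum_congr rfl fun q _ => by ring

theorem famFun_moyalModel_nabla (hθ : θ.transpose = -θ) (hs : ∀ a, (A a).IsSymm)
    (hdet : ∀ a b, a ≠ b → (A b - A a).det ≠ 0) (j : Idx n) (ξ : HomSpace A a b) :
    dualFam (A b - A a) (famFun 0 ((moyalModel hθ hs hdet).nabla a b j ξ)) = (swapSign j : ℂ) •
      conn 0 (-θ) (A a) (A b) (swapIdx j) (dualFam (A b - A a) (famFun 0 ξ)) := by
  rw [← famFun_dualHom hs hdet, dualHom_nabla, ← famFun_dualHom hs hdet,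
    ← famFun_nabla (neg_transpose_eq hθ) (fun a => det_dmat_zero (A a)) hdet]
  exact congrArg Subtype.val ((famEquiv (fun a => det_dmat_zero (A a)) hdet a b).map_smul _ _)

/-- The transform takes a derivative to minus multiplication by the invariant coordinate; the sign
in `swapSign` compensates this minus. Injectivity follows from the transform having order four. -/
theorem famFun_moyalModel_nabla_inl (hθ : θ.transpose = -θ) (hs : ∀ a, (A a).IsSymm)
    (hdet : ∀ a b, a ≠ b → (A b - A a).det ≠ 0) (p : Fin n) (ξ : HomSpace A a b) :
    famFun 0 ((moyalModel hθ hs hdet).nabla a b (Sum.inl p) ξ) = pd p (famFun 0 ξ) := by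
  have hB := isSymm_sub hs a b
  have hξ := famFun_zero_mem hdet ξ
  have h := famFun_moyalModel_nabla hθ hs hdet (Sum.inl p) ξ
  change _ = ((-1 : ℝ) : ℂ) • (lf 0 (A a) (A b) (EuclideanSpace.single p 1) * _) at h
  rw [lf_single_mul, Complex.ofReal_neg, Complex.ofReal_one, neg_one_smul,
    ← dualFam_pd hB hξ] at h
  rw [← dualFam_four hB (famFun_zero_mem hdet _), h, dualFam_four hB ⟨hξ.1.pd p, hξ.2.pd p⟩]

theorem famFun_moyalModel_nabla_inr (hθ : θ.transpose = -θ) (hs : ∀ a, (A a).IsSymm)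
    (hdet : ∀ a b, a ≠ b → (A b - A a).det ≠ 0) (p : Fin n) (ξ : HomSpace A a b) :
    famFun 0 ((moyalModel hθ hs hdet).nabla a b (Sum.inr p) ξ) =
      posMul (A b - A a) p (famFun 0 ξ) +
        ∑ q, (((1 / 2 : ℝ) * (toReal (A a + A b) * θ) p q : ℝ) : ℂ) • pd q (famFun 0 ξ) := by
  have hB := isSymm_sub hs a b
  have hξ := famFun_zero_mem hdet ξ
  have hsum : (∑ q, (((1 / 2 : ℝ) * (toReal (A a + A b) * θ) p q : ℝ) : ℂ) •
      pd q (famFun 0 ξ)) ∈ RF 1 (A b - A a) :=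
    Submodule.sum_mem _ fun q _ => Submodule.smul_mem _ _ ⟨hξ.1.pd q, hξ.2.pd q⟩
  have h := famFun_moyalModel_nabla hθ hs hdet (Sum.inr p) ξ
  change _ = ((1 : ℝ) : ℂ) • (pd p _ + lf 0 (A a) (A b) (connVec 0 (-θ) (A a) (A b) p) * _) at h
  rw [lf_mul_eq_sum, Complex.ofReal_one, one_smul, pd_dualFam hξ] at h
  -- The correction vector of the dual connection becomes, after the transform, the coefficients `½
  -- A⁺_ab θ₁` of the derivatives.
  have hc : ∀ q, connVec 0 (-θ) (A a) (A b) p q = -((1 / 2 : ℝ) * (toReal (A a + A b) * θ) p q) :=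
      fun q => by
    rw [← inner_single q, real_inner_comm, inner_connVec (neg_transpose_eq hθ), kmat_zero,
      kmat_zero, ← toReal_add, transpose_toReal ((hs a).add (hs b)), act_single]
    simp
  rw [← dualFam_four hB (famFun_zero_mem hdet _), h,
    ← dualFam_four hB (Submodule.add_mem _ (posMul_mem hξ p) hsum),
    dualFam_add (posMul_mem hξ p) hsum, dualFam_sum_smul _ _ fun q => ⟨hξ.1.pd q, hξ.2.pd q⟩]
  simp only [dualFam_pd hB hξ, hc, smul_neg, Complex.ofReal_neg, neg_smul]

theorem denom_type1 (hθ : θ.transpose = -θ) (B : Matrix (Fin n) (Fin n) ℤ) :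
    (Deformation.type1 θ hθ).denom B = Matrix.fromBlocks 1 0 (-(toReal B * θ)) 1 := by
  rw [Deformation.denom, Deformation.param, Matrix.fromBlocks_multiply, ← Matrix.fromBlocks_one,
    Matrix.fromBlocks_add]
  simp

theorem denom_type1_inv (hθ : θ.transpose = -θ) (B : Matrix (Fin n) (Fin n) ℤ) :
    ((Deformation.type1 θ hθ).denom B)⁻¹ = Matrix.fromBlocks 1 0 (toReal B * θ) 1 := by
  refine Matrix.inv_eq_left_inv ?_
  rw [denom_type1, Matrix.fromBlocks_multiply, ← Matrix.fromBlocks_one]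
  simp

theorem objParam_type1 (hθ : θ.transpose = -θ) (B : Matrix (Fin n) (Fin n) ℤ) :
    (Deformation.type1 θ hθ).objParam B = Matrix.fromBlocks θ 0 0 0 := by
  rw [Deformation.objParam, denom_type1_inv, Deformation.param, Matrix.fromBlocks_multiply]
  simp

theorem traceFactor_type1 (hθ : θ.transpose = -θ) (B : Matrix (Fin n) (Fin n) ℤ) :
    (Deformation.type1 θ hθ).traceFactor B = 1 := by
  rw [Deformation.traceFactor, denom_type1, Matrix.det_fromBlocks_zero₁₂]
  simp

theorem coeff_eq_dualHom (hs : ∀ a, (A a).IsSymm)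
    (hdet : ∀ a b, a ≠ b → (A b - A a).det ≠ 0) (ξ : HomSpace A a a) (m : Idx n → ℤ) :
    coeff ξ m = coeff (dualHom hs hdet a a ξ)
      (idx (fun i => m (Sum.inr i)) (-fun i => m (Sum.inl i))) := by
  rw [coeff_dualHom, neg_neg, idx_eta]

theorem moyalModel_one (hθ : θ.transpose = -θ) (hs : ∀ a, (A a).IsSymm)
    (hdet : ∀ a b, a ≠ b → (A b - A a).det ≠ 0) (a : Ob) (m : Idx n → ℤ) :
    coeff ((moyalModel hθ hs hdet).one a) m = Pi.single (M := fun _ => ℂ) (0 : Idx n → ℤ) 1 m := by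
  rw [coeff_eq_dualHom hs hdet, dualHom_one, famModel_one, Pi.single_apply, Pi.single_apply]
  congr 1
  refine propext ⟨fun h => funext fun i => ?_, ?_⟩
  · rcases i with i | i
    · exact neg_eq_zero.mp (congrFun h (Sum.inr i))
    · exact congrFun h (Sum.inl i)
  · rintro rfl
    ext i
    rcases i with i | i
    · rfl
    · exact neg_zero

theorem moyalModel_nabla_torus (hθ : θ.transpose = -θ) (hs : ∀ a, (A a).IsSymm)
    (hdet : ∀ a b, a ≠ b → (A b - A a).det ≠ 0) (a : Ob) (j : Idx n) (u : HomSpace A a a)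
    (m : Idx n → ℤ) :
    coeff ((moyalModel hθ hs hdet).nabla a a j u) m = 2 * Real.pi * Complex.I *
      (((Matrix.fromBlocks 1 0 (toReal (A a) * θ) 1).mulVec (fun i => (m i : ℝ)) j : ℝ) : ℂ) *
        coeff u m := by
  rw [coeff_eq_dualHom hs hdet, dualHom_nabla, coeff_eq_dualHom hs hdet u]
  change (swapSign j : ℂ) * coeff _ _ = _
  rw [famModel_nabla_torus, gradMat, dmat_zero, kmat_zero, transpose_toReal (hs a)]
  set z := coeff (dualHom hs hdet a a u) (idx (fun i => m (Sum.inr i)) (-fun i => m (Sum.inl i)))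
  -- The quarter turn of the indices and the signed exchange of directions conjugate `gradMat` into
  -- the matrix prescribed for Type `θ₁`.
  have h : (Matrix.fromBlocks 1 0 (toReal (A a) * θ) 1).mulVec (fun i => (m i : ℝ)) j =
      swapSign j * (Matrix.fromBlocks ((1 : Matrix (Fin n) (Fin n) ℝ)⁻¹).transpose
        (toReal (A a) * -θ * (1 - toReal (A a) * 0)) 0 (1 - toReal (A a) * 0)).mulVec
        (fun i => ((idx (fun i => m (Sum.inr i)) (-fun i => m (Sum.inl i)) i : ℤ) : ℝ))
        (swapIdx j) := by
    have hm : (fun i => (m i : ℝ)) = Sum.elim (fun i => (m (Sum.inl i) : ℝ))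
        (fun i => (m (Sum.inr i) : ℝ)) := (Sum.elim_comp_inl_inr fun i => (m i : ℝ)).symm
    have hi : (fun i => ((idx (fun i => m (Sum.inr i)) (-fun i => m (Sum.inl i)) i : ℤ) : ℝ)) =
        Sum.elim (fun i => (m (Sum.inr i) : ℝ)) (-fun i => (m (Sum.inl i) : ℝ)) := by
      ext i
      rcases i with i | i
      · rfl
      · exact Int.cast_neg _
    rw [hm, hi, Matrix.fromBlocks_mulVec, Matrix.fromBlocks_mulVec]
    rcases j with p | p
    · simp [swapSign, swapIdx]
    · simp [swapSign, swapIdx, Matrix.mulVec_neg, Matrix.neg_mulVec, add_comm]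
  rw [h]
  push_cast
  ring

theorem moyalModel_nabla_general (hθ : θ.transpose = -θ) (hs : ∀ a, (A a).IsSymm)
    (hdet : ∀ a b, a ≠ b → (A b - A a).det ≠ 0) (hab : a ≠ b) (j : Idx n) (ξ : HomSpace A a b)
    (μ : Fin n → ℤ) (x : E n) :
    (fn ((moyalModel hθ hs hdet).nabla a b j ξ)).eval μ x =
      ∑ p : Fin n, ((Deformation.type1 θ hθ).connMatrix (A a) (A b) j (Sum.inl p) : ℂ) *
          fderiv ℝ ((fn ξ).eval μ) x (EuclideanSpace.single p 1) +
      ∑ p : Fin n, ((Deformation.type1 θ hθ).connMatrix (A a) (A b) j (Sum.inr p) : ℂ) *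
          (2 * Real.pi * Complex.I * (x p : ℂ)) * (fn ξ).eval μ x := by
  rw [fn_eval_eq hab]
  set y := act (toReal (A b - A a))⁻¹ (vec μ) with hy
  have hpd : ∀ q, fderiv ℝ ((fn ξ).eval μ) x (EuclideanSpace.single q 1) =
      pd q (famFun 0 ξ) μ (x + y) := fun q => by
    rw [pd, show (fn ξ).eval μ = fun x => famFun 0 ξ μ (x + y) from
      funext fun x => fn_eval_eq hab ξ μ x, fderiv_comp_add_right]
  rw [fn_eval_eq hab ξ, ← hy]
  simp only [hpd]
  rcases j with p | p
  · rw [famFun_moyalModel_nabla_inl]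
    simp [Deformation.connMatrix, Matrix.one_apply, apply_ite Complex.ofReal]
  · rw [famFun_moyalModel_nabla_inr, Pi.add_apply, Pi.add_apply, add_comm]
    congr 1
    · simp [Finset.sum_apply, Deformation.connMatrix]
    · rw [posMul, act_add, hy, act_act_inv (det_toReal_ne_zero (hdet a b hab)),
        sub_add_cancel_right, ← neg_act, ← Finset.sum_mul]
      change 2 * Real.pi * Complex.I * ((∑ q, (-toReal (A b - A a)) p q * x q : ℝ) : ℂ) * _ =
        (∑ q, ((-toReal (A b - A a)) p q : ℂ) * (2 * Real.pi * Complex.I * (x q : ℂ))) * _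
      push_cast
      rw [Finset.mul_sum]
      congr 1
      exact Finset.sum_congr rfl fun q _ => by ring

/-- Every formula is the transform of the one for `θ = 0`, `κ = -θ₁`; the pairing again needs only
its zeroth coefficient, which the trace property provides. -/
theorem isLineBundleModel_type1 (hθ : θ.transpose = -θ) (hs : ∀ a, (A a).IsSymm)
    (hdet : ∀ a b, a ≠ b → (A b - A a).det ≠ 0) :
    IsLineBundleModel (Deformation.type1 θ hθ) A (moyalModel hθ hs hdet) := by
  have htorus : ∀ (a : Ob) (u w : HomSpace A a a) (m : Idx n → ℤ),
      HasSum (fun l : Idx n → ℤ => coeff u l * coeff w (m - l) *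
        e (-(1 / 2) * Deformation.bil ((Deformation.type1 θ hθ).objParam (A a)) l (m - l)))
      (coeff ((moyalModel hθ hs hdet).comp a a a u w) m) := fun a u w m => by
    refine (moyalModel_torus hθ hs hdet u w m).congr_fun fun l => ?_
    congr 2
    rw [objParam_type1, bil_fromBlocks]
    simp only [zero_act, inner_zero_right, add_zero]
  refine
    { one_coeff := moyalModel_one hθ hs hdet
      comp_torus := htorus
      comp_right := fun a b hab ξ u μ x => moyalModel_right hθ hs hdet hab ξ u μ x
      comp_left := fun a b hab u ξ μ x => moyalModel_left hθ hs hdet hab u ξ μ x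
      comp_pairing := fun a b hab ξ ζ m => pairing_of_coeff_zero
        (moyalModel_isPreCategory hθ hs hdet).comp_assoc htorus
        (fun a b hab ξ u μ x => moyalModel_right hθ hs hdet hab ξ u μ x) ?_ ?_ a b hab ξ ζ m
      comp_general := fun a b c hab hbc hac ξ ζ ρ x =>
        moyalModel_general hθ hs hdet hab hbc hac ξ ζ ρ x
      nabla_torus := fun a j u m => ?_
      nabla_general := fun a b hab j ξ μ x => moyalModel_nabla_general hθ hs hdet hab j ξ μ x
      F_eq := fun a => ?_
      Tr_eq := fun a u => ?_ }
  · intro a m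
    rw [objParam_type1, bil_fromBlocks]
    simp only [zero_act, inner_zero_right, vec_neg_comp, act_neg, inner_neg_right,
      inner_act_self hθ, neg_zero, add_zero]
  · intro a b hab ξ ζ
    rw [moyalModel_coeff_zero hθ hs hdet hab, traceFactor_type1, Complex.ofReal_one, inv_one,
      one_mul]
    rfl
  · rw [moyalModel_nabla_torus, denom_type1_inv]
  · have h : (moyalModel hθ hs hdet).F a = Matrix.of fun i j => swapSign i * swapSign j *
        curvMat 0 (-θ) (A a) (swapIdx i) (swapIdx j) := by
      rw [← famModel_F (neg_transpose_eq hθ) (fun a => det_dmat_zero (A a)) hdet]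
      rfl
    rw [h, curvMat, kmat_zero, transpose_toReal (hs a)]
    ext i j
    rcases i with i | i <;> rcases j with j | j <;>
      simp [swapSign, swapIdx, Deformation.curv]
  · rw [traceFactor_type1, Complex.ofReal_one, one_mul]
    have h := famModel_Tr (neg_transpose_eq hθ) (fun a => det_dmat_zero (A a)) hdet
      (dualHom hs hdet a a u)
    rw [dmat_zero, Matrix.det_one, abs_one, Complex.ofReal_one, one_mul] at h
    refine h.trans ?_
    have := coeff_dualHom hs hdet u 0 0
    rwa [neg_zero, show idx (0 : Fin n → ℤ) 0 = 0 from Sum.elim_zero_zero] at this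

end MoyalLineBundles

end NCTori

end

theorem mainTheorem3 {n : ℕ} {Ob : Type*} (D : NCTori.Deformation n)
    (A : Ob → Matrix (Fin n) (Fin n) ℤ) (hsymm : ∀ a, (A a).IsSymm)
    (hdet : ∀ a b, a ≠ b → (A b - A a).det ≠ 0)
    (hadm : ∀ a, D.Admissible (A a))
    (τ : Matrix (Fin n) (Fin n) ℂ) (hτ : (τ.map Complex.im).PosDef) :
    (∃! P : NCTori.PreCategoryData n Ob (fun a b => NCTori.HomSpace A a b),
      NCTori.IsLineBundleModel D A P) ∧
    ∀ P : NCTori.PreCategoryData n Ob (fun a b => NCTori.HomSpace A a b),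
      NCTori.IsLineBundleModel D A P →
        P.IsPreCategory ∧ (P.toCDG τ).IsCyclicCDGCategory P.eta (-(n : ℤ)) := by
  -- Admissibility for Type `θ₂` is precisely invertibility of `D_a`. In the other two types the
  -- underlying families have `θ = 0`, so `D_a = 1` and nothing is required.
  obtain ⟨P, hP, hPc⟩ : ∃ P : NCTori.PreCategoryData n Ob (fun a b => NCTori.HomSpace A a b),
      NCTori.IsLineBundleModel D A P ∧ P.IsPreCategory := by
    cases D with
    | type1 θ hθ => exact ⟨_, NCTori.isLineBundleModel_type1 hθ hsymm hdet,
        NCTori.moyalModel_isPreCategory hθ hsymm hdet⟩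
    | type2 θ => exact ⟨_, NCTori.isLineBundleModel_type2 hsymm hadm hdet,
        NCTori.famModel_isPreCategory _ hadm hdet⟩
    | type3 θ hθ => exact ⟨_, NCTori.isLineBundleModel_type3 hθ hsymm hdet,
        NCTori.famModel_isPreCategory hθ _ hdet⟩
  refine ⟨⟨P, hP, fun P' hP' => hP'.unique hP⟩, fun P' hP' => ?_⟩
  obtain rfl := hP'.unique hP
  exact ⟨hPc, NCTori.PreCategoryData.toCDG_isCyclicCDGCategory hPc hP.trace_nabla⟩
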